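/- Manifolds are smooth, finite-dimensional and without boundary. Let $M$ be a Hausdorff second countable manifold and let $G$ be a manifold (not necessarily Hausdorff). An \emph{arrow space} structure on $G$ over $M$ consists of smooth submersions $s,t:G\to M$ with Hausdorff fibres and a smooth map $u:M\to G$ with $s\circ u=t\circ u=\mathrm{id}$ (so $u$ is an embedding and $s,t$ are surjective); put $T^sG=\ker ds$, $T^tG=\ker dt$, and write $T^s_MG,T^t_MG$ for their restrictions to $M\cong u(M)$. A \emph{local Lie groupoid} structure on $(G,s,t,u)$ consists of a smooth submersion $m:\mathcal U\to G$, $(g,h)\mapsto gh$, where $\mathcal U$ is an open subset of $G\,{}_s\!\times_t G$ containing all $(g,u(s(g)))$ and $(u(t(g)),g)$, and a smooth map $i:\mathcal V\to\mathcal V$, where $\mathcal V\subset G$ is an open neighbourhood of $u(M)$ with $\mathcal V\,{}_s\!\times_t\mathcal V\subset\mathcal U$, such that $s(gh)=s(h)$, $t(gh)=t(g)$; $g\,u(s(g))=g=u(t(g))\,g$; $s(i(g))=t(g)$, $t(i(g))=s(g)$, $i(g)g=u(s(g))$, $g\,i(g)=u(t(g))$ for $g\in\mathcal V$; and $(gh)k=g(hk)$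 for all $(g,h,k)$ in a neighbourhood, in $G\,{}_s\!\times_t G\,{}_s\!\times_t G$, of the set of composable triples at least two of whose entries are units. It is \emph{bi-regular} if for each $g\in G$ the differential at $u(t(g))$ of right multiplication $\rho_g:h\mapsto hg$ is an isomorphism $T^s_{u(t(g))}G\to T^s_gG$ and the differential at $u(s(g))$ of left multiplication $\lambda_g:h\mapsto gh$ is an isomorphism $T^t_{u(s(g))}G\to T^t_gG$. A \emph{restriction} of it is a local Lie groupoid structure on the same $(G,s,t,u)$ obtained by restricting $m$ and $i$ to smaller domains. It is \emph{3-associative} if $(gh)k=g(hk)$ whenever both sides are defined. It is \emph{strongly connected} if $M$, $\mathcal U$, $\mathcal V$, all $s$- and $t$-fibres and all sets $\{(g,h)\in\mathcal U: s(g)=t(h)=x\}$, $x\in M$, are connected and it is bi-regular. A \emph{morphism} of local Lie groupoids is a pair of smooth maps on arrows and objects commuting with sources, targets and units, mapping $\mathcal U$ into $\mathcal U$ and $\mathcal V$ into $\mathcal V$ and commuting with $m$ and $i$ there. A \emph{generalized covering} of a local Lie groupoid $G$ over $M$ is an arrow space $(G',s',t',u')$ over the same $M$ with a smooth map $\varphi:G'\to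 G$ such that $s'=s\circ\varphi$, $t'=t\circ\varphi$, $u=\varphi\circ u'$, and such that for each $x\in M$ the restriction $(s')^{-1}(x)\to s^{-1}(x)$ of $\varphi$ is a local diffeomorphism. \textbf{Coverings.} Let $\varphi:G'\to G$ be a generalized covering of a bi-regular local Lie groupoid $G$ over $M$. Then $(G',s',t',u')$ carries a local Lie groupoid structure that is bi-regular and for which $(\varphi,\mathrm{id}_M)$ is a morphism of local Lie groupoids. \textbf{Characterization.} Let $(G,s,t,u)$ be an arrow space over $M$ with connected $s$-fibres and connected $t$-fibres. An \emph{$s$-framing} is an isomorphism of smooth vector bundles $\omega_s:T^sG\to t^*(T^s_MG)$ over $\mathrm{id}_G$, and a \emph{$t$-framing} is an isomorphism $\omega_t:T^tG\to s^*(T^t_MG)$ over $\mathrm{id}_G$, each equal to the identity over $M$. Given both, a smooth section $X$ of $T^sG$ is \emph{right-invariant} if $\omega_s(X)=t^*\sigma$ for some smooth section $\sigma$ of $T^s_MG$, and a smooth section $X$ of $T^tG$ is \emph{left-invariant} if $\omega_t(X)=s^*\sigma$ for some smooth section $\sigma$ of $T^t_MG$. Then there is a bi-regular local Lie groupoid structure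 on $(G,s,t,u)$ giving rise to these framings, that is, with $\omega_s(v)=(d_{u(t(g))}\rho_g)^{-1}(v)$ for $v\in T^s_gG$ and $\omega_t(v)=(d_{u(s(g))}\lambda_g)^{-1}(v)$ for $v\in T^t_gG$, if and only if the Lie bracket of two left-invariant vector fields is left-invariant, the Lie bracket of two right-invariant vector fields is right-invariant, and the Lie bracket of a left-invariant and a right-invariant vector field is zero. Moreover, such a structure is unique up to restriction: any two bi-regular structures giving rise to the same pair of framings have a common restriction; and if both are strongly connected and 3-associative and have the same domains $\mathcal U$ and $\mathcal V$, they are equal. -/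

import Mathlib

open scoped Manifold ContDiff Topology
open Set

namespace LocalLie

section LocalDiffeo

variable {E F : Type*} [NormedAddCommGroup E] [NormedSpace ℝ E]
  [NormedAddCommGroup F] [NormedSpace ℝ F]
  {N P : Type*} [TopologicalSpace N] [ChartedSpace E N] [TopologicalSpace P] [ChartedSpace F P]

/-- A map `f : N → P` restricts to a local diffeomorphism from `A ⊆ N` to `B ⊆ P` (used for
embedded submanifolds `A`, `B`): every point of `A` has an open neighbourhood in `A` that `f` maps
bijectively onto an open subset of `B`, smoothly and with a smooth inverse. -/
def IsLocalDiffeoBetween (f : N → P) (A : Set N) (B : Set P) : Prop :=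
  ∀ a ∈ A, ∃ (W : Set N) (W' : Set P) (r : P → N), IsOpen W ∧ a ∈ W ∧ IsOpen W' ∧
    BijOn f (W ∩ A) (W' ∩ B) ∧ LeftInvOn r f (W ∩ A) ∧
    ContMDiffOn 𝓘(ℝ, E) 𝓘(ℝ, F) ∞ f (W ∩ A) ∧ ContMDiffOn 𝓘(ℝ, F) 𝓘(ℝ, E) ∞ r (W' ∩ B)

end LocalDiffeo

/-- The data `(s, t, u)` underlying a local Lie groupoid with arrows `G` and objects `M`:
submersions `s`, `t` and a smooth common section `u` (which is then automatically an embedding,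
and `s`, `t` are automatically surjective). The manifold `G` need not be Hausdorff, but its source
and target fibres are. -/
structure ArrowSpace (E F : Type*) [NormedAddCommGroup E] [NormedSpace ℝ E]
    [NormedAddCommGroup F] [NormedSpace ℝ F]
    (M : Type*) [TopologicalSpace M] [ChartedSpace F M]
    (G : Type*) [TopologicalSpace G] [ChartedSpace E G] where
  /-- source -/
  s : G → M
  /-- target -/
  t : G → M
  /-- units -/
  u : M → G
  smooth_s : ContMDiff 𝓘(ℝ, E) 𝓘(ℝ, F) ∞ s
  smooth_t : ContMDiff 𝓘(ℝ, E) 𝓘(ℝ, F) ∞ t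
  smooth_u : ContMDiff 𝓘(ℝ, F) 𝓘(ℝ, E) ∞ u
  submersion_s : ∀ g, Function.Surjective (mfderiv 𝓘(ℝ, E) 𝓘(ℝ, F) s g)
  submersion_t : ∀ g, Function.Surjective (mfderiv 𝓘(ℝ, E) 𝓘(ℝ, F) t g)
  s_u : ∀ x, s (u x) = x
  t_u : ∀ x, t (u x) = x
  t2_s : ∀ x, T2Space (s ⁻¹' {x})
  t2_t : ∀ x, T2Space (t ⁻¹' {x})

section

variable {E F : Type*} [NormedAddCommGroup E] [NormedSpace ℝ E]
  [NormedAddCommGroup F] [NormedSpace ℝ F]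
  {M : Type*} [TopologicalSpace M] [ChartedSpace F M]
  {G : Type*} [TopologicalSpace G] [ChartedSpace E G]

namespace ArrowSpace

variable (S : ArrowSpace E F M G)

/-- The fibre product `G ×_{s,t} G` of composable pairs. -/
def pairs : Set (G × G) := {p | S.s p.1 = S.t p.2}

/-- `T^s_g G`, the kernel of `ds` at `g`. -/
noncomputable def Ts (g : G) : Submodule ℝ (TangentSpace 𝓘(ℝ, E) g) :=
  LinearMap.ker (mfderiv 𝓘(ℝ, E) 𝓘(ℝ, F) S.s g).toLinearMap

/-- `T^t_g G`, the kernel of `dt` at `g`. -/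
noncomputable def Tt (g : G) : Submodule ℝ (TangentSpace 𝓘(ℝ, E) g) :=
  LinearMap.ker (mfderiv 𝓘(ℝ, E) 𝓘(ℝ, F) S.t g).toLinearMap

/-- All source fibres are connected. -/
def SConnected : Prop := ∀ x, IsConnected (S.s ⁻¹' {x})

/-- All target fibres are connected. -/
def TConnected : Prop := ∀ x, IsConnected (S.t ⁻¹' {x})

end ArrowSpace

/-- A local Lie groupoid structure on `G` over `M` with source, target and unit maps those of `S`.
The multiplication and the inversion are total functions whose values are meaningful only on their
domains `U` and `V`. -/
structure LocalLieGroupoid (S : ArrowSpace E F M G) where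
  /-- domain of multiplication -/
  U : Set (G × G)
  /-- multiplication -/
  mul : G × G → G
  /-- domain of inversion -/
  V : Set G
  /-- inversion -/
  inv : G → G
  isOpen_U : ∃ O : Set (G × G), IsOpen O ∧ U = O ∩ S.pairs
  right_unit_mem : ∀ g, (g, S.u (S.s g)) ∈ U
  left_unit_mem : ∀ g, (S.u (S.t g), g) ∈ U
  smooth_mul : ContMDiffOn (𝓘(ℝ, E).prod 𝓘(ℝ, E)) 𝓘(ℝ, E) ∞ mul U
  /-- `mul` is a submersion on `U`; the tangent space of `G ×_{s,t} G` at `p` consists of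
  the pairs `(v, w)` with `ds v = dt w`. -/
  submersion_mul : ∀ p ∈ U,
    ∃ D : TangentSpace (𝓘(ℝ, E).prod 𝓘(ℝ, E)) p →L[ℝ] TangentSpace 𝓘(ℝ, E) (mul p),
      HasMFDerivWithinAt (𝓘(ℝ, E).prod 𝓘(ℝ, E)) 𝓘(ℝ, E) mul U p D ∧
      ∀ z : TangentSpace 𝓘(ℝ, E) (mul p),
        ∃ (v : TangentSpace 𝓘(ℝ, E) p.1) (w : TangentSpace 𝓘(ℝ, E) p.2),
          tangentMap 𝓘(ℝ, E) 𝓘(ℝ, F) S.s ⟨p.1, v⟩ = tangentMap 𝓘(ℝ, E) 𝓘(ℝ, F) S.t ⟨p.2, w⟩ ∧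
          D (v, w) = z
  isOpen_V : IsOpen V
  unit_mem_V : ∀ x, S.u x ∈ V
  inv_mem : ∀ g ∈ V, inv g ∈ V
  smooth_inv : ContMDiffOn 𝓘(ℝ, E) 𝓘(ℝ, E) ∞ inv V
  V_pairs : ∀ g ∈ V, ∀ h ∈ V, S.s g = S.t h → (g, h) ∈ U
  s_mul : ∀ p ∈ U, S.s (mul p) = S.s p.2
  t_mul : ∀ p ∈ U, S.t (mul p) = S.t p.1
  /-- local associativity: the associative law holds on a neighbourhood, in the space of composable
  triples, of the set of triples having at least two unit entries -/
  assoc : ∃ O : Set (G × G × G), IsOpen O ∧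
    (∀ g, (S.u (S.t g), S.u (S.t g), g) ∈ O ∧ (S.u (S.t g), g, S.u (S.s g)) ∈ O ∧
      (g, S.u (S.s g), S.u (S.s g)) ∈ O) ∧
    ∀ g h k, (g, h, k) ∈ O → S.s g = S.t h → S.s h = S.t k →
      (g, h) ∈ U ∧ (h, k) ∈ U ∧ (mul (g, h), k) ∈ U ∧ (g, mul (h, k)) ∈ U ∧
      mul (mul (g, h), k) = mul (g, mul (h, k))
  mul_unit : ∀ g, mul (g, S.u (S.s g)) = g
  unit_mul : ∀ g, mul (S.u (S.t g), g) = g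
  s_inv : ∀ g ∈ V, S.s (inv g) = S.t g
  t_inv : ∀ g ∈ V, S.t (inv g) = S.s g
  inv_mul : ∀ g ∈ V, mul (inv g, g) = S.u (S.s g)
  mul_inv : ∀ g ∈ V, mul (g, inv g) = S.u (S.t g)

namespace LocalLieGroupoid

variable {S : ArrowSpace E F M G} (L : LocalLieGroupoid S)

/-- `D` is a differential at `u (t g)` of the right translation `h ↦ h g`, which is defined on an
open subset of the source fibre over `t g`. Only the values of `D` on `T^s` are determined by
this, and only these are ever used. -/
def IsRightTranslationDeriv (g : G)
    (D : TangentSpace 𝓘(ℝ, E) (S.u (S.t g)) →L[ℝ]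
      TangentSpace 𝓘(ℝ, E) (L.mul (S.u (S.t g), g))) : Prop :=
  HasMFDerivWithinAt 𝓘(ℝ, E) 𝓘(ℝ, E) (fun h => L.mul (h, g)) {h | (h, g) ∈ L.U} (S.u (S.t g)) D

/-- `D` is a differential at `u (s g)` of the left translation `h ↦ g h`, which is defined on an
open subset of the target fibre over `s g`. Only the values of `D` on `T^t` are determined by
this, and only these are ever used. -/
def IsLeftTranslationDeriv (g : G)
    (D : TangentSpace 𝓘(ℝ, E) (S.u (S.s g)) →L[ℝ]
      TangentSpace 𝓘(ℝ, E) (L.mul (g, S.u (S.s g)))) : Prop :=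
  HasMFDerivWithinAt 𝓘(ℝ, E) 𝓘(ℝ, E) (fun h => L.mul (g, h)) {h | (g, h) ∈ L.U} (S.u (S.s g)) D

/-- Right translation by `g` induces an isomorphism from `T^s` at the unit `t g` to `T^s` at
`(t g) g = g`. -/
def RightRegularAt (g : G) : Prop :=
  ∃ D, L.IsRightTranslationDeriv g D ∧
    BijOn D (S.Ts (S.u (S.t g))) (S.Ts (L.mul (S.u (S.t g), g)))

/-- Left translation by `g` induces an isomorphism from `T^t` at the unit `s g` to `T^t` at
`g (s g) = g`. -/
def LeftRegularAt (g : G) : Prop :=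
  ∃ D, L.IsLeftTranslationDeriv g D ∧
    BijOn D (S.Tt (S.u (S.s g))) (S.Tt (L.mul (g, S.u (S.s g))))

/-- Bi-regularity. -/
def BiRegular : Prop := ∀ g, L.RightRegularAt g ∧ L.LeftRegularAt g

/-- 3-associativity. -/
def ThreeAssociative : Prop :=
  ∀ g h k, (g, h) ∈ L.U → (h, k) ∈ L.U → (L.mul (g, h), k) ∈ L.U → (g, L.mul (h, k)) ∈ L.U →
    L.mul (L.mul (g, h), k) = L.mul (g, L.mul (h, k))

/-- Strong connectedness. -/
def StronglyConnected : Prop :=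
  ConnectedSpace M ∧ IsConnected L.U ∧ IsConnected L.V ∧
    (∀ x, IsConnected {p ∈ L.U | S.s p.1 = x ∧ S.t p.2 = x}) ∧
    S.SConnected ∧ S.TConnected ∧ L.BiRegular

/-- `L` is a restriction of `L'`: the same arrows, objects, source, target and units, with
multiplication and inversion restricted to smaller domains. -/
def IsRestrictionOf (L L' : LocalLieGroupoid S) : Prop :=
  L.U ⊆ L'.U ∧ L.V ⊆ L'.V ∧ EqOn L.mul L'.mul L.U ∧ EqOn L.inv L'.inv L.V

end LocalLieGroupoid

/-- An `s`-framing: an isomorphism of vector bundles `T^s G → t^*(T^s_M G)` over the identity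
of `G` that is the identity over `M`. (A smooth bundle map that is bijective on fibres has a smooth
inverse.) -/
structure SFraming [IsManifold 𝓘(ℝ, E) ∞ G] (S : ArrowSpace E F M G) where
  /-- the isomorphism on the fibre over `g` -/
  iso : (g : G) → S.Ts g ≃ₗ[ℝ] S.Ts (S.u (S.t g))
  /-- the framing as a map on `T^s G` with values in `T G`, extended to `T G` by junk -/
  map : TangentBundle 𝓘(ℝ, E) G → TangentBundle 𝓘(ℝ, E) G
  map_eq : ∀ (g : G) (v : S.Ts g), map ⟨g, v⟩ = ⟨S.u (S.t g), iso g v⟩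
  smooth : ContMDiffOn 𝓘(ℝ, E).tangent 𝓘(ℝ, E).tangent ∞ map {v | v.2 ∈ S.Ts v.1}
  map_unit : ∀ (x : M) (v : S.Ts (S.u x)), map ⟨S.u x, v⟩ = ⟨S.u x, v⟩

/-- A `t`-framing: an isomorphism of vector bundles `T^t G → s^*(T^t_M G)` over the identity
of `G` that is the identity over `M`. -/
structure TFraming [IsManifold 𝓘(ℝ, E) ∞ G] (S : ArrowSpace E F M G) where
  /-- the isomorphism on the fibre over `g` -/
  iso : (g : G) → S.Tt g ≃ₗ[ℝ] S.Tt (S.u (S.s g))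
  /-- the framing as a map on `T^t G` with values in `T G`, extended to `T G` by junk -/
  map : TangentBundle 𝓘(ℝ, E) G → TangentBundle 𝓘(ℝ, E) G
  map_eq : ∀ (g : G) (v : S.Tt g), map ⟨g, v⟩ = ⟨S.u (S.s g), iso g v⟩
  smooth : ContMDiffOn 𝓘(ℝ, E).tangent 𝓘(ℝ, E).tangent ∞ map {v | v.2 ∈ S.Tt v.1}
  map_unit : ∀ (x : M) (v : S.Tt (S.u x)), map ⟨S.u x, v⟩ = ⟨S.u x, v⟩

section Framings

variable [IsManifold 𝓘(ℝ, E) ∞ G] {S : ArrowSpace E F M G}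

/-- A vector field on `G` is right-invariant for an `s`-framing if it is a smooth section of
`T^s G` corresponding to `t^* σ` for a smooth section `σ` of `T^s_M G`. -/
def SFraming.RightInvariant (θ : SFraming S) (X : (g : G) → TangentSpace 𝓘(ℝ, E) g) : Prop :=
  ContMDiff 𝓘(ℝ, E) 𝓘(ℝ, E).tangent ∞ (fun g => (⟨g, X g⟩ : TangentBundle 𝓘(ℝ, E) G)) ∧
  ∃ hX : ∀ g, X g ∈ S.Ts g, ∃ σ : (x : M) → S.Ts (S.u x),
    ContMDiff 𝓘(ℝ, F) 𝓘(ℝ, E).tangent ∞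
      (fun x => (⟨S.u x, (σ x : TangentSpace 𝓘(ℝ, E) (S.u x))⟩ : TangentBundle 𝓘(ℝ, E) G)) ∧
    ∀ g, θ.iso g ⟨X g, hX g⟩ = σ (S.t g)

/-- A vector field on `G` is left-invariant for a `t`-framing if it is a smooth section of
`T^t G` corresponding to `s^* σ` for a smooth section `σ` of `T^t_M G`. -/
def TFraming.LeftInvariant (θ : TFraming S) (X : (g : G) → TangentSpace 𝓘(ℝ, E) g) : Prop :=
  ContMDiff 𝓘(ℝ, E) 𝓘(ℝ, E).tangent ∞ (fun g => (⟨g, X g⟩ : TangentBundle 𝓘(ℝ, E) G)) ∧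
  ∃ hX : ∀ g, X g ∈ S.Tt g, ∃ σ : (x : M) → S.Tt (S.u x),
    ContMDiff 𝓘(ℝ, F) 𝓘(ℝ, E).tangent ∞
      (fun x => (⟨S.u x, (σ x : TangentSpace 𝓘(ℝ, E) (S.u x))⟩ : TangentBundle 𝓘(ℝ, E) G)) ∧
    ∀ g, θ.iso g ⟨X g, hX g⟩ = σ (S.s g)

/-- The local Lie groupoid `L` is bi-regular and gives rise to the framings `ωs` and `ωt`, i.e.
these are its Maurer-Cartan forms: `ωs` is inverse to the differentials of right translations at
the units, and `ωt` is inverse to the differentials of left translations at the units. -/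
def LocalLieGroupoid.GivesRiseTo (L : LocalLieGroupoid S) (ωs : SFraming S) (ωt : TFraming S) :
    Prop :=
  L.BiRegular ∧
  (∀ g, ∃ D, L.IsRightTranslationDeriv g D ∧ ∀ v : S.Ts g,
    (⟨L.mul (S.u (S.t g), g), D (ωs.iso g v)⟩ : TangentBundle 𝓘(ℝ, E) G) = ⟨g, v⟩) ∧
  (∀ g, ∃ D, L.IsLeftTranslationDeriv g D ∧ ∀ v : S.Tt g,
    (⟨L.mul (g, S.u (S.s g)), D (ωt.iso g v)⟩ : TangentBundle 𝓘(ℝ, E) G) = ⟨g, v⟩)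

/-- Left-invariant fields are closed under the Lie bracket, right-invariant fields are closed under
the Lie bracket, and left-invariant fields commute with right-invariant fields. -/
def BracketConditions (ωs : SFraming S) (ωt : TFraming S) : Prop :=
  (∀ X Y, ωt.LeftInvariant X → ωt.LeftInvariant Y →
    ωt.LeftInvariant (VectorField.mlieBracket 𝓘(ℝ, E) X Y)) ∧
  (∀ X Y, ωs.RightInvariant X → ωs.RightInvariant Y →
    ωs.RightInvariant (VectorField.mlieBracket 𝓘(ℝ, E) X Y)) ∧
  (∀ X Y, ωt.LeftInvariant X → ωs.RightInvariant Y →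
    ∀ g, VectorField.mlieBracket 𝓘(ℝ, E) X Y g = 0)

end Framings

end

section Morphisms

variable {E₁ F₁ E₂ F₂ : Type*} [NormedAddCommGroup E₁] [NormedSpace ℝ E₁]
  [NormedAddCommGroup F₁] [NormedSpace ℝ F₁] [NormedAddCommGroup E₂] [NormedSpace ℝ E₂]
  [NormedAddCommGroup F₂] [NormedSpace ℝ F₂]
  {M₁ M₂ G₁ G₂ : Type*} [TopologicalSpace M₁] [ChartedSpace F₁ M₁]
  [TopologicalSpace M₂] [ChartedSpace F₂ M₂] [TopologicalSpace G₁] [ChartedSpace E₁ G₁]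
  [TopologicalSpace G₂] [ChartedSpace E₂ G₂]

/-- `(Φ, f)` is a morphism of local Lie groupoids from `L₁` to `L₂`. -/
structure IsMorphism {S₁ : ArrowSpace E₁ F₁ M₁ G₁} {S₂ : ArrowSpace E₂ F₂ M₂ G₂}
    (L₁ : LocalLieGroupoid S₁) (L₂ : LocalLieGroupoid S₂) (Φ : G₁ → G₂) (f : M₁ → M₂) :
    Prop where
  smooth_arrows : ContMDiff 𝓘(ℝ, E₁) 𝓘(ℝ, E₂) ∞ Φ
  smooth_objects : ContMDiff 𝓘(ℝ, F₁) 𝓘(ℝ, F₂) ∞ f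
  map_u : ∀ x, Φ (S₁.u x) = S₂.u (f x)
  map_s : ∀ g, f (S₁.s g) = S₂.s (Φ g)
  map_t : ∀ g, f (S₁.t g) = S₂.t (Φ g)
  map_U : ∀ g h, (g, h) ∈ L₁.U → (Φ g, Φ h) ∈ L₂.U
  map_mul : ∀ g h, (g, h) ∈ L₁.U → Φ (L₁.mul (g, h)) = L₂.mul (Φ g, Φ h)
  map_V : ∀ g ∈ L₁.V, Φ g ∈ L₂.V
  map_inv : ∀ g ∈ L₁.V, Φ (L₁.inv g) = L₂.inv (Φ g)

end Morphisms

section Coverings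

variable {E E' F : Type*} [NormedAddCommGroup E] [NormedSpace ℝ E]
  [NormedAddCommGroup E'] [NormedSpace ℝ E'] [NormedAddCommGroup F] [NormedSpace ℝ F]
  {M G G' : Type*} [TopologicalSpace M] [ChartedSpace F M]
  [TopologicalSpace G] [ChartedSpace E G] [TopologicalSpace G'] [ChartedSpace E' G']

/-- `φ : G' → G` is a generalized covering: it is smooth, compatible with sources, targets and
units, and restricts to a local diffeomorphism between source fibres. -/
structure IsGeneralizedCovering (S' : ArrowSpace E' F M G') (S : ArrowSpace E F M G)
    (φ : G' → G) : Prop where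
  smooth : ContMDiff 𝓘(ℝ, E') 𝓘(ℝ, E) ∞ φ
  comp_s : ∀ g, S'.s g = S.s (φ g)
  comp_t : ∀ g, S'.t g = S.t (φ g)
  comp_u : ∀ x, S.u x = φ (S'.u x)
  localDiffeo : ∀ x : M,
    IsLocalDiffeoBetween (E := E') (F := E) φ (S'.s ⁻¹' {x}) (S.s ⁻¹' {x})

end Coverings

end LocalLie

/-! Both existence statements are instances of one construction. Call a class of germs of
multiplications rigid if a member is determined along a fibre by one value: two members with the
same value at `(g, h)` agree for nearby `h` in the target fibre and for nearby `g` in the source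
fibre. `MulGerm` axiomatizes such a class, together with the existence of members near `(g, u (s
g))` and `(u (t g), g)`. Fibres are Hausdorff and small balls in them are connected, so agreement at
units continues along fibres. Hence germs at pairs with one unit entry are unique, and they glue
over the paracompact base (`MulGerm.exists_isLocalMul`). Associativity near triples with two unit
entries is again an identity between two maps of a fibre that holds at a unit and propagates.
Inversions exist locally by the inverse function theorem, are unique near units by associativity,
and therefore glue too.

For a generalized covering, the class consists of the local lifts of the given multiplication. A map
compatible with the source submersions that is a local diffeomorphism between their fibres is itself
a local diffeomorphism, so lifts exist and are rigid.

For a pair of framings, the class consists of the multiplications whose left translations preserve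
left-invariant fields along target fibres and whose right translations preserve right-invariant
fields along source fibres. Preserving a frame is a total differential equation `Dφ = Λ(φ) B`, whose
solutions are determined by one value. To solve it, `g` is multiplied by the points of a ray in the
target fibre through `u (s g)`, by integrating `k' = Λ(k) B a`. Closure of the left-invariant fields
under brackets makes their projections along the source, and their structure functions, depend on
the source only, hence agree at `g h` and at `h`. The Maurer-Cartan equation is then what gives the
endpoint of the ray solution the prescribed derivative in every direction of the fibre, not just
along the ray. Vanishing of the mixed brackets says that right-invariant fields solve the
variational equation along these rays, so that right translations preserve them. See
`exists_model_multiplication` and `LeftParallelism.exists_translations`.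

Conversely, associativity near units places the multiplication of a local Lie groupoid giving rise
to the framings in this class near pairs with one unit entry. A map relating vector fields relates
their brackets, so brackets of invariant fields are invariant. On a product of a source fibre and a
target fibre, right- and left-invariant fields come from different factors, so they commute.

Uniqueness is rigidity once more. Two structures with the same framings agree near units, which
yields a common restriction. Under 3-associativity the multiplication belongs to the class on all of
`U`; over each `x` the agreement of two structures is then locally constant on a connected set
containing `(u x, u x)`. Inversions are compared by associating the product of one inverse of `g`,
`g` and the other inverse. -/

namespace LocalLie

/-! ### Smooth dependence of solutions of differential equations, through calculus in `C([0, 1], Z)`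
-/

section Analysis

variable {K : Type*} [TopologicalSpace K] [CompactSpace K]
  {E F : Type*} [NormedAddCommGroup E] [NormedSpace ℝ E] [NormedAddCommGroup F] [NormedSpace ℝ F]

/-- Pointwise application of a continuous family of operators. -/
noncomputable def pointwiseApply : C(K, E →L[ℝ] F) →L[ℝ] C(K, E) →L[ℝ] C(K, F) :=
  LinearMap.mkContinuous₂
    (LinearMap.mk₂ ℝ (fun (A : C(K, E →L[ℝ] F)) (γ : C(K, E)) => (⟨fun r => A r (γ r), by fun_prop⟩ : C(K, F)))
      (fun A B γ => by ext; simp) (fun c A γ => by ext; simp)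
      (fun A γ δ => by ext; simp) (fun c A γ => by ext; simp)) 1
    (fun A γ => by
      rw [ContinuousMap.norm_le _ (by positivity : 0 ≤ 1 * ‖A‖ * ‖γ‖)]
      intro r
      simp only [LinearMap.mk₂_apply, ContinuousMap.coe_mk, one_mul]
      refine ((A r).le_opNorm _).trans ?_
      gcongr
      · exact A.norm_coe_le_norm r
      · exact γ.norm_coe_le_norm r)

@[simp]
theorem pointwiseApply_apply (A : C(K, E →L[ℝ] F)) (γ : C(K, E)) (r : K) :
    pointwiseApply A γ r = A r (γ r) := rfl

/-- Postcomposition with `f'` is continuous for the sup norm because `K` is compact. So `f'` varies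
by at most `c` on the segments from `γ r` to `γ r + h r`, uniformly in `r`, and the mean value
inequality at each `r` bounds the remainder. -/
theorem hasFDerivAt_continuousMap_comp {f : E → F} {f' : E → E →L[ℝ] F} (hf : Continuous f)
    (hf' : Continuous f') (hff' : ∀ x, HasFDerivAt f (f' x) x) (γ : C(K, E)) :
    HasFDerivAt (fun γ : C(K, E) => (⟨f, hf⟩ : C(E, F)).comp γ)
      (pointwiseApply ((⟨f', hf'⟩ : C(E, E →L[ℝ] F)).comp γ)) γ := by
  rw [hasFDerivAt_iff_isLittleO_nhds_zero, Asymptotics.isLittleO_iff]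
  intro c hc
  have hcont : Continuous fun η : C(K, E) => (⟨f', hf'⟩ : C(E, E →L[ℝ] F)).comp η :=
    ContinuousMap.continuous_postcomp _
  obtain ⟨δ, hδ, hball⟩ := Metric.eventually_nhds_iff.1
    (hcont.continuousAt.eventually_mem (Metric.ball_mem_nhds
      ((⟨f', hf'⟩ : C(E, E →L[ℝ] F)).comp γ) hc))
  filter_upwards [Metric.ball_mem_nhds (0 : C(K, E)) hδ] with h hh
  rw [ContinuousMap.norm_le _ (by positivity)]
  intro r
  have hseg : ∀ z ∈ segment ℝ (γ r) (γ r + h r), ‖f' z - f' (γ r)‖ ≤ c := by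
    intro z hz
    rw [segment_eq_image'] at hz
    obtain ⟨θ, hθ, rfl⟩ := hz
    have h1 : dist (γ + θ • h) γ < δ := by
      rw [dist_eq_norm, add_sub_cancel_left, norm_smul, Real.norm_eq_abs, abs_of_nonneg hθ.1]
      have : ‖h‖ < δ := by simpa using hh
      nlinarith [norm_nonneg h, hθ.2]
    have h2 : dist _ _ < c := hball h1
    have h3 := ContinuousMap.dist_apply_le_dist
      (f := (⟨f', hf'⟩ : C(E, E →L[ℝ] F)).comp (γ + θ • h))
      (g := (⟨f', hf'⟩ : C(E, E →L[ℝ] F)).comp γ) r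
    rw [dist_eq_norm] at h3
    simp only [ContinuousMap.comp_apply, ContinuousMap.coe_mk, ContinuousMap.add_apply,
      ContinuousMap.smul_apply] at h3
    simpa using h3.trans h2.le
  have := (convex_segment (γ r) (γ r + h r)).norm_image_sub_le_of_norm_hasFDerivWithin_le'
    (f := f) (fun x _ => (hff' x).hasFDerivWithinAt) hseg (left_mem_segment _ _ _)
    (right_mem_segment _ _ _)
  simp only [add_sub_cancel_left] at this
  exact this.trans (mul_le_mul_of_nonneg_left (h.norm_coe_le_norm r) hc.le)

/-- Induction on the order of differentiability: the derivative is postcomposition with `f'`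
followed by the continuous linear map `pointwiseApply`. The spaces share a universe so that the
induction can replace `F` by `E →L[ℝ] F`. -/
theorem contDiff_continuousMap_comp.{v} {E F : Type v} [NormedAddCommGroup E] [NormedSpace ℝ E]
    [NormedAddCommGroup F] [NormedSpace ℝ F] {f : E → F} (hf : ContDiff ℝ ∞ f) :
    ContDiff ℝ ∞ (fun γ : C(K, E) => (⟨f, hf.continuous⟩ : C(E, F)).comp γ) := by
  rw [contDiff_infty]
  intro n
  induction n generalizing F with
  | zero =>
    rw [Nat.cast_zero, contDiff_zero]
    exact ContinuousMap.continuous_postcomp _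
  | succ n ih =>
    have h1 : ContDiff ℝ ∞ (fderiv ℝ f) := hf.fderiv_right (by simp)
    rw [Nat.cast_add, Nat.cast_one, contDiff_succ_iff_hasFDerivAt]
    refine ⟨_, (pointwiseApply (K := K) (E := E) (F := F)).contDiff.comp (ih h1), fun γ => ?_⟩
    exact hasFDerivAt_continuousMap_comp hf.continuous h1.continuous
      (fun x => (hf.differentiable (by simp) x).hasFDerivAt) γ

/-- A smooth map near a point of a finite-dimensional space extends to a globally smooth map. -/
theorem exists_contDiff_extension [FiniteDimensional ℝ E] {f : E → F} {O : Set E} (hO : IsOpen O)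
    {z : E} (hz : z ∈ O) (hf : ContDiffOn ℝ ∞ f O) :
    ∃ g : E → F, ContDiff ℝ ∞ g ∧ ∃ O' : Set E, IsOpen O' ∧ z ∈ O' ∧ O' ⊆ O ∧ EqOn g f O' := by
  obtain ⟨R, hR, hball⟩ := Metric.isOpen_iff.1 hO z hz
  let b : ContDiffBump z := ⟨R / 4, R / 2, by positivity, by linarith⟩
  refine ⟨fun x => b x • f x, ?_, Metric.ball z (R / 4), Metric.isOpen_ball,
    Metric.mem_ball_self (by positivity),
    (Metric.ball_subset_ball (by linarith)).trans hball, fun x hx => ?_⟩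
  · rw [contDiff_iff_contDiffAt]
    intro x
    by_cases hx : x ∈ O
    · exact b.contDiffAt.smul (hf.contDiffAt (hO.mem_nhds hx))
    · have hx' : x ∉ tsupport b := by
        rw [b.tsupport_eq]
        intro h
        exact hx (hball (lt_of_le_of_lt h (by show R / 2 < R; linarith)))
      have : (fun x => b x • f x) =ᶠ[𝓝 x] fun _ => 0 := by
        filter_upwards [(isClosed_tsupport b).isOpen_compl.mem_nhds hx'] with y hy
        rw [image_eq_zero_of_notMem_tsupport hy, zero_smul]
      exact contDiffAt_const.congr_of_eventuallyEq this
  · show b x • f x = f x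
    rw [b.one_of_mem_closedBall (Metric.ball_subset_closedBall hx), one_smul]

/-- The implicit function theorem, giving an implicit function smooth on a neighbourhood. -/
theorem exists_smooth_implicit {E₁ E₂ F : Type*} [NormedAddCommGroup E₁] [NormedSpace ℝ E₁]
    [CompleteSpace E₁] [NormedAddCommGroup E₂] [NormedSpace ℝ E₂] [CompleteSpace E₂]
    [NormedAddCommGroup F] [NormedSpace ℝ F] [CompleteSpace F] {f : E₁ × E₂ → F} {O : Set (E₁ × E₂)}
    (hO : IsOpen O) {p : E₁ × E₂} (hp : p ∈ O) (hf : ContDiffOn ℝ ∞ f O)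
    (hinv : (fderiv ℝ f p ∘L .inr ℝ E₁ E₂).IsInvertible) :
    ∃ (A : Set E₁) (ψ : E₁ → E₂), IsOpen A ∧ p.1 ∈ A ∧ ContDiffOn ℝ ∞ ψ A ∧ ψ p.1 = p.2 ∧
      (∀ x ∈ A, (x, ψ x) ∈ O ∧ f (x, ψ x) = f p) ∧
      ∀ᶠ v in 𝓝 p, f v = f p → v.2 = ψ v.1 := by
  have hfp : ∀ q ∈ O, ContDiffAt ℝ ∞ f q := fun q hq => hf.contDiffAt (hO.mem_nhds hq)
  let ψ := (hfp p hp).implicitFunction (by simp) hinv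
  have hψp : ψ p.1 = p.2 := (hfp p hp).implicitFunction_apply_self (by simp) hinv
  have hψ : ContDiffAt ℝ ∞ ψ p.1 := (hfp p hp).contDiffAt_implicitFunction (by simp) hinv
  have hψ1 : ∀ᶠ x in 𝓝 p.1, ContDiffAt ℝ 1 ψ x :=
    (hψ.of_le (by simp)).eventually (by simp)
  have hgr : ContinuousAt (fun x => (x, ψ x)) p.1 := continuousAt_id.prodMk hψ.continuousAt
  have hgr' : Filter.Tendsto (fun x => (x, ψ x)) (𝓝 p.1) (𝓝 p) := by
    have := hgr.tendsto
    simpa only [hψp] using this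
  have hOe : ∀ᶠ x in 𝓝 p.1, (x, ψ x) ∈ O := hgr' (hO.mem_nhds hp)
  have hdc : ContinuousAt (fun q => fderiv ℝ f q ∘L .inr ℝ E₁ E₂) p :=
    ((hfp p hp).fderiv_right (m := 0) (by simp)).continuousAt.clm_comp continuousAt_const
  have hinve : ∀ᶠ q in 𝓝 p, (fderiv ℝ f q ∘L .inr ℝ E₁ E₂).IsInvertible := by
    obtain ⟨e, he⟩ := hinv
    have := hdc.tendsto (show _ ∈ 𝓝 (fderiv ℝ f p ∘L .inr ℝ E₁ E₂) from he ▸ e.nhds)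
    filter_upwards [this] with q hq
    obtain ⟨e', he'⟩ := hq
    exact ⟨e', he'⟩
  have hval : ∀ᶠ x in 𝓝 p.1, f (x, ψ x) = f p :=
    (hfp p hp).eventually_apply_implicitFunction (by simp) hinv
  have hall := hψ1.and (hOe.and ((hgr'.eventually hinve).and hval))
  obtain ⟨A, hA, hAo, hpA⟩ := eventually_nhds_iff.1 hall
  refine ⟨A, ψ, hAo, hpA, ?_, hψp, fun x hx => ⟨(hA x hx).2.1, (hA x hx).2.2.2⟩, ?_⟩
  -- Smoothness of order `∞` at the single point `p.1` does not give a neighbourhood on which all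
  -- orders hold. The implicit function theorem is therefore applied afresh at each `(x, ψ x)`, and
  -- local uniqueness identifies the new implicit function with `ψ` near `x`.
  · intro x hx
    obtain ⟨h1, h2, h3, h4⟩ := hA x hx
    have key := (hfp _ h2).eventually_apply_eq_iff_implicitFunction (by simp) h3
    have hgx : ContinuousAt (fun x => (x, ψ x)) x := continuousAt_id.prodMk h1.continuousAt
    have hsm : ContDiffAt ℝ ∞ ((hfp _ h2).implicitFunction (by simp) h3) x :=
      (hfp _ h2).contDiffAt_implicitFunction (by simp) h3
    refine (hsm.congr_of_eventuallyEq ?_).contDiffWithinAt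
    filter_upwards [hgx.eventually key, hAo.mem_nhds hx] with y hy hyA
    exact (hy.1 (by rw [(hA y hyA).2.2.2, h4])).symm
  · filter_upwards [(hfp p hp).eventually_apply_eq_iff_implicitFunction (by simp) hinv] with v hv hv'
    exact (hv.1 hv').symm

/-- Integration from `0` as an operator on continuous curves on `[0, 1]`. -/
noncomputable def primitiveCLM (Z : Type*) [NormedAddCommGroup Z] [NormedSpace ℝ Z] :
    C(Icc (0 : ℝ) 1, Z) →L[ℝ] C(Icc (0 : ℝ) 1, Z) :=
  LinearMap.mkContinuous
    { toFun := fun γ => ⟨fun r => ∫ θ in (0 : ℝ)..r, IccExtend zero_le_one γ θ, by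
        have : Continuous fun r : ℝ => ∫ θ in (0 : ℝ)..r, IccExtend zero_le_one γ θ :=
          intervalIntegral.continuous_primitive
            (fun a b => (γ.continuous.Icc_extend' ).intervalIntegrable a b) 0
        exact this.comp continuous_subtype_val⟩
      map_add' := fun γ δ => by
        ext r
        simp only [ContinuousMap.coe_mk, ContinuousMap.add_apply]
        rw [← intervalIntegral.integral_add
          ((γ.continuous.Icc_extend' ).intervalIntegrable _ _)
          ((δ.continuous.Icc_extend' ).intervalIntegrable _ _)]
        rfl
      map_smul' := fun c γ => by
        ext r
        simp only [ContinuousMap.coe_mk, ContinuousMap.smul_apply, RingHom.id_apply]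
        rw [← intervalIntegral.integral_smul]
        rfl } 1
    (fun γ => by
      rw [ContinuousMap.norm_le _ (by positivity)]
      intro r
      have h := intervalIntegral.norm_integral_le_of_norm_le_const (a := 0) (b := (r : ℝ))
        (C := ‖γ‖) (f := IccExtend zero_le_one γ) (fun x _ => γ.norm_coe_le_norm _)
      have hr := r.2
      simp only [sub_zero, abs_of_nonneg hr.1] at h
      simp only [LinearMap.coe_mk, AddHom.coe_mk, ContinuousMap.coe_mk, one_mul]
      exact h.trans (mul_le_of_le_one_right (norm_nonneg _) hr.2))

theorem primitiveCLM_apply {Z : Type*} [NormedAddCommGroup Z] [NormedSpace ℝ Z]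
    (γ : C(Icc (0 : ℝ) 1, Z)) (r : Icc (0 : ℝ) 1) :
    primitiveCLM Z γ r = ∫ θ in (0 : ℝ)..r, IccExtend zero_le_one γ θ := rfl

theorem hasDerivWithinAt_primitiveCLM {Z : Type*} [NormedAddCommGroup Z] [NormedSpace ℝ Z]
    [CompleteSpace Z]
    (γ : C(Icc (0 : ℝ) 1, Z)) (r : Icc (0 : ℝ) 1) :
    HasDerivWithinAt (IccExtend zero_le_one (primitiveCLM Z γ)) (γ r) (Icc 0 1) r := by
  have hc := γ.continuous.Icc_extend' (h := zero_le_one)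
  have h := (hc.integral_hasStrictDerivAt 0 (r : ℝ)).hasDerivAt.hasDerivWithinAt (s := Icc 0 1)
  rw [IccExtend_val] at h
  refine h.congr (fun x hx => ?_) ?_
  · rw [IccExtend_of_mem _ _ hx, primitiveCLM_apply]
  · rw [IccExtend_val, primitiveCLM_apply]

/-- Solutions on `[0, 1]` of `γ' = ε V(γ)` depend smoothly on the initial value, and their
derivatives with respect to the initial value solve the variational equation. -/
theorem exists_smooth_solutions {Z : Type*} [NormedAddCommGroup Z] [NormedSpace ℝ Z]
    [FiniteDimensional ℝ Z] {V : Z → Z} {O : Set Z} (hO : IsOpen O) {z₀ : Z} (hz₀ : z₀ ∈ O)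
    (hV : ContDiffOn ℝ ∞ V O) :
    ∃ ε > (0 : ℝ), ∃ (A : Set Z) (Γ : Z → C(Icc (0 : ℝ) 1, Z)), IsOpen A ∧ z₀ ∈ A ∧
      ContDiffOn ℝ ∞ Γ A ∧ ∀ z ∈ A, (∀ r, Γ z r ∈ O) ∧ Γ z 0 = z ∧
        (∀ r, HasDerivWithinAt (IccExtend zero_le_one (Γ z)) (ε • V (Γ z r)) (Icc 0 1) r) ∧
        ∀ v, fderiv ℝ Γ z v 0 = v ∧ ∀ r, HasDerivWithinAt (IccExtend zero_le_one (fderiv ℝ Γ z v))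
          (ε • fderiv ℝ V (Γ z r) (fderiv ℝ Γ z v r)) (Icc 0 1) r := by
  have : CompleteSpace Z := FiniteDimensional.complete ℝ Z
  -- A globally defined vector field makes `γ ↦ W ∘ γ` a smooth map on the whole Banach space of
  -- curves.
  obtain ⟨W, hW, O', hO', hzO', hO'O, hWV⟩ := exists_contDiff_extension hO hz₀ hV
  let I := Icc (0 : ℝ) 1
  let ψ : C(I, Z) → C(I, Z) := fun γ => (⟨W, hW.continuous⟩ : C(Z, Z)).comp γ
  have hψ : ContDiff ℝ ∞ ψ := contDiff_continuousMap_comp hW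
  let cst : Z →L[ℝ] C(I, Z) := ContinuousLinearMap.const ℝ I
  let P := primitiveCLM Z
  -- The zeros of `f` are the solutions of `γ = z + ε ∫ W(γ)`. At `ε = 0` the partial derivative in
  -- `γ` is the identity, so `γ` is a smooth function of `(z, ε)` near `(z₀, 0)`; a small `ε > 0` is
  -- then fixed.
  let f : (Z × ℝ) × C(I, Z) → C(I, Z) := fun q => q.2 - cst q.1.1 - q.1.2 • P (ψ q.2)
  have hf : ContDiff ℝ ∞ f := by fun_prop
  let p : (Z × ℝ) × C(I, Z) := ((z₀, 0), cst z₀)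
  have hfp : f p = 0 := by simp [f, p]
  have hinv : (fderiv ℝ f p ∘L .inr ℝ (Z × ℝ) C(I, Z)).IsInvertible := by
    have h1 : HasFDerivAt (fun γ : C(I, Z) => f ((z₀, 0), γ))
        (fderiv ℝ f p ∘L .inr ℝ (Z × ℝ) C(I, Z)) (cst z₀) :=
      HasFDerivAt.comp (cst z₀) ((hf.differentiable (by simp) p).hasFDerivAt)
        (hasFDerivAt_prodMk_right (z₀, (0 : ℝ)) (cst z₀))
    have h2 : HasFDerivAt (fun γ : C(I, Z) => f ((z₀, 0), γ))
        (ContinuousLinearMap.id ℝ C(I, Z)) (cst z₀) := by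
      have : (fun γ : C(I, Z) => f ((z₀, 0), γ)) = fun γ => γ - cst z₀ := by
        funext γ; simp [f]
      rw [this]
      exact (hasFDerivAt_id _).sub_const _
    rw [h1.unique h2]
    exact ⟨ContinuousLinearEquiv.refl ℝ _, rfl⟩
  obtain ⟨A, Ψ, hAo, hpA, hΨ, hΨp, hΨA, -⟩ :=
    exists_smooth_implicit isOpen_univ (mem_univ p) hf.contDiffOn hinv
  have hnhds : ∀ᶠ q in 𝓝 (z₀, (0 : ℝ)), q ∈ A ∧ ∀ r, Ψ q r ∈ O' := by
    have hS : IsOpen {γ : C(I, Z) | MapsTo γ univ O'} := ContinuousMap.isOpen_setOfPred_mapsTo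
      isCompact_univ hO'
    have hc : ContinuousAt Ψ (z₀, 0) := (hΨ.continuousOn).continuousAt (hAo.mem_nhds hpA)
    have hm : Ψ (z₀, 0) ∈ {γ : C(I, Z) | MapsTo γ univ O'} := by
      have : Ψ (z₀, 0) = cst z₀ := hΨp
      rw [this]
      exact fun r _ => hzO'
    filter_upwards [hAo.mem_nhds hpA, hc (hS.mem_nhds hm)] with q hq1 hq2
    exact ⟨hq1, fun r => hq2 (mem_univ r)⟩
  rw [nhds_prod_eq] at hnhds
  obtain ⟨pa, hpa, pb, hpb, hab⟩ := Filter.eventually_prod_iff.1 hnhds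
  obtain ⟨B, hB, hBo, hzB⟩ := eventually_nhds_iff.1 hpa
  obtain ⟨ε, hε, hεb⟩ : ∃ ε > (0 : ℝ), pb ε := by
    obtain ⟨δ, hδ, h⟩ := Metric.eventually_nhds_iff.1 hpb
    exact ⟨δ / 2, by positivity, h (by simp [abs_of_pos hδ]; linarith)⟩
  let Γ : Z → C(I, Z) := fun z => Ψ (z, ε)
  have hmem : ∀ z ∈ B, (z, ε) ∈ A := fun z hz => (hab (hB z hz) hεb).1
  have hΓ : ContDiffOn ℝ ∞ Γ B :=
    hΨ.comp (contDiff_prodMk_left ε).contDiffOn hmem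
  have heq : ∀ z ∈ B, Γ z = cst z + ε • P (ψ (Γ z)) := by
    intro z hz
    have := (hΨA _ (hmem z hz)).2
    rw [hfp] at this
    simp only [f] at this
    rw [sub_eq_zero, sub_eq_iff_eq_add'] at this
    exact this
  have hval : ∀ z ∈ B, ∀ r, Γ z r ∈ O' := fun z hz r => (hab (hB z hz) hεb).2 r
  have hzero : ∀ γ : C(I, Z), P γ 0 = 0 := by
    intro γ
    show ∫ θ in (0 : ℝ)..((0 : I) : ℝ), IccExtend zero_le_one γ θ = 0
    simp
  have hder : ∀ (γ δ : C(I, Z)) (c : Z), γ = cst c + ε • P δ → γ 0 = c ∧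
      ∀ r : I, HasDerivWithinAt (IccExtend zero_le_one γ) (ε • δ r) (Icc 0 1) r := by
    intro γ δ c h
    refine ⟨?_, fun r => ?_⟩
    · rw [h, ContinuousMap.add_apply, ContinuousMap.smul_apply, hzero]
      simp [cst]
    · have h1 := ((hasDerivWithinAt_primitiveCLM δ r).const_smul ε).const_add c
      refine h1.congr_of_mem (fun x hx => ?_) r.2
      rw [h]
      rfl
  refine ⟨ε, hε, B, Γ, hBo, hzB, hΓ, fun z hz => ⟨fun r => hO'O (hval z hz r), ?_, ?_, ?_⟩⟩
  · exact (hder _ _ _ (heq z hz)).1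
  · intro r
    have := (hder _ _ _ (heq z hz)).2 r
    simp only [ψ, ContinuousMap.comp_apply, ContinuousMap.coe_mk] at this
    rwa [hWV (hval z hz r)] at this
  · intro v
    have hd : HasFDerivAt Γ (fderiv ℝ Γ z) z :=
      ((hΓ.contDiffAt (hBo.mem_nhds hz)).differentiableAt (by simp)).hasFDerivAt
    have hW1 : ContDiff ℝ ∞ (fderiv ℝ W) := hW.fderiv_right (by simp)
    have hψd := hasFDerivAt_continuousMap_comp hW.continuous hW1.continuous
      (fun x => (hW.differentiable (by simp) x).hasFDerivAt) (Γ z)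
    have h2 : HasFDerivAt (fun z => cst z + ε • P (ψ (Γ z)))
        (cst + ε • (P ∘L (pointwiseApply ((⟨fderiv ℝ W, hW1.continuous⟩ : C(Z, Z →L[ℝ] Z)).comp
          (Γ z)) ∘L fderiv ℝ Γ z))) z :=
      cst.hasFDerivAt.add ((P.hasFDerivAt.comp z (hψd.comp z hd)).const_smul ε)
    -- The derivative of the integral equation in `z` is an integral equation for the derivative of
    -- `Γ`, which is the variational equation.
    have h3 := hd.unique (h2.congr_of_eventuallyEq
      (Filter.eventuallyEq_of_mem (hBo.mem_nhds hz) heq))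
    have h4 := congrArg (fun L => L v) h3
    simp only [add_apply, smul_apply,
      ContinuousLinearMap.comp_apply] at h4
    refine ⟨(hder _ _ _ h4).1, fun r => ?_⟩
    have h5 := (hder _ _ _ h4).2 r
    rw [pointwiseApply_apply] at h5
    simp only [ContinuousMap.comp_apply, ContinuousMap.coe_mk] at h5
    have h6 : fderiv ℝ W (Γ z r) = fderiv ℝ V (Γ z r) :=
      Filter.EventuallyEq.fderiv_eq
        (Filter.eventuallyEq_of_mem (hO'.mem_nhds (hval z hz r)) hWV)
    rwa [h6] at h5

end Analysis


/-! ### Differential calculus and uniqueness for curves on `[0, 1]` -/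

section CurveDeriv

variable {X Y Z : Type*} [NormedAddCommGroup X] [NormedSpace ℝ X] [NormedAddCommGroup Y]
  [NormedSpace ℝ Y] [NormedAddCommGroup Z] [NormedSpace ℝ Z]

/-- `f'` is the derivative of the curve `f` on `[0, 1]`. -/
def HasCurveDeriv (f f' : Icc (0 : ℝ) 1 → X) : Prop :=
  ∀ r : Icc (0 : ℝ) 1, HasDerivWithinAt (IccExtend zero_le_one f) (f' r) (Icc 0 1) r

theorem HasCurveDeriv.congr_deriv {f f' g' : Icc (0 : ℝ) 1 → X} (hf : HasCurveDeriv f f')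
    (h : ∀ r, f' r = g' r) : HasCurveDeriv f g' :=
  fun r => h r ▸ hf r

theorem HasCurveDeriv.comp {f f' : Icc (0 : ℝ) 1 → X} (hf : HasCurveDeriv f f') {G : X → Y}
    {G' : Icc (0 : ℝ) 1 → X →L[ℝ] Y} (hG : ∀ r, HasFDerivAt G (G' r) (f r)) :
    HasCurveDeriv (fun r => G (f r)) (fun r => G' r (f' r)) := by
  intro r
  have h := hG r
  rw [← IccExtend_val zero_le_one f r] at h
  exact h.comp_hasDerivWithinAt (r : ℝ) (hf r)

theorem HasCurveDeriv.clm {f f' : Icc (0 : ℝ) 1 → X} (hf : HasCurveDeriv f f') (L : X →L[ℝ] Y) :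
    HasCurveDeriv (fun r => L (f r)) (fun r => L (f' r)) :=
  hf.comp (G' := fun _ => L) fun _ => L.hasFDerivAt

theorem HasCurveDeriv.prodMk {f f' : Icc (0 : ℝ) 1 → X} {g g' : Icc (0 : ℝ) 1 → Y}
    (hf : HasCurveDeriv f f') (hg : HasCurveDeriv g g') :
    HasCurveDeriv (fun r => (f r, g r)) (fun r => (f' r, g' r)) :=
  fun r => (hf r).prodMk (hg r)

theorem hasCurveDeriv_const (x : X) : HasCurveDeriv (fun _ => x) (fun _ => 0) :=
  fun r => hasDerivWithinAt_const (r : ℝ) _ x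

theorem hasCurveDeriv_smul (x : X) : HasCurveDeriv (fun r => (r : ℝ) • x) (fun _ => x) := by
  intro r
  have h : HasDerivWithinAt (fun r : ℝ => r • x) x (Icc 0 1) r := by
    simpa using (hasDerivWithinAt_id (r : ℝ) (Icc 0 1)).smul_const x
  refine h.congr_of_mem (fun y hy => ?_) r.2
  rw [IccExtend_of_mem _ _ hy]

theorem HasCurveDeriv.clm_apply {A A' : Icc (0 : ℝ) 1 → X →L[ℝ] Y} {f f' : Icc (0 : ℝ) 1 → X}
    (hA : HasCurveDeriv A A') (hf : HasCurveDeriv f f') :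
    HasCurveDeriv (fun r => A r (f r)) (fun r => A' r (f r) + A r (f' r)) := by
  intro r
  have := (hA r).clm_apply (hf r)
  simp only [IccExtend_val] at this
  exact this

theorem HasCurveDeriv.continuous {f f' : Icc (0 : ℝ) 1 → X} (hf : HasCurveDeriv f f') :
    Continuous f := by
  have : ContinuousOn (IccExtend zero_le_one f) (Icc 0 1) :=
    fun r hr => (hf ⟨r, hr⟩).continuousWithinAt
  have h2 := this.domRestrict
  rwa [domRestrict_eq, IccExtend, Function.comp_assoc,
    show projIcc (0 : ℝ) 1 zero_le_one ∘ Subtype.val = id from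
      funext fun r => projIcc_val zero_le_one r] at h2

/-- Grönwall for the difference of the curves. The bound is asked for along the two curves only, so
local Lipschitz estimates suffice in the applications. -/
theorem HasCurveDeriv.eq_of_bound {f f' g g' : Icc (0 : ℝ) 1 → X} (hf : HasCurveDeriv f f')
    (hg : HasCurveDeriv g g') (h0 : f 0 = g 0) {C : ℝ}
    (hC : ∀ r, ‖f' r - g' r‖ ≤ C * ‖f r - g r‖) : f = g := by
  let d : ℝ → X := fun r => IccExtend zero_le_one f r - IccExtend zero_le_one g r
  have hd : ∀ r : Icc (0 : ℝ) 1, HasDerivWithinAt d (f' r - g' r) (Icc 0 1) r :=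
    fun r => (hf r).sub (hg r)
  have key := eq_zero_of_abs_deriv_le_mul_abs_self_of_eq_zero_right (f := d)
    (f' := fun r => IccExtend zero_le_one f' r - IccExtend zero_le_one g' r) (K := C)
    (a := 0) (b := 1) (fun r hr => (hd ⟨r, hr⟩).continuousWithinAt) ?_ ?_ ?_
  · funext r
    have := key r r.2
    simp only [d, IccExtend_val] at this
    exact sub_eq_zero.1 this
  · intro x hx
    have hx' : x ∈ Icc (0 : ℝ) 1 := ⟨hx.1, hx.2.le⟩
    rw [IccExtend_of_mem _ _ hx', IccExtend_of_mem _ _ hx']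
    refine ((hd ⟨x, hx'⟩).mono_of_mem_nhdsWithin ?_)
    exact Icc_mem_nhdsGE_of_mem hx
  · have : (0 : ℝ) ∈ Icc (0 : ℝ) 1 := by simp
    simp only [d, IccExtend_of_mem _ _ this]
    exact sub_eq_zero.2 h0
  · intro x hx
    have hx' : x ∈ Icc (0 : ℝ) 1 := ⟨hx.1, hx.2.le⟩
    simp only [d, IccExtend_of_mem _ _ hx']
    exact hC _

theorem HasCurveDeriv.eq_of_deriv_eq {f f' g g' : Icc (0 : ℝ) 1 → X} (hf : HasCurveDeriv f f')
    (hg : HasCurveDeriv g g') (h0 : f 0 = g 0) (h : ∀ r, f' r = g' r) : f = g :=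
  hf.eq_of_bound hg h0 (C := 0) fun r => by simp [h r]

/-- Uniqueness for linear equations. -/
theorem HasCurveDeriv.eq_of_linear {f f' g g' : Icc (0 : ℝ) 1 → X} (hf : HasCurveDeriv f f')
    (hg : HasCurveDeriv g g') (h0 : f 0 = g 0) {A : Icc (0 : ℝ) 1 → X →L[ℝ] X} (hA : Continuous A)
    (h : ∀ r, f' r - g' r = A r (f r - g r)) : f = g := by
  obtain ⟨C, hC⟩ := (isCompact_range hA).isBounded.exists_norm_le
  refine hf.eq_of_bound hg h0 (C := C) fun r => ?_
  rw [h r]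
  exact (A r).le_of_opNorm_le (hC _ ⟨r, rfl⟩) _

end CurveDeriv

/-! ### Equations along rays in a parameter space -/

section RadialSolutions

variable {E F K K' : Type*} [NormedAddCommGroup E] [NormedSpace ℝ E] [FiniteDimensional ℝ E]
  [NormedAddCommGroup F] [NormedSpace ℝ F] [FiniteDimensional ℝ F]
  [NormedAddCommGroup K] [NormedSpace ℝ K]
  [NormedAddCommGroup K'] [NormedSpace ℝ K'] [FiniteDimensional ℝ K']

/-- Solutions of `k' = Λ(k) B(x, r a) a` for `r` in `[0, 1]`, with their variational equation. -/
theorem exists_radial_solutions {Λ : E → K →L[ℝ] E} {O₁ : Set E} (hO₁ : IsOpen O₁)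
    (hΛ : ContDiffOn ℝ ∞ Λ O₁) {B : F × K' → K' →L[ℝ] K} {O₂ : Set (F × K')} (hO₂ : IsOpen O₂)
    (hB : ContDiffOn ℝ ∞ B O₂) {y₀ : E} (hy₀ : y₀ ∈ O₁) {x₀ : F} (hx₀ : (x₀, 0) ∈ O₂) :
    ∃ (N : Set (E × F × K')) (k : E × F × K' → C(Icc (0 : ℝ) 1, E)),
      IsOpen N ∧ (y₀, x₀, 0) ∈ N ∧ ContDiffOn ℝ ∞ k N ∧ ∀ p ∈ N,
        (∀ r : Icc (0 : ℝ) 1, k p r ∈ O₁ ∧ (p.2.1, (r : ℝ) • p.2.2) ∈ O₂) ∧ k p 0 = p.1 ∧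
        HasCurveDeriv (k p) (fun r => Λ (k p r) (B (p.2.1, (r : ℝ) • p.2.2) p.2.2)) ∧
        ∀ v : E × F × K', fderiv ℝ k p v 0 = v.1 ∧
          HasCurveDeriv (fderiv ℝ k p v) (fun r =>
            fderiv ℝ Λ (k p r) (fderiv ℝ k p v r) (B (p.2.1, (r : ℝ) • p.2.2) p.2.2) +
            Λ (k p r) (fderiv ℝ B (p.2.1, (r : ℝ) • p.2.2) (v.2.1, (r : ℝ) • v.2.2) p.2.2 +
              B (p.2.1, (r : ℝ) • p.2.2) v.2.2)) := by
  -- The coordinates are `(k, x, b, a)`. Carrying `x`, the moving point `b` of the ray and its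
  -- velocity `a` as further unknowns makes the equation autonomous.
  let V : (E × F × K' × K') → (E × F × K' × K') := fun z => (Λ z.1 (B (z.2.1, z.2.2.1) z.2.2.2), 0, z.2.2.2, 0)
  let O : Set (E × F × K' × K') := {z | z.1 ∈ O₁ ∧ (z.2.1, z.2.2.1) ∈ O₂}
  have hO : IsOpen O := (hO₁.preimage (by fun_prop)).inter (hO₂.preimage (by fun_prop))
  have hV : ContDiffOn ℝ ∞ V O := by
    have h1 : ContDiffOn ℝ ∞ (fun z : (E × F × K' × K') => Λ z.1) O :=
      hΛ.comp contDiff_fst.contDiffOn fun z hz => hz.1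
    have h2 : ContDiffOn ℝ ∞ (fun z : (E × F × K' × K') => B (z.2.1, z.2.2.1)) O :=
      hB.comp (g := B) (f := fun z : (E × F × K' × K') => (z.2.1, z.2.2.1))
        (by fun_prop : ContDiff ℝ ∞ _).contDiffOn fun z hz => hz.2
    have h3 : ContDiffOn ℝ ∞ (fun z : (E × F × K' × K') => z.2.2.2) O :=
      (by fun_prop : ContDiff ℝ ∞ _).contDiffOn
    exact (h1.clm_apply (h2.clm_apply h3)).prodMk (contDiffOn_const.prodMk
      (h3.prodMk contDiffOn_const))
  have hz₀ : ((y₀, x₀, 0, 0) : (E × F × K' × K')) ∈ O := ⟨hy₀, hx₀⟩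
  obtain ⟨ε, hε, A, Γ, hA, hzA, hΓ, hsol⟩ := exists_smooth_solutions hO hz₀ hV
  -- The available solutions satisfy `γ' = ε V(γ)`. The velocity enters `V` linearly, so starting
  -- with velocity `ε⁻¹ a` cancels the factor `ε` and gives `b = r a`.
  let ι : E × F × K' → (E × F × K' × K') := fun p => (p.1, p.2.1, 0, ε⁻¹ • p.2.2)
  have hι : ContDiff ℝ ∞ ι := by fun_prop
  let ι' : E × F × K' →L[ℝ] (E × F × K' × K') :=
    (ContinuousLinearMap.fst ℝ E (F × K')).prod (((ContinuousLinearMap.fst ℝ F K').comp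
      (ContinuousLinearMap.snd ℝ E (F × K'))).prod ((0 : E × F × K' →L[ℝ] K').prod
        (ε⁻¹ • ((ContinuousLinearMap.snd ℝ F K').comp (ContinuousLinearMap.snd ℝ E (F × K'))))))
  have hι' : ∀ p, HasFDerivAt ι ι' p := fun p => ι'.hasFDerivAt
  let π := (ContinuousLinearMap.fst ℝ E (F × K' × K')).compLeftContinuous ℝ (Icc (0 : ℝ) 1)
  let k : E × F × K' → C(Icc (0 : ℝ) 1, E) := fun p => π (Γ (ι p))
  have hN : IsOpen (ι ⁻¹' A) := hA.preimage hι.continuous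
  refine ⟨ι ⁻¹' A, k, hN, by simpa [ι] using hzA, π.contDiff.comp_contDiffOn
    (hΓ.comp hι.contDiffOn fun p hp => hp), fun p hp => ?_⟩
  obtain ⟨hmem, hinit, hder, hvar⟩ := hsol (ι p) hp
  have hder : HasCurveDeriv (Γ (ι p)) (fun r => ε • V (Γ (ι p) r)) := hder
  let Lx : (E × F × K' × K') →L[ℝ] F :=
    (ContinuousLinearMap.fst ℝ F (K' × K')).comp (ContinuousLinearMap.snd ℝ E (F × K' × K'))
  let Lb : (E × F × K' × K') →L[ℝ] K' := (ContinuousLinearMap.fst ℝ K' K').comp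
    ((ContinuousLinearMap.snd ℝ F (K' × K')).comp (ContinuousLinearMap.snd ℝ E (F × K' × K')))
  let La : (E × F × K' × K') →L[ℝ] K' := (ContinuousLinearMap.snd ℝ K' K').comp
    ((ContinuousLinearMap.snd ℝ F (K' × K')).comp (ContinuousLinearMap.snd ℝ E (F × K' × K')))
  have hx : ∀ r, (Γ (ι p) r).2.1 = p.2.1 := by
    have h1 := hder.clm Lx
    exact fun r => congrFun (h1.eq_of_deriv_eq (hasCurveDeriv_const p.2.1)
      (by rw [hinit]; simp [ι, Lx]) (fun r => by simp [V, Lx])) r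
  have ha : ∀ r, (Γ (ι p) r).2.2.2 = ε⁻¹ • p.2.2 := by
    have h1 := hder.clm La
    exact fun r => congrFun (h1.eq_of_deriv_eq (hasCurveDeriv_const (ε⁻¹ • p.2.2))
      (by rw [hinit]; simp [ι, La]) (fun r => by simp [V, La])) r
  have hb : ∀ r, (Γ (ι p) r).2.2.1 = (r : ℝ) • p.2.2 := by
    have h1 := hder.clm Lb
    exact fun r => congrFun (h1.eq_of_deriv_eq (hasCurveDeriv_smul p.2.2)
      (by rw [hinit]; simp [ι, Lb]) (fun r => by simp [V, Lb, ha, smul_smul, hε.ne'])) r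
  have hkr : ∀ r, k p r = (Γ (ι p) r).1 := fun r => rfl
  have hfst := fun (f : Icc (0 : ℝ) 1 → (E × F × K' × K')) f' (hf : HasCurveDeriv f f') =>
    hf.clm (ContinuousLinearMap.fst ℝ E (F × K' × K'))
  refine ⟨fun r => ?_, ?_, ?_, fun v => ?_⟩
  · have := hmem r
    simp only [O, mem_ofPred_eq, hx, hb] at this
    exact this
  · rw [hkr, hinit]
  · refine (hfst _ _ hder).congr_deriv fun r => ?_
    simp only [V, ContinuousLinearMap.coe_fst', hx, hb, ha, hkr, map_smul,
      smul_smul, mul_inv_cancel₀ hε.ne', one_smul]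
  · have hkd : fderiv ℝ k p = π ∘L (fderiv ℝ Γ (ι p) ∘L ι') := by
      have h1 : HasFDerivAt Γ (fderiv ℝ Γ (ι p)) (ι p) :=
        ((hΓ.contDiffAt (hA.mem_nhds hp)).differentiableAt (by simp)).hasFDerivAt
      exact (π.hasFDerivAt.comp p (h1.comp p (hι' p))).fderiv
    obtain ⟨hv0, hvd⟩ := hvar (ι' v)
    have hvd : HasCurveDeriv (fderiv ℝ Γ (ι p) (ι' v)) (fun r =>
      ε • fderiv ℝ V (Γ (ι p) r) (fderiv ℝ Γ (ι p) (ι' v) r)) := hvd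
    have hJ : ∀ r, fderiv ℝ k p v r = (fderiv ℝ Γ (ι p) (ι' v) r).1 := fun r => by
      rw [hkd]; rfl
    have hVd : ∀ r, HasFDerivAt V (fderiv ℝ V (Γ (ι p) r)) (Γ (ι p) r) := fun r =>
      ((hV.contDiffAt (hO.mem_nhds (hmem r))).differentiableAt (by simp)).hasFDerivAt
    have hVform : ∀ r (w : (E × F × K' × K')), fderiv ℝ V (Γ (ι p) r) w =
        (fderiv ℝ Λ (k p r) w.1 (B (p.2.1, (r : ℝ) • p.2.2) (ε⁻¹ • p.2.2)) +
          Λ (k p r) (fderiv ℝ B (p.2.1, (r : ℝ) • p.2.2) (w.2.1, w.2.2.1) (ε⁻¹ • p.2.2) +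
            B (p.2.1, (r : ℝ) • p.2.2) w.2.2.2), 0, w.2.2.2, 0) := by
      intro r w
      have hm := hmem r
      have h1 : HasFDerivAt (fun z : (E × F × K' × K') => Λ z.1) (fderiv ℝ Λ (Γ (ι p) r).1 ∘L
          ContinuousLinearMap.fst ℝ E (F × K' × K')) (Γ (ι p) r) :=
        HasFDerivAt.comp _ ((hΛ.contDiffAt (hO₁.mem_nhds hm.1)).differentiableAt
          (by simp)).hasFDerivAt hasFDerivAt_fst
      let L : (E × F × K' × K') →L[ℝ] F × K' := ((ContinuousLinearMap.fst ℝ F (K' × K')).comp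
        (ContinuousLinearMap.snd ℝ E (F × K' × K'))).prod ((ContinuousLinearMap.fst ℝ K' K').comp
          ((ContinuousLinearMap.snd ℝ F (K' × K')).comp
            (ContinuousLinearMap.snd ℝ E (F × K' × K'))))
      have h2 : HasFDerivAt (fun z : (E × F × K' × K') => B (z.2.1, z.2.2.1))
          (fderiv ℝ B ((Γ (ι p) r).2.1, (Γ (ι p) r).2.2.1) ∘L L) (Γ (ι p) r) :=
        HasFDerivAt.comp (g := B) (f := fun z : (E × F × K' × K') => (z.2.1, z.2.2.1)) (Γ (ι p) r)
          ((hB.contDiffAt (hO₂.mem_nhds hm.2)).differentiableAt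
          (by simp)).hasFDerivAt L.hasFDerivAt
      let L4 : (E × F × K' × K') →L[ℝ] K' := (ContinuousLinearMap.snd ℝ K' K').comp
        ((ContinuousLinearMap.snd ℝ F (K' × K')).comp (ContinuousLinearMap.snd ℝ E (F × K' × K')))
      have h3 : HasFDerivAt (fun z : (E × F × K' × K') => z.2.2.2) L4 (Γ (ι p) r) := L4.hasFDerivAt
      have h4 := (h1.clm_apply (h2.clm_apply h3)).prodMk ((hasFDerivAt_const (0 : F) _).prodMk
        (h3.prodMk (hasFDerivAt_const (0 : K') (Γ (ι p) r))))
      rw [(hVd r).unique h4]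
      simp only [L, L4, hx, hb, ha, ContinuousLinearMap.prod_apply, add_apply,
        ContinuousLinearMap.comp_apply, ContinuousLinearMap.flip_apply, zero_apply,
        ContinuousLinearMap.coe_fst', ContinuousLinearMap.coe_snd', hkr]
      simp only [map_add]
      congr 1
      abel
    have hvd := hvd.congr_deriv fun r => by rw [hVform]
    have hJx : ∀ r, (fderiv ℝ Γ (ι p) (ι' v) r).2.1 = v.2.1 := by
      have h1 := hvd.clm Lx
      exact fun r => congrFun (h1.eq_of_deriv_eq (hasCurveDeriv_const v.2.1)
        (by rw [hv0]; rfl) (fun r => by simp [Lx])) r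
    have hJa : ∀ r, (fderiv ℝ Γ (ι p) (ι' v) r).2.2.2 = ε⁻¹ • v.2.2 := by
      have h1 := hvd.clm La
      exact fun r => congrFun (h1.eq_of_deriv_eq (hasCurveDeriv_const (ε⁻¹ • v.2.2))
        (by rw [hv0]; rfl) (fun r => by simp [La])) r
    have hJb : ∀ r, (fderiv ℝ Γ (ι p) (ι' v) r).2.2.1 = (r : ℝ) • v.2.2 := by
      have h1 := hvd.clm Lb
      exact fun r => congrFun (h1.eq_of_deriv_eq (hasCurveDeriv_smul v.2.2)
        (by rw [hv0]; simp [ι', Lb]) (fun r => by simp [Lb, hJa, smul_smul, hε.ne'])) r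
    refine ⟨by rw [hJ, hv0]; rfl, ?_⟩
    have h1 := hfst _ _ hvd
    have h2 : (fun r => (fderiv ℝ Γ (ι p) (ι' v) r).1) = fderiv ℝ k p v :=
      funext fun r => (hJ r).symm
    replace h1 : HasCurveDeriv (fun r => (fderiv ℝ Γ (ι p) (ι' v) r).1) _ := h1
    rw [h2] at h1
    refine h1.congr_deriv fun r => ?_
    simp only [ContinuousLinearMap.coe_fst', hJx, hJb, hJa, ← hJ, map_smul,
      smul_add, map_add, smul_smul, mul_inv_cancel₀ hε.ne',
      one_smul]

end RadialSolutions


/-! ### Multiplication in coordinates: integration along rays -/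

section LocalModel

variable {E F K K' : Type*} [NormedAddCommGroup E] [NormedSpace ℝ E] [FiniteDimensional ℝ E]
  [NormedAddCommGroup F] [NormedSpace ℝ F] [FiniteDimensional ℝ F]
  [NormedAddCommGroup K] [NormedSpace ℝ K]
  [NormedAddCommGroup K'] [NormedSpace ℝ K'] [FiniteDimensional ℝ K']

/-- Local model of the multiplication by elements close to a unit: `y` is the coordinate of an
arrow, `(x, a)` are coordinates of arrows close to units, with target `x` and source `s₂ (x, a)`. -/
theorem exists_model_multiplication {Λ : E → K →L[ℝ] E} {O₁ : Set E} (hO₁ : IsOpen O₁)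
    (hΛ : ContDiffOn ℝ ∞ Λ O₁) {B : F × K' → K' →L[ℝ] K} {O₂ : Set (F × K')} (hO₂ : IsOpen O₂)
    (hB : ContDiffOn ℝ ∞ B O₂) {O₃ : Set F} (hO₃ : IsOpen O₃) {ρ : F → K →L[ℝ] F}
    (hρ : ContDiffOn ℝ ∞ ρ O₃) {s₁ : E → F} (hs₁ : ContDiffOn ℝ ∞ s₁ O₁) {s₂ : F × K' → F}
    (hs₂ : ContDiffOn ℝ ∞ s₂ O₂) {y₀ : E} (hy₀ : y₀ ∈ O₁) (hx₀ : (s₁ y₀, 0) ∈ O₂)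
    (hx₀' : s₁ y₀ ∈ O₃) (hs₂0 : ∀ x, (x, 0) ∈ O₂ → s₂ (x, 0) = x)
    (hρ₁ : ∀ y ∈ O₁, s₁ y ∈ O₃ → ∀ ξ, fderiv ℝ s₁ y (Λ y ξ) = ρ (s₁ y) ξ)
    (hρ₂ : ∀ q ∈ O₂, s₂ q ∈ O₃ → ∀ β, fderiv ℝ s₂ q (0, β) = ρ (s₂ q) (B q β))
    {c : F → K → K → K}
    (hbr : ∀ y ∈ O₁, s₁ y ∈ O₃ → ∀ ξ η,
      fderiv ℝ Λ y (Λ y ξ) η - fderiv ℝ Λ y (Λ y η) ξ = Λ y (c (s₁ y) ξ η))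
    (hmc : ∀ q ∈ O₂, s₂ q ∈ O₃ → ∀ a b,
      c (s₂ q) (B q a) (B q b) + fderiv ℝ B q (0, a) b - fderiv ℝ B q (0, b) a = 0) :
    ∃ (N : Set (E × K')) (f : E × K' → E), IsOpen N ∧ (y₀, 0) ∈ N ∧ ContDiffOn ℝ ∞ f N ∧
      ∀ q ∈ N, q.1 ∈ O₁ ∧ f q ∈ O₁ ∧ (s₁ q.1, q.2) ∈ O₂ ∧ s₁ (f q) = s₂ (s₁ q.1, q.2) ∧
        (q.2 = 0 → f q = q.1) ∧
        (∀ β, fderiv ℝ f q (0, β) = Λ (f q) (B (s₁ q.1, q.2) β)) ∧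
        (∀ t : E → F, DifferentiableOn ℝ t O₁ → (∀ y ∈ O₁, ∀ ξ, fderiv ℝ t y (Λ y ξ) = 0) →
          t (f q) = t q.1) ∧
        (∀ R : E → E, DifferentiableOn ℝ R O₁ →
          (∀ y ∈ O₁, s₁ y ∈ O₃ → ∀ ξ, fderiv ℝ R y (Λ y ξ) = fderiv ℝ Λ y (R y) ξ) →
          (∀ y ∈ O₁, fderiv ℝ s₁ y (R y) = 0) → fderiv ℝ f q (R q.1, 0) = R (f q)) := by
  -- A neighbourhood on which the anchor `ρ` is Lipschitz. Both domains are shrunk so that sources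
  -- stay in it along the solutions and along the rays.
  obtain ⟨C, U, hU, hLip⟩ := (((hρ.contDiffAt (hO₃.mem_nhds hx₀')).of_le
    (by simp : (1 : WithTop ℕ∞) ≤ ∞))).exists_lipschitzOnWith
  obtain ⟨W, hWs, hW, hxW⟩ := mem_nhds_iff.1 (Filter.inter_mem hU (hO₃.mem_nhds hx₀'))
  let O₁' := O₁ ∩ s₁ ⁻¹' W
  let O₂' := O₂ ∩ s₂ ⁻¹' W
  have hO₁' : IsOpen O₁' := hs₁.continuousOn.isOpen_inter_preimage hO₁ hW
  have hO₂' : IsOpen O₂' := hs₂.continuousOn.isOpen_inter_preimage hO₂ hW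
  have hx₀2 : (s₁ y₀, 0) ∈ O₂' := ⟨hx₀, by rw [mem_preimage, hs₂0 _ hx₀]; exact hxW⟩
  obtain ⟨N, k, hN, hyN, hk, hsol⟩ := exists_radial_solutions hO₁' (hΛ.mono inter_subset_left)
    hO₂' (hB.mono inter_subset_left) (y₀ := y₀) ⟨hy₀, hxW⟩ hx₀2
  let g : E × K' → E × F × K' := fun q => (q.1, s₁ q.1, q.2)
  let D : Set (E × K') := Prod.fst ⁻¹' O₁'
  have hD : IsOpen D := hO₁'.preimage continuous_fst
  have hg : ContDiffOn ℝ ∞ g D := contDiff_fst.contDiffOn.prodMk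
    ((hs₁.comp contDiff_fst.contDiffOn fun q hq => hq.1).prodMk contDiff_snd.contDiffOn)
  let ev : C(Icc (0 : ℝ) 1, E) →L[ℝ] E := ContinuousMap.evalCLM ℝ 1
  have hev : ∀ γ, ev γ = γ 1 := fun _ => rfl
  let f : E × K' → E := fun q => ev (k (g q))
  have hNo : IsOpen (D ∩ g ⁻¹' N) := hg.continuousOn.isOpen_inter_preimage hD hN
  refine ⟨D ∩ g ⁻¹' N, f, hNo, ⟨⟨hy₀, hxW⟩, hyN⟩, ?_, fun q hq => ?_⟩
  · exact ev.contDiff.comp_contDiffOn (hk.comp (hg.mono inter_subset_left) fun q hq => hq.2)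
  obtain ⟨hmem, hinit, hder, hvar⟩ := hsol _ hq.2
  have h1 : ((1 : Icc (0 : ℝ) 1) : ℝ) = 1 := rfl
  have hmem₁ : ∀ r, k (g q) r ∈ O₁ ∧ s₁ (k (g q) r) ∈ O₃ := fun r =>
    ⟨(hmem r).1.1, (hWs (hmem r).1.2).2⟩
  have hmem₂ : ∀ r : Icc (0 : ℝ) 1, (s₁ q.1, (r : ℝ) • q.2) ∈ O₂ ∧
    s₂ (s₁ q.1, (r : ℝ) • q.2) ∈ O₃ := fun r => ⟨(hmem r).2.1, (hWs (hmem r).2.2).2⟩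
  have hΛd : ∀ r, HasFDerivAt Λ (fderiv ℝ Λ (k (g q) r)) (k (g q) r) := fun r =>
    ((hΛ.contDiffAt (hO₁.mem_nhds (hmem₁ r).1)).differentiableAt (by simp)).hasFDerivAt
  have hBd : ∀ r : Icc (0 : ℝ) 1, HasFDerivAt B (fderiv ℝ B (s₁ q.1, (r : ℝ) • q.2))
      (s₁ q.1, (r : ℝ) • q.2) := fun r =>
    ((hB.contDiffAt (hO₂.mem_nhds (hmem₂ r).1)).differentiableAt (by simp)).hasFDerivAt
  have hs₁d : ∀ y ∈ O₁, HasFDerivAt s₁ (fderiv ℝ s₁ y) y := fun y hy =>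
    ((hs₁.contDiffAt (hO₁.mem_nhds hy)).differentiableAt (by simp)).hasFDerivAt
  have hline : HasCurveDeriv (fun r : Icc (0 : ℝ) 1 => (s₁ q.1, (r : ℝ) • q.2))
      (fun _ => (0, q.2)) := (hasCurveDeriv_const _).prodMk (hasCurveDeriv_smul _)
  have hBcurve : HasCurveDeriv (fun r : Icc (0 : ℝ) 1 => B (s₁ q.1, (r : ℝ) • q.2))
      (fun r => fderiv ℝ B (s₁ q.1, (r : ℝ) • q.2) (0, q.2)) := hline.comp hBd
  have hξc : Continuous fun r : Icc (0 : ℝ) 1 => B (s₁ q.1, (r : ℝ) • q.2) q.2 :=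
    hBcurve.continuous.clm_apply continuous_const
  have hΛc : Continuous fun r => fderiv ℝ Λ (k (g q) r) :=
    (((hΛ.fderiv_of_isOpen hO₁ (m := 0) (by simp)).continuousOn).comp_continuous
      (k (g q)).continuous fun r => (hmem₁ r).1)
  have hAc : Continuous fun r : Icc (0 : ℝ) 1 =>
      (fderiv ℝ Λ (k (g q) r)).flip (B (s₁ q.1, (r : ℝ) • q.2) q.2) :=
    ((ContinuousLinearMap.flipₗᵢ ℝ E K E).continuous.comp hΛc).clm_apply hξc
  -- Both sides solve `x' = ρ(x) ξ` with the same `ξ = B(·) a` and the same initial value `s₁ q.1`.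
  -- This equality is what allows the structure functions at the two points to be compared below.
  have hs : ∀ r : Icc (0 : ℝ) 1, s₁ (k (g q) r) = s₂ (s₁ q.1, (r : ℝ) • q.2) := by
    have e1 := hder.comp (G := s₁) fun r => hs₁d _ (hmem₁ r).1
    have e2 := hline.comp (G := s₂) fun r =>
      ((hs₂.contDiffAt (hO₂.mem_nhds (hmem₂ r).1)).differentiableAt (by simp)).hasFDerivAt
    obtain ⟨C', hC'⟩ := (isCompact_range hξc).isBounded.exists_norm_le
    refine fun r => congrFun (e1.eq_of_bound e2 ?_ (C := C * C') fun r => ?_) r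
    · rw [hinit]
      simp only [g, Icc.coe_zero, zero_smul]
      refine (hs₂0 _ ?_).symm
      have := (hmem₂ 0).1
      simpa using this
    · rw [hρ₁ _ (hmem₁ r).1 (hmem₁ r).2, hρ₂ _ (hmem₂ r).1 (hmem₂ r).2,
        ← sub_apply]
      refine (ContinuousLinearMap.le_opNorm _ _).trans ?_
      have e3 := hLip.norm_sub_le (hWs (hmem r).1.2).1 (hWs (hmem r).2.2).1
      have e4 : ‖B (s₁ q.1, (r : ℝ) • q.2) q.2‖ ≤ C' := hC' _ ⟨r, rfl⟩
      calc _ ≤ (C * ‖s₁ (k (g q) r) - s₂ (s₁ q.1, (r : ℝ) • q.2)‖) * C' :=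
            mul_le_mul e3 e4 (norm_nonneg _) (by positivity)
        _ = _ := by ring
  have hfd : ∀ v : E × K', fderiv ℝ f q v =
      fderiv ℝ k (g q) (v.1, fderiv ℝ s₁ q.1 v.1, v.2) 1 := by
    intro v
    have e1 : HasFDerivAt k (fderiv ℝ k (g q)) (g q) :=
      ((hk.contDiffAt (hN.mem_nhds hq.2)).differentiableAt (by simp)).hasFDerivAt
    have e2 : HasFDerivAt g ((ContinuousLinearMap.fst ℝ E K').prod
        (((fderiv ℝ s₁ q.1).comp (ContinuousLinearMap.fst ℝ E K')).prod
          (ContinuousLinearMap.snd ℝ E K'))) q :=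
      hasFDerivAt_fst.prodMk (((hs₁d _ hq.1.1).comp q hasFDerivAt_fst).prodMk hasFDerivAt_snd)
    have e3 : HasFDerivAt f _ q := ev.hasFDerivAt.comp q (e1.comp q e2)
    rw [e3.fderiv]
    rfl
  have hq1 : k (g q) 0 = q.1 := hinit
  refine ⟨hq.1.1, (hmem₁ 1).1, by simpa using (hmem₂ 1).1, ?_, fun h0 => ?_,
    fun β => ?_, fun t ht htΛ => ?_, fun R hR hRΛ hRs => ?_⟩
  · have e1 := hs 1
    rw [h1, one_smul] at e1
    exact e1
  · have e1 := hder.eq_of_deriv_eq (hasCurveDeriv_const q.1) hq1 fun r => by simp [g, h0]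
    exact congrFun e1 1
  -- The variation in the direction `β` is compared with `Λ(k) B(x, r a) (r β)`. Both vanish at `r =
  -- 0`. By the bracket relation and the Maurer-Cartan equation, the inhomogeneous terms cancel, and
  -- their difference solves a homogeneous linear equation. The value at `r = 1` is the assertion.
  · obtain ⟨hv0, hv⟩ := hvar (0, 0, β)
    have e1 := (hder.comp hΛd).clm_apply (hBcurve.clm_apply (hasCurveDeriv_smul β))
    have e2 := e1.eq_of_linear hv (by simp [hv0]) hAc fun r => by
      have m1 := hbr _ (hmem₁ r).1 (hmem₁ r).2 (B (s₁ q.1, (r : ℝ) • q.2) q.2)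
        (B (s₁ q.1, (r : ℝ) • q.2) ((r : ℝ) • β))
      have m2 := hmc _ (hmem₂ r).1 (hmem₂ r).2 q.2 ((r : ℝ) • β)
      rw [hs r] at m1
      have m3 : c (s₂ (s₁ q.1, (r : ℝ) • q.2)) (B (s₁ q.1, (r : ℝ) • q.2) q.2)
        (B (s₁ q.1, (r : ℝ) • q.2) ((r : ℝ) • β)) =
        fderiv ℝ B (s₁ q.1, (r : ℝ) • q.2) (0, (r : ℝ) • β) q.2 -
          fderiv ℝ B (s₁ q.1, (r : ℝ) • q.2) (0, q.2) ((r : ℝ) • β) := by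
        rw [eq_sub_iff_add_eq, ← sub_eq_zero, m2]
      rw [m3, map_sub] at m1
      simp only [ContinuousLinearMap.flip_apply, map_sub, map_add]
      simp only [g]
      rw [sub_eq_iff_eq_add] at m1
      rw [m1]
      abel
    rw [hfd]
    simp only [map_zero]
    have e3 := congrFun e2 1
    simp only [h1, one_smul] at e3
    exact e3.symm
  · have e1 := hder.comp (G := t) (G' := fun r => fderiv ℝ t (k (g q) r)) fun r =>
      (ht.differentiableAt (hO₁.mem_nhds (hmem₁ r).1)).hasFDerivAt
    have e2 := e1.eq_of_deriv_eq (hasCurveDeriv_const (t q.1)) (by rw [hq1]) fun r =>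
      htΛ _ (hmem₁ r).1 _
    exact congrFun e2 1
  -- The commutation relation says that `R` along the solution satisfies the linearized equation. As
  -- `R` is tangent to the fibres of `s₁`, moving `y` along `R` leaves the base point `x` of the ray
  -- fixed to first order, so no variation of `B` occurs.
  · obtain ⟨hv0, hv⟩ := hvar (R q.1, 0, 0)
    have e1 := hder.comp (G := R) (G' := fun r => fderiv ℝ R (k (g q) r)) fun r =>
      (hR.differentiableAt (hO₁.mem_nhds (hmem₁ r).1)).hasFDerivAt
    have e2 := hv.eq_of_linear e1 (by rw [hv0, hq1]) hAc fun r => by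
      rw [hRΛ _ (hmem₁ r).1 (hmem₁ r).2]
      have e3 : ((0 : F), (r : ℝ) • (0 : K')) = 0 := by simp
      simp only [g, e3, map_zero, zero_apply, add_zero, map_sub,
        ContinuousLinearMap.flip_apply]
    rw [hfd]
    simp only [hRs _ hq.1.1]
    exact congrFun e2 1

/-- Two maps solving the same total differential equation `Dφ(a) = Λ(φ(a)) B(a)` and agreeing at a
point agree nearby. -/
theorem eventuallyEq_of_same_equation {A : Type*} [NormedAddCommGroup A] [NormedSpace ℝ A]
    {Λ : E → K →L[ℝ] E} {y₀ : E} (hΛ : ContDiffAt ℝ 1 Λ y₀) {a₀ : A} {B : A → A →L[ℝ] K}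
    (hB : ContinuousAt B a₀) {f g : A → E} (hf0 : f a₀ = y₀) (hg0 : g a₀ = y₀)
    (hf : ∀ᶠ a in 𝓝 a₀, HasFDerivAt f (Λ (f a) ∘L B a) a)
    (hg : ∀ᶠ a in 𝓝 a₀, HasFDerivAt g (Λ (g a) ∘L B a) a) : f =ᶠ[𝓝 a₀] g := by
  obtain ⟨C, U, hU, hLip⟩ := hΛ.exists_lipschitzOnWith
  have hfc : ContinuousAt f a₀ := hf.self_of_nhds.continuousAt
  have hgc : ContinuousAt g a₀ := hg.self_of_nhds.continuousAt
  have hfU : ∀ᶠ a in 𝓝 a₀, f a ∈ U := hfc (by rwa [hf0])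
  have hgU : ∀ᶠ a in 𝓝 a₀, g a ∈ U := hgc (by rwa [hg0])
  have hBb : ∀ᶠ a in 𝓝 a₀, ‖B a‖ < ‖B a₀‖ + 1 :=
    hB.norm.eventually_lt continuousAt_const (by simp)
  obtain ⟨δ, hδ, hball⟩ := Metric.eventually_nhds_iff_ball.1
    (hf.and (hg.and (hfU.and (hgU.and hBb))))
  filter_upwards [Metric.ball_mem_nhds a₀ hδ] with a ha
  have hseg : ∀ r : Icc (0 : ℝ) 1, a₀ + (r : ℝ) • (a - a₀) ∈ Metric.ball a₀ δ := by
    intro r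
    rw [mem_ball_iff_norm, add_sub_cancel_left, norm_smul, Real.norm_eq_abs, abs_of_nonneg r.2.1]
    rw [mem_ball_iff_norm] at ha
    nlinarith [norm_nonneg (a - a₀), r.2.2]
  have hl : HasCurveDeriv (fun r : Icc (0 : ℝ) 1 => a₀ + (r : ℝ) • (a - a₀)) (fun _ => a - a₀) := by
    intro r
    have := (hasCurveDeriv_smul (a - a₀) r).const_add a₀
    exact this
  have e1 := hl.comp (G := f) fun r => (hball _ (hseg r)).1
  have e2 := hl.comp (G := g) fun r => (hball _ (hseg r)).2.1
  have e3 := e1.eq_of_bound e2 (by simp [hf0, hg0])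
    (C := C * ((‖B a₀‖ + 1) * ‖a - a₀‖)) fun r => by
      obtain ⟨-, -, h1, h2, h3⟩ := hball _ (hseg r)
      simp only [ContinuousLinearMap.comp_apply]
      rw [← sub_apply]
      refine (ContinuousLinearMap.le_opNorm _ _).trans ?_
      have h4 := hLip.norm_sub_le h1 h2
      have h5 : ‖B (a₀ + (r : ℝ) • (a - a₀)) (a - a₀)‖ ≤ (‖B a₀‖ + 1) * ‖a - a₀‖ :=
        (ContinuousLinearMap.le_opNorm _ _).trans
          (mul_le_mul_of_nonneg_right h3.le (norm_nonneg _))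
      refine (mul_le_mul h4 h5 (norm_nonneg _) (by positivity)).trans (le_of_eq ?_)
      ring
  simpa using congrFun e3 1

end LocalModel


/-! ### The inverse function theorem on manifolds -/

section InverseFunction

/-- The source is shrunk to points where the derivative is invertible, so that the inverse is smooth
at every point of the target and not only at `f p`. -/
theorem exists_smooth_local_inverse {E₁ E₂ : Type*} [NormedAddCommGroup E₁] [NormedSpace ℝ E₁]
    [CompleteSpace E₁] [NormedAddCommGroup E₂] [NormedSpace ℝ E₂] {f : E₁ → E₂} {O : Set E₁}
    (hO : IsOpen O) {p : E₁} (hp : p ∈ O) (hf : ContDiffOn ℝ ∞ f O)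
    (hinv : (fderiv ℝ f p).IsInvertible) :
    ∃ e : OpenPartialHomeomorph E₁ E₂, p ∈ e.source ∧ e.source ⊆ O ∧ (∀ x, e x = f x) ∧
      ContDiffOn ℝ ∞ e.symm e.target := by
  have hfp : ∀ q ∈ O, ContDiffAt ℝ ∞ f q := fun q hq => hf.contDiffAt (hO.mem_nhds hq)
  obtain ⟨f', hf'⟩ := hinv
  have hd : HasFDerivAt f (f' : E₁ →L[ℝ] E₂) p := by
    rw [hf']; exact ((hfp p hp).differentiableAt (by simp)).hasFDerivAt
  let e₀ := (hfp p hp).toOpenPartialHomeomorph f hd (by simp)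
  have hdc : ContinuousAt (fderiv ℝ f) p :=
    ((hfp p hp).fderiv_right (m := 0) (by simp)).continuousAt
  have hinve : ∀ᶠ q in 𝓝 p, (fderiv ℝ f q).IsInvertible ∧ q ∈ O := by
    filter_upwards [hdc.tendsto (show _ ∈ 𝓝 (fderiv ℝ f p) from hf' ▸ f'.nhds),
      hO.mem_nhds hp] with q hq hqO
    obtain ⟨e', he'⟩ := hq
    exact ⟨⟨e', he'⟩, hqO⟩
  obtain ⟨U, hU, hUo, hpU⟩ := eventually_nhds_iff.1 hinve
  refine ⟨e₀.restrOpen U hUo, ⟨(hfp p hp).mem_toOpenPartialHomeomorph_source hd (by simp), hpU⟩,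
    fun x hx => (hU x hx.2).2, fun x => rfl, fun y hy => ?_⟩
  have hx := (e₀.restrOpen U hUo).map_target hy
  obtain ⟨⟨g', hg'⟩, hxO⟩ := hU _ hx.2
  refine ((e₀.restrOpen U hUo).contDiffAt_symm hy (f₀' := g') ?_ (hfp _ hxO)).contDiffWithinAt
  rw [hg']
  exact ((hfp _ hxO).differentiableAt (by simp)).hasFDerivAt

variable {E₁ E₂ H₁ H₂ N P : Type*} [NormedAddCommGroup E₁] [NormedSpace ℝ E₁]
  [FiniteDimensional ℝ E₁] [NormedAddCommGroup E₂] [NormedSpace ℝ E₂] [FiniteDimensional ℝ E₂]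
  [TopologicalSpace H₁] [TopologicalSpace H₂] {I : ModelWithCorners ℝ E₁ H₁}
  {J : ModelWithCorners ℝ E₂ H₂} [I.Boundaryless] [J.Boundaryless]
  [TopologicalSpace N] [ChartedSpace H₁ N] [IsManifold I ∞ N]
  [TopologicalSpace P] [ChartedSpace H₂ P] [IsManifold J ∞ P]

/-- The inverse function theorem on manifolds. -/
theorem exists_openPartialHomeomorph_of_bijective_mfderiv {f : N → P} {O : Set N} (hO : IsOpen O)
    {p : N} (hp : p ∈ O) (hf : ContMDiffOn I J ∞ f O)
    (hbij : Function.Bijective (mfderiv I J f p)) :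
    ∃ e : OpenPartialHomeomorph N P, p ∈ e.source ∧ e.source ⊆ O ∧ (∀ x ∈ e.source, e x = f x) ∧
      ContMDiffOn I J ∞ e e.source ∧ ContMDiffOn J I ∞ e.symm e.target := by
  have : CompleteSpace E₁ := FiniteDimensional.complete ℝ E₁
  -- Without boundary the model maps are homeomorphisms onto the vector spaces, so the extended
  -- charts are open partial homeomorphisms and can be composed as such.
  let c := (chartAt H₁ p).trans I.toHomeomorph.toOpenPartialHomeomorph
  let d := (chartAt H₂ (f p)).trans J.toHomeomorph.toOpenPartialHomeomorph
  have hc : ∀ x, c x = extChartAt I p x := fun x => rfl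
  have hcs : ∀ x, c.symm x = (extChartAt I p).symm x := fun x => rfl
  have hd : ∀ x, d x = extChartAt J (f p) x := fun x => rfl
  have hds : ∀ x, d.symm x = (extChartAt J (f p)).symm x := fun x => rfl
  have hcsrc : c.source = (extChartAt I p).source := by simp [c]
  have hdsrc : d.source = (extChartAt J (f p)).source := by simp [d]
  have hctgt : c.target = (extChartAt I p).target := by
    ext x
    simp only [c, extChartAt_target]
    simp
    try exact fun _ => ⟨I.symm x, I.right_inv (by simp [ModelWithCorners.Boundaryless.range_eq_univ])⟩
  have hdtgt : d.target = (extChartAt J (f p)).target := by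
    ext x
    simp only [d, extChartAt_target]
    simp
    try exact fun _ => ⟨J.symm x, J.right_inv (by simp [ModelWithCorners.Boundaryless.range_eq_univ])⟩
  let F : E₁ → E₂ := fun x => d (f (c.symm x))
  let D : Set N := O ∩ f ⁻¹' d.source
  have hD : IsOpen D := hf.continuousOn.isOpen_inter_preimage hO d.open_source
  let Q : Set E₁ := c.target ∩ c.symm ⁻¹' D
  have hQ : IsOpen Q := c.isOpen_inter_preimage_symm hD
  have hpc : p ∈ c.source := by rw [hcsrc]; exact mem_extChartAt_source p
  have hpd : f p ∈ d.source := by rw [hdsrc]; exact mem_extChartAt_source (f p)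
  have hpQ : c p ∈ Q := ⟨c.map_source hpc, by
    simp only [mem_preimage, c.left_inv hpc]; exact ⟨hp, hpd⟩⟩
  have hdm : ContMDiffOn J 𝓘(ℝ, E₂) ∞ d d.source := by
    rw [hdsrc, extChartAt_source]; exact contMDiffOn_extChartAt
  have hcm : ContMDiffOn I 𝓘(ℝ, E₁) ∞ c c.source := by
    rw [hcsrc, extChartAt_source]; exact contMDiffOn_extChartAt
  have hcsm : ContMDiffOn 𝓘(ℝ, E₁) I ∞ c.symm c.target := by
    rw [hctgt]; exact contMDiffOn_extChartAt_symm p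
  have hdsm : ContMDiffOn 𝓘(ℝ, E₂) J ∞ d.symm d.target := by
    rw [hdtgt]; exact contMDiffOn_extChartAt_symm (f p)
  have hF : ContDiffOn ℝ ∞ F Q := by
    rw [← contMDiffOn_iff_contDiffOn]
    exact hdm.comp (hf.comp (hcsm.mono inter_subset_left) fun x hx => hx.2.1) fun x hx => hx.2.2
  let A : E₁ →L[ℝ] E₂ := mfderiv I J f p
  have hFd : fderiv ℝ F (c p) = A := by
    have h := ((hf.contMDiffAt (hO.mem_nhds hp)).mdifferentiableAt
      (by simp)).hasMFDerivAt.2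
    rw [ModelWithCorners.Boundaryless.range_eq_univ] at h
    have h' : HasFDerivWithinAt F A univ (c p) := h
    exact (hasFDerivWithinAt_univ.1 h').fderiv
  have hinv : (fderiv ℝ F (c p)).IsInvertible := by
    change Function.Bijective A at hbij
    rw [← hFd] at hbij
    exact ⟨(LinearEquiv.ofBijective (fderiv ℝ F (c p)).toLinearMap hbij).toContinuousLinearEquiv,
      by ext x; rfl⟩
  obtain ⟨e, hpe, heQ, heF, hes⟩ := exists_smooth_local_inverse hQ hpQ hF hinv
  let e' := (c.trans e).trans d.symm
  have hsrc : ∀ x ∈ e'.source, x ∈ c.source ∧ c x ∈ e.source ∧ x ∈ D ∧ e (c x) = d (f x) := by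
    intro x hx
    have h1 : x ∈ c.source ∧ c x ∈ e.source := by
      have := hx.1; simpa using this
    have h2 := (heQ h1.2).2
    simp only [mem_preimage, c.left_inv h1.1] at h2
    exact ⟨h1.1, h1.2, h2, by rw [heF]; simp only [F, c.left_inv h1.1]⟩
  have hval : ∀ x ∈ e'.source, e' x = f x := by
    intro x hx
    obtain ⟨h1, h2, h3, h4⟩ := hsrc x hx
    show d.symm (e (c x)) = f x
    rw [h4, d.left_inv h3.2]
  refine ⟨e', ?_, fun x hx => (hsrc x hx).2.2.1.1, hval, ?_, ?_⟩
  · refine ⟨⟨hpc, hpe⟩, ?_⟩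
    show e (c p) ∈ d.symm.source
    rw [heF]
    simp only [F, c.left_inv hpc]
    exact d.map_source hpd
  · exact (hf.mono fun x hx => (hsrc x hx).2.2.1.1).congr hval
  · have htgt : ∀ y ∈ e'.target, y ∈ d.source ∧ d y ∈ e.target ∧ e.symm (d y) ∈ c.target := by
      intro y hy
      have h1 : y ∈ d.source := hy.1
      have h2 : d y ∈ (c.trans e).target := hy.2
      exact ⟨h1, h2.1, h2.2⟩
    have hes' : ContMDiffOn 𝓘(ℝ, E₂) 𝓘(ℝ, E₁) ∞ e.symm e.target :=
      contMDiffOn_iff_contDiffOn.2 hes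
    exact hcsm.comp (hes'.comp (hdm.mono fun y hy => (htgt y hy).1) fun y hy => (htgt y hy).2.1)
      fun y hy => (htgt y hy).2.2

end InverseFunction

/-! ### Charts straightening a submersion -/

section FibreChart

variable {E F : Type*} [NormedAddCommGroup E] [NormedSpace ℝ E] [FiniteDimensional ℝ E]
  [NormedAddCommGroup F] [NormedSpace ℝ F] [FiniteDimensional ℝ F]
  {M : Type*} [TopologicalSpace M] [ChartedSpace F M] [IsManifold 𝓘(ℝ, F) ∞ M]
  {G : Type*} [TopologicalSpace G] [ChartedSpace E G] [IsManifold 𝓘(ℝ, E) ∞ G]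

/-- A chart straightening the map `π` over the open set `W`. -/
structure FibreChart (π : G → M) (K : Type*) [NormedAddCommGroup K] [NormedSpace ℝ K] where
  /-- the chart -/
  e : OpenPartialHomeomorph G (M × K)
  /-- the base -/
  W : Set M
  /-- the radius of the fibre coordinate -/
  r : ℝ
  isOpen_W : IsOpen W
  r_pos : 0 < r
  target_eq : e.target = W ×ˢ Metric.ball 0 r
  fst_eq : ∀ g ∈ e.source, (e g).1 = π g
  smooth : ContMDiffOn 𝓘(ℝ, E) (𝓘(ℝ, F).prod 𝓘(ℝ, K)) ∞ e e.source
  smooth_symm : ContMDiffOn (𝓘(ℝ, F).prod 𝓘(ℝ, K)) 𝓘(ℝ, E) ∞ e.symm e.target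


/-- The chart is `h ↦ (π h, Q (c h) - Q (c (w (π h))))` with `K = ker dπ`. The subtraction turns `w`
into the zero section when `w` is a section; a constant `w` gives a chart centred at an arbitrary
point. On `ker dπ` the differential at `g₀` is the identity of `K`, so it is injective, and
dimensions agree. -/
theorem exists_fibreChart {π : G → M} (hπ : ContMDiff 𝓘(ℝ, E) 𝓘(ℝ, F) ∞ π) (g₀ : G)
    (hsub : Function.Surjective (mfderiv 𝓘(ℝ, E) 𝓘(ℝ, F) π g₀)) {w : M → G}
    (hw : ContMDiff 𝓘(ℝ, F) 𝓘(ℝ, E) ∞ w) (hw₀ : w (π g₀) = g₀) :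
    ∃ (K : Submodule ℝ E) (Φ : FibreChart (E := E) (F := F) π K), g₀ ∈ Φ.e.source ∧ π g₀ ∈ Φ.W ∧
      Φ.e g₀ = (π g₀, 0) ∧
      ((∀ x, π (w x) = x) → ∀ x ∈ Φ.W, w x ∈ Φ.e.source ∧ Φ.e (w x) = (x, 0)) := by
  let D : E →L[ℝ] F := mfderiv 𝓘(ℝ, E) 𝓘(ℝ, F) π g₀
  let K : Submodule ℝ E := LinearMap.ker D.toLinearMap
  obtain ⟨P, hP⟩ := Submodule.ClosedComplemented.of_finiteDimensional K
  let c : G → E := extChartAt 𝓘(ℝ, E) g₀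
  let s : Set G := (chartAt E g₀).source
  have hs : IsOpen s := (chartAt E g₀).open_source
  have hcs : ContMDiffOn 𝓘(ℝ, E) 𝓘(ℝ, E) ∞ c s := contMDiffOn_extChartAt
  have hgs : g₀ ∈ s := mem_chart_source E g₀
  have hAi : (mfderiv 𝓘(ℝ, E) 𝓘(ℝ, E) c g₀).IsInvertible :=
    isInvertible_mfderiv_extChartAt (mem_extChartAt_source g₀)
  obtain ⟨A, hA⟩ : ∃ A : E ≃L[ℝ] E,
      (A : E →L[ℝ] E) = mfderiv 𝓘(ℝ, E) 𝓘(ℝ, E) c g₀ := hAi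
  -- The inverse of the derivative of the extended chart is included in order that `Q ∘ c` have
  -- derivative exactly `P` at `g₀`.
  let Q : E →L[ℝ] K := P ∘L (A.symm : E →L[ℝ] E)
  let O : Set G := s ∩ (fun h => w (π h)) ⁻¹' s
  have hwπ : ContMDiff 𝓘(ℝ, E) 𝓘(ℝ, E) ∞ (fun h => w (π h)) := hw.comp hπ
  have hO : IsOpen O := hs.inter (hs.preimage hwπ.continuous)
  have hgO : g₀ ∈ O := ⟨hgs, by simpa [hw₀] using hgs⟩
  let f₂ : G → K := fun h => Q (c h) - Q (c (w (π h)))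
  let f : G → M × K := fun h => (π h, f₂ h)
  have hQ : ContMDiff 𝓘(ℝ, E) 𝓘(ℝ, K) ∞ Q := Q.contDiff.contMDiff
  have hf₁ : ContMDiffOn 𝓘(ℝ, E) 𝓘(ℝ, K) ∞ (fun h => Q (c h)) O :=
    hQ.comp_contMDiffOn (hcs.mono inter_subset_left)
  have hf₃ : ContMDiffOn 𝓘(ℝ, F) 𝓘(ℝ, K) ∞ (fun x => Q (c (w x))) (w ⁻¹' s) :=
    hQ.comp_contMDiffOn (hcs.comp hw.contMDiffOn fun x hx => hx)
  have hf₂ : ContMDiffOn 𝓘(ℝ, E) 𝓘(ℝ, K) ∞ f₂ O :=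
    hf₁.sub (hf₃.comp hπ.contMDiffOn fun x hx => hx.2)
  have hf : ContMDiffOn 𝓘(ℝ, E) (𝓘(ℝ, F).prod 𝓘(ℝ, K)) ∞ f O := hπ.contMDiffOn.prodMk hf₂
  have hne : (∞ : WithTop ℕ∞) ≠ 0 := by simp
  have hπd := (hπ.contMDiffAt (x := g₀)).mdifferentiableAt hne
  have hf₂d := (hf₂.contMDiffAt (hO.mem_nhds hgO)).mdifferentiableAt hne
  have hws : w ⁻¹' s ∈ 𝓝 (π g₀) :=
    (hs.preimage hw.continuous).mem_nhds (by simpa [hw₀] using hgs)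
  have hd₁ : HasMFDerivAt 𝓘(ℝ, E) 𝓘(ℝ, K) (fun h => Q (c h)) g₀ P := by
    have h1 := ((hcs.contMDiffAt (hs.mem_nhds hgs)).mdifferentiableAt hne).hasMFDerivAt
    have h2 : HasMFDerivAt 𝓘(ℝ, E) 𝓘(ℝ, K) Q (c g₀) Q := Q.hasFDerivAt.hasMFDerivAt
    have h3 := h2.comp g₀ h1
    have h4 : Q ∘L (mfderiv 𝓘(ℝ, E) 𝓘(ℝ, E) c g₀ : E →L[ℝ] E) = P := by
      rw [← hA]
      ext v
      exact congrArg (fun z => (P z : E)) (A.symm_apply_apply v)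
    exact h4 ▸ h3
  obtain ⟨D₃, hD₃⟩ : ∃ D₃ : F →L[ℝ] K, HasMFDerivAt 𝓘(ℝ, F) 𝓘(ℝ, K) (fun x => Q (c (w x))) (π g₀) D₃ :=
    ⟨_, ((hf₃.contMDiffAt hws).mdifferentiableAt hne).hasMFDerivAt⟩
  have hd₂ : HasMFDerivAt 𝓘(ℝ, E) 𝓘(ℝ, K) f₂ g₀ (P - D₃ ∘L D) :=
    hd₁.sub (hD₃.comp g₀ hπd.hasMFDerivAt)
  have hd : HasMFDerivAt 𝓘(ℝ, E) (𝓘(ℝ, F).prod 𝓘(ℝ, K)) f g₀ (D.prod (P - D₃ ∘L D)) :=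
    hπd.hasMFDerivAt.prodMk hd₂
  have hbij : Function.Bijective
      (mfderiv 𝓘(ℝ, E) (𝓘(ℝ, F).prod 𝓘(ℝ, K)) f g₀) := by
    rw [hd.mfderiv]
    have hinj : Function.Injective (D.prod (P - D₃ ∘L D)) := by
      refine (injective_iff_map_eq_zero _).2 fun v hv => ?_
      have h1 : D v = 0 := congrArg Prod.fst hv
      have h2 : P v - D₃ (D v) = 0 := congrArg Prod.snd hv
      rw [h1, map_zero, sub_zero] at h2
      have h3 := hP ⟨v, h1⟩
      rw [show P v = 0 from h2] at h3
      exact congrArg Subtype.val h3.symm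
    have hrank : Module.finrank ℝ E = Module.finrank ℝ (F × K) := by
      have h1 := LinearMap.finrank_range_add_finrank_ker D.toLinearMap
      rw [(LinearMap.range_eq_top.2 hsub : D.toLinearMap.range = ⊤), finrank_top] at h1
      rw [Module.finrank_prod]
      exact h1.symm
    exact ⟨hinj, (LinearMap.injective_iff_surjective_of_finrank_eq_finrank
      (f := (D.prod (P - D₃ ∘L D)).toLinearMap) hrank).1 hinj⟩
  obtain ⟨e, hge, heO, hef, hes, het⟩ :=
    exists_openPartialHomeomorph_of_bijective_mfderiv hO hgO hf hbij
  have hfg : f g₀ = (π g₀, 0) := by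
    simp only [f, f₂, hw₀, sub_self]
  have htg : (π g₀, (0 : K)) ∈ e.target := by
    rw [← hfg, ← hef g₀ hge]; exact e.map_source hge
  obtain ⟨W₀, V₀, hW₀, hV₀, hxW, h0V, hWV⟩ := isOpen_prod_iff.1 e.open_target _ _ htg
  obtain ⟨r, hr, hrV⟩ := Metric.isOpen_iff.1 hV₀ 0 h0V
  let W : Set M := W₀ ∩ w ⁻¹' e.source
  have hW : IsOpen W := hW₀.inter (e.open_source.preimage hw.continuous)
  have hWt : W ×ˢ Metric.ball (0 : K) r ⊆ e.target :=
    fun q hq => hWV ⟨hq.1.1, hrV hq.2⟩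
  let e' := (e.symm.restrOpen (W ×ˢ Metric.ball (0 : K) r) (hW.prod Metric.isOpen_ball)).symm
  have hsrc' : ∀ g, g ∈ e.source → e g ∈ W ×ˢ Metric.ball (0 : K) r → g ∈ e'.source := by
    intro g hg hg'
    have h1 : e.symm (e g) ∈ e'.source :=
      e'.symm.map_source (x := e g) ⟨e.map_source hg, hg'⟩
    rwa [e.left_inv hg] at h1
  have hsub' : e'.source ⊆ e.source := fun g hg => by
    have h1 := (e'.map_source hg).1
    have h2 := e.map_target h1
    have h3 : e'.symm (e' g) = g := e'.left_inv hg
    rwa [show e.symm (e' g) = g from h3] at h2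
  have htgt' : e'.target = W ×ˢ Metric.ball (0 : K) r :=
    inter_eq_right.2 hWt
  have hxW' : π g₀ ∈ W := ⟨hxW, by simpa [hw₀] using hge⟩
  have heg : ∀ g ∈ e'.source, e' g = f g := fun g hg => hef g (hsub' hg)
  refine ⟨K, ⟨e', W, r, hW, hr, htgt', fun g hg => by rw [heg g hg], hes.mono hsub',
    het.mono (htgt' ▸ hWt)⟩, ?_, hxW', ?_, ?_⟩
  · exact hsrc' g₀ hge (by rw [hef g₀ hge, hfg]; exact ⟨hxW', Metric.mem_ball_self hr⟩)
  · exact (hef g₀ hge).trans hfg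
  · intro hw x hx
    have h1 : f (w x) = (x, 0) := by
      simp only [f, f₂, hw x, sub_self]
    exact ⟨hsrc' _ hx.2 (by rw [hef _ hx.2, h1]; exact ⟨hx, Metric.mem_ball_self hr⟩),
      (hef _ hx.2).trans h1⟩

end FibreChart


/-! ### Curves in fibres and differentials along fibres -/

section FibreTools

variable {E F : Type*} [NormedAddCommGroup E] [NormedSpace ℝ E] [FiniteDimensional ℝ E]
  [NormedAddCommGroup F] [NormedSpace ℝ F] [FiniteDimensional ℝ F]
  {M : Type*} [TopologicalSpace M] [ChartedSpace F M] [IsManifold 𝓘(ℝ, F) ∞ M]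
  {G : Type*} [TopologicalSpace G] [ChartedSpace E G] [IsManifold 𝓘(ℝ, E) ∞ G]

/-- Every vector tangent to a fibre of a submersion is the velocity of a curve in this fibre. -/
theorem exists_fibre_curve {π : G → M} (hπ : ContMDiff 𝓘(ℝ, E) 𝓘(ℝ, F) ∞ π) (g : G)
    (hsub : Function.Surjective (mfderiv 𝓘(ℝ, E) 𝓘(ℝ, F) π g)) {v : TangentSpace 𝓘(ℝ, E) g}
    (hv : mfderiv 𝓘(ℝ, E) 𝓘(ℝ, F) π g v = 0) :
    ∃ γ : ℝ → G, ∃ D : ℝ →L[ℝ] TangentSpace 𝓘(ℝ, E) (γ 0), γ 0 = g ∧ (∀ τ, π (γ τ) = π g) ∧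
      HasMFDerivAt 𝓘(ℝ, ℝ) 𝓘(ℝ, E) γ 0 D ∧ D 1 = (v : E) := by
  obtain ⟨K, Φ, hg, hW, hΦ, -⟩ := exists_fibreChart hπ g hsub (w := fun _ => g) contMDiff_const rfl
  have hne : (∞ : WithTop ℕ∞) ≠ 0 := by simp
  have hd := ((Φ.smooth.contMDiffAt (Φ.e.open_source.mem_nhds hg)).mdifferentiableAt
    hne).hasMFDerivAt
  have hπd := (hπ.contMDiffAt (x := g)).mdifferentiableAt hne |>.hasMFDerivAt
  set A : E →L[ℝ] F × K := mfderiv 𝓘(ℝ, E) (𝓘(ℝ, F).prod 𝓘(ℝ, K)) Φ.e g with hA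
  have hA1 : (A v).1 = 0 := by
    have h1 : HasMFDerivAt 𝓘(ℝ, E) 𝓘(ℝ, F) (fun h => (Φ.e h).1) g
        (ContinuousLinearMap.fst ℝ F K ∘L A) :=
      (hasMFDerivAt_fst (Φ.e g)).comp g hd
    have h2 : HasMFDerivAt 𝓘(ℝ, E) 𝓘(ℝ, F) π g (ContinuousLinearMap.fst ℝ F K ∘L A) :=
      h1.congr_of_eventuallyEq (Filter.eventually_of_mem (Φ.e.open_source.mem_nhds hg)
        fun h hh => (Φ.fst_eq h hh).symm)
    rw [h2.mfderiv] at hv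
    exact hv
  have htg : Φ.e g ∈ Φ.e.target := Φ.e.map_source hg
  have hds := ((Φ.smooth_symm.contMDiffAt (Φ.e.open_target.mem_nhds htg)).mdifferentiableAt
    hne).hasMFDerivAt
  set B : F × K →L[ℝ] E := mfderiv (𝓘(ℝ, F).prod 𝓘(ℝ, K)) 𝓘(ℝ, E) Φ.e.symm (Φ.e g) with hB
  have hBA : B (A v) = v := by
    have h1 : HasMFDerivAt 𝓘(ℝ, E) 𝓘(ℝ, E) (Φ.e.symm ∘ Φ.e) g (B ∘L A) := hds.comp g hd
    have h2 : HasMFDerivAt 𝓘(ℝ, E) 𝓘(ℝ, E) (Φ.e.symm ∘ Φ.e) g (.id ℝ E) :=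
      (hasMFDerivAt_id g).congr_of_eventuallyEq
        (Filter.eventually_of_mem (Φ.e.open_source.mem_nhds hg) fun h hh => Φ.e.left_inv hh)
    exact congrArg (fun L : E →L[ℝ] E => L v) (hasMFDerivAt_unique h1 h2)
  let ℓ : ℝ → M × K := fun τ => (π g, τ • (A v).2)
  have hℓ : HasMFDerivAt 𝓘(ℝ, ℝ) (𝓘(ℝ, F).prod 𝓘(ℝ, K)) ℓ 0
      ((0 : ℝ →L[ℝ] F).prod ((1 : ℝ →L[ℝ] ℝ).smulRight (A v).2)) :=
    (hasMFDerivAt_const _ _).prodMk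
      ((1 : ℝ →L[ℝ] ℝ).smulRight (A v).2).hasFDerivAt.hasMFDerivAt
  have hℓ0 : ℓ 0 = Φ.e g := by simp [ℓ, hΦ]
  let γ₀ : ℝ → G := fun τ => Φ.e.symm (ℓ τ)
  have hγ₀ : HasMFDerivAt 𝓘(ℝ, ℝ) 𝓘(ℝ, E) γ₀ 0
      (B ∘L ((0 : ℝ →L[ℝ] F).prod ((1 : ℝ →L[ℝ] ℝ).smulRight (A v).2))) := by
    have h1 := hds
    rw [← hℓ0] at h1
    exact h1.comp (0 : ℝ) hℓ
  have hev : ∀ᶠ τ in 𝓝 (0 : ℝ), ℓ τ ∈ Φ.e.target :=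
    hℓ.continuousAt.eventually (by rw [hℓ0]; exact Φ.e.open_target.mem_nhds htg)
  have hγπ : ∀ τ, ℓ τ ∈ Φ.e.target → π (γ₀ τ) = π g := by
    intro τ hτ
    rw [← Φ.fst_eq _ (Φ.e.map_target hτ), Φ.e.right_inv hτ]
  classical
  -- The chart curve lies in the fibre only for small `τ`. Replacing it by the constant `g`
  -- elsewhere keeps its germ at `0` and puts the whole curve in the fibre.
  let γ : ℝ → G := fun τ => if π (γ₀ τ) = π g then γ₀ τ else g
  have hγ0 : γ 0 = g := by
    show (if _ then _ else _) = _
    split_ifs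
    · simp only [γ₀, hℓ0, Φ.e.left_inv hg]
    · rfl
  have hγe : γ =ᶠ[𝓝 0] γ₀ := by
    filter_upwards [hev] with τ hτ
    exact if_pos (hγπ τ hτ)
  refine ⟨γ, B ∘L ((0 : ℝ →L[ℝ] F).prod ((1 : ℝ →L[ℝ] ℝ).smulRight (A v).2)), hγ0, fun τ => ?_,
    hγ₀.congr_of_eventuallyEq hγe, ?_⟩
  · show π (if _ then _ else _) = _
    split_ifs with h
    · exact h
    · rfl
  · refine Eq.trans ?_ hBA
    have : ((0 : ℝ →L[ℝ] F).prod ((1 : ℝ →L[ℝ] ℝ).smulRight (A v).2)) 1 = A v :=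
      Prod.ext hA1.symm (by simp)
    exact congrArg B this

variable {E₂ H₂ : Type*} [NormedAddCommGroup E₂] [NormedSpace ℝ E₂] [TopologicalSpace H₂]
  {J : ModelWithCorners ℝ E₂ H₂} {P : Type*} [TopologicalSpace P] [ChartedSpace H₂ P]

omit [FiniteDimensional ℝ E] [IsManifold 𝓘(ℝ, E) ∞ G] in
/-- The chain rule for maps into a set. -/
theorem hasMFDerivAt_comp_curve {X : Type*} [NormedAddCommGroup X] [NormedSpace ℝ X] {f : G → P}
    {A : Set G} {g : G} {D : E →L[ℝ] E₂}
    (hf : HasMFDerivWithinAt 𝓘(ℝ, E) J f A g D) {γ : X → G} {a : X} (hγ : γ a = g)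
    (hA : ∀ᶠ τ in 𝓝 a, γ τ ∈ A) {Dγ : X →L[ℝ] E}
    (hd : HasMFDerivAt 𝓘(ℝ, X) 𝓘(ℝ, E) γ a Dγ) :
    HasMFDerivAt 𝓘(ℝ, X) J (fun τ => f (γ τ)) a (D ∘L Dγ) := by
  subst hγ
  exact (hf.comp a (hd.hasMFDerivWithinAt (s := γ ⁻¹' A)) subset_rfl).hasMFDerivAt hA

/-- Differentials along a fibre are determined on the tangent space of the fibre. -/
theorem fibre_deriv_unique {π : G → M} (hπ : ContMDiff 𝓘(ℝ, E) 𝓘(ℝ, F) ∞ π) {g : G}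
    (hsub : Function.Surjective (mfderiv 𝓘(ℝ, E) 𝓘(ℝ, F) π g)) {v : E}
    (hv : mfderiv 𝓘(ℝ, E) 𝓘(ℝ, F) π g v = (0 : F)) {f : G → P} {x : M} (hx : π g = x)
    {D₁ D₂ : E →L[ℝ] E₂}
    (h₁ : HasMFDerivWithinAt 𝓘(ℝ, E) J f (π ⁻¹' {x}) g D₁)
    (h₂ : HasMFDerivWithinAt 𝓘(ℝ, E) J f (π ⁻¹' {x}) g D₂) : D₁ v = D₂ v := by
  obtain ⟨γ, Dγ, hγ0, hγπ, hd, h1⟩ := exists_fibre_curve hπ g hsub hv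
  have hA : ∀ᶠ τ in 𝓝 0, γ τ ∈ π ⁻¹' {x} := .of_forall fun τ => (hγπ τ).trans hx
  have e1 := hasMFDerivAt_comp_curve h₁ hγ0 hA hd
  have e2 := hasMFDerivAt_comp_curve h₂ hγ0 hA hd
  have h3 := congrArg (fun L : ℝ →L[ℝ] E₂ => L 1) (hasMFDerivAt_unique e1 e2)
  have h4 : D₁ (Dγ 1) = D₂ (Dγ 1) := h3
  rwa [show Dγ 1 = v from h1] at h4

end FibreTools

/-! ### Opposite arrow spaces and the space of composable pairs -/

section ArrowSpaceTools

variable {E F : Type*} [NormedAddCommGroup E] [NormedSpace ℝ E]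
  [NormedAddCommGroup F] [NormedSpace ℝ F]
  {M : Type*} [TopologicalSpace M] [ChartedSpace F M]
  {G : Type*} [TopologicalSpace G] [ChartedSpace E G]

namespace ArrowSpace

/-- The opposite arrow space, with source and target exchanged. -/
def op (S : ArrowSpace E F M G) : ArrowSpace E F M G where
  s := S.t
  t := S.s
  u := S.u
  smooth_s := S.smooth_t
  smooth_t := S.smooth_s
  smooth_u := S.smooth_u
  submersion_s := S.submersion_t
  submersion_t := S.submersion_s
  s_u := S.t_u
  t_u := S.s_u
  t2_s := S.t2_t
  t2_t := S.t2_s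

variable (S : ArrowSpace E F M G)

@[simp] theorem op_s : S.op.s = S.t := rfl
@[simp] theorem op_t : S.op.t = S.s := rfl
@[simp] theorem op_u : S.op.u = S.u := rfl
theorem mem_pairs {p : G × G} : p ∈ S.pairs ↔ S.s p.1 = S.t p.2 := Iff.rfl

theorem mem_op_pairs {p : G × G} : p ∈ S.op.pairs ↔ p.swap ∈ S.pairs := eq_comm

theorem right_unit_mem_pairs (g : G) : (g, S.u (S.s g)) ∈ S.pairs := (S.t_u _).symm

theorem left_unit_mem_pairs (g : G) : (S.u (S.t g), g) ∈ S.pairs := S.s_u _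

theorem tendsto_swap_pairs (p : G × G) :
    Filter.Tendsto Prod.swap (𝓝[S.op.pairs] p) (𝓝[S.pairs] p.swap) :=
  tendsto_nhdsWithin_iff.2 ⟨(continuous_swap.tendsto p).mono_left nhdsWithin_le_nhds,
    Filter.eventually_of_mem self_mem_nhdsWithin fun _ h => S.mem_op_pairs.1 h⟩

variable [FiniteDimensional ℝ E] [FiniteDimensional ℝ F] [IsManifold 𝓘(ℝ, F) ∞ M]
  [IsManifold 𝓘(ℝ, E) ∞ G]

/-- The composable pairs are locally a smooth retract. -/
theorem exists_pairs_retraction {p : G × G} (hp : p ∈ S.pairs) :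
    ∃ (O : Set (G × G)) (R : G × G → G × G), IsOpen O ∧ p ∈ O ∧
      ContMDiffOn (𝓘(ℝ, E).prod 𝓘(ℝ, E)) (𝓘(ℝ, E).prod 𝓘(ℝ, E)) ∞ R O ∧
      ∀ q ∈ O, R q ∈ S.pairs ∧ (R q).1 = q.1 ∧ (q ∈ S.pairs → R q = q) := by
  obtain ⟨K, Φ, hg, hW, hΦ, -⟩ := exists_fibreChart S.smooth_t p.2 (S.submersion_t p.2)
    (w := fun _ => p.2) contMDiff_const rfl
  let O : Set (G × G) := (fun q => S.s q.1) ⁻¹' Φ.W ∩ Prod.snd ⁻¹' Φ.e.source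
  have hO : IsOpen O := (Φ.isOpen_W.preimage (S.smooth_s.continuous.comp continuous_fst)).inter
    (Φ.e.open_source.preimage continuous_snd)
  have hmem : ∀ q ∈ O, (S.s q.1, (Φ.e q.2).2) ∈ Φ.e.target := fun q hq => by
    have h1 := Φ.e.map_source hq.2
    rw [Φ.target_eq] at h1 ⊢
    exact ⟨hq.1, h1.2⟩
  have hs1 : ContMDiffOn (𝓘(ℝ, E).prod 𝓘(ℝ, E)) 𝓘(ℝ, F) ∞ (fun q : G × G => S.s q.1) O :=
    (S.smooth_s.comp contMDiff_fst).contMDiffOn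
  have he2 : ContMDiffOn (𝓘(ℝ, E).prod 𝓘(ℝ, E)) 𝓘(ℝ, K) ∞ (fun q : G × G => (Φ.e q.2).2) O :=
    contMDiff_snd.comp_contMDiffOn
      (Φ.smooth.comp contMDiff_snd.contMDiffOn fun q hq => hq.2)
  -- The retraction changes only the target of the second entry, to the source of the first one,
  -- keeping the fibre coordinate.
  refine ⟨O, fun q => (q.1, Φ.e.symm (S.s q.1, (Φ.e q.2).2)), hO, ⟨?_, hg⟩, ?_, fun q hq => ?_⟩
  · show S.s p.1 ∈ Φ.W
    rw [S.mem_pairs.1 hp]; exact hW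
  · exact contMDiff_fst.contMDiffOn.prodMk (Φ.smooth_symm.comp (hs1.prodMk he2) hmem)
  · refine ⟨?_, rfl, fun hq' => ?_⟩
    · show S.s q.1 = S.t _
      rw [← Φ.fst_eq _ (Φ.e.map_target (hmem q hq)), Φ.e.right_inv (hmem q hq)]
    · refine Prod.ext rfl ?_
      show Φ.e.symm (S.s q.1, (Φ.e q.2).2) = q.2
      rw [S.mem_pairs.1 hq', ← Φ.fst_eq _ hq.2]
      exact Φ.e.left_inv hq.2

end ArrowSpace

end ArrowSpaceTools


/-! ### Gluing germs over a paracompact base -/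

section Gluing

variable {M : Type*} [TopologicalSpace M] [T2Space M] [ParacompactSpace M]

/-- A locally finite closed shrinking. Closedness and local finiteness imply that near `x₀` only the
finitely many indices belonging to `x₀` itself occur. -/
theorem exists_closed_refinement {A : M → Set M} (hA : ∀ x, IsOpen (A x)) (hmem : ∀ x, x ∈ A x) :
    ∃ C : M → Set M, (∀ k, C k ⊆ A k) ∧ (∀ x, ∃ k, x ∈ C k) ∧
      ∀ x₀, {k | x₀ ∈ C k}.Finite ∧ ∀ᶠ x in 𝓝 x₀, ∀ k, x ∈ C k → x₀ ∈ C k := by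
  obtain ⟨v, hvo, hvc, hvf, hvA⟩ := precise_refinement A hA
    (iUnion_eq_univ_iff.2 fun x => ⟨x, hmem x⟩)
  obtain ⟨C, hCu, hCc, hCv⟩ := exists_iUnion_eq_closed_subset hvo (fun x => hvf.point_finite x) hvc
  have hCf : LocallyFinite C := hvf.subset hCv
  refine ⟨C, fun k => (hCv k).trans (hvA k), iUnion_eq_univ_iff.1 hCu, fun x₀ =>
    ⟨hCf.point_finite x₀, ?_⟩⟩
  filter_upwards [hCf.iInter_compl_mem_nhds hCc x₀] with x hx k hxk
  by_contra h
  exact mem_iInter₂.1 hx k h hxk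

/-- Functions with the same germs along a set `Z` lying over a paracompact space can be glued. -/
theorem exists_glued {P Y : Type*} {q : P → M} {Z : Set P} {nb : P → Filter P}
    (hq : ∀ z ∈ Z, Filter.Tendsto q (nb z) (𝓝 (q z))) {A : M → Set M} (hA : ∀ x, IsOpen (A x))
    (hmem : ∀ x, x ∈ A x) {j : M → P → Y}
    (hj : ∀ z ∈ Z, ∀ k l, q z ∈ A k → q z ∈ A l → j k =ᶠ[nb z] j l) :
    ∃ J : P → Y, ∀ z ∈ Z, ∀ k, q z ∈ A k → J =ᶠ[nb z] j k := by
  obtain ⟨C, hCA, hCc, hCf⟩ := exists_closed_refinement hA hmem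
  choose κ hκ using hCc
  -- The choice `κ` of an index at each point may be arbitrary. Near `z` it takes finitely many
  -- values, all of them indices at `q z`, and the corresponding functions have equal germs at `z`.
  refine ⟨fun p => j (κ (q p)) p, fun z hz k hk => ?_⟩
  have h1 : ∀ᶠ p in nb z, ∀ l ∈ {l | q z ∈ C l}, j l p = j k p :=
    (Filter.eventually_all_finite (hCf (q z)).1).2 fun l hl => hj z hz l k (hCA l hl) hk
  filter_upwards [h1, (hq z hz).eventually (hCf (q z)).2] with p hp hp'
  exact hp _ (hp' _ (hκ _))

/-- A tube lemma for composable pairs of elements close to units. -/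
theorem exists_tube {G : Type*} [TopologicalSpace G] {s t : G → M} {u : M → G}
    (hs : Continuous s) (ht : Continuous t) (hu : Continuous u) (hsu : ∀ x, s (u x) = x)
    (htu : ∀ x, t (u x) = x) {Q : G × G → Prop} (hQ : ∀ x, ∀ᶠ p in 𝓝 (u x, u x), Q p) :
    ∃ V : Set G, IsOpen V ∧ (∀ x, u x ∈ V) ∧ ∀ g ∈ V, ∀ h ∈ V, s g = t h → Q (g, h) := by
  have h1 : ∀ x, ∃ W : Set G, IsOpen W ∧ u x ∈ W ∧ ∀ p ∈ W ×ˢ W, Q p := fun x => by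
    obtain ⟨W₁, W₂, h₁, hx₁, h₂, hx₂, h⟩ := mem_nhds_prod_iff'.1 (hQ x)
    exact ⟨W₁ ∩ W₂, h₁.inter h₂, ⟨hx₁, hx₂⟩, fun p hp => h ⟨hp.1.1, hp.2.2⟩⟩
  choose W hW hxW hWQ using h1
  obtain ⟨C, hCA, hCc, hCf⟩ := exists_closed_refinement (A := fun x => u ⁻¹' W x)
    (fun x => (hW x).preimage hu) hxW
  -- An element is admitted if it lies in `W k` for every index `k` at its source and at its target.
  -- Composable `g` and `h` share the indices at `s g = t h`, so `(g, h) ∈ W k ×ˢ W k` for such a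
  -- `k`.
  refine ⟨interior {g | (∀ k, s g ∈ C k → g ∈ W k) ∧ ∀ k, t g ∈ C k → g ∈ W k},
    isOpen_interior, fun x => ?_, fun g hg h hh hgh => ?_⟩
  · rw [mem_interior_iff_mem_nhds]
    have h2 : ∀ᶠ g in 𝓝 (u x), ∀ l ∈ {l | x ∈ C l}, g ∈ W l :=
      (Filter.eventually_all_finite (hCf x).1).2 fun l hl => (hW l).mem_nhds (hCA l hl)
    have h3 := (hs.tendsto (u x)).eventually ((hsu x).symm ▸ (hCf x).2)
    have h4 := (ht.tendsto (u x)).eventually ((htu x).symm ▸ (hCf x).2)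
    filter_upwards [h2, h3, h4] with g h2 h3 h4
    exact ⟨fun k hk => h2 k (hsu x ▸ h3 k hk), fun k hk => h2 k (htu x ▸ h4 k hk)⟩
  · obtain ⟨k, hk⟩ := hCc (s g)
    exact hWQ k _ ⟨(interior_subset hg).1 k hk, (interior_subset hh).2 k (hgh ▸ hk)⟩

end Gluing

/-! ### Continuation of identities along fibres -/

section Continuation

variable {M G : Type*} [TopologicalSpace G]

/-- The conditions under which agreement of two maps on the fibre of `π` over `x`, with values in
the fibre of `τ` over `y`, propagates from the point `h`. -/
structure Propagates (π τ : G → M) (x y : M) (f₁ f₂ : G → G) (h : G) : Prop where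
  left : τ (f₁ h) = y
  right : τ (f₂ h) = y
  continuous_left : ContinuousWithinAt f₁ (π ⁻¹' {x}) h
  continuous_right : ContinuousWithinAt f₂ (π ⁻¹' {x}) h
  propagate : f₁ h = f₂ h → f₁ =ᶠ[𝓝[π ⁻¹' {x}] h] f₂

/-- The set of agreement is open by propagation. It is closed because both maps take values in one
Hausdorff fibre of `τ`; `G` itself need not be Hausdorff. -/
theorem Propagates.eq_of_preconnected {π τ : G → M} {x y : M} {f₁ f₂ : G → G}
    (hτ : T2Space (τ ⁻¹' {y})) {X : Type*} [TopologicalSpace X] [PreconnectedSpace X] {p : X → G}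
    (hp : Continuous p) (hpx : ∀ a, π (p a) = x) (h : ∀ a, Propagates π τ x y f₁ f₂ (p a)) {a₀ : X}
    (h₀ : f₁ (p a₀) = f₂ (p a₀)) (a : X) : f₁ (p a) = f₂ (p a) := by
  have hpw : ∀ a, Filter.Tendsto p (𝓝 a) (𝓝[π ⁻¹' {x}] (p a)) := fun a =>
    tendsto_nhdsWithin_iff.2 ⟨hp.tendsto a, Filter.Eventually.of_forall hpx⟩
  have hc : ∀ i : G → G, (∀ a, ContinuousWithinAt i (π ⁻¹' {x}) (p a)) →
      (hy : ∀ a, τ (i (p a)) = y) →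
      Continuous (fun a => (⟨i (p a), hy a⟩ : τ ⁻¹' {y})) := fun i hi hy =>
    Continuous.subtype_mk (continuous_iff_continuousAt.2 fun a => (hi a).tendsto.comp (hpw a)) _
  have hcl : IsClosed {a | f₁ (p a) = f₂ (p a)} := by
    convert isClosed_eq (hc f₁ (fun a => (h a).continuous_left) fun a => (h a).left)
      (hc f₂ (fun a => (h a).continuous_right) fun a => (h a).right) using 1
    ext a
    simp [Subtype.ext_iff]
  have hop : IsOpen {a | f₁ (p a) = f₂ (p a)} := isOpen_iff_mem_nhds.2 fun a ha =>
    (hpw a).eventually ((h a).propagate ha)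
  have := IsClopen.eq_univ ⟨hcl, hop⟩ ⟨a₀, h₀⟩
  exact (Set.ext_iff.1 this a).2 trivial

variable {E F : Type*} [NormedAddCommGroup E] [NormedSpace ℝ E]
  [NormedAddCommGroup F] [NormedSpace ℝ F] [TopologicalSpace M] [ChartedSpace F M]
  [ChartedSpace E G] {K : Type*} [NormedAddCommGroup K] [NormedSpace ℝ K]

theorem FibreChart.continuous_symm {π : G → M} (Φ : FibreChart (E := E) (F := F) π K) {x : M}
    (hx : x ∈ Φ.W) {X : Type*} [TopologicalSpace X] {a : X → K} (ha : Continuous a)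
    (har : ∀ z, ‖a z‖ < Φ.r) :
    Continuous (fun z => Φ.e.symm (x, a z)) ∧ ∀ z, π (Φ.e.symm (x, a z)) = x := by
  have hm : ∀ z, (x, a z) ∈ Φ.e.target := fun z => by
    rw [Φ.target_eq]; exact ⟨hx, mem_ball_zero_iff.2 (har z)⟩
  refine ⟨Φ.e.continuousOn_symm.comp_continuous (by fun_prop) hm, fun z => ?_⟩
  rw [← Φ.fst_eq _ (Φ.e.map_target (hm z)), Φ.e.right_inv (hm z)]

/-- A property holding near `(z, w x₀)` holds, for parameters close to `z`, on balls of a fixed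
radius in the fibres. -/
theorem FibreChart.eventually_slice {π : G → M} (Φ : FibreChart (E := E) (F := F) π K) {w : M → G}
    (hw : ∀ x ∈ Φ.W, w x ∈ Φ.e.source ∧ Φ.e (w x) = (x, 0)) {x₀ : M} (hx₀ : x₀ ∈ Φ.W)
    {T : Type*} {l : Filter T} {ξ : T → M} (hξ : Filter.Tendsto ξ l (𝓝 x₀)) {Q : T × G → Prop}
    (hQ : ∀ᶠ q in l ×ˢ 𝓝 (w x₀), π q.2 = ξ q.1 → Q q) :
    ∃ ε > 0, ε ≤ Φ.r ∧ ∀ᶠ z in l, ξ z ∈ Φ.W ∧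
      ∀ a : K, ‖a‖ < ε → Q (z, Φ.e.symm (ξ z, a)) := by
  have hx0t : (x₀, (0 : K)) ∈ Φ.e.target := (hw x₀ hx₀).2 ▸ Φ.e.map_source (hw x₀ hx₀).1
  have hsym : Φ.e.symm (x₀, 0) = w x₀ := by
    rw [← (hw x₀ hx₀).2, Φ.e.left_inv (hw x₀ hx₀).1]
  obtain ⟨P₁, h₁, P₂, h₂, hP⟩ := Filter.eventually_prod_iff.1 hQ
  have h3 : ∀ᶠ p in 𝓝 (x₀, (0 : K)), P₂ (Φ.e.symm p) :=
    (Φ.e.continuousAt_symm hx0t).tendsto.eventually (by rwa [hsym])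
  rw [nhds_prod_eq] at h3
  obtain ⟨R₁, hR₁, R₂, hR₂, hR⟩ := Filter.eventually_prod_iff.1 h3
  obtain ⟨ε, hε, hball⟩ := Metric.eventually_nhds_iff.1 hR₂
  refine ⟨min ε Φ.r, lt_min hε Φ.r_pos, min_le_right _ _, ?_⟩
  filter_upwards [h₁, hξ.eventually hR₁, hξ.eventually (Φ.isOpen_W.mem_nhds hx₀)] with z h1 h2 h4
  refine ⟨h4, fun a ha => ?_⟩
  refine hP h1 (hR h2 (hball (by simpa using ha.trans_le (min_le_left _ _)))) ?_
  exact (Φ.continuous_symm h4 (X := Unit) (a := fun _ => a) continuous_const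
    fun _ => ha.trans_le (min_le_right _ _)).2 ()

theorem FibreChart.eventually_small {π : G → M} (Φ : FibreChart (E := E) (F := F) π K) {w : M → G}
    (hw : ∀ x ∈ Φ.W, w x ∈ Φ.e.source ∧ Φ.e (w x) = (x, 0)) {x₀ : M} (hx₀ : x₀ ∈ Φ.W) {ε : ℝ}
    (hε : 0 < ε) : ∀ᶠ h in 𝓝 (w x₀), h ∈ Φ.e.source ∧ ‖(Φ.e h).2‖ < ε ∧
      Φ.e.symm (π h, (Φ.e h).2) = h := by
  have h1 := Φ.e.open_source.mem_nhds (hw x₀ hx₀).1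
  have h2 : ContinuousAt (fun h => ‖(Φ.e h).2‖) (w x₀) :=
    (continuous_snd.continuousAt.comp (Φ.e.continuousAt (hw x₀ hx₀).1)).norm
  filter_upwards [h1, h2.eventually_lt continuousAt_const (by simpa [(hw x₀ hx₀).2] using hε)]
    with h hh hn
  refine ⟨hh, hn, ?_⟩
  rw [← Φ.fst_eq h hh]
  exact Φ.e.left_inv hh

/-- Maps depending on a parameter that agree at units and whose agreement propagates along the
fibres agree near units. -/
theorem FibreChart.eventually_eq {π τ : G → M} (Φ : FibreChart (E := E) (F := F) π K) {w : M → G}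
    (hw : ∀ x ∈ Φ.W, w x ∈ Φ.e.source ∧ Φ.e (w x) = (x, 0)) {x₀ : M} (hx₀ : x₀ ∈ Φ.W)
    (hτ : ∀ y, T2Space (τ ⁻¹' {y})) {T : Type*} {l : Filter T} {ξ y : T → M}
    (hξ : Filter.Tendsto ξ l (𝓝 x₀)) {f₁ f₂ : T → G → G}
    (h : ∀ᶠ q : T × G in l ×ˢ 𝓝 (w x₀), π q.2 = ξ q.1 →
      Propagates π τ (ξ q.1) (y q.1) (f₁ q.1) (f₂ q.1) q.2)
    (h₀ : ∀ᶠ z in l, f₁ z (w (ξ z)) = f₂ z (w (ξ z))) :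
    ∀ᶠ q : T × G in l ×ˢ 𝓝 (w x₀), π q.2 = ξ q.1 → f₁ q.1 q.2 = f₂ q.1 q.2 := by
  obtain ⟨ε, hε, hεr, hev⟩ := Φ.eventually_slice hw hx₀ hξ h
  filter_upwards [Filter.prod_mem_prod (hev.and h₀) (Φ.eventually_small hw hx₀ hε)] with q hq hπ
  obtain ⟨⟨⟨hW, hP⟩, h0⟩, -, hn, hs⟩ := hq
  have : PreconnectedSpace (Metric.ball (0 : K) ε) :=
    Subtype.preconnectedSpace (convex_ball (0 : K) ε).isPreconnected
  have hc := Φ.continuous_symm hW (X := Metric.ball (0 : K) ε) (a := Subtype.val)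
    continuous_subtype_val fun z => (mem_ball_zero_iff.1 z.2).trans_le hεr
  have hw0 : Φ.e.symm (ξ q.1, 0) = w (ξ q.1) := by
    rw [← (hw _ hW).2, Φ.e.left_inv (hw _ hW).1]
  -- The connected set is a ball of the fibre through `q.2`; its centre is the point `w (ξ q.1)`,
  -- where the maps agree by `h₀`.
  have h1 := Propagates.eq_of_preconnected (hτ (y q.1)) hc.1 hc.2
    (fun z => hP z (mem_ball_zero_iff.1 z.2)) (a₀ := ⟨0, Metric.mem_ball_self hε⟩)
    (by simpa only [hw0] using h0) ⟨(Φ.e q.2).2, mem_ball_zero_iff.2 hn⟩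
  simp only [← hπ, hs] at h1
  exact h1

end Continuation


/-! ### Rigid classes of germs of multiplications -/

section MulGerms

variable {E F : Type*} [NormedAddCommGroup E] [NormedSpace ℝ E]
  [NormedAddCommGroup F] [NormedSpace ℝ F]
  {M : Type*} [TopologicalSpace M] [ChartedSpace F M]
  {G : Type*} [TopologicalSpace G] [ChartedSpace E G]

/-- `f` behaves like a multiplication at the composable pair `q`. -/
structure ArrowSpace.IsMulAt (S : ArrowSpace E F M G) (f : G × G → G) (q : G × G) : Prop where
  smooth : ContMDiffWithinAt (𝓘(ℝ, E).prod 𝓘(ℝ, E)) 𝓘(ℝ, E) ∞ f S.pairs q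
  s_eq : S.s (f q) = S.s q.2
  t_eq : S.t (f q) = S.t q.1

/-- `f` is a submersion at `p`, as a map on the subset `A` of the space of composable pairs. -/
def ArrowSpace.IsSubmersionAt (S : ArrowSpace E F M G) (f : G × G → G) (A : Set (G × G))
    (p : G × G) : Prop :=
  ∃ D : TangentSpace (𝓘(ℝ, E).prod 𝓘(ℝ, E)) p →L[ℝ] TangentSpace 𝓘(ℝ, E) (f p),
    HasMFDerivWithinAt (𝓘(ℝ, E).prod 𝓘(ℝ, E)) 𝓘(ℝ, E) f A p D ∧
    ∀ z : TangentSpace 𝓘(ℝ, E) (f p),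
      ∃ (v : TangentSpace 𝓘(ℝ, E) p.1) (w : TangentSpace 𝓘(ℝ, E) p.2),
        tangentMap 𝓘(ℝ, E) 𝓘(ℝ, F) S.s ⟨p.1, v⟩ = tangentMap 𝓘(ℝ, E) 𝓘(ℝ, F) S.t ⟨p.2, w⟩ ∧
        D (v, w) = z

/-- `f` is near `p` a multiplication satisfying the additional condition `P`. -/
def ArrowSpace.Adm (S : ArrowSpace E F M G) (P : (G × G → G) → G × G → Prop) (f : G × G → G)
    (p : G × G) : Prop :=
  ∀ᶠ q in 𝓝[S.pairs] p, S.IsMulAt f q ∧ P f q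

/-- A class of germs of multiplications, given by a local condition, that is rigid along fibres
and contains multiplications near all pairs with one unit entry. -/
structure MulGerm (S : ArrowSpace E F M G) where
  /-- the local condition -/
  P : (G × G → G) → G × G → Prop
  /-- triples on which associativity propagates -/
  T : G × G × G → Prop
  congr : ∀ {f f' : G × G → G} {q}, q ∈ S.pairs → f =ᶠ[𝓝[S.pairs] q] f' → P f q → P f' q
  propagate_left : ∀ {f f' : G × G → G} {g h}, S.s g = S.t h → S.Adm P f (g, h) →
    S.Adm P f' (g, h) → f (g, h) = f' (g, h) →
    ∀ᶠ h' in 𝓝[S.t ⁻¹' {S.s g}] h, f (g, h') = f' (g, h')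
  propagate_right : ∀ {f f' : G × G → G} {g h}, S.s g = S.t h → S.Adm P f (g, h) →
    S.Adm P f' (g, h) → f (g, h) = f' (g, h) →
    ∀ᶠ g' in 𝓝[S.s ⁻¹' {S.t h}] g, f (g', h) = f' (g', h)
  unit_left : ∀ {f : G × G → G} {x h}, S.t h = x → S.Adm P f (S.u x, h) → f (S.u x, h) = h →
    ∀ᶠ h' in 𝓝[S.t ⁻¹' {x}] h, f (S.u x, h') = h'
  unit_right : ∀ {f : G × G → G} {x g}, S.s g = x → S.Adm P f (g, S.u x) → f (g, S.u x) = g →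
    ∀ᶠ g' in 𝓝[S.s ⁻¹' {x}] g, f (g', S.u x) = g'
  submersion : ∀ {f : G × G → G} {q}, q ∈ S.pairs → S.Adm P f q → S.IsSubmersionAt f S.pairs q
  T_near : ∀ g, (∀ᶠ p in 𝓝 (S.u (S.t g), S.u (S.t g), g), T p) ∧
    (∀ᶠ p in 𝓝 (S.u (S.t g), g, S.u (S.s g)), T p) ∧
    ∀ᶠ p in 𝓝 (g, S.u (S.s g), S.u (S.s g)), T p
  assoc_left : ∀ {f : G × G → G} {g h k}, T (g, h, k) → S.s g = S.t h → S.s h = S.t k →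
    S.Adm P f (g, h) → S.Adm P f (h, k) → S.Adm P f (f (g, h), k) → S.Adm P f (g, f (h, k)) →
    f (f (g, h), k) = f (g, f (h, k)) →
    ∀ᶠ k' in 𝓝[S.t ⁻¹' {S.s h}] k, f (f (g, h), k') = f (g, f (h, k'))
  assoc_right : ∀ {f : G × G → G} {g h k}, T (g, h, k) → S.s g = S.t h → S.s h = S.t k →
    S.Adm P f (g, h) → S.Adm P f (h, k) → S.Adm P f (f (g, h), k) → S.Adm P f (g, f (h, k)) →
    f (f (g, h), k) = f (g, f (h, k)) →
    ∀ᶠ g' in 𝓝[S.s ⁻¹' {S.t h}] g, f (f (g', h), k) = f (g', f (h, k))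
  exists_right : ∀ g, ∃ f, S.Adm P f (g, S.u (S.s g)) ∧ ∀ᶠ g' in 𝓝 g, f (g', S.u (S.s g')) = g'
  exists_left : ∀ g, ∃ f, S.Adm P f (S.u (S.t g), g) ∧ ∀ᶠ g' in 𝓝 g, f (S.u (S.t g'), g') = g'

variable {S : ArrowSpace E F M G}

theorem ArrowSpace.IsMulAt.op {f : G × G → G} {q : G × G} (h : S.IsMulAt f q) :
    S.op.IsMulAt (f ∘ Prod.swap) q.swap where
  smooth := by
    have h1 : ContMDiffWithinAt (𝓘(ℝ, E).prod 𝓘(ℝ, E)) 𝓘(ℝ, E) ∞ f S.pairs q.swap.swap := by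
      simpa using h.smooth
    have h2 : ContMDiff (𝓘(ℝ, E).prod 𝓘(ℝ, E)) (𝓘(ℝ, E).prod 𝓘(ℝ, E)) ∞
        (Prod.swap : G × G → G × G) := contMDiff_snd.prodMk contMDiff_fst
    exact h1.comp q.swap h2.contMDiffAt.contMDiffWithinAt fun p hp => S.mem_op_pairs.1 hp
  s_eq := by simpa using h.t_eq
  t_eq := by simpa using h.s_eq

theorem ArrowSpace.Adm.op {P : (G × G → G) → G × G → Prop} {f : G × G → G} {q : G × G}
    (h : S.Adm P f q) {P' : (G × G → G) → G × G → Prop}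
    (hP : ∀ q, P f q → P' (f ∘ Prod.swap) q.swap) : S.op.Adm P' (f ∘ Prod.swap) q.swap := by
  have h1 := (S.tendsto_swap_pairs q.swap).eventually (p := fun q => S.IsMulAt f q ∧ P f q)
    (by rw [Prod.swap_swap]; exact h)
  refine h1.mono fun p hp => ?_
  simpa using And.intro hp.1.op (hP _ hp.2)

theorem ArrowSpace.IsSubmersionAt.op {f : G × G → G} {q : G × G}
    (h : S.IsSubmersionAt f S.pairs q) :
    S.op.IsSubmersionAt (f ∘ Prod.swap) S.op.pairs q.swap := by
  obtain ⟨D, hD, hz⟩ := h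
  have h1 : HasMFDerivAt (𝓘(ℝ, E).prod 𝓘(ℝ, E)) (𝓘(ℝ, E).prod 𝓘(ℝ, E)) (Prod.swap : G × G → G × G)
      q.swap ((ContinuousLinearMap.snd ℝ E E).prod (ContinuousLinearMap.fst ℝ E E)) :=
    (hasMFDerivAt_snd q.swap).prodMk (hasMFDerivAt_fst q.swap)
  have hD' : HasMFDerivWithinAt (𝓘(ℝ, E).prod 𝓘(ℝ, E)) 𝓘(ℝ, E) f S.pairs q.swap.swap D := hD
  refine ⟨_, hD'.comp q.swap h1.hasMFDerivWithinAt fun p hp => S.mem_op_pairs.1 hp, fun z => ?_⟩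
  obtain ⟨v, w, hvw, hz⟩ := hz z
  exact ⟨w, v, hvw.symm, hz⟩

theorem ArrowSpace.tendsto_prodMk_left {g h : G} :
    Filter.Tendsto (fun h' => (g, h')) (𝓝[S.t ⁻¹' {S.s g}] h) (𝓝[S.pairs] (g, h)) :=
  tendsto_nhdsWithin_iff.2
    ⟨((Continuous.prodMk_right g).tendsto h).mono_left nhdsWithin_le_nhds,
      Filter.eventually_of_mem self_mem_nhdsWithin fun _ h => Eq.symm h⟩

theorem ArrowSpace.tendsto_prodMk_right {g h : G} :
    Filter.Tendsto (fun g' => (g', h)) (𝓝[S.s ⁻¹' {S.t h}] g) (𝓝[S.pairs] (g, h)) :=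
  tendsto_nhdsWithin_iff.2
    ⟨((Continuous.prodMk_left h).tendsto g).mono_left nhdsWithin_le_nhds,
      Filter.eventually_of_mem self_mem_nhdsWithin fun _ h => h⟩

namespace MulGerm

/-- The class of germs of multiplications opposite to a given class. -/
def op (𝒞 : MulGerm S) : MulGerm S.op :=
  have hadm : ∀ {f : G × G → G} {q : G × G},
      S.op.Adm (fun f q => 𝒞.P (f ∘ Prod.swap) q.swap) f q →
      S.Adm 𝒞.P (f ∘ Prod.swap) q.swap := fun {f q} h => h.op fun q hq => hq
  { P := fun f q => 𝒞.P (f ∘ Prod.swap) q.swap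
    T := fun p => 𝒞.T (p.2.2, p.2.1, p.1)
    congr := fun {f f' q} hq hff' h => 𝒞.congr (S.mem_op_pairs.1 hq)
      ((S.op.tendsto_swap_pairs q.swap).eventually (p := fun q => f q = f' q)
        (by rw [Prod.swap_swap]; exact hff')) h
    propagate_left := fun hgh h h' => 𝒞.propagate_right hgh.symm (hadm h) (hadm h')
    propagate_right := fun hgh h h' => 𝒞.propagate_left hgh.symm (hadm h) (hadm h')
    unit_left := fun hx h => 𝒞.unit_right hx (hadm h)
    unit_right := fun hx h => 𝒞.unit_left hx (hadm h)
    submersion := fun {f q} hq h => by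
      have := (𝒞.submersion (S.mem_op_pairs.1 hq) (hadm h)).op
      simpa [Function.comp_def] using this
    T_near := fun g => by
      have hc : Continuous fun p : G × G × G => (p.2.2, p.2.1, p.1) := by fun_prop
      obtain ⟨h1, h2, h3⟩ := 𝒞.T_near g
      exact ⟨(hc.tendsto (S.u (S.s g), S.u (S.s g), g)).eventually h3,
        (hc.tendsto (S.u (S.s g), g, S.u (S.t g))).eventually h2,
        (hc.tendsto (g, S.u (S.t g), S.u (S.t g))).eventually h1⟩
    assoc_left := fun hT h1 h2 a1 a2 a3 a4 h => (𝒞.assoc_right hT h2.symm h1.symm (hadm a2)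
      (hadm a1) (hadm a4) (hadm a3) h.symm).mono fun _ => Eq.symm
    assoc_right := fun hT h1 h2 a1 a2 a3 a4 h => (𝒞.assoc_left hT h2.symm h1.symm (hadm a2)
      (hadm a1) (hadm a4) (hadm a3) h.symm).mono fun _ => Eq.symm
    exists_right := fun g => by
      obtain ⟨f, hf, h⟩ := 𝒞.exists_left g
      exact ⟨f ∘ Prod.swap, hf.op fun q hq => hq, h⟩
    exists_left := fun g => by
      obtain ⟨f, hf, h⟩ := 𝒞.exists_right g
      exact ⟨f ∘ Prod.swap, hf.op fun q hq => hq, h⟩ }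

variable (𝒞 : MulGerm S)

/-- `f` belongs to the class near `p`. -/
abbrev Adm (f : G × G → G) (p : G × G) : Prop := S.Adm 𝒞.P f p

theorem adm_op {f : G × G → G} {q : G × G} (h : 𝒞.Adm f q) : 𝒞.op.Adm (f ∘ Prod.swap) q.swap :=
  h.op fun _ hq => hq

variable {𝒞}

theorem Adm.eventually {f : G × G → G} {p : G × G} (h : 𝒞.Adm f p) :
    ∀ᶠ q in 𝓝[S.pairs] p, 𝒞.Adm f q :=
  eventually_eventually_nhdsWithin.2 h

theorem Adm.isMulAt {f : G × G → G} {p : G × G} (h : 𝒞.Adm f p) (hp : p ∈ S.pairs) :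
    S.IsMulAt f p :=
  (Filter.Eventually.self_of_nhdsWithin h hp).1

theorem Adm.tendsto {f : G × G → G} {p : G × G} (h : 𝒞.Adm f p) (hp : p ∈ S.pairs) :
    Filter.Tendsto f (𝓝[S.pairs] p) (𝓝 (f p)) :=
  (h.isMulAt hp).smooth.continuousWithinAt

theorem Adm.congr {f f' : G × G → G} {p : G × G} (h : 𝒞.Adm f p)
    (hff' : f =ᶠ[𝓝[S.pairs] p] f') : 𝒞.Adm f' p := by
  filter_upwards [h, eventually_eventually_nhdsWithin.2 hff', self_mem_nhdsWithin]
    with q hq hqq hqp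
  have h1 : f' q = f q := (Filter.Eventually.self_of_nhdsWithin hqq hqp).symm
  exact ⟨⟨hq.1.smooth.congr_of_eventuallyEq (Filter.EventuallyEq.symm hqq) h1,
    h1 ▸ hq.1.s_eq, h1 ▸ hq.1.t_eq⟩, 𝒞.congr hqp hqq hq.2⟩

/-- Left translations by `g` carry the target fibre over `s g` into the target fibre over `t g`;
this is the setting in which continuation is used. -/
theorem Adm.propagates {f f' : G × G → G} {g h : G} (hf : 𝒞.Adm f (g, h)) (hf' : 𝒞.Adm f' (g, h))
    (hgh : S.s g = S.t h) : Propagates S.t S.t (S.s g) (S.t g) (fun h => f (g, h))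
      (fun h => f' (g, h)) h where
  left := (hf.isMulAt hgh).t_eq
  right := (hf'.isMulAt hgh).t_eq
  continuous_left := (hf.tendsto hgh).comp S.tendsto_prodMk_left
  continuous_right := (hf'.tendsto hgh).comp S.tendsto_prodMk_left
  propagate := 𝒞.propagate_left hgh hf hf'

variable (𝒞) in
/-- `f` is a multiplication in the class defined near all pairs with one unit entry. -/
structure IsLocalMul (f : G × G → G) : Prop where
  adm_right : ∀ g, 𝒞.Adm f (g, S.u (S.s g))
  adm_left : ∀ g, 𝒞.Adm f (S.u (S.t g), g)
  mul_unit : ∀ g, f (g, S.u (S.s g)) = g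
  unit_mul : ∀ g, f (S.u (S.t g), g) = g

theorem IsLocalMul.op {f : G × G → G} (h : 𝒞.IsLocalMul f) :
    𝒞.op.IsLocalMul (f ∘ Prod.swap) where
  adm_right g := 𝒞.adm_op (h.adm_left g)
  adm_left g := 𝒞.adm_op (h.adm_right g)
  mul_unit := h.unit_mul
  unit_mul := h.mul_unit

end MulGerm

end MulGerms


/-! ### A local multiplication from a rigid class of germs -/

section LocalMultiplications

variable {E F : Type*} [NormedAddCommGroup E] [NormedSpace ℝ E]
  [NormedAddCommGroup F] [NormedSpace ℝ F]
  {M : Type*} [TopologicalSpace M] [ChartedSpace F M]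
  {G : Type*} [TopologicalSpace G] [ChartedSpace E G]

/-- A local Lie groupoid without inversion. -/
structure PreGroupoid (S : ArrowSpace E F M G) where
  /-- domain of multiplication -/
  U : Set (G × G)
  /-- multiplication -/
  mul : G × G → G
  isOpen_U : ∃ O : Set (G × G), IsOpen O ∧ U = O ∩ S.pairs
  right_unit_mem : ∀ g, (g, S.u (S.s g)) ∈ U
  left_unit_mem : ∀ g, (S.u (S.t g), g) ∈ U
  isMulAt : ∀ p ∈ U, S.IsMulAt mul p
  submersion : ∀ p ∈ U, S.IsSubmersionAt mul S.pairs p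
  mul_unit : ∀ g, mul (g, S.u (S.s g)) = g
  unit_mul : ∀ g, mul (S.u (S.t g), g) = g
  assoc : ∀ᶠ p : G × G × G in ⨆ g, (𝓝 (S.u (S.t g), S.u (S.t g), g) ⊔
      𝓝 (S.u (S.t g), g, S.u (S.s g)) ⊔ 𝓝 (g, S.u (S.s g), S.u (S.s g))),
    S.s p.1 = S.t p.2.1 → S.s p.2.1 = S.t p.2.2 →
      mul (mul (p.1, p.2.1), p.2.2) = mul (p.1, mul (p.2.1, p.2.2))

theorem ArrowSpace.tendsto_triple (S : ArrowSpace E F M G) (g h k : G) :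
    Filter.Tendsto (fun p : G × G × G => ((p.1, p.2.1), p.2.2))
      (𝓝[{p | S.s p.1 = S.t p.2.1}] (g, h, k)) (𝓝[S.pairs] (g, h) ×ˢ 𝓝 k) := by
  have hc : ∀ {X : Type _} [TopologicalSpace X] {f : G × G × G → X}, Continuous f →
      Filter.Tendsto f (𝓝[{p | S.s p.1 = S.t p.2.1}] (g, h, k)) (𝓝 (f (g, h, k))) :=
    fun hf => (hf.tendsto _).mono_left nhdsWithin_le_nhds
  refine Filter.Tendsto.prodMk (tendsto_nhdsWithin_iff.2 ⟨?_, ?_⟩) ?_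
  · exact hc (f := fun p => (p.1, p.2.1)) (by fun_prop)
  · exact Filter.eventually_of_mem self_mem_nhdsWithin fun p hp => hp
  · exact hc (f := fun p => p.2.2) (by fun_prop)

variable [FiniteDimensional ℝ E] [FiniteDimensional ℝ F] [IsManifold 𝓘(ℝ, F) ∞ M]
  [IsManifold 𝓘(ℝ, E) ∞ G] {S : ArrowSpace E F M G}

theorem ArrowSpace.exists_unit_chart (S : ArrowSpace E F M G) (x : M) :
    ∃ (K : Submodule ℝ E) (Φ : FibreChart (E := E) (F := F) S.t K), x ∈ Φ.W ∧
      ∀ y ∈ Φ.W, S.u y ∈ Φ.e.source ∧ Φ.e (S.u y) = (y, 0) := by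
  obtain ⟨K, Φ, -, hW, -, h⟩ := exists_fibreChart S.smooth_t (S.u x) (S.submersion_t _) S.smooth_u
    (by rw [S.t_u])
  exact ⟨K, Φ, by rwa [S.t_u] at hW, h S.t_u⟩

namespace MulGerm

variable {𝒞 : MulGerm S}

/-- Multiplications that agree on `(g, u (s g))` for all `g` close to `g₀` have the same germ. -/
theorem eventuallyEq_of_right_units {f f' : G × G → G} {g₀ : G}
    (hf : 𝒞.Adm f (g₀, S.u (S.s g₀))) (hf' : 𝒞.Adm f' (g₀, S.u (S.s g₀)))
    (h : ∀ᶠ g in 𝓝 g₀, f (g, S.u (S.s g)) = f' (g, S.u (S.s g))) :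
    f =ᶠ[𝓝[S.pairs] (g₀, S.u (S.s g₀))] f' := by
  obtain ⟨K, Φ, hx, hΦ⟩ := S.exists_unit_chart (S.s g₀)
  have h1 := Φ.eventually_eq (τ := S.t) hΦ hx S.t2_t (S.smooth_s.continuous.tendsto g₀) (y := S.t)
    (f₁ := fun g h => f (g, h)) (f₂ := fun g h => f' (g, h)) ?_ h
  · rw [← nhds_prod_eq] at h1
    filter_upwards [nhdsWithin_le_nhds h1, self_mem_nhdsWithin] with q hq hq'
    exact hq (Eq.symm hq')
  · rw [← nhds_prod_eq]
    filter_upwards [eventually_nhdsWithin_iff.1 hf.eventually,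
      eventually_nhdsWithin_iff.1 hf'.eventually] with q h1 h2 hq
    exact (h1 hq.symm).propagates (h2 hq.symm) hq.symm

/-- A multiplication preserving the unit `u x` has the units close to `u x` as left units. -/
theorem eventually_left_unit {f : G × G → G} {x₀ : M} (hf : 𝒞.Adm f (S.u x₀, S.u x₀))
    (h : ∀ᶠ x in 𝓝 x₀, f (S.u x, S.u x) = S.u x) :
    ∀ᶠ g in 𝓝 (S.u x₀), f (S.u (S.t g), g) = g := by
  obtain ⟨K, Φ, hx, hΦ⟩ := S.exists_unit_chart x₀
  have h1 := Φ.eventually_eq (τ := S.t) hΦ hx S.t2_t Filter.tendsto_id (l := 𝓝 x₀) (y := id)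
    (f₁ := fun x g => f (S.u x, g)) (f₂ := fun x g => g) ?_ h
  · rw [← nhds_prod_eq] at h1
    have h2 : Filter.Tendsto (fun g => (S.t g, g)) (𝓝 (S.u x₀)) (𝓝 (x₀, S.u x₀)) := by
      have := (S.smooth_t.continuous.prodMk continuous_id).tendsto (S.u x₀)
      rwa [id, S.t_u] at this
    exact (h2.eventually h1).mono fun g hg => hg rfl
  · rw [← nhds_prod_eq]
    have h2 : Filter.Tendsto (fun q : M × G => (S.u q.1, q.2)) (𝓝 (x₀, S.u x₀))
        (𝓝 (S.u x₀, S.u x₀)) :=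
      ((S.smooth_u.continuous.comp continuous_fst).prodMk continuous_snd).tendsto (x₀, S.u x₀)
    filter_upwards [h2.eventually (eventually_nhdsWithin_iff.1 hf.eventually)] with q hq hq'
    have hp : S.s (S.u q.1) = S.t q.2 := by rw [S.s_u, hq']; rfl
    have had := hq hp
    refine ⟨?_, hq', ?_, continuousWithinAt_id, fun h3 => ?_⟩
    · rw [(had.isMulAt hp).t_eq, S.t_u]; rfl
    · have h4 := (had.tendsto hp).comp S.tendsto_prodMk_left
      rw [S.s_u] at h4
      exact h4
    · exact 𝒞.unit_left hq' had h3

theorem eventually_right_unit {f : G × G → G} {x₀ : M} (hf : 𝒞.Adm f (S.u x₀, S.u x₀))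
    (h : ∀ᶠ x in 𝓝 x₀, f (S.u x, S.u x) = S.u x) :
    ∀ᶠ g in 𝓝 (S.u x₀), f (g, S.u (S.s g)) = g :=
  eventually_left_unit (𝒞 := 𝒞.op) (𝒞.adm_op hf) h

variable [T2Space M] [ParacompactSpace M]

variable (𝒞) in
-- Each germ `φ i` is meaningful only near `(i, u (s i))`. In a fibre chart, the value at `p` is
-- taken from any `φ i` that fixes `p.1` on the right and is admissible along the radial segment
-- from the unit to `p.2`. Continuation along this segment shows that the value does not depend on
-- `i`. The resulting functions, one for each chart, have the same germs and are glued over the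
-- base.
theorem exists_right_mul :
    ∃ f, ∀ g, 𝒞.Adm f (g, S.u (S.s g)) ∧ f (g, S.u (S.s g)) = g := by
  choose φ hφ' hφu using 𝒞.exists_right
  have hφ : ∀ g, 𝒞.Adm (φ g) (g, S.u (S.s g)) := hφ'
  choose K Φ hx hΦ using S.exists_unit_chart
  let Good : M → G → G × G → Prop := fun k i p => φ i (p.1, S.u (S.s p.1)) = p.1 ∧
    ∀ τ : Icc (0 : ℝ) 1, 𝒞.Adm (φ i) (p.1, (Φ k).e.symm (S.s p.1, (τ : ℝ) • ((Φ k).e p.2).2))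
  classical
  let j : M → G × G → G := fun k p => if h : ∃ i, Good k i p then φ h.choose p else p.1
  have hj : ∀ g₀ k, S.s g₀ ∈ (Φ k).W → j k =ᶠ[𝓝[S.pairs] (g₀, S.u (S.s g₀))] φ g₀ := by
    intro g₀ k hk
    have h1 : ∀ᶠ q in 𝓝 g₀ ×ˢ 𝓝 (S.u (S.s g₀)), S.t q.2 = S.s q.1 → 𝒞.Adm (φ g₀) q := by
      rw [← nhds_prod_eq]
      exact (eventually_nhdsWithin_iff.1 (hφ g₀).eventually).mono fun q hq h => hq h.symm
    obtain ⟨ε, hε, hεr, h2⟩ := (Φ k).eventually_slice (hΦ k) hk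
      (S.smooth_s.continuous.tendsto g₀) h1
    have h3 := Filter.prod_mem_prod (h2.and (hφu g₀)) ((Φ k).eventually_small (hΦ k) hk hε)
    rw [← nhds_prod_eq] at h3
    filter_upwards [nhdsWithin_le_nhds h3, self_mem_nhdsWithin] with p hp hpp
    obtain ⟨⟨⟨hW, hball⟩, hu⟩, hsrc, hn, hs⟩ := hp
    have hnτ : ∀ τ : Icc (0 : ℝ) 1, ‖(τ : ℝ) • ((Φ k).e p.2).2‖ < ε := fun τ => by
      rw [norm_smul, Real.norm_eq_abs, abs_of_nonneg τ.2.1]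
      exact (mul_le_of_le_one_left (norm_nonneg _) τ.2.2).trans_lt hn
    have hg₀ : Good k g₀ p := ⟨hu, fun τ => hball _ (hnτ τ)⟩
    have hex : ∃ i, Good k i p := ⟨g₀, hg₀⟩
    show j k p = φ g₀ p
    rw [show j k p = φ hex.choose p from dif_pos hex]
    have hi := hex.choose_spec
    generalize hex.choose = i at hi
    have hc := (Φ k).continuous_symm hW (X := Icc (0 : ℝ) 1)
      (a := fun τ => (τ : ℝ) • ((Φ k).e p.2).2) (by fun_prop) fun τ => (hnτ τ).trans_le hεr
    have hsm : S.s p.1 = S.t p.2 := hpp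
    have hw0 : (Φ k).e.symm (S.s p.1, 0) = S.u (S.s p.1) := by
      rw [← (hΦ k _ hW).2, (Φ k).e.left_inv (hΦ k _ hW).1]
    -- Both candidates equal `p.1` at the start of the segment, which is a unit, hence they agree at
    -- its end `p.2`.
    have h4 := Propagates.eq_of_preconnected (S.t2_t (S.t p.1)) hc.1 hc.2
      (f₁ := fun h => φ i (p.1, h)) (f₂ := fun h => φ g₀ (p.1, h))
      (fun τ => (hi.2 τ).propagates (hg₀.2 τ) (hc.2 τ).symm) (a₀ := 0)
      (by
        simp only [Icc.coe_zero, zero_smul, hw0]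
        rw [hi.1, hu]) 1
    simpa only [Icc.coe_one, one_smul, hsm, hs] using h4
  obtain ⟨f, hf⟩ := exists_glued (q := fun p : G × G => S.s p.1)
    (Z := range fun g => (g, S.u (S.s g))) (nb := fun p => 𝓝[S.pairs] p)
    (fun z _ => ((S.smooth_s.continuous.comp continuous_fst).tendsto z).mono_left
      nhdsWithin_le_nhds) (A := fun x => (Φ x).W) (fun x => (Φ x).isOpen_W) hx (j := j)
    (by
      rintro _ ⟨g, rfl⟩ k l hk hl
      exact (hj g k hk).trans (hj g l hl).symm)
  refine ⟨f, fun g => ?_⟩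
  have h1 : f =ᶠ[𝓝[S.pairs] (g, S.u (S.s g))] φ g :=
    (hf _ ⟨g, rfl⟩ _ (hx (S.s g))).trans (hj g _ (hx (S.s g)))
  refine ⟨(hφ g).congr h1.symm, ?_⟩
  have h2 : f (g, S.u (S.s g)) = φ g (g, S.u (S.s g)) :=
    Filter.Eventually.self_of_nhdsWithin (p := fun p => f p = φ g p) h1
      (S.right_unit_mem_pairs g)
  rw [h2, (hφu g).self_of_nhds]

variable (𝒞) in
-- A multiplication near the pairs `(g, unit)` and one near the pairs `(unit, g)`, the latter from
-- the opposite class, must be made to agree where both are relevant. Near `(u x, u x)` they do,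
-- since by rigidity units are right units for the second one as well. A tube around the units then
-- separates the two regimes.
theorem exists_isLocalMul : ∃ f, 𝒞.IsLocalMul f := by
  obtain ⟨f₁, h₁⟩ := 𝒞.exists_right_mul
  obtain ⟨f₂', h₂'⟩ := 𝒞.op.exists_right_mul
  obtain ⟨f₂, h₂, h₂u⟩ : ∃ f₂, (∀ g, 𝒞.Adm f₂ (S.u (S.t g), g)) ∧
      ∀ g, f₂ (S.u (S.t g), g) = g :=
    ⟨f₂' ∘ Prod.swap, fun g => 𝒞.op.adm_op (h₂' g).1, fun g => (h₂' g).2⟩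
  have hQ : ∀ x, ∀ᶠ p in 𝓝 (S.u x, S.u x), p ∈ S.pairs → f₁ p = f₂ p := by
    intro x
    have a₁ : 𝒞.Adm f₁ (S.u x, S.u (S.s (S.u x))) := (h₁ (S.u x)).1
    have a₂ : 𝒞.Adm f₂ (S.u x, S.u (S.s (S.u x))) := by
      have := h₂ (S.u x); rw [S.t_u] at this; rwa [S.s_u]
    have h3 : ∀ᶠ g in 𝓝 (S.u x), f₂ (g, S.u (S.s g)) = g :=
      eventually_right_unit (by rwa [S.s_u] at a₂)
        (Filter.Eventually.of_forall fun y => by have := h₂u (S.u y); rwa [S.t_u] at this)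
    have h4 := eventuallyEq_of_right_units a₁ a₂ (h3.mono fun g hg => by rw [hg, (h₁ g).2])
    rw [S.s_u] at h4
    exact eventually_nhdsWithin_iff.1 h4
  obtain ⟨V, hV, huV, hVQ⟩ := exists_tube S.smooth_s.continuous S.smooth_t.continuous
    S.smooth_u.continuous S.s_u S.t_u hQ
  classical
  -- Near `(g, unit)` the second entry is in `V`. Near `(unit, g)` the first entry is in `V`; if the
  -- second one is too, the tube property makes the two functions agree.
  let f : G × G → G := fun p => if p.2 ∈ V then f₁ p else f₂ p
  have e₁ : ∀ g, f₁ =ᶠ[𝓝[S.pairs] (g, S.u (S.s g))] f := fun g => by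
    have : ∀ᶠ p : G × G in 𝓝 (g, S.u (S.s g)), p.2 ∈ V :=
      (continuous_snd.tendsto (g, S.u (S.s g))).eventually (hV.mem_nhds (huV _))
    exact nhdsWithin_le_nhds (this.mono fun p hp => (if_pos hp).symm)
  have e₂ : ∀ g, f₂ =ᶠ[𝓝[S.pairs] (S.u (S.t g), g)] f := fun g => by
    have : ∀ᶠ p : G × G in 𝓝 (S.u (S.t g), g), p.1 ∈ V :=
      (continuous_fst.tendsto (S.u (S.t g), g)).eventually (hV.mem_nhds (huV _))
    filter_upwards [nhdsWithin_le_nhds this, self_mem_nhdsWithin] with p hp hpp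
    show f₂ p = if _ then _ else _
    split_ifs with h
    · exact (hVQ p.1 hp p.2 h hpp hpp).symm
    · rfl
  refine ⟨f, fun g => (h₁ g).1.congr (e₁ g), fun g => (h₂ g).congr (e₂ g), fun g => ?_,
    fun g => ?_⟩
  · exact (if_pos (huV _)).trans (h₁ g).2
  · rw [← Filter.Eventually.self_of_nhdsWithin (e₂ g) (S.left_unit_mem_pairs g), h₂u]

omit [T2Space M] [ParacompactSpace M] in
/-- A local multiplication is associative near `(g₀, h₀, u (s h₀))` if `g₀` or `h₀` is a unit. -/
theorem IsLocalMul.assoc_right {f : G × G → G} (hf : 𝒞.IsLocalMul f) {g₀ h₀ : G}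
    (hgh : S.s g₀ = S.t h₀) (h₀f : 𝒞.Adm f (g₀, h₀))
    (hT : ∀ᶠ p in 𝓝 (g₀, h₀, S.u (S.s h₀)), 𝒞.T p) :
    ∀ᶠ p : G × G × G in 𝓝 (g₀, h₀, S.u (S.s h₀)), S.s p.1 = S.t p.2.1 →
      S.s p.2.1 = S.t p.2.2 → f (f (p.1, p.2.1), p.2.2) = f (p.1, f (p.2.1, p.2.2)) := by
  obtain ⟨K, Φ, hx, hΦ⟩ := S.exists_unit_chart (S.s h₀)
  set k₀ := S.u (S.s h₀) with hk₀
  set l := 𝓝[S.pairs] (g₀, h₀) with hl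
  have hfst : Filter.Tendsto (fun z : G × G => z.1) l (𝓝 g₀) :=
    (continuous_fst.tendsto (g₀, h₀)).mono_left nhdsWithin_le_nhds
  have hsnd : Filter.Tendsto (fun z : G × G => z.2) l (𝓝 h₀) :=
    (continuous_snd.tendsto (g₀, h₀)).mono_left nhdsWithin_le_nhds
  have hξ : Filter.Tendsto (fun z : G × G => S.s z.2) l (𝓝 (S.s h₀)) :=
    (S.smooth_s.continuous.tendsto h₀).comp hsnd
  -- The filter of composable triples tending to `(g₀, h₀, k₀)`. It is kept as a product with `k`
  -- separate because `(g, h)` serves as the parameter and `k` as the fibre variable of the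
  -- continuation.
  let l' := (l ×ˢ 𝓝 k₀) ⊓ Filter.principal {q : (G × G) × G | S.t q.2 = S.s q.1.2}
  have hl' : l' ≤ l ×ˢ 𝓝 k₀ := inf_le_left
  have hl₁ : Filter.Tendsto (fun q : (G × G) × G => q.1) l' l := Filter.tendsto_fst.mono_left hl'
  have hl₂ : Filter.Tendsto (fun q : (G × G) × G => q.2) l' (𝓝 k₀) :=
    Filter.tendsto_snd.mono_left hl'
  have hcomp : ∀ᶠ q in l', S.t q.2 = S.s q.1.2 :=
    Filter.eventually_of_mem (Filter.mem_inf_of_right (Filter.mem_principal_self _)) fun q hq => hq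
  have hpairs : ∀ᶠ q in l', q.1 ∈ S.pairs := hl₁.eventually self_mem_nhdsWithin
  have hAll : ∀ᶠ q : (G × G) × G in l', S.IsMulAt f q.1 ∧ 𝒞.Adm f q.1 ∧ 𝒞.Adm f (q.1.2, q.2) ∧
      𝒞.Adm f (f q.1, q.2) ∧ 𝒞.Adm f (q.1.1, f (q.1.2, q.2)) ∧ 𝒞.T (q.1.1, q.1.2, q.2) := by
    have t₁ : Filter.Tendsto (fun q : (G × G) × G => (q.1.2, q.2)) l' (𝓝[S.pairs] (h₀, k₀)) :=
      tendsto_nhdsWithin_iff.2 ⟨(hsnd.comp hl₁).prodMk_nhds hl₂, hcomp.mono fun q hq => hq.symm⟩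
    have a₂ : 𝒞.Adm f (h₀, k₀) := hf.adm_right h₀
    have hmul : ∀ᶠ q : (G × G) × G in l', S.IsMulAt f q.1 :=
      hl₁.eventually (h₀f.mono fun q hq => hq.1)
    have hp₀ : S.s (f (g₀, h₀)) = S.s h₀ := (h₀f.isMulAt hgh).s_eq
    have a₃ : 𝒞.Adm f (f (g₀, h₀), k₀) := by
      have := hf.adm_right (f (g₀, h₀)); rwa [hp₀] at this
    have t₃ : Filter.Tendsto (fun q : (G × G) × G => (f q.1, q.2)) l'
        (𝓝[S.pairs] (f (g₀, h₀), k₀)) :=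
      tendsto_nhdsWithin_iff.2 ⟨((h₀f.tendsto hgh).comp hl₁).prodMk_nhds hl₂, by
        filter_upwards [hcomp, hmul] with q hq hq'
        exact hq'.s_eq.trans hq.symm⟩
    have e₄ : f (h₀, k₀) = h₀ := hf.mul_unit h₀
    have a₄ : 𝒞.Adm f (g₀, f (h₀, k₀)) := by rwa [e₄]
    have hmul' : ∀ᶠ q : (G × G) × G in l', S.IsMulAt f (q.1.2, q.2) :=
      t₁.eventually (a₂.mono fun q hq => hq.1)
    have t₄ : Filter.Tendsto (fun q : (G × G) × G => (q.1.1, f (q.1.2, q.2))) l'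
        (𝓝[S.pairs] (g₀, f (h₀, k₀))) :=
      tendsto_nhdsWithin_iff.2 ⟨(hfst.comp hl₁).prodMk_nhds
        ((a₂.tendsto (S.right_unit_mem_pairs h₀)).comp t₁), by
        filter_upwards [hpairs, hmul'] with q hq hq'
        exact Eq.trans hq hq'.t_eq.symm⟩
    have t₅ : Filter.Tendsto (fun q : (G × G) × G => (q.1.1, q.1.2, q.2)) l' (𝓝 (g₀, h₀, k₀)) :=
      (hfst.comp hl₁).prodMk_nhds ((hsnd.comp hl₁).prodMk_nhds hl₂)
    filter_upwards [hmul, hl₁.eventually h₀f.eventually, t₁.eventually a₂.eventually,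
      t₃.eventually a₃.eventually, t₄.eventually a₄.eventually, t₅.eventually hT]
      with q h1 h2 h3 h4 h5 h6
    exact ⟨h1, h2, h3, h4, h5, h6⟩
  -- For fixed `(g, h)`, both bracketings are maps from the target fibre over `s h` to that over `t
  -- g`. At `k = u (s h)` both equal `f (g, h)`, because units are right units; `assoc_left`
  -- propagates the equality.
  have h1 := Φ.eventually_eq (τ := S.t) hΦ hx S.t2_t hξ (y := fun z => S.t z.1)
    (f₁ := fun z k => f (f z, k)) (f₂ := fun z k => f (z.1, f (z.2, k))) ?_ ?_
  · refine (eventually_nhdsWithin_iff.1 ((S.tendsto_triple g₀ h₀ k₀).eventually h1)).mono ?_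
    exact fun p hp h2 h3 => hp h2 h3.symm
  · have h2 := Filter.eventually_inf_principal.1 (hpairs.and hAll)
    filter_upwards [h2] with q hq hq'
    obtain ⟨hp, m₁, a₁, a₂, a₃, a₄, hT⟩ := hq hq'
    have hp' : S.s q.1.2 = S.t q.2 := hq'.symm
    have p₃ : S.s (f q.1) = S.t q.2 := m₁.s_eq.trans hp'
    have p₄ : S.s q.1.1 = S.t (f (q.1.2, q.2)) := Eq.trans hp (a₂.isMulAt hp').t_eq.symm
    refine ⟨(a₃.isMulAt p₃).t_eq.trans m₁.t_eq, (a₄.isMulAt p₄).t_eq, ?_, ?_, fun h => ?_⟩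
    · have := (a₃.tendsto p₃).comp S.tendsto_prodMk_left
      rwa [m₁.s_eq] at this
    · have c₁ := (a₂.tendsto hp').comp S.tendsto_prodMk_left
      refine (a₄.tendsto p₄).comp (tendsto_nhdsWithin_iff.2
        ⟨tendsto_const_nhds.prodMk_nhds c₁, ?_⟩)
      filter_upwards [S.tendsto_prodMk_left.eventually a₂, self_mem_nhdsWithin] with k hk hk'
      exact Eq.trans hp (hk.1.t_eq).symm
    · exact 𝒞.assoc_left hT hp hp' a₁ a₂ a₃ a₄ h
  · filter_upwards [h₀f] with z hz
    show f (f z, S.u (S.s z.2)) = f (z.1, f (z.2, S.u (S.s z.2)))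
    rw [hf.mul_unit, ← hz.1.s_eq, hf.mul_unit]

omit [T2Space M] [ParacompactSpace M] in
/-- A local multiplication defines a local Lie groupoid without inversion. -/
theorem IsLocalMul.exists_preGroupoid {f : G × G → G} (hf : 𝒞.IsLocalMul f) :
    ∃ Γ : PreGroupoid S, Γ.mul = f ∧ ∀ p ∈ Γ.U, 𝒞.Adm f p := by
  let O : Set (G × G) := {p | ∀ᶠ q in 𝓝 p, q ∈ S.pairs → S.IsMulAt f q ∧ 𝒞.P f q}
  have hO : ∀ p, p ∈ O ↔ 𝒞.Adm f p := fun p => eventually_nhdsWithin_iff.symm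
  refine ⟨{
    U := O ∩ S.pairs
    mul := f
    isOpen_U := ⟨O, isOpen_setOfPred_eventually_nhds, rfl⟩
    right_unit_mem := fun g => ⟨(hO _).2 (hf.adm_right g), S.right_unit_mem_pairs g⟩
    left_unit_mem := fun g => ⟨(hO _).2 (hf.adm_left g), S.left_unit_mem_pairs g⟩
    isMulAt := fun p hp => ((hO p).1 hp.1).isMulAt hp.2
    submersion := fun p hp => 𝒞.submersion hp.2 ((hO p).1 hp.1)
    mul_unit := hf.mul_unit
    unit_mul := hf.unit_mul
    assoc := Filter.eventually_iSup.2 fun g => Filter.eventually_sup.2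
      ⟨Filter.eventually_sup.2 ⟨?_, ?_⟩, ?_⟩ }, rfl, fun p hp => (hO p).1 hp.1⟩
  -- For `(unit, unit, g)` the variable entry is on the wrong side; reversing the order of the
  -- triple reduces it to the opposite structure.
  · have h := hf.op.assoc_right (g₀ := g) (h₀ := S.u (S.t g)) (S.s_u _).symm
      (𝒞.adm_op (hf.adm_left g)) (by
        have := (𝒞.op.T_near g).2.2
        simpa only [ArrowSpace.op_s, ArrowSpace.op_u, S.t_u] using this)
    have hc : Continuous fun p : G × G × G => (p.2.2, p.2.1, p.1) := by fun_prop
    simp only [ArrowSpace.op_s, ArrowSpace.op_u, S.t_u] at h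
    exact ((hc.tendsto (S.u (S.t g), S.u (S.t g), g)).eventually h).mono
      fun p hp h1 h2 => (hp h2.symm h1.symm).symm
  · exact hf.assoc_right (S.s_u _) (hf.adm_left g) (𝒞.T_near g).2.1
  · have := hf.assoc_right (g₀ := g) (h₀ := S.u (S.s g)) (S.t_u _).symm (hf.adm_right g)
    rw [S.s_u] at this
    exact this (𝒞.T_near g).2.2

end MulGerm

end LocalMultiplications


/-! ### Inverses near units and completion to a local Lie groupoid -/

section Completion

variable {E F : Type*} [NormedAddCommGroup E] [NormedSpace ℝ E]
  [NormedAddCommGroup F] [NormedSpace ℝ F]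
  {M : Type*} [TopologicalSpace M] [ChartedSpace F M]
  {G : Type*} [TopologicalSpace G] [ChartedSpace E G] {S : ArrowSpace E F M G}

namespace PreGroupoid

variable (Γ : PreGroupoid S)

theorem pairs_of_mem {p : G × G} (hp : p ∈ Γ.U) : p ∈ S.pairs := by
  obtain ⟨O, -, h⟩ := Γ.isOpen_U
  exact (h ▸ hp : p ∈ O ∩ S.pairs).2

theorem eventually_mem {p : G × G} (hp : p ∈ Γ.U) : ∀ᶠ q in 𝓝[S.pairs] p, q ∈ Γ.U := by
  obtain ⟨O, hO, h⟩ := Γ.isOpen_U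
  rw [h] at hp ⊢
  exact Filter.inter_mem (nhdsWithin_le_nhds (hO.mem_nhds hp.1)) self_mem_nhdsWithin

theorem tendsto_mul {p : G × G} (hp : p ∈ Γ.U) :
    Filter.Tendsto Γ.mul (𝓝[S.pairs] p) (𝓝 (Γ.mul p)) :=
  (Γ.isMulAt p hp).smooth.continuousWithinAt

theorem unit_mem (x : M) : (S.u x, S.u x) ∈ Γ.U := by
  simpa only [S.s_u] using Γ.right_unit_mem (S.u x)

theorem unit_mul_unit (x : M) : Γ.mul (S.u x, S.u x) = S.u x := by
  simpa only [S.s_u] using Γ.mul_unit (S.u x)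

theorem assoc_unit (x : M) : ∀ᶠ p : G × G × G in 𝓝 (S.u x, S.u x, S.u x),
    S.s p.1 = S.t p.2.1 → S.s p.2.1 = S.t p.2.2 →
      Γ.mul (Γ.mul (p.1, p.2.1), p.2.2) = Γ.mul (p.1, Γ.mul (p.2.1, p.2.2)) := by
  have := (Filter.eventually_sup.1 (Filter.eventually_iSup.1 Γ.assoc (S.u x))).2
  rwa [S.s_u] at this

/-- Left and right inverses close to units agree. -/
theorem eventually_eq_of_inverses {x : M} {X : Type*} {l : Filter X} {a g b : X → G}
    (ha : Filter.Tendsto a l (𝓝 (S.u x))) (hg : Filter.Tendsto g l (𝓝 (S.u x)))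
    (hb : Filter.Tendsto b l (𝓝 (S.u x)))
    (hag : ∀ᶠ z in l, S.s (a z) = S.t (g z) ∧ S.t (a z) = S.s (g z) ∧
      Γ.mul (a z, g z) = S.u (S.s (g z)))
    (hgb : ∀ᶠ z in l, S.s (g z) = S.t (b z) ∧ Γ.mul (g z, b z) = S.u (S.t (g z))) :
    ∀ᶠ z in l, a z = b z := by
  filter_upwards [(ha.prodMk_nhds (hg.prodMk_nhds hb)).eventually (Γ.assoc_unit x), hag, hgb]
    with z h1 h2 h3
  have h4 := h1 h2.1 h3.1
  simp only [h2.2.2, h3.2] at h4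
  rw [h3.1, Γ.unit_mul, ← h2.1, Γ.mul_unit] at h4
  exact h4.symm

variable (S) in
/-- `r` is a right inversion for `mul` near the unit `u x`. -/
structure _root_.LocalLie.ArrowSpace.IsRightInversion (mul : G × G → G) (r : G → G) (x : M) :
    Prop where
  map_unit : r (S.u x) = S.u x
  smooth : ∀ᶠ g in 𝓝 (S.u x), ContMDiffAt 𝓘(ℝ, E) 𝓘(ℝ, E) ∞ r g
  t_eq : ∀ᶠ g in 𝓝 (S.u x), S.t (r g) = S.s g
  s_eq : ∀ᶠ g in 𝓝 (S.u x), S.s (r g) = S.t g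
  mul_eq : ∀ᶠ g in 𝓝 (S.u x), mul (g, r g) = S.u (S.t g)

variable {Γ}

theorem _root_.LocalLie.ArrowSpace.IsRightInversion.tendsto {mul : G × G → G} {r : G → G} {x : M}
    (h : S.IsRightInversion mul r x) : Filter.Tendsto r (𝓝 (S.u x)) (𝓝 (S.u x)) := by
  have := h.smooth.self_of_nhds.continuousAt.tendsto
  rwa [h.map_unit] at this

/-- With respect to `r g`, the element `g` is a left inverse and `r (r g)` is a right inverse; close
to units the two coincide. -/
theorem inv_inv_eventually {r : G → G} {x : M} (h : S.IsRightInversion Γ.mul r x) :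
    ∀ᶠ g in 𝓝 (S.u x), r (r g) = g := by
  have hr := h.tendsto
  refine (Γ.eventually_eq_of_inverses (a := id) (g := r) (b := fun g => r (r g))
    Filter.tendsto_id hr (hr.comp hr) ?_ ?_).mono fun g => Eq.symm
  · filter_upwards [h.t_eq, h.s_eq, h.mul_eq] with g h1 h2 h3
    exact ⟨h1.symm, h2.symm, by rw [h2]; exact h3⟩
  · filter_upwards [hr.eventually h.t_eq, hr.eventually h.mul_eq] with g h1 h3
    exact ⟨h1.symm, h3⟩

theorem inv_mul_eventually {r : G → G} {x : M} (h : S.IsRightInversion Γ.mul r x) :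
    ∀ᶠ g in 𝓝 (S.u x), Γ.mul (r g, g) = S.u (S.s g) := by
  filter_upwards [inv_inv_eventually h, h.tendsto.eventually h.mul_eq, h.t_eq] with g h1 h2 h3
  rw [h1, h3] at h2
  exact h2

/-- Near units a right inversion is also a left inversion, so `r g` is a left inverse and `r' g` a
right inverse of the same `g`. -/
theorem right_inversion_unique {r r' : G → G} {x : M} (h : S.IsRightInversion Γ.mul r x)
    (h' : S.IsRightInversion Γ.mul r' x) : r =ᶠ[𝓝 (S.u x)] r' := by
  refine Γ.eventually_eq_of_inverses h.tendsto Filter.tendsto_id h'.tendsto ?_ ?_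
  · filter_upwards [h.t_eq, h.s_eq, inv_mul_eventually h] with g h1 h2 h3
    exact ⟨h2, h1, h3⟩
  · filter_upwards [h'.t_eq, h'.mul_eq] with g h1 h2
    exact ⟨h1.symm, h2⟩

/-- Associativity holds, with all products defined, near triples for which this makes sense. -/
theorem eventually_mem_triple {g h k : G} (h₁ : (g, h) ∈ Γ.U) (h₂ : (h, k) ∈ Γ.U)
    (h₃ : (Γ.mul (g, h), k) ∈ Γ.U) (h₄ : (g, Γ.mul (h, k)) ∈ Γ.U) :
    ∀ᶠ p : G × G × G in 𝓝 (g, h, k), S.s p.1 = S.t p.2.1 → S.s p.2.1 = S.t p.2.2 →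
      (p.1, p.2.1) ∈ Γ.U ∧ (p.2.1, p.2.2) ∈ Γ.U ∧ (Γ.mul (p.1, p.2.1), p.2.2) ∈ Γ.U ∧
      (p.1, Γ.mul (p.2.1, p.2.2)) ∈ Γ.U := by
  have key : ∀ᶠ p in 𝓝[{p : G × G × G | S.s p.1 = S.t p.2.1 ∧ S.s p.2.1 = S.t p.2.2}] (g, h, k),
      (p.1, p.2.1) ∈ Γ.U ∧ (p.2.1, p.2.2) ∈ Γ.U ∧ (Γ.mul (p.1, p.2.1), p.2.2) ∈ Γ.U ∧
      (p.1, Γ.mul (p.2.1, p.2.2)) ∈ Γ.U := by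
    set l := 𝓝[{p : G × G × G | S.s p.1 = S.t p.2.1 ∧ S.s p.2.1 = S.t p.2.2}] (g, h, k)
    have hs : ∀ᶠ p in l, S.s p.1 = S.t p.2.1 ∧ S.s p.2.1 = S.t p.2.2 :=
      Filter.eventually_of_mem self_mem_nhdsWithin fun p hp => hp
    have c₁ : Filter.Tendsto (fun p : G × G × G => p.1) l (𝓝 g) :=
      (continuous_fst.tendsto (g, h, k)).mono_left nhdsWithin_le_nhds
    have c₂ : Filter.Tendsto (fun p : G × G × G => p.2.1) l (𝓝 h) :=
      ((continuous_fst.comp continuous_snd).tendsto (g, h, k)).mono_left nhdsWithin_le_nhds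
    have c₃ : Filter.Tendsto (fun p : G × G × G => p.2.2) l (𝓝 k) :=
      ((continuous_snd.comp continuous_snd).tendsto (g, h, k)).mono_left nhdsWithin_le_nhds
    have t₁ : Filter.Tendsto (fun p : G × G × G => (p.1, p.2.1)) l (𝓝[S.pairs] (g, h)) :=
      tendsto_nhdsWithin_iff.2 ⟨c₁.prodMk_nhds c₂, hs.mono fun p hp => hp.1⟩
    have t₂ : Filter.Tendsto (fun p : G × G × G => (p.2.1, p.2.2)) l (𝓝[S.pairs] (h, k)) :=
      tendsto_nhdsWithin_iff.2 ⟨c₂.prodMk_nhds c₃, hs.mono fun p hp => hp.2⟩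
    have e₁ := t₁.eventually (Γ.eventually_mem h₁)
    have e₂ := t₂.eventually (Γ.eventually_mem h₂)
    have t₃ : Filter.Tendsto (fun p : G × G × G => (Γ.mul (p.1, p.2.1), p.2.2)) l
        (𝓝[S.pairs] (Γ.mul (g, h), k)) :=
      tendsto_nhdsWithin_iff.2 ⟨((Γ.tendsto_mul h₁).comp t₁).prodMk_nhds c₃, by
        filter_upwards [hs, e₁] with p hp hp'
        exact (Γ.isMulAt _ hp').s_eq.trans hp.2⟩
    have t₄ : Filter.Tendsto (fun p : G × G × G => (p.1, Γ.mul (p.2.1, p.2.2))) l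
        (𝓝[S.pairs] (g, Γ.mul (h, k))) :=
      tendsto_nhdsWithin_iff.2 ⟨c₁.prodMk_nhds ((Γ.tendsto_mul h₂).comp t₂), by
        filter_upwards [hs, e₂] with p hp hp'
        exact hp.1.trans (Γ.isMulAt _ hp').t_eq.symm⟩
    filter_upwards [e₁, e₂, t₃.eventually (Γ.eventually_mem h₃),
      t₄.eventually (Γ.eventually_mem h₄)] with p h1 h2 h3 h4
    exact ⟨h1, h2, h3, h4⟩
  exact (eventually_nhdsWithin_iff.1 key).mono fun p hp h1 h2 => hp ⟨h1, h2⟩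

variable [T2Space M] [ParacompactSpace M]

/-- A local Lie groupoid without inversion and a germ of an inversion define a local Lie
groupoid. -/
theorem exists_localLieGroupoid (Γ : PreGroupoid S) {r : G → G}
    (hr : ∀ x, S.IsRightInversion Γ.mul r x) {Q : G → Prop} (hQ : ∀ x, ∀ᶠ g in 𝓝 (S.u x), Q g) :
    ∃ L : LocalLieGroupoid S, L.U = Γ.U ∧ L.mul = Γ.mul ∧ L.inv = r ∧ ∀ g ∈ L.V, Q g := by
  obtain ⟨O, hO, hUO⟩ := Γ.isOpen_U
  obtain ⟨V₀, hV₀, huV₀, hVU⟩ := exists_tube (Q := fun p => p ∈ O) S.smooth_s.continuous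
    S.smooth_t.continuous S.smooth_u.continuous S.s_u S.t_u fun x => hO.mem_nhds (by
      have := Γ.unit_mem x; rw [hUO] at this; exact this.1)
  let A : Set G := {g | ContMDiffAt 𝓘(ℝ, E) 𝓘(ℝ, E) ∞ r g ∧ S.t (r g) = S.s g ∧
    S.s (r g) = S.t g ∧ Γ.mul (g, r g) = S.u (S.t g) ∧ Γ.mul (r g, g) = S.u (S.s g) ∧
    r (r g) = g ∧ Q g}
  let V₁ : Set G := V₀ ∩ interior A
  have hV₁ : IsOpen V₁ := hV₀.inter isOpen_interior
  have huV₁ : ∀ x, S.u x ∈ V₁ := fun x => ⟨huV₀ x, mem_interior_iff_mem_nhds.2 (by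
    filter_upwards [(hr x).smooth, (hr x).t_eq, (hr x).s_eq, (hr x).mul_eq,
      inv_mul_eventually (hr x), inv_inv_eventually (hr x), hQ x] with g h1 h2 h3 h4 h5 h6 h7
    exact ⟨h1, h2, h3, h4, h5, h6, h7⟩)⟩
  have hA : ∀ g ∈ V₁, g ∈ A := fun g hg => interior_subset hg.2
  have hrs : ContMDiffOn 𝓘(ℝ, E) 𝓘(ℝ, E) ∞ r V₁ := fun g hg =>
    (hA g hg).1.contMDiffWithinAt
  have hUp : Γ.U ⊆ S.pairs := fun p hp => Γ.pairs_of_mem hp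
  have htriple : ∀ g, (∀ᶠ p : G × G × G in 𝓝 (S.u (S.t g), S.u (S.t g), g) ⊔
      𝓝 (S.u (S.t g), g, S.u (S.s g)) ⊔ 𝓝 (g, S.u (S.s g), S.u (S.s g)),
      S.s p.1 = S.t p.2.1 → S.s p.2.1 = S.t p.2.2 →
      (p.1, p.2.1) ∈ Γ.U ∧ (p.2.1, p.2.2) ∈ Γ.U ∧ (Γ.mul (p.1, p.2.1), p.2.2) ∈ Γ.U ∧
      (p.1, Γ.mul (p.2.1, p.2.2)) ∈ Γ.U) := fun g => by
    have h1 := Γ.right_unit_mem g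
    have h2 := Γ.left_unit_mem g
    refine Filter.eventually_sup.2 ⟨Filter.eventually_sup.2 ⟨?_, ?_⟩, ?_⟩
    · exact eventually_mem_triple (Γ.unit_mem _) h2 (by rwa [Γ.unit_mul_unit])
        (by rwa [Γ.unit_mul])
    · exact eventually_mem_triple h2 h1 (by rwa [Γ.unit_mul]) (by rwa [Γ.mul_unit])
    · exact eventually_mem_triple h1 (Γ.unit_mem _) (by rwa [Γ.mul_unit])
        (by rwa [Γ.unit_mul_unit])
  refine ⟨{
    U := Γ.U
    mul := Γ.mul
    -- On `V₁` the map `r` is an involution, so this intersection is stable under `r`.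
    V := V₁ ∩ r ⁻¹' V₁
    inv := r
    isOpen_U := Γ.isOpen_U
    right_unit_mem := Γ.right_unit_mem
    left_unit_mem := Γ.left_unit_mem
    smooth_mul := fun p hp => (Γ.isMulAt p hp).smooth.mono hUp
    submersion_mul := fun p hp => by
      obtain ⟨D, hD, h⟩ := Γ.submersion p hp
      exact ⟨D, hD.mono hUp, h⟩
    isOpen_V := hrs.continuousOn.isOpen_inter_preimage hV₁ hV₁
    unit_mem_V := fun x => ⟨huV₁ x, by rw [mem_preimage, (hr x).map_unit]; exact huV₁ x⟩
    inv_mem := fun g hg => ⟨hg.2, by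
      rw [mem_preimage, (hA g hg.1).2.2.2.2.2.1]; exact hg.1⟩
    smooth_inv := hrs.mono inter_subset_left
    V_pairs := fun g hg h hh hgh => hUO ▸ ⟨hVU g hg.1.1 h hh.1.1 hgh, hgh⟩
    s_mul := fun p hp => (Γ.isMulAt p hp).s_eq
    t_mul := fun p hp => (Γ.isMulAt p hp).t_eq
    assoc := ⟨interior {p | S.s p.1 = S.t p.2.1 → S.s p.2.1 = S.t p.2.2 →
      ((p.1, p.2.1) ∈ Γ.U ∧ (p.2.1, p.2.2) ∈ Γ.U ∧ (Γ.mul (p.1, p.2.1), p.2.2) ∈ Γ.U ∧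
      (p.1, Γ.mul (p.2.1, p.2.2)) ∈ Γ.U) ∧
      Γ.mul (Γ.mul (p.1, p.2.1), p.2.2) = Γ.mul (p.1, Γ.mul (p.2.1, p.2.2))}, isOpen_interior,
      fun g => by
        have h1 := (htriple g).and (Filter.eventually_iSup.1 Γ.assoc g)
        have h2 := h1.mono fun p hp h h' => And.intro (hp.1 h h') (hp.2 h h')
        simp only [mem_interior_iff_mem_nhds]
        have h3 := Filter.eventually_sup.1 h2
        exact ⟨(Filter.eventually_sup.1 h3.1).1, (Filter.eventually_sup.1 h3.1).2, h3.2⟩,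
      fun g h k hp h1 h2 => by
        obtain ⟨⟨a1, a2, a3, a4⟩, a5⟩ := interior_subset hp h1 h2
        exact ⟨a1, a2, a3, a4, a5⟩⟩
    mul_unit := Γ.mul_unit
    unit_mul := Γ.unit_mul
    s_inv := fun g hg => (hA g hg.1).2.2.1
    t_inv := fun g hg => (hA g hg.1).2.1
    inv_mul := fun g hg => (hA g hg.1).2.2.2.2.1
    mul_inv := fun g hg => (hA g hg.1).2.2.2.1 }, rfl, rfl, rfl, fun g hg =>
      (hA g hg.1).2.2.2.2.2.2⟩

end PreGroupoid

namespace LocalLieGroupoid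

variable (L : LocalLieGroupoid S)

/-- The local Lie groupoid `L`, forgetting the inversion. -/
def toPreGroupoid : PreGroupoid S where
  U := L.U
  mul := L.mul
  isOpen_U := L.isOpen_U
  right_unit_mem := L.right_unit_mem
  left_unit_mem := L.left_unit_mem
  isMulAt p hp := by
    obtain ⟨O, hO, h⟩ := L.isOpen_U
    have hp' : p ∈ O := (h ▸ hp : p ∈ O ∩ S.pairs).1
    refine ⟨?_, L.s_mul p hp, L.t_mul p hp⟩
    have h1 := L.smooth_mul p hp
    rw [h, inter_comm] at h1
    exact (contMDiffWithinAt_inter (hO.mem_nhds hp')).1 h1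
  submersion p hp := by
    obtain ⟨O, hO, h⟩ := L.isOpen_U
    have hp' : p ∈ O := (h ▸ hp : p ∈ O ∩ S.pairs).1
    obtain ⟨D, hD, hz⟩ := L.submersion_mul p hp
    refine ⟨D, ?_, hz⟩
    rw [h, inter_comm] at hD
    exact (hasMFDerivWithinAt_inter (hO.mem_nhds hp')).1 hD
  mul_unit := L.mul_unit
  unit_mul := L.unit_mul
  assoc := by
    obtain ⟨O, hO, hu, h⟩ := L.assoc
    refine Filter.eventually_iSup.2 fun g => ?_
    have h1 : ∀ p ∈ O, S.s p.1 = S.t p.2.1 → S.s p.2.1 = S.t p.2.2 →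
        L.mul (L.mul (p.1, p.2.1), p.2.2) = L.mul (p.1, L.mul (p.2.1, p.2.2)) :=
      fun p hp h1 h2 => (h p.1 p.2.1 p.2.2 hp h1 h2).2.2.2.2
    exact Filter.eventually_sup.2 ⟨Filter.eventually_sup.2
      ⟨Filter.eventually_of_mem (hO.mem_nhds (hu g).1) h1,
        Filter.eventually_of_mem (hO.mem_nhds (hu g).2.1) h1⟩,
        Filter.eventually_of_mem (hO.mem_nhds (hu g).2.2) h1⟩

@[simp] theorem toPreGroupoid_mul : L.toPreGroupoid.mul = L.mul := rfl

theorem inv_unit (x : M) : L.inv (S.u x) = S.u x := by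
  have h1 := L.mul_inv _ (L.unit_mem_V x)
  have h2 := L.unit_mul (L.inv (S.u x))
  rw [L.t_inv _ (L.unit_mem_V x), S.s_u] at h2
  rw [h2, S.t_u] at h1
  exact h1

theorem isRightInversion (x : M) : S.IsRightInversion L.mul L.inv x where
  map_unit := L.inv_unit x
  smooth := Filter.eventually_of_mem (L.isOpen_V.mem_nhds (L.unit_mem_V x)) fun g hg =>
    L.smooth_inv.contMDiffAt (L.isOpen_V.mem_nhds hg)
  t_eq := Filter.eventually_of_mem (L.isOpen_V.mem_nhds (L.unit_mem_V x)) L.t_inv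
  s_eq := Filter.eventually_of_mem (L.isOpen_V.mem_nhds (L.unit_mem_V x)) L.s_inv
  mul_eq := Filter.eventually_of_mem (L.isOpen_V.mem_nhds (L.unit_mem_V x)) L.mul_inv

end LocalLieGroupoid

end Completion


/-! ### Construction of the inversion -/

section Inversion

variable {E F : Type*} [NormedAddCommGroup E] [NormedSpace ℝ E]
  [NormedAddCommGroup F] [NormedSpace ℝ F]
  {M : Type*} [TopologicalSpace M] [ChartedSpace F M]
  {G : Type*} [TopologicalSpace G] [ChartedSpace E G] {S : ArrowSpace E F M G}
  [FiniteDimensional ℝ E] [FiniteDimensional ℝ F] [IsManifold 𝓘(ℝ, F) ∞ M]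
  [IsManifold 𝓘(ℝ, E) ∞ G]

namespace PreGroupoid

variable (Γ : PreGroupoid S)

/-- An inverse of `g` is sought in the target fibre over `s g`, with fibre coordinate `a`. The
equation is `Θ (g, a) = 0`, where `Θ` is the fibre coordinate of the product. Left multiplication by
a unit is the identity, so `Θ (u x₀, a) = a` and `(g, a) ↦ (g, Θ (g, a))` is invertible near `(u x₀,
0)`. A product with target `t g` and fibre coordinate `0` is the unit at `t g`. -/
theorem exists_local_inversion (x₀ : M) : ∃ (A : Set M) (r : G → G), IsOpen A ∧ x₀ ∈ A ∧
    ∀ x ∈ A, S.IsRightInversion Γ.mul r x := by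
  obtain ⟨K, Φ, hx, hΦ⟩ := S.exists_unit_chart x₀
  obtain ⟨O, hO, hUO⟩ := Γ.isOpen_U
  let B : Set (G × K) := (S.s ⁻¹' Φ.W) ×ˢ Metric.ball 0 Φ.r
  have hB : IsOpen B := (Φ.isOpen_W.preimage S.smooth_s.continuous).prod Metric.isOpen_ball
  let ι : G × K → G × G := fun q => (q.1, Φ.e.symm (S.s q.1, q.2))
  have htgt : ∀ q ∈ B, (S.s q.1, q.2) ∈ Φ.e.target := fun q hq => by
    rw [Φ.target_eq]; exact hq
  have hιp : ∀ q ∈ B, ι q ∈ S.pairs := fun q hq => by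
    show S.s q.1 = S.t _
    rw [← Φ.fst_eq _ (Φ.e.map_target (htgt q hq)), Φ.e.right_inv (htgt q hq)]
  have hsk : ContMDiff (𝓘(ℝ, E).prod 𝓘(ℝ, K)) (𝓘(ℝ, F).prod 𝓘(ℝ, K)) ∞
      (fun q : G × K => (S.s q.1, q.2)) := (S.smooth_s.comp contMDiff_fst).prodMk contMDiff_snd
  have hι : ContMDiffOn (𝓘(ℝ, E).prod 𝓘(ℝ, K)) (𝓘(ℝ, E).prod 𝓘(ℝ, E)) ∞ ι B :=
    contMDiff_fst.contMDiffOn.prodMk (Φ.smooth_symm.comp hsk.contMDiffOn htgt)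
  let B₁ : Set (G × K) := B ∩ ι ⁻¹' O
  have hB₁ : IsOpen B₁ := hι.continuousOn.isOpen_inter_preimage hB hO
  have hιU : ∀ q ∈ B₁, ι q ∈ Γ.U := fun q hq => hUO ▸ ⟨hq.2, hιp q hq.1⟩
  let m : G × K → G := fun q => Γ.mul (ι q)
  have hm : ContMDiffOn (𝓘(ℝ, E).prod 𝓘(ℝ, K)) 𝓘(ℝ, E) ∞ m B₁ := fun q hq =>
    ((Γ.isMulAt _ (hιU q hq)).smooth).comp q (hι.mono inter_subset_left q hq)
      fun q' hq' => hιp q' hq'.1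
  let D : Set (G × K) := B₁ ∩ m ⁻¹' Φ.e.source
  have hD : IsOpen D := hm.continuousOn.isOpen_inter_preimage hB₁ Φ.e.open_source
  let Θ : G × K → K := fun q => (Φ.e (m q)).2
  have hΘ : ContMDiffOn (𝓘(ℝ, E).prod 𝓘(ℝ, K)) 𝓘(ℝ, K) ∞ Θ D :=
    contMDiff_snd.comp_contMDiffOn (Φ.smooth.comp (hm.mono inter_subset_left) fun q hq => hq.2)
  let Ψ : G × K → G × K := fun q => (q.1, Θ q)
  have hΨ : ContMDiffOn (𝓘(ℝ, E).prod 𝓘(ℝ, K)) (𝓘(ℝ, E).prod 𝓘(ℝ, K)) ∞ Ψ D :=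
    contMDiff_fst.contMDiffOn.prodMk hΘ
  have hsym0 : ∀ x ∈ Φ.W, Φ.e.symm (x, 0) = S.u x := fun x hx => by
    rw [← (hΦ x hx).2, Φ.e.left_inv (hΦ x hx).1]
  have hι0 : ∀ x ∈ Φ.W, ι (S.u x, 0) = (S.u x, S.u x) := fun x hx => by
    simp only [ι, S.s_u, hsym0 x hx]
  have hm0 : ∀ x ∈ Φ.W, m (S.u x, 0) = S.u x := fun x hx => by
    simp only [m, hι0 x hx, Γ.unit_mul_unit]
  have hD0 : ∀ x ∈ Φ.W, (S.u x, (0 : K)) ∈ D := fun x hx => by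
    refine ⟨⟨⟨?_, Metric.mem_ball_self Φ.r_pos⟩, ?_⟩, ?_⟩
    · rw [mem_preimage, S.s_u]; exact hx
    · rw [mem_preimage, hι0 x hx]
      have := Γ.unit_mem x
      rw [hUO] at this
      exact this.1
    · rw [mem_preimage, hm0 x hx]; exact (hΦ x hx).1
  have hΨ0 : ∀ x ∈ Φ.W, Ψ (S.u x, 0) = (S.u x, 0) := fun x hx => by
    simp only [Ψ, Θ, hm0 x hx, (hΦ x hx).2]
  set p₀ : G × K := (S.u x₀, 0) with hp₀
  have hne : (∞ : WithTop ℕ∞) ≠ 0 := by simp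
  obtain ⟨Θ', hΘ'⟩ : ∃ Θ' : E × K →L[ℝ] K,
      HasMFDerivAt (𝓘(ℝ, E).prod 𝓘(ℝ, K)) 𝓘(ℝ, K) Θ p₀ Θ' :=
    ⟨_, ((hΘ.contMDiffAt (hD.mem_nhds (hD0 x₀ hx))).mdifferentiableAt hne).hasMFDerivAt⟩
  have hΘβ : ∀ β, Θ' (0, β) = β := by
    have h1 : HasMFDerivAt 𝓘(ℝ, K) (𝓘(ℝ, E).prod 𝓘(ℝ, K)) (fun a : K => (S.u x₀, a)) 0
        ((0 : K →L[ℝ] E).prod (.id ℝ K)) :=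
      (hasMFDerivAt_const _ _).prodMk (hasMFDerivAt_id _)
    have h2 : HasMFDerivAt 𝓘(ℝ, K) 𝓘(ℝ, K) (fun a : K => Θ (S.u x₀, a)) 0
        (Θ' ∘L ((0 : K →L[ℝ] E).prod (.id ℝ K))) := hΘ'.comp (0 : K) h1
    have h3 : HasMFDerivAt 𝓘(ℝ, K) 𝓘(ℝ, K) (fun a : K => Θ (S.u x₀, a)) 0 (.id ℝ K) := by
      refine (hasMFDerivAt_id _).congr_of_eventuallyEq ?_
      filter_upwards [Metric.ball_mem_nhds (0 : K) Φ.r_pos] with a ha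
      have hB' : (S.u x₀, a) ∈ B := ⟨by rw [mem_preimage, S.s_u]; exact hx, ha⟩
      have h4 := htgt _ hB'
      simp only [S.s_u] at h4
      have h5 : S.t (Φ.e.symm (x₀, a)) = x₀ := by
        rw [← Φ.fst_eq _ (Φ.e.map_target h4), Φ.e.right_inv h4]
      have h6 := Γ.unit_mul (Φ.e.symm (x₀, a))
      rw [h5] at h6
      simp only [Θ, m, ι, S.s_u, h6, Φ.e.right_inv h4, id]
    intro β
    exact congrArg (fun L : K →L[ℝ] K => L β) (hasMFDerivAt_unique h2 h3)
  have hΨ' : HasMFDerivAt (𝓘(ℝ, E).prod 𝓘(ℝ, K)) (𝓘(ℝ, E).prod 𝓘(ℝ, K)) Ψ p₀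
      ((ContinuousLinearMap.fst ℝ E K).prod Θ') := (hasMFDerivAt_fst p₀).prodMk hΘ'
  have hbij : Function.Bijective (mfderiv (𝓘(ℝ, E).prod 𝓘(ℝ, K)) (𝓘(ℝ, E).prod 𝓘(ℝ, K)) Ψ p₀) := by
    rw [hΨ'.mfderiv]
    have hsplit : ∀ v : E × K, Θ' v = Θ' (v.1, 0) + v.2 := fun v => by
      conv_lhs => rw [show v = (v.1, 0) + (0, v.2) by simp]
      rw [map_add, hΘβ]
    constructor
    · refine (injective_iff_map_eq_zero ((ContinuousLinearMap.fst ℝ E K).prod Θ')).2 fun v hv => ?_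
      have h1 : v.1 = 0 := congrArg Prod.fst hv
      have h2 : Θ' v = 0 := congrArg Prod.snd hv
      rw [hsplit, h1, show ((0 : E), (0 : K)) = 0 from rfl, map_zero, zero_add] at h2
      exact Prod.ext h1 h2
    · intro w
      let w' : E × K := w
      refine ⟨((w'.1, w'.2 - Θ' (w'.1, 0)) : E × K), ?_⟩
      refine Prod.ext rfl ?_
      show Θ' (w'.1, w'.2 - Θ' (w'.1, 0)) = w'.2
      rw [hsplit]
      simp
  obtain ⟨e, hpe, heD, heΨ, -, hes⟩ :=
    exists_openPartialHomeomorph_of_bijective_mfderiv hD (hD0 x₀ hx) hΨ hbij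
  let r : G → G := fun g => Φ.e.symm (S.s g, (e.symm (g, 0)).2)
  let A : Set M := Φ.W ∩ (fun x => (S.u x, (0 : K))) ⁻¹' e.source
  have hu0 : Continuous fun x => (S.u x, (0 : K)) := S.smooth_u.continuous.prodMk continuous_const
  have hA : IsOpen A := Φ.isOpen_W.inter (e.open_source.preimage hu0)
  let T : Set G := {g | (g, (0 : K)) ∈ e.target}
  have hT : IsOpen T := e.open_target.preimage (Continuous.prodMk_left 0)
  have hspec : ∀ g ∈ T, ∃ a : K, e.symm (g, 0) = (g, a) ∧ (g, a) ∈ D ∧ Θ (g, a) = 0 := by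
    intro g hg
    have h1 := e.map_target hg
    have h2 := e.right_inv hg
    rw [heΨ _ h1] at h2
    have h3 : (e.symm (g, 0)).1 = g := congrArg Prod.fst h2
    have h4 : Θ (e.symm (g, 0)) = 0 := congrArg Prod.snd h2
    have h5 : e.symm (g, 0) = (g, (e.symm (g, 0)).2) := Prod.ext h3 rfl
    refine ⟨_, h5, ?_, ?_⟩
    · rw [← h5]; exact heD h1
    · rw [← h5]; exact h4
  have hAT : ∀ x ∈ A, S.u x ∈ T ∧ e.symm (S.u x, 0) = (S.u x, 0) := fun x hx => by
    have h1 := e.map_source hx.2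
    rw [heΨ _ hx.2, hΨ0 x hx.1] at h1
    refine ⟨h1, ?_⟩
    have h2 := e.left_inv hx.2
    rwa [heΨ _ hx.2, hΨ0 x hx.1] at h2
  have hTnhds : ∀ x ∈ A, T ∈ 𝓝 (S.u x) := fun x hx => hT.mem_nhds (hAT x hx).1
  refine ⟨A, r, hA, ⟨hx, hpe⟩, fun x hxA => ⟨?_, ?_, ?_, ?_, ?_⟩⟩
  · simp only [r, (hAT x hxA).2, S.s_u, hsym0 x hxA.1]
  · filter_upwards [hTnhds x hxA] with g hg
    have hrs : ContMDiffOn 𝓘(ℝ, E) 𝓘(ℝ, E) ∞ r T := by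
      have h1 : ContMDiffOn 𝓘(ℝ, E) (𝓘(ℝ, E).prod 𝓘(ℝ, K)) ∞ (fun g => e.symm (g, 0)) T :=
        hes.comp (contMDiff_id.prodMk contMDiff_const).contMDiffOn fun g hg => hg
      refine Φ.smooth_symm.comp (S.smooth_s.contMDiffOn.prodMk
        (contMDiff_snd.comp_contMDiffOn h1)) fun g hg => ?_
      obtain ⟨a, ha, hD, -⟩ := hspec g hg
      show (S.s g, (e.symm (g, 0)).2) ∈ Φ.e.target
      rw [ha]
      exact htgt _ hD.1.1
    exact hrs.contMDiffAt (hT.mem_nhds hg)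
  · filter_upwards [hTnhds x hxA] with g hg
    obtain ⟨a, ha, hD, -⟩ := hspec g hg
    have := hιp _ hD.1.1
    simp only [r, ha]
    exact Eq.symm this
  · filter_upwards [hTnhds x hxA, (Φ.isOpen_W.preimage S.smooth_t.continuous).mem_nhds
      (show S.t (S.u x) ∈ Φ.W by rw [S.t_u]; exact hxA.1)] with g hg hgW
    obtain ⟨a, ha, hD, hΘ0⟩ := hspec g hg
    have hmt : S.t (m (g, a)) = S.t g := (Γ.isMulAt _ (hιU _ hD.1)).t_eq
    have hms : S.s (m (g, a)) = S.s (r g) := by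
      simp only [r, ha]; exact (Γ.isMulAt _ (hιU _ hD.1)).s_eq
    -- Both sides have first coordinate `t g` and fibre coordinate `0` in the chart. The source of
    -- the inverse is then read off from the source of the product.
    have hmu : m (g, a) = S.u (S.t g) := by
      refine Φ.e.injOn hD.2 (hΦ _ hgW).1 ?_
      rw [(hΦ _ hgW).2]
      exact Prod.ext ((Φ.fst_eq _ hD.2).trans hmt) hΘ0
    rw [← hms, hmu, S.s_u]
  · filter_upwards [hTnhds x hxA, (Φ.isOpen_W.preimage S.smooth_t.continuous).mem_nhds
      (show S.t (S.u x) ∈ Φ.W by rw [S.t_u]; exact hxA.1)] with g hg hgW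
    obtain ⟨a, ha, hD, hΘ0⟩ := hspec g hg
    have hmt : S.t (m (g, a)) = S.t g := (Γ.isMulAt _ (hιU _ hD.1)).t_eq
    have hmu : m (g, a) = S.u (S.t g) := by
      refine Φ.e.injOn hD.2 (hΦ _ hgW).1 ?_
      rw [(hΦ _ hgW).2]
      exact Prod.ext ((Φ.fst_eq _ hD.2).trans hmt) hΘ0
    simp only [r, ha]
    exact hmu

variable [T2Space M] [ParacompactSpace M]

/-- Local right inversions have the same germs at units by `right_inversion_unique`, so they can be
glued over the base. -/
theorem exists_inversion : ∃ r, ∀ x, S.IsRightInversion Γ.mul r x := by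
  choose A r hA hx hr using Γ.exists_local_inversion
  obtain ⟨R, hR⟩ := exists_glued (q := S.t) (Z := range S.u) (nb := fun g => 𝓝 g)
    (fun z _ => S.smooth_t.continuous.tendsto z) hA hx (j := r) (by
      rintro _ ⟨x, rfl⟩ k l hk hl
      rw [S.t_u] at hk hl
      exact right_inversion_unique (hr k x hk) (hr l x hl))
  refine ⟨R, fun x => ?_⟩
  have h1 : R =ᶠ[𝓝 (S.u x)] r x := hR _ ⟨x, rfl⟩ x (by rw [S.t_u]; exact hx x)
  have h2 := hr x x (hx x)
  have h3 : ∀ᶠ g in 𝓝 (S.u x), R =ᶠ[𝓝 g] r x := h1.eventuallyEq_nhds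
  exact {
    map_unit := by rw [h1.self_of_nhds, h2.map_unit]
    smooth := by
      filter_upwards [h3, h2.smooth] with g hg hg'
      exact hg'.congr_of_eventuallyEq hg
    t_eq := by filter_upwards [h1, h2.t_eq] with g hg hg'; rwa [hg]
    s_eq := by filter_upwards [h1, h2.s_eq] with g hg hg'; rwa [hg]
    mul_eq := by filter_upwards [h1, h2.mul_eq] with g hg hg'; rwa [hg] }

end PreGroupoid

end Inversion


/-! ### Generalized coverings are local diffeomorphisms -/

section CoveringTheory

variable {E E' F : Type*} [NormedAddCommGroup E] [NormedSpace ℝ E] [FiniteDimensional ℝ E]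
  [NormedAddCommGroup E'] [NormedSpace ℝ E'] [FiniteDimensional ℝ E']
  [NormedAddCommGroup F] [NormedSpace ℝ F] [FiniteDimensional ℝ F]
  {M G G' : Type*} [TopologicalSpace M] [ChartedSpace F M] [IsManifold 𝓘(ℝ, F) ∞ M]
  [TopologicalSpace G] [ChartedSpace E G] [IsManifold 𝓘(ℝ, E) ∞ G]
  [TopologicalSpace G'] [ChartedSpace E' G'] [IsManifold 𝓘(ℝ, E') ∞ G']
  {S' : ArrowSpace E' F M G'} {S : ArrowSpace E F M G} {φ : G' → G}

namespace IsGeneralizedCovering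

variable (h : IsGeneralizedCovering S' S φ)
include h

theorem mfderiv_s (p : G') (v : E') : (mfderiv 𝓘(ℝ, E') 𝓘(ℝ, F) S'.s p v : F) =
    mfderiv 𝓘(ℝ, E) 𝓘(ℝ, F) S.s (φ p) (mfderiv 𝓘(ℝ, E') 𝓘(ℝ, E) φ p v) := by
  have hne : (∞ : WithTop ℕ∞) ≠ 0 := by simp
  have h1 := (S.smooth_s.contMDiffAt (x := φ p)).mdifferentiableAt hne |>.hasMFDerivAt
  have h2 := (h.smooth.contMDiffAt (x := p)).mdifferentiableAt hne |>.hasMFDerivAt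
  have h3 := h1.comp p h2
  have h4 : S.s ∘ φ = S'.s := funext fun g => (h.comp_s g).symm
  rw [h4] at h3
  exact congrArg (fun L : E' →L[ℝ] F => L v) h3.mfderiv

/-- The fibrewise inverse `r` is smooth on the fibre only, so it is differentiated along curves in
fibres. A vector killed by `dφ` is tangent to the source fibre, and `r ∘ φ = id` along a curve shows
that it is zero. Conversely, after subtracting from `z` the image of a vector with the same source
projection, the rest is tangent to the fibre and is reached through `φ ∘ r = id`. Both halves are
proved, as `E` and `E'` are not assumed to have equal dimension. -/
theorem bijective_mfderiv (p : G') : Function.Bijective (mfderiv 𝓘(ℝ, E') 𝓘(ℝ, E) φ p) := by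
  have hne : (∞ : WithTop ℕ∞) ≠ 0 := by simp
  obtain ⟨Dφ, hDφ⟩ : ∃ Dφ : E' →L[ℝ] E, Dφ = mfderiv 𝓘(ℝ, E') 𝓘(ℝ, E) φ p := ⟨_, rfl⟩
  have hφ : HasMFDerivAt 𝓘(ℝ, E') 𝓘(ℝ, E) φ p Dφ := by
    rw [hDφ]; exact ((h.smooth.contMDiffAt (x := p)).mdifferentiableAt hne).hasMFDerivAt
  have hds : ∀ v : E', (mfderiv 𝓘(ℝ, E') 𝓘(ℝ, F) S'.s p v : F) =
      mfderiv 𝓘(ℝ, E) 𝓘(ℝ, F) S.s (φ p) (Dφ v) := fun v => by rw [hDφ]; exact h.mfderiv_s p v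
  obtain ⟨W, W', r, hW, hpW, hW', hbij, hinv, -, hr⟩ := h.localDiffeo (S'.s p) p rfl
  have hφp : φ p ∈ W' ∩ S.s ⁻¹' {S'.s p} := hbij.mapsTo ⟨hpW, rfl⟩
  have hrp : r (φ p) = p := hinv ⟨hpW, rfl⟩
  obtain ⟨R, hR⟩ : ∃ R : E →L[ℝ] E', HasMFDerivWithinAt 𝓘(ℝ, E) 𝓘(ℝ, E') r
      (W' ∩ S.s ⁻¹' {S'.s p}) (φ p) R :=
    ⟨_, ((hr _ hφp).mdifferentiableWithinAt hne).hasMFDerivWithinAt⟩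
  have hφr : ∀ q ∈ W' ∩ S.s ⁻¹' {S'.s p}, φ (r q) = q := fun q hq => by
    obtain ⟨a, ha, rfl⟩ := hbij.surjOn hq
    rw [hinv ha]
  have hφu : HasMFDerivWithinAt 𝓘(ℝ, E') 𝓘(ℝ, E) φ univ p Dφ := hφ.hasMFDerivWithinAt
  rw [← hDφ]
  constructor
  · refine (injective_iff_map_eq_zero Dφ).2 fun v hv => ?_
    have hv' : mfderiv 𝓘(ℝ, E') 𝓘(ℝ, F) S'.s p v = (0 : F) := by
      rw [hds v, hv]; exact map_zero (mfderiv 𝓘(ℝ, E) 𝓘(ℝ, F) S.s (φ p))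
    obtain ⟨γ, D, hγ0, hγs, hD, hD1⟩ := exists_fibre_curve S'.smooth_s p (S'.submersion_s p) hv'
    have e1 := hasMFDerivAt_comp_curve hφu hγ0 (by simp) hD
    have hev : ∀ᶠ τ in 𝓝 (0 : ℝ), γ τ ∈ W :=
      hD.continuousAt.eventually (by rw [hγ0]; exact hW.mem_nhds hpW)
    have e2 := hasMFDerivAt_comp_curve hR (γ := fun τ => φ (γ τ)) (by rw [hγ0])
      (hev.mono fun τ hτ => hbij.mapsTo ⟨hτ, hγs τ⟩) e1
    have e3 := e2.congr_of_eventuallyEq (f₁ := γ)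
      (hev.mono fun τ hτ => (hinv ⟨hτ, hγs τ⟩).symm)
    have e4 : D 1 = R (Dφ (D 1)) :=
      congrArg (fun L : ℝ →L[ℝ] E' => L 1) (hasMFDerivAt_unique hD e3)
    rw [show D 1 = v from hD1, hv] at e4
    exact e4.trans (map_zero R)
  · intro (z : E)
    obtain ⟨(v₀ : E'), hv₀⟩ := S'.submersion_s p (mfderiv 𝓘(ℝ, E) 𝓘(ℝ, F) S.s (φ p) z : F)
    have hz : mfderiv 𝓘(ℝ, E) 𝓘(ℝ, F) S.s (φ p) (z - Dφ v₀ : E) = (0 : F) := by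
      have h1 := (hds v₀).symm.trans hv₀
      exact (map_sub (mfderiv 𝓘(ℝ, E) 𝓘(ℝ, F) S.s (φ p)) z (Dφ v₀)).trans
        (sub_eq_zero.2 h1.symm)
    obtain ⟨γ, D, hγ0, hγs, hD, hD1⟩ := exists_fibre_curve S.smooth_s (φ p) (S.submersion_s _) hz
    have hev : ∀ᶠ τ in 𝓝 (0 : ℝ), γ τ ∈ W' ∩ S.s ⁻¹' {S'.s p} := by
      have h1 : ∀ᶠ τ in 𝓝 (0 : ℝ), γ τ ∈ W' :=
        hD.continuousAt.eventually (by rw [hγ0]; exact hW'.mem_nhds hφp.1)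
      exact h1.mono fun τ hτ => ⟨hτ, (hγs τ).trans hφp.2⟩
    have e1 := hasMFDerivAt_comp_curve hR hγ0 hev hD
    have e2 := hasMFDerivAt_comp_curve hφu (γ := fun τ => r (γ τ)) (by rw [hγ0, hrp])
      (by simp) e1
    have e3 := e2.congr_of_eventuallyEq (f₁ := γ) (hev.mono fun τ hτ => (hφr _ hτ).symm)
    have e4 : D 1 = Dφ (R (D 1)) :=
      congrArg (fun L : ℝ →L[ℝ] E => L 1) (hasMFDerivAt_unique hD e3)
    refine ⟨v₀ + R (D 1), ?_⟩
    have e5 : z - Dφ v₀ = Dφ (R (D 1)) := Eq.trans (Eq.symm hD1) e4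
    have e6 : Dφ (v₀ + R (D 1)) = z := by
      rw [map_add, ← e5]
      abel
    exact e6

/-- A generalized covering is a local diffeomorphism. -/
theorem exists_sheet (p : G') : ∃ (e : OpenPartialHomeomorph G' G) (A : E' ≃L[ℝ] E),
    p ∈ e.source ∧ (∀ x ∈ e.source, e x = φ x) ∧
    ContMDiffOn 𝓘(ℝ, E) 𝓘(ℝ, E') ∞ e.symm e.target ∧
    HasMFDerivAt 𝓘(ℝ, E') 𝓘(ℝ, E) φ p (A : E' →L[ℝ] E) ∧
    HasMFDerivAt 𝓘(ℝ, E) 𝓘(ℝ, E') e.symm (φ p) (A.symm : E →L[ℝ] E') := by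
  have hne : (∞ : WithTop ℕ∞) ≠ 0 := by simp
  obtain ⟨e, hp, -, heφ, -, hes⟩ := exists_openPartialHomeomorph_of_bijective_mfderiv isOpen_univ
    (mem_univ p) h.smooth.contMDiffOn (h.bijective_mfderiv p)
  obtain ⟨Dφ, hDφ⟩ : ∃ Dφ : E' →L[ℝ] E, Dφ = mfderiv 𝓘(ℝ, E') 𝓘(ℝ, E) φ p := ⟨_, rfl⟩
  have hφ : HasMFDerivAt 𝓘(ℝ, E') 𝓘(ℝ, E) φ p Dφ := by
    rw [hDφ]; exact ((h.smooth.contMDiffAt (x := p)).mdifferentiableAt hne).hasMFDerivAt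
  have hbij : Function.Bijective Dφ := by rw [hDφ]; exact h.bijective_mfderiv p
  let A : E' ≃L[ℝ] E := (LinearEquiv.ofBijective Dφ.toLinearMap hbij).toContinuousLinearEquiv
  have hA : (A : E' →L[ℝ] E) = Dφ := by ext x; rfl
  have htg : φ p ∈ e.target := heφ p hp ▸ e.map_source hp
  obtain ⟨B, hB⟩ : ∃ B : E →L[ℝ] E', HasMFDerivAt 𝓘(ℝ, E) 𝓘(ℝ, E') e.symm (φ p) B :=
    ⟨_, ((hes.contMDiffAt (e.open_target.mem_nhds htg)).mdifferentiableAt hne).hasMFDerivAt⟩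
  have hBA : B ∘L Dφ = .id ℝ E' := by
    have h1 := hB.comp p hφ
    have h2 : HasMFDerivAt 𝓘(ℝ, E') 𝓘(ℝ, E') (e.symm ∘ φ) p (.id ℝ E') :=
      (hasMFDerivAt_id p).congr_of_eventuallyEq
        (Filter.eventually_of_mem (e.open_source.mem_nhds hp) fun x hx => by
          show e.symm (φ x) = x
          rw [← heφ x hx, e.left_inv hx])
    exact hasMFDerivAt_unique h1 h2
  refine ⟨e, A, hp, heφ, hes, by rw [hA]; exact hφ, ?_⟩
  have : B = A.symm := by
    ext z
    obtain ⟨v, rfl⟩ := A.surjective z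
    have h1 : B (Dφ v) = v := congrArg (fun L : E' →L[ℝ] E' => L v) hBA
    rw [← hA] at h1
    simpa using h1
  rw [← this]
  exact hB

/-- The source of the rigidity of lifts: `φ` is injective near the common limit. -/
theorem eventually_eq_of_comp_eq {X : Type*} {l : Filter X} {a b : X → G'} {z : G'}
    (ha : Filter.Tendsto a l (𝓝 z)) (hb : Filter.Tendsto b l (𝓝 z))
    (hab : ∀ᶠ x in l, φ (a x) = φ (b x)) : ∀ᶠ x in l, a x = b x := by
  obtain ⟨e, -, hz, heφ, -⟩ := h.exists_sheet z
  filter_upwards [ha.eventually (e.open_source.mem_nhds hz),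
    hb.eventually (e.open_source.mem_nhds hz), hab] with x h1 h2 h3
  exact e.injOn h1 h2 (by rw [heφ _ h1, heφ _ h2, h3])

theorem map_pairs {q : G' × G'} (hq : q ∈ S'.pairs) : (φ q.1, φ q.2) ∈ S.pairs := by
  show S.s _ = S.t _
  rw [← h.comp_s, ← h.comp_t]; exact hq

theorem tendsto_pairs (q : G' × G') : Filter.Tendsto (fun q : G' × G' => (φ q.1, φ q.2))
    (𝓝[S'.pairs] q) (𝓝[S.pairs] (φ q.1, φ q.2)) :=
  tendsto_nhdsWithin_iff.2 ⟨(((h.smooth.continuous.comp continuous_fst).prodMk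
    (h.smooth.continuous.comp continuous_snd)).tendsto q).mono_left nhdsWithin_le_nhds,
    Filter.eventually_of_mem self_mem_nhdsWithin fun q hq => h.map_pairs hq⟩

theorem tangentMap_eq {π' : G' → M} {π : G → M} (hπ : ContMDiff 𝓘(ℝ, E) 𝓘(ℝ, F) ∞ π)
    (hc : ∀ g, π' g = π (φ g)) {p : G'} {v : E'} {w : E} {A : E' →L[ℝ] E}
    (hA : HasMFDerivAt 𝓘(ℝ, E') 𝓘(ℝ, E) φ p A) (hvw : A v = w) :
    tangentMap 𝓘(ℝ, E') 𝓘(ℝ, F) π' ⟨p, v⟩ = tangentMap 𝓘(ℝ, E) 𝓘(ℝ, F) π ⟨φ p, w⟩ := by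
  have hne : (∞ : WithTop ℕ∞) ≠ 0 := by simp
  have h4 : π' = π ∘ φ := funext hc
  rw [h4, tangentMap_comp_at ⟨p, v⟩ ((hπ.contMDiffAt).mdifferentiableAt hne)
    ((h.smooth.contMDiffAt (x := p)).mdifferentiableAt hne)]
  congr 1
  show (⟨φ p, mfderiv 𝓘(ℝ, E') 𝓘(ℝ, E) φ p v⟩ : TangentBundle 𝓘(ℝ, E) G) = _
  rw [hA.mfderiv, ← hvw]
  rfl

/-- Regularity of translations lifts to generalized coverings. -/
theorem regular_lift {π' : G' → M} {π : G → M} (hπ : ContMDiff 𝓘(ℝ, E) 𝓘(ℝ, F) ∞ π)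
    (hc : ∀ g, π' g = π (φ g)) {f' : G' → G'} {f : G → G} {A' : Set G'} {A : Set G}
    (hAA : MapsTo φ A' A) (hff : ∀ g ∈ A', φ (f' g) = f (φ g)) {y : G'} (hy : y ∈ A')
    (hcont : ContinuousWithinAt f' A' y) {D : E →L[ℝ] E}
    (hD : HasMFDerivWithinAt 𝓘(ℝ, E) 𝓘(ℝ, E) f A (φ y) D)
    (hb : BijOn D {v | mfderiv 𝓘(ℝ, E) 𝓘(ℝ, F) π (φ y) v = (0 : F)}
      {v | mfderiv 𝓘(ℝ, E) 𝓘(ℝ, F) π (f (φ y)) v = (0 : F)}) :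
    ∃ D' : E' →L[ℝ] E', HasMFDerivWithinAt 𝓘(ℝ, E') 𝓘(ℝ, E') f' A' y D' ∧
      BijOn D' {v | mfderiv 𝓘(ℝ, E') 𝓘(ℝ, F) π' y v = (0 : F)}
        {v | mfderiv 𝓘(ℝ, E') 𝓘(ℝ, F) π' (f' y) v = (0 : F)} := by
  have hne : (∞ : WithTop ℕ∞) ≠ 0 := by simp
  have hker : ∀ {p : G'} {B : E' →L[ℝ] E}, HasMFDerivAt 𝓘(ℝ, E') 𝓘(ℝ, E) φ p B → ∀ v : E',
      (mfderiv 𝓘(ℝ, E') 𝓘(ℝ, F) π' p v : F) = mfderiv 𝓘(ℝ, E) 𝓘(ℝ, F) π (φ p) (B v) := by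
    intro p B hB v
    have h1 := (hπ.contMDiffAt (x := φ p)).mdifferentiableAt hne |>.hasMFDerivAt
    have h3 := h1.comp p hB
    have h4 : π ∘ φ = π' := funext fun g => (hc g).symm
    rw [h4] at h3
    exact congrArg (fun L : E' →L[ℝ] F => L v) h3.mfderiv
  obtain ⟨-, B, -, -, -, hB, -⟩ := h.exists_sheet y
  obtain ⟨e, C, hye, heφ, -, hC, hCs⟩ := h.exists_sheet (f' y)
  rw [hff y hy] at hCs
  have h1 : HasMFDerivWithinAt 𝓘(ℝ, E') 𝓘(ℝ, E') (e.symm ∘ f ∘ φ) A' y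
      ((C.symm : E →L[ℝ] E') ∘L D ∘L (B : E' →L[ℝ] E)) :=
    hCs.comp_hasMFDerivWithinAt y (hD.comp y hB.hasMFDerivWithinAt hAA)
  -- By continuity the values of `f'` stay in the sheet through `f' y`, so `f'` is `f ∘ φ` followed
  -- by the inverse of this sheet. Its derivative is therefore conjugate to `D` by the differentials
  -- of `φ`, which identify the kernels involved.
  have h2 : ∀ᶠ g in 𝓝[A'] y, f' g = (e.symm ∘ f ∘ φ) g := by
    filter_upwards [hcont.tendsto.eventually (e.open_source.mem_nhds hye), self_mem_nhdsWithin]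
      with g hg hgA
    show f' g = e.symm (f (φ g))
    rw [← hff g hgA, ← heφ _ hg, e.left_inv hg]
  refine ⟨_, h1.congr_of_eventuallyEq h2 (h2.self_of_nhdsWithin hy), ?_⟩
  have hCs' : BijOn C.symm {v | mfderiv 𝓘(ℝ, E) 𝓘(ℝ, F) π (f (φ y)) v = (0 : F)}
      {v | mfderiv 𝓘(ℝ, E') 𝓘(ℝ, F) π' (f' y) v = (0 : F)} := by
    refine ⟨fun z hz => ?_, C.symm.injective.injOn, fun v hv => ⟨C v, ?_, C.symm_apply_apply v⟩⟩
    · show (mfderiv 𝓘(ℝ, E') 𝓘(ℝ, F) π' (f' y) (C.symm z) : F) = 0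
      rw [hker hC, hff y hy]
      exact (congrArg (mfderiv 𝓘(ℝ, E) 𝓘(ℝ, F) π (f (φ y))) (C.apply_symm_apply z)).trans hz
    · have hv' : (mfderiv 𝓘(ℝ, E') 𝓘(ℝ, F) π' (f' y) v : F) = 0 := hv
      rw [hker hC, hff y hy] at hv'
      exact hv'
  have hB' : BijOn B {v | mfderiv 𝓘(ℝ, E') 𝓘(ℝ, F) π' y v = (0 : F)}
      {v | mfderiv 𝓘(ℝ, E) 𝓘(ℝ, F) π (φ y) v = (0 : F)} := by
    refine ⟨fun v hv => ?_, B.injective.injOn, fun z hz => ⟨B.symm z, ?_, B.apply_symm_apply z⟩⟩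
    · have hv' : (mfderiv 𝓘(ℝ, E') 𝓘(ℝ, F) π' y v : F) = 0 := hv
      rw [hker hB] at hv'
      exact hv'
    · show (mfderiv 𝓘(ℝ, E') 𝓘(ℝ, F) π' y (B.symm z) : F) = 0
      rw [hker hB]
      exact (congrArg (mfderiv 𝓘(ℝ, E) 𝓘(ℝ, F) π (φ y)) (B.apply_symm_apply z)).trans hz
  exact hCs'.comp (hb.comp hB')

end IsGeneralizedCovering

end CoveringTheory


/-! ### Lifting the multiplication to a generalized covering -/

section CoveringTheory

variable {E E' F : Type*} [NormedAddCommGroup E] [NormedSpace ℝ E] [FiniteDimensional ℝ E]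
  [NormedAddCommGroup E'] [NormedSpace ℝ E'] [FiniteDimensional ℝ E']
  [NormedAddCommGroup F] [NormedSpace ℝ F] [FiniteDimensional ℝ F]
  {M G G' : Type*} [TopologicalSpace M] [ChartedSpace F M] [IsManifold 𝓘(ℝ, F) ∞ M]
  [TopologicalSpace G] [ChartedSpace E G] [IsManifold 𝓘(ℝ, E) ∞ G]
  [TopologicalSpace G'] [ChartedSpace E' G'] [IsManifold 𝓘(ℝ, E') ∞ G']
  {S' : ArrowSpace E' F M G'} {S : ArrowSpace E F M G} {φ : G' → G}

namespace IsGeneralizedCovering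

variable (hφ : IsGeneralizedCovering S' S φ) (L : LocalLieGroupoid S)

/-- The condition that `f` lifts the multiplication of `L` at `q`. -/
def LiftsMul (_ : IsGeneralizedCovering S' S φ) (L : LocalLieGroupoid S) (f : G' × G' → G')
    (q : G' × G') : Prop :=
  (φ q.1, φ q.2) ∈ L.U ∧ φ (f q) = L.mul (φ q.1, φ q.2)

include hφ

/-- The multiplication of `L` lifts near a composable pair, with a prescribed value. -/
theorem exists_lift {p : G' × G'} (hU : (φ p.1, φ p.2) ∈ L.U) {g : G'}
    (hg : φ g = L.mul (φ p.1, φ p.2)) :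
    ∃ e : OpenPartialHomeomorph G' G, g ∈ e.source ∧ (∀ x ∈ e.source, e x = φ x) ∧
      S'.Adm (hφ.LiftsMul L) (fun q => e.symm (L.mul (φ q.1, φ q.2))) p := by
  obtain ⟨e, -, hge, heφ, hes, -⟩ := hφ.exists_sheet g
  refine ⟨e, hge, heφ, ?_⟩
  have h1 := (hφ.tendsto_pairs p).eventually (L.toPreGroupoid.eventually_mem hU)
  have h2 := ((L.toPreGroupoid.tendsto_mul hU).comp (hφ.tendsto_pairs p)).eventually
    (e.open_target.mem_nhds (show L.mul (φ p.1, φ p.2) ∈ e.target by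
      rw [← hg, ← heφ g hge]; exact e.map_source hge))
  filter_upwards [h1, h2, self_mem_nhdsWithin] with q hqU hqe hq
  have hqU' : (φ q.1, φ q.2) ∈ L.U := hqU
  have hqe' : L.mul (φ q.1, φ q.2) ∈ e.target := hqe
  have hm := L.toPreGroupoid.isMulAt _ hqU
  have h3 : φ (e.symm (L.mul (φ q.1, φ q.2))) = L.mul (φ q.1, φ q.2) := by
    rw [← heφ _ (e.map_target hqe'), e.right_inv hqe']
  refine ⟨⟨?_, ?_, ?_⟩, hqU', h3⟩
  · have c1 : ContMDiff (𝓘(ℝ, E').prod 𝓘(ℝ, E')) (𝓘(ℝ, E).prod 𝓘(ℝ, E)) ∞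
        (fun q : G' × G' => (φ q.1, φ q.2)) :=
      (hφ.smooth.comp contMDiff_fst).prodMk (hφ.smooth.comp contMDiff_snd)
    have c2 := hm.smooth.comp q c1.contMDiffAt.contMDiffWithinAt
      (fun q' (hq' : q' ∈ S'.pairs) => hφ.map_pairs hq')
    exact (hes.contMDiffAt (e.open_target.mem_nhds hqe')).comp_contMDiffWithinAt q c2
  · rw [hφ.comp_s, h3, hφ.comp_s]; exact hm.s_eq
  · rw [hφ.comp_t, h3, hφ.comp_t]; exact hm.t_eq

theorem adm_tendsto {f : G' × G' → G'} {p : G' × G'} (hp : p ∈ S'.pairs)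
    (hf : S'.Adm (hφ.LiftsMul L) f p) : Filter.Tendsto f (𝓝[S'.pairs] p) (𝓝 (f p)) :=
  (Filter.Eventually.self_of_nhdsWithin hf hp).1.smooth.continuousWithinAt

/-- Two lifts with equal values at `p` have the same limit there and the same images under `φ`. -/
theorem adm_eventually_eq {f f' : G' × G' → G'} {p : G' × G'} (hp : p ∈ S'.pairs)
    (hf : S'.Adm (hφ.LiftsMul L) f p) (hf' : S'.Adm (hφ.LiftsMul L) f' p) (h : f p = f' p) :
    f =ᶠ[𝓝[S'.pairs] p] f' := by
  have h1 := hφ.adm_tendsto L hp hf'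
  rw [← h] at h1
  refine hφ.eventually_eq_of_comp_eq (hφ.adm_tendsto L hp hf) h1 ?_
  filter_upwards [hf, hf'] with q hq hq'
  rw [hq.2.2, hq'.2.2]

/-- Lifts of the multiplication of `L` to a generalized covering form a class of germs of
multiplications. -/
def mulGerm : MulGerm S' where
  P := hφ.LiftsMul L
  -- Associativity downstairs is guaranteed only near triples with two unit entries. On the triples
  -- in `T`, both bracketings upstairs are lifts of one product, so their agreement at a point
  -- propagates.
  T := fun p => ∀ᶠ q : G' × G' × G' in 𝓝 p, S'.s q.1 = S'.t q.2.1 → S'.s q.2.1 = S'.t q.2.2 →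
    L.mul (L.mul (φ q.1, φ q.2.1), φ q.2.2) = L.mul (φ q.1, L.mul (φ q.2.1, φ q.2.2))
  congr := fun {f f' q} hq hff' h => by
    have h1 : f q = f' q := Filter.Eventually.self_of_nhdsWithin (p := fun q => f q = f' q) hff' hq
    exact ⟨h.1, h1 ▸ h.2⟩
  propagate_left := fun {f f' g h} hgh hf hf' he =>
    S'.tendsto_prodMk_left.eventually (hφ.adm_eventually_eq L (p := (g, h)) hgh hf hf' he)
  propagate_right := fun {f f' g h} hgh hf hf' he =>
    S'.tendsto_prodMk_right.eventually (hφ.adm_eventually_eq L (p := (g, h)) hgh hf hf' he)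
  unit_left := fun {f x h} hx hf he => by
    have hp : (S'.u x, h) ∈ S'.pairs := (S'.s_u x).trans hx.symm
    have ht : Filter.Tendsto (fun h' => (S'.u x, h')) (𝓝[S'.t ⁻¹' {x}] h)
        (𝓝[S'.pairs] (S'.u x, h)) := by
      have := S'.tendsto_prodMk_left (g := S'.u x) (h := h); rwa [S'.s_u] at this
    have h1 := (hφ.adm_tendsto L hp hf).comp ht
    rw [he] at h1
    refine hφ.eventually_eq_of_comp_eq h1 (Filter.tendsto_id.mono_left nhdsWithin_le_nhds) ?_
    filter_upwards [ht.eventually hf, self_mem_nhdsWithin] with h' hh hh'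
    have h2 := L.unit_mul (φ h')
    rw [← hφ.comp_t, show S'.t h' = x from hh', hφ.comp_u] at h2
    exact hh.2.2.trans h2
  unit_right := fun {f x g} hx hf he => by
    have hp : (g, S'.u x) ∈ S'.pairs := hx.trans (S'.t_u x).symm
    have ht : Filter.Tendsto (fun g' => (g', S'.u x)) (𝓝[S'.s ⁻¹' {x}] g)
        (𝓝[S'.pairs] (g, S'.u x)) := by
      have := S'.tendsto_prodMk_right (g := g) (h := S'.u x); rwa [S'.t_u] at this
    have h1 := (hφ.adm_tendsto L hp hf).comp ht
    rw [he] at h1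
    refine hφ.eventually_eq_of_comp_eq h1 (Filter.tendsto_id.mono_left nhdsWithin_le_nhds) ?_
    filter_upwards [ht.eventually hf, self_mem_nhdsWithin] with g' hg hg'
    have h2 := L.mul_unit (φ g')
    rw [← hφ.comp_s, show S'.s g' = x from hg', hφ.comp_u] at h2
    exact hg.2.2.trans h2
  submersion := fun {f q} hq hf => by
    have hfq := Filter.Eventually.self_of_nhdsWithin hf hq
    obtain ⟨D, hD, hz⟩ := L.toPreGroupoid.submersion _ hfq.2.1
    obtain ⟨-, A, -, -, -, hA, -⟩ := hφ.exists_sheet q.1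
    obtain ⟨-, B, -, -, -, hB, -⟩ := hφ.exists_sheet q.2
    obtain ⟨e, C, hqe, heφ, -, hC, hCs⟩ := hφ.exists_sheet (f q)
    rw [hfq.2.2] at hCs
    have hAB : HasMFDerivAt (𝓘(ℝ, E').prod 𝓘(ℝ, E')) (𝓘(ℝ, E).prod 𝓘(ℝ, E))
        (fun q : G' × G' => (φ q.1, φ q.2)) q
        (((A : E' →L[ℝ] E) ∘L .fst ℝ E' E').prod ((B : E' →L[ℝ] E) ∘L .snd ℝ E' E')) :=
      (hA.comp q (hasMFDerivAt_fst q)).prodMk (hB.comp q (hasMFDerivAt_snd q))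
    have hsub : S'.pairs ⊆ (fun q : G' × G' => (φ q.1, φ q.2)) ⁻¹' S.pairs :=
      fun q' hq' => hφ.map_pairs hq'
    have h1 := hCs.comp_hasMFDerivWithinAt q (hD.comp q hAB.hasMFDerivWithinAt hsub)
    have h2 : ∀ᶠ p in 𝓝[S'.pairs] q, f p = (e.symm ∘ L.mul ∘ fun q => (φ q.1, φ q.2)) p := by
      filter_upwards [hf, (hφ.adm_tendsto L hq hf).eventually (e.open_source.mem_nhds hqe)]
        with p hp hpe
      show f p = e.symm (L.mul (φ p.1, φ p.2))
      rw [← hp.2.2, ← heφ _ hpe, e.left_inv hpe]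
    refine ⟨_, h1.congr_of_eventuallyEq h2 (h2.self_of_nhdsWithin hq), fun z => ?_⟩
    obtain ⟨v, w, hvw, hz⟩ := hz (C z)
    let v' : E' := A.symm (v : E)
    let w' : E' := B.symm (w : E)
    have hv' : A v' = v := A.apply_symm_apply (v : E)
    have hw' : B w' = w := B.apply_symm_apply (w : E)
    refine ⟨v', w', ?_, ?_⟩
    · exact (hφ.tangentMap_eq S.smooth_s hφ.comp_s hA hv').trans
        (hvw.trans (hφ.tangentMap_eq S.smooth_t hφ.comp_t hB hw').symm)
    · have h3 : C.symm (D ((A v', B w') : E × E)) = C.symm (C (z : E')) := by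
        rw [hv', hw']; exact congrArg C.symm hz
      exact h3.trans (C.symm_apply_apply (z : E'))
  T_near := fun g => by
    have hc : Continuous fun q : G' × G' × G' => (φ q.1, φ q.2.1, φ q.2.2) := by
      have := hφ.smooth.continuous; fun_prop
    have h1 := Filter.eventually_sup.1 (Filter.eventually_iSup.1 L.toPreGroupoid.assoc (φ g))
    have h2 := Filter.eventually_sup.1 h1.1
    have key : ∀ p : G' × G' × G', (∀ᶠ q : G × G × G in 𝓝 (φ p.1, φ p.2.1, φ p.2.2),
        S.s q.1 = S.t q.2.1 → S.s q.2.1 = S.t q.2.2 →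
        L.mul (L.mul (q.1, q.2.1), q.2.2) = L.mul (q.1, L.mul (q.2.1, q.2.2))) →
        ∀ᶠ p' in 𝓝 p, ∀ᶠ q : G' × G' × G' in 𝓝 p', S'.s q.1 = S'.t q.2.1 →
        S'.s q.2.1 = S'.t q.2.2 →
        L.mul (L.mul (φ q.1, φ q.2.1), φ q.2.2) = L.mul (φ q.1, L.mul (φ q.2.1, φ q.2.2)) :=
      fun p hp => eventually_eventually_nhds.2 (((hc.tendsto p).eventually hp).mono
        fun q hq h1 h2 => hq (hφ.map_pairs (q := (q.1, q.2.1)) h1)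
          (hφ.map_pairs (q := (q.2.1, q.2.2)) h2))
    refine ⟨key _ ?_, key _ ?_, key _ ?_⟩
    · simpa only [← hφ.comp_u, hφ.comp_t, L.toPreGroupoid_mul] using h2.1
    · simpa only [← hφ.comp_u, hφ.comp_t, hφ.comp_s, L.toPreGroupoid_mul] using h2.2
    · simpa only [← hφ.comp_u, hφ.comp_s, L.toPreGroupoid_mul] using h1.2
  assoc_left := fun {f g h k} hT hgh hhk a₁ a₂ a₃ a₄ he => by
    have m₁ := (Filter.Eventually.self_of_nhdsWithin a₁ hgh)
    have p₃ : S'.s (f (g, h)) = S'.t k := m₁.1.s_eq.trans hhk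
    have p₄ : S'.s g = S'.t (f (h, k)) :=
      Eq.trans hgh (Filter.Eventually.self_of_nhdsWithin a₂ hhk).1.t_eq.symm
    have t₂ := S'.tendsto_prodMk_left (g := h) (h := k)
    have t₃ : Filter.Tendsto (fun k' => (f (g, h), k')) (𝓝[S'.t ⁻¹' {S'.s h}] k)
        (𝓝[S'.pairs] (f (g, h), k)) := by
      have := S'.tendsto_prodMk_left (g := f (g, h)) (h := k); rwa [m₁.1.s_eq] at this
    have t₄ : Filter.Tendsto (fun k' => (g, f (h, k'))) (𝓝[S'.t ⁻¹' {S'.s h}] k)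
        (𝓝[S'.pairs] (g, f (h, k))) :=
      tendsto_nhdsWithin_iff.2 ⟨tendsto_const_nhds.prodMk_nhds
        ((hφ.adm_tendsto L hhk a₂).comp t₂), by
        filter_upwards [t₂.eventually a₂] with k' hk'
        exact Eq.trans hgh hk'.1.t_eq.symm⟩
    have t₅ : Filter.Tendsto (fun k' => (g, h, k')) (𝓝[S'.t ⁻¹' {S'.s h}] k) (𝓝 (g, h, k)) :=
      tendsto_const_nhds.prodMk_nhds (tendsto_const_nhds.prodMk_nhds
        (Filter.tendsto_id.mono_left nhdsWithin_le_nhds))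
    have c₄ := (hφ.adm_tendsto L p₄ a₄).comp t₄
    rw [← he] at c₄
    refine hφ.eventually_eq_of_comp_eq ((hφ.adm_tendsto L p₃ a₃).comp t₃) c₄ ?_
    filter_upwards [t₂.eventually a₂, t₃.eventually a₃, t₄.eventually a₄, t₅.eventually hT,
      self_mem_nhdsWithin] with k' h2 h3 h4 h5 h6
    have h7 := h5 hgh (Eq.symm h6)
    rw [← m₁.2.2, ← h2.2.2, ← h3.2.2, ← h4.2.2] at h7
    exact h7
  assoc_right := fun {f g h k} hT hgh hhk a₁ a₂ a₃ a₄ he => by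
    have m₂ := (Filter.Eventually.self_of_nhdsWithin a₂ hhk)
    have p₃ : S'.s (f (g, h)) = S'.t k :=
      Eq.trans (Filter.Eventually.self_of_nhdsWithin a₁ hgh).1.s_eq hhk
    have p₄ : S'.s g = S'.t (f (h, k)) := Eq.trans hgh m₂.1.t_eq.symm
    have t₁ := S'.tendsto_prodMk_right (g := g) (h := h)
    have t₄ : Filter.Tendsto (fun g' => (g', f (h, k))) (𝓝[S'.s ⁻¹' {S'.t h}] g)
        (𝓝[S'.pairs] (g, f (h, k))) := by
      have := S'.tendsto_prodMk_right (g := g) (h := f (h, k)); rwa [m₂.1.t_eq] at this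
    have t₃ : Filter.Tendsto (fun g' => (f (g', h), k)) (𝓝[S'.s ⁻¹' {S'.t h}] g)
        (𝓝[S'.pairs] (f (g, h), k)) :=
      tendsto_nhdsWithin_iff.2 ⟨((hφ.adm_tendsto L hgh a₁).comp t₁).prodMk_nhds
        tendsto_const_nhds, by
        filter_upwards [t₁.eventually a₁] with g' hg'
        exact Eq.trans hg'.1.s_eq hhk⟩
    have t₅ : Filter.Tendsto (fun g' => (g', h, k)) (𝓝[S'.s ⁻¹' {S'.t h}] g) (𝓝 (g, h, k)) :=
      (Filter.tendsto_id.mono_left nhdsWithin_le_nhds).prodMk_nhds tendsto_const_nhds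
    have c₄ := (hφ.adm_tendsto L p₄ a₄).comp t₄
    rw [← he] at c₄
    refine hφ.eventually_eq_of_comp_eq ((hφ.adm_tendsto L p₃ a₃).comp t₃) c₄ ?_
    filter_upwards [t₁.eventually a₁, t₃.eventually a₃, t₄.eventually a₄, t₅.eventually hT,
      self_mem_nhdsWithin] with g' h1 h3 h4 h5 h6
    have h7 := h5 h6 hhk
    rw [← m₂.2.2, ← h1.2.2, ← h3.2.2, ← h4.2.2] at h7
    exact h7
  exists_right := fun g => by
    have e1 : L.mul (φ g, φ (S'.u (S'.s g))) = φ g := by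
      rw [← hφ.comp_u, hφ.comp_s, L.mul_unit]
    obtain ⟨e, hge, heφ, h⟩ := hφ.exists_lift L (p := (g, S'.u (S'.s g))) (g := g)
      (by rw [← hφ.comp_u, hφ.comp_s]; exact L.right_unit_mem _) e1.symm
    refine ⟨_, h, ?_⟩
    filter_upwards [e.open_source.mem_nhds hge] with g' hg'
    rw [← hφ.comp_u, hφ.comp_s, L.mul_unit, ← heφ _ hg', e.left_inv hg']
  exists_left := fun g => by
    have e1 : L.mul (φ (S'.u (S'.t g)), φ g) = φ g := by
      rw [← hφ.comp_u, hφ.comp_t, L.unit_mul]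
    obtain ⟨e, hge, heφ, h⟩ := hφ.exists_lift L (p := (S'.u (S'.t g), g)) (g := g)
      (by rw [← hφ.comp_u, hφ.comp_t]; exact L.left_unit_mem _) e1.symm
    refine ⟨_, h, ?_⟩
    filter_upwards [e.open_source.mem_nhds hge] with g' hg'
    rw [← hφ.comp_u, hφ.comp_t, L.unit_mul, ← heφ _ hg', e.left_inv hg']

/-- Bi-regular local Lie groupoid structures lift to generalized coverings. -/
theorem exists_lift_localLieGroupoid [T2Space M] [ParacompactSpace M] (hL : L.BiRegular) :
    ∃ L' : LocalLieGroupoid S', IsMorphism L' L φ id ∧ L'.BiRegular := by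
  obtain ⟨f, hf⟩ := (hφ.mulGerm L).exists_isLocalMul
  obtain ⟨Γ, hΓf, hΓ⟩ := hf.exists_preGroupoid
  obtain ⟨r, hr⟩ := Γ.exists_inversion
  have hlift : ∀ p ∈ Γ.U, (φ p.1, φ p.2) ∈ L.U ∧ φ (Γ.mul p) = L.mul (φ p.1, φ p.2) := by
    intro p hp
    rw [hΓf]
    exact (Filter.Eventually.self_of_nhdsWithin (hΓ p hp) (Γ.pairs_of_mem hp)).2
  have hφu : ∀ x, Filter.Tendsto φ (𝓝 (S'.u x)) (𝓝 (S.u x)) := fun x => by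
    rw [hφ.comp_u]; exact hφ.smooth.continuous.tendsto _
  have hQ : ∀ x, ∀ᶠ g in 𝓝 (S'.u x), φ g ∈ L.V ∧ φ (r g) = L.inv (φ g) := by
    intro x
    have hV := (hφu x).eventually (L.isOpen_V.mem_nhds (L.unit_mem_V x))
    refine hV.and ?_
    have hri := L.isRightInversion x
    -- Close to units, `L.inv (φ g)` is a left inverse and `φ (r g)` a right inverse of `φ g`.
    have h1 := L.toPreGroupoid.eventually_eq_of_inverses (x := x) (l := 𝓝 (S'.u x))
      (a := fun g => L.inv (φ g)) (g := φ) (b := fun g => φ (r g))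
      (hri.tendsto.comp (hφu x)) (hφu x) ((hφu x).comp (hr x).tendsto) ?_ ?_
    · exact h1.mono fun g => Eq.symm
    · filter_upwards [hV] with g hg
      exact ⟨L.s_inv _ hg, L.t_inv _ hg, L.inv_mul _ hg⟩
    · have hU : ∀ᶠ g in 𝓝 (S'.u x), (g, r g) ∈ Γ.U := by
        have ht : Filter.Tendsto (fun g => (g, r g)) (𝓝 (S'.u x))
            (𝓝[S'.pairs] (S'.u x, S'.u x)) :=
          tendsto_nhdsWithin_iff.2 ⟨Filter.tendsto_id.prodMk_nhds (hr x).tendsto,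
            (hr x).t_eq.mono fun g hg => Eq.symm hg⟩
        exact ht.eventually (Γ.eventually_mem (Γ.unit_mem x))
      filter_upwards [hU, (hr x).t_eq, (hr x).mul_eq] with g h1 h2 h3
      refine ⟨?_, ?_⟩
      · rw [← hφ.comp_s, ← hφ.comp_t, h2]
      · have h4 := (hlift _ h1).2
        rw [h3, ← hφ.comp_u, hφ.comp_t] at h4
        exact h4.symm
  obtain ⟨L', hU, hmul, hinv, hV⟩ := Γ.exists_localLieGroupoid hr hQ
  rw [← hU, ← hmul] at hlift
  refine ⟨L', ⟨hφ.smooth, contMDiff_id, fun x => (hφ.comp_u x).symm, hφ.comp_s, hφ.comp_t,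
    fun g h hgh => (hlift _ hgh).1, fun g h hgh => (hlift _ hgh).2, fun g hg => (hV g hg).1,
    fun g hg => by rw [hinv]; exact (hV g hg).2⟩, fun g => ⟨?_, ?_⟩⟩
  · obtain ⟨D, hD, hb⟩ : ∃ D : E →L[ℝ] E, HasMFDerivWithinAt 𝓘(ℝ, E) 𝓘(ℝ, E)
        (fun h => L.mul (h, φ g)) {h | (h, φ g) ∈ L.U} (S.u (S.t (φ g))) D ∧
        BijOn D {v | mfderiv 𝓘(ℝ, E) 𝓘(ℝ, F) S.s (S.u (S.t (φ g))) v = (0 : F)}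
          {v | mfderiv 𝓘(ℝ, E) 𝓘(ℝ, F) S.s (L.mul (S.u (S.t (φ g)), φ g)) v = (0 : F)} :=
      (hL (φ g)).1
    rw [← hφ.comp_t, hφ.comp_u] at hD hb
    have hm := L'.left_unit_mem g
    have hA : MapsTo (fun h => (h, g)) {h | (h, g) ∈ L'.U} S'.pairs :=
      fun h hh => L'.toPreGroupoid.pairs_of_mem hh
    exact hφ.regular_lift (f' := fun h => L'.mul (h, g)) (f := fun h => L.mul (h, φ g))
      (A' := {h | (h, g) ∈ L'.U}) (A := {h | (h, φ g) ∈ L.U}) (y := S'.u (S'.t g)) S.smooth_s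
      hφ.comp_s (fun h hh => (hlift _ hh).1) (fun h hh => (hlift _ hh).2) hm
      ((L'.toPreGroupoid.tendsto_mul hm).comp
        ((Continuous.prodMk_left g).continuousWithinAt.tendsto_nhdsWithin hA)) hD hb
  · obtain ⟨D, hD, hb⟩ : ∃ D : E →L[ℝ] E, HasMFDerivWithinAt 𝓘(ℝ, E) 𝓘(ℝ, E)
        (fun h => L.mul (φ g, h)) {h | (φ g, h) ∈ L.U} (S.u (S.s (φ g))) D ∧
        BijOn D {v | mfderiv 𝓘(ℝ, E) 𝓘(ℝ, F) S.t (S.u (S.s (φ g))) v = (0 : F)}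
          {v | mfderiv 𝓘(ℝ, E) 𝓘(ℝ, F) S.t (L.mul (φ g, S.u (S.s (φ g)))) v = (0 : F)} :=
      (hL (φ g)).2
    rw [← hφ.comp_s, hφ.comp_u] at hD hb
    have hm := L'.right_unit_mem g
    have hA : MapsTo (fun h => (g, h)) {h | (g, h) ∈ L'.U} S'.pairs :=
      fun h hh => L'.toPreGroupoid.pairs_of_mem hh
    exact hφ.regular_lift (f' := fun h => L'.mul (g, h)) (f := fun h => L.mul (φ g, h))
      (A' := {h | (g, h) ∈ L'.U}) (A := {h | (φ g, h) ∈ L.U}) (y := S'.u (S'.s g)) S.smooth_t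
      hφ.comp_t (fun h hh => (hlift _ hh).1) (fun h hh => (hlift _ hh).2) hm
      ((L'.toPreGroupoid.tendsto_mul hm).comp
        ((Continuous.prodMk_right g).continuousWithinAt.tendsto_nhdsWithin hA)) hD hb

end IsGeneralizedCovering

end CoveringTheory


/-! ### Vector fields in charts -/

section ChartFields

variable {E : Type*} [NormedAddCommGroup E] [NormedSpace ℝ E] [FiniteDimensional ℝ E]
  {G : Type*} [TopologicalSpace G] [ChartedSpace E G] [IsManifold 𝓘(ℝ, E) ∞ G]

/-- The coordinate expression of a vector field in the preferred chart at `p`. -/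
noncomputable def chartField (p : G) (X : (g : G) → TangentSpace 𝓘(ℝ, E) g) (y : E) : E :=
  VectorField.mpullback 𝓘(ℝ, E) 𝓘(ℝ, E) (extChartAt 𝓘(ℝ, E) p).symm X y

omit [FiniteDimensional ℝ E] in
theorem hasMFDerivAt_chart_symm {p : G} {y : E} (hy : y ∈ (extChartAt 𝓘(ℝ, E) p).target) :
    ∃ A : E ≃L[ℝ] E, HasMFDerivAt 𝓘(ℝ, E) 𝓘(ℝ, E) (extChartAt 𝓘(ℝ, E) p).symm y (A : E →L[ℝ] E) ∧
      HasMFDerivAt 𝓘(ℝ, E) 𝓘(ℝ, E) (extChartAt 𝓘(ℝ, E) p) ((extChartAt 𝓘(ℝ, E) p).symm y)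
        (A.symm : E →L[ℝ] E) := by
  have hne : (∞ : WithTop ℕ∞) ≠ 0 := by simp
  set c := extChartAt 𝓘(ℝ, E) p with hc
  have ho : IsOpen c.target := isOpen_extChartAt_target p
  have hs : IsOpen c.source := isOpen_extChartAt_source p
  have h1 : ContMDiffOn 𝓘(ℝ, E) 𝓘(ℝ, E) ∞ c.symm c.target := contMDiffOn_extChartAt_symm p
  have h2 : ContMDiffOn 𝓘(ℝ, E) 𝓘(ℝ, E) ∞ c c.source := by
    rw [hc, extChartAt_source]; exact contMDiffOn_extChartAt
  have hys := c.map_target hy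
  obtain ⟨A, hA⟩ : ∃ A : E →L[ℝ] E, HasMFDerivAt 𝓘(ℝ, E) 𝓘(ℝ, E) c.symm y A :=
    ⟨_, ((h1.contMDiffAt (ho.mem_nhds hy)).mdifferentiableAt hne).hasMFDerivAt⟩
  obtain ⟨B, hB⟩ : ∃ B : E →L[ℝ] E, HasMFDerivAt 𝓘(ℝ, E) 𝓘(ℝ, E) c (c.symm y) B :=
    ⟨_, ((h2.contMDiffAt (hs.mem_nhds hys)).mdifferentiableAt hne).hasMFDerivAt⟩
  have hBA : B ∘L A = .id ℝ E := by
    have h3 := hB.comp y hA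
    have h4 : HasMFDerivAt 𝓘(ℝ, E) 𝓘(ℝ, E) (c ∘ c.symm) y (.id ℝ E) :=
      (hasMFDerivAt_id y).congr_of_eventuallyEq
        (Filter.eventually_of_mem (ho.mem_nhds hy) fun x hx => c.right_inv hx)
    exact hasMFDerivAt_unique h3 h4
  have hAB : A ∘L B = .id ℝ E := by
    have hA' : HasMFDerivAt 𝓘(ℝ, E) 𝓘(ℝ, E) c.symm (c (c.symm y)) A := by
      rw [c.right_inv hy]; exact hA
    have h3 := hA'.comp (c.symm y) hB
    have h4 : HasMFDerivAt 𝓘(ℝ, E) 𝓘(ℝ, E) (c.symm ∘ c) (c.symm y) (.id ℝ E) :=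
      (hasMFDerivAt_id _).congr_of_eventuallyEq
        (Filter.eventually_of_mem (hs.mem_nhds hys) fun x hx => c.left_inv hx)
    exact hasMFDerivAt_unique h3 h4
  exact ⟨ContinuousLinearEquiv.equivOfInverse A B
    (fun v => congrArg (fun L : E →L[ℝ] E => L v) hBA)
    fun v => congrArg (fun L : E →L[ℝ] E => L v) hAB, hA, hB⟩

omit [FiniteDimensional ℝ E] in
theorem chartField_spec {p : G} {y : E} (hy : y ∈ (extChartAt 𝓘(ℝ, E) p).target) {A : E →L[ℝ] E}
    (hA : HasMFDerivAt 𝓘(ℝ, E) 𝓘(ℝ, E) (extChartAt 𝓘(ℝ, E) p).symm y A)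
    (X : (g : G) → TangentSpace 𝓘(ℝ, E) g) :
    A (chartField p X y) = X ((extChartAt 𝓘(ℝ, E) p).symm y) := by
  obtain ⟨A', hA', -⟩ := hasMFDerivAt_chart_symm hy
  have h1 : A = A' := hasMFDerivAt_unique hA hA'
  have h2 : chartField p X y =
      (A' : E →L[ℝ] E).inverse (X ((extChartAt 𝓘(ℝ, E) p).symm y) : E) := by
    show (mfderiv 𝓘(ℝ, E) 𝓘(ℝ, E) (extChartAt 𝓘(ℝ, E) p).symm y).inverse _ = _
    rw [hA'.mfderiv]
    rfl
  rw [h1, h2, ContinuousLinearMap.inverse_equiv]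
  exact A'.apply_symm_apply _

omit [FiniteDimensional ℝ E] in
theorem chartField_apply {p g : G} (hg : g ∈ (extChartAt 𝓘(ℝ, E) p).source) {B : E →L[ℝ] E}
    (hB : HasMFDerivAt 𝓘(ℝ, E) 𝓘(ℝ, E) (extChartAt 𝓘(ℝ, E) p) g B)
    (X : (g : G) → TangentSpace 𝓘(ℝ, E) g) :
    B (X g) = chartField p X (extChartAt 𝓘(ℝ, E) p g) := by
  obtain ⟨A, hA, hA'⟩ := hasMFDerivAt_chart_symm ((extChartAt 𝓘(ℝ, E) p).map_source hg)
  have h1 := chartField_spec ((extChartAt 𝓘(ℝ, E) p).map_source hg) hA X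
  rw [(extChartAt 𝓘(ℝ, E) p).left_inv hg] at hA' h1
  have h2 : B = (A.symm : E →L[ℝ] E) := hasMFDerivAt_unique hB hA'
  rw [h2, ← show _ = (X g : E) from h1]
  exact A.symm_apply_apply _

theorem contDiffOn_chartField (p : G) {X : (g : G) → TangentSpace 𝓘(ℝ, E) g}
    (hX : ContMDiff 𝓘(ℝ, E) 𝓘(ℝ, E).tangent ∞
      (fun g => (⟨g, X g⟩ : TangentBundle 𝓘(ℝ, E) G))) :
    ContDiffOn ℝ ∞ (chartField p X) (extChartAt 𝓘(ℝ, E) p).target := by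
  intro y hy
  have : CompleteSpace E := FiniteDimensional.complete ℝ E
  obtain ⟨A, hA, -⟩ := hasMFDerivAt_chart_symm hy
  have h1 : ContMDiffAt 𝓘(ℝ, E) 𝓘(ℝ, E) ∞ (extChartAt 𝓘(ℝ, E) p).symm y :=
    (contMDiffOn_extChartAt_symm p).contMDiffAt ((isOpen_extChartAt_target p).mem_nhds hy)
  have h2 := ContMDiffAt.mpullback_vectorField_preimage (n := ∞) (m := ∞)
    (hX.contMDiffAt (x := (extChartAt 𝓘(ℝ, E) p).symm y)) h1 ⟨A, hA.mfderiv.symm⟩ (by simp)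
  exact (contMDiffAt_vectorSpace_iff_contDiffAt.1 h2).contDiffWithinAt

/-- The bracket is natural under pullback by the inverse chart, and in a vector space it is given by
derivatives. This translates the bracket conditions into the identities of the local model. -/
theorem lieBracket_chartField {p : G} {y : E} (hy : y ∈ (extChartAt 𝓘(ℝ, E) p).target)
    {X Y : (g : G) → TangentSpace 𝓘(ℝ, E) g}
    (hX : ContMDiff 𝓘(ℝ, E) 𝓘(ℝ, E).tangent ∞ (fun g => (⟨g, X g⟩ : TangentBundle 𝓘(ℝ, E) G)))
    (hY : ContMDiff 𝓘(ℝ, E) 𝓘(ℝ, E).tangent ∞ (fun g => (⟨g, Y g⟩ : TangentBundle 𝓘(ℝ, E) G))) :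
    fderiv ℝ (chartField p Y) y (chartField p X y) - fderiv ℝ (chartField p X) y (chartField p Y y)
      = chartField p (VectorField.mlieBracket 𝓘(ℝ, E) X Y) y := by
  have : CompleteSpace E := FiniteDimensional.complete ℝ E
  have h2le : (2 : WithTop ℕ∞) ≤ ∞ :=
    (WithTop.coe_le_coe.2 le_top : ((2 : ℕ∞) : WithTop ℕ∞) ≤ ((⊤ : ℕ∞) : WithTop ℕ∞))
  have : IsManifold 𝓘(ℝ, E) (minSmoothness ℝ 2) G := by
    simpa using IsManifold.of_le (n := ∞) h2le
  have hne : (∞ : WithTop ℕ∞) ≠ 0 := by simp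
  have h1 : ContMDiffAt 𝓘(ℝ, E) 𝓘(ℝ, E) ∞ (extChartAt 𝓘(ℝ, E) p).symm y :=
    (contMDiffOn_extChartAt_symm p).contMDiffAt ((isOpen_extChartAt_target p).mem_nhds hy)
  have h2 := VectorField.mpullback_mlieBracket (n := ∞)
    ((hX.contMDiffAt (x := (extChartAt 𝓘(ℝ, E) p).symm y)).mdifferentiableAt hne)
    ((hY.contMDiffAt (x := (extChartAt 𝓘(ℝ, E) p).symm y)).mdifferentiableAt hne) h1 (by simpa using h2le)
  refine Eq.trans ?_ h2.symm
  rw [← VectorField.mlieBracketWithin_univ, VectorField.mlieBracketWithin_eq_lieBracketWithin]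
  show _ = VectorField.lieBracketWithin ℝ (chartField p X) (chartField p Y) univ y
  rw [VectorField.lieBracketWithin_univ]
  rfl

theorem smooth_mlieBracket {X Y : (g : G) → TangentSpace 𝓘(ℝ, E) g}
    (hX : ContMDiff 𝓘(ℝ, E) 𝓘(ℝ, E).tangent ∞ (fun g => (⟨g, X g⟩ : TangentBundle 𝓘(ℝ, E) G)))
    (hY : ContMDiff 𝓘(ℝ, E) 𝓘(ℝ, E).tangent ∞ (fun g => (⟨g, Y g⟩ : TangentBundle 𝓘(ℝ, E) G))) :
    ContMDiff 𝓘(ℝ, E) 𝓘(ℝ, E).tangent ∞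
      (fun g => (⟨g, VectorField.mlieBracket 𝓘(ℝ, E) X Y g⟩ : TangentBundle 𝓘(ℝ, E) G)) := by
  have : CompleteSpace E := FiniteDimensional.complete ℝ E
  have h2le : (2 : WithTop ℕ∞) ≤ ∞ :=
    (WithTop.coe_le_coe.2 le_top : ((2 : ℕ∞) : WithTop ℕ∞) ≤ ((⊤ : ℕ∞) : WithTop ℕ∞))
  have : IsManifold 𝓘(ℝ, E) (minSmoothness ℝ 2) G := by
    simpa using IsManifold.of_le (n := ∞) h2le
  have : IsManifold 𝓘(ℝ, E) (((⊤ : ℕ∞) : WithTop ℕ∞) + 1) G := by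
    show IsManifold 𝓘(ℝ, E) (∞ + 1) G
    simpa using (inferInstance : IsManifold 𝓘(ℝ, E) ∞ G)
  exact fun g => ContMDiffAt.mlieBracket_vectorField (m := ⊤) (n := ⊤) (hX g) (hY g) (by simp)

end ChartFields


/-! ### Frame coefficients and the Maurer-Cartan equation -/

section FrameCoefficients

variable {A E K K' : Type*} [NormedAddCommGroup A] [NormedSpace ℝ A]
  [NormedAddCommGroup E] [NormedSpace ℝ E]
  [NormedAddCommGroup K] [NormedSpace ℝ K] [FiniteDimensional ℝ K]
  [NormedAddCommGroup K'] [NormedSpace ℝ K'] [FiniteDimensional ℝ E]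

/-- Partial derivatives taking values in the span of a frame depend smoothly on this frame. -/
theorem exists_frame_coefficients {Λ : E → K →L[ℝ] E} {O : Set E} (hO : IsOpen O)
    (hΛ : ContDiffOn ℝ ∞ Λ O) {e : A → E} {O' : Set A} (hO' : IsOpen O')
    (he : ContDiffOn ℝ ∞ e O') (heO : MapsTo e O' O) (ι : K' →L[ℝ] A) {q₀ : A} (hq₀ : q₀ ∈ O')
    (hinj : Function.Injective (Λ (e q₀)))
    (hran : ∀ q ∈ O', ∀ β, ∃ κ, Λ (e q) κ = fderiv ℝ e q (ι β)) :
    ∃ (O'' : Set A) (B : A → K' →L[ℝ] K), IsOpen O'' ∧ q₀ ∈ O'' ∧ O'' ⊆ O' ∧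
      ContDiffOn ℝ ∞ B O'' ∧ ∀ q ∈ O'', ∀ β, fderiv ℝ e q (ι β) = Λ (e q) (B q β) := by
  have : CompleteSpace K := FiniteDimensional.complete ℝ K
  -- A left inverse `P` of the frame at `q₀` stays invertible on the frame nearby: `N = P Λ(e)` is
  -- the identity at `q₀`. Hence the coefficients are `N⁻¹ P De`, which depends smoothly on `q`.
  obtain ⟨P₀, hP₀⟩ := (Λ (e q₀)).toLinearMap.exists_leftInverse_of_injective
    (LinearMap.ker_eq_bot.2 hinj)
  let P : E →L[ℝ] K := LinearMap.toContinuousLinearMap P₀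
  let N : A → K →L[ℝ] K := fun q => P ∘L Λ (e q)
  have hN : ContDiffOn ℝ ∞ N O' := contDiffOn_const.clm_comp (hΛ.comp he heO)
  have hN0 : N q₀ = ContinuousLinearEquiv.refl ℝ K := by
    ext κ
    exact congrArg (fun L : K →ₗ[ℝ] K => L κ) hP₀
  let O'' : Set A := O' ∩ N ⁻¹' range ((↑) : (K ≃L[ℝ] K) → K →L[ℝ] K)
  have hO'' : IsOpen O'' := hN.continuousOn.isOpen_inter_preimage hO' (ContinuousLinearEquiv.isOpen)
  let B : A → K' →L[ℝ] K := fun q => (N q).inverse ∘L P ∘L fderiv ℝ e q ∘L ι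
  refine ⟨O'', B, hO'', ⟨hq₀, ⟨_, hN0.symm⟩⟩, inter_subset_left, ?_, fun q hq β => ?_⟩
  · have h1 : ContDiffOn ℝ ∞ (fderiv ℝ e) O' :=
      he.fderiv_of_isOpen hO' (by simp)
    have h2 : ContDiffOn ℝ ∞ (fun q => (N q).inverse) O'' := fun q hq => by
      obtain ⟨e', he'⟩ := hq.2
      have h3 : ContDiffAt ℝ ∞ ContinuousLinearMap.inverse (N q) := by
        rw [← he']; exact contDiffAt_map_inverse e'
      exact h3.comp_contDiffWithinAt q (hN.mono inter_subset_left q hq)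
    exact h2.clm_comp (contDiffOn_const.clm_comp
      ((h1.mono inter_subset_left).clm_comp contDiffOn_const))
  · obtain ⟨κ, hκ⟩ := hran q hq.1 β
    obtain ⟨e', he'⟩ := hq.2
    have h1 : B q β = κ := by
      show (N q).inverse (P (fderiv ℝ e q (ι β))) = κ
      rw [← hκ]
      show (N q).inverse (N q κ) = κ
      rw [← he', ContinuousLinearMap.inverse_equiv]
      exact e'.symm_apply_apply κ
    rw [h1, hκ]

omit [FiniteDimensional ℝ K] [FiniteDimensional ℝ E] in
/-- The Maurer-Cartan equation. -/
theorem maurer_cartan {Λ : E → K →L[ℝ] E} {e : A → E} {O' : Set A} (hO' : IsOpen O')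
    (he : ContDiffOn ℝ ∞ e O') {ι : K' →L[ℝ] A} {B : A → K' →L[ℝ] K} (hB : ContDiffOn ℝ ∞ B O')
    (heq : ∀ q ∈ O', ∀ β, fderiv ℝ e q (ι β) = Λ (e q) (B q β)) {q : A} (hq : q ∈ O')
    (hΛ : DifferentiableAt ℝ Λ (e q)) (hinj : Function.Injective (Λ (e q))) {c : K → K → K}
    (hbr : ∀ ξ η, fderiv ℝ Λ (e q) (Λ (e q) ξ) η - fderiv ℝ Λ (e q) (Λ (e q) η) ξ =
      Λ (e q) (c ξ η)) (a b : K') :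
    c (B q a) (B q b) + fderiv ℝ B q (ι a) b - fderiv ℝ B q (ι b) a = 0 := by
  have hea := he.contDiffAt (hO'.mem_nhds hq)
  have hne : (∞ : WithTop ℕ∞) ≠ 0 := by simp
  have hed := (hea.differentiableAt hne).hasFDerivAt
  have hBd := ((hB.contDiffAt (hO'.mem_nhds hq)).differentiableAt hne).hasFDerivAt
  have hd2 : HasFDerivAt (fderiv ℝ e) (fderiv ℝ (fderiv ℝ e) q) q :=
    ((hea.fderiv_right (m := ∞) (by simp)).differentiableAt hne).hasFDerivAt
  -- The equation `De (ι b) = Λ(e) B b` is differentiated in the direction `ι a`. Symmetry of the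
  -- second derivative, the bracket relation and injectivity of the frame give the result.
  have key : ∀ a b, fderiv ℝ (fderiv ℝ e) q (ι a) (ι b) =
      fderiv ℝ Λ (e q) (Λ (e q) (B q a)) (B q b) + Λ (e q) (fderiv ℝ B q (ι a) b) := by
    intro a b
    have h1 : HasFDerivAt (fun q => fderiv ℝ e q (ι b))
        ((ContinuousLinearMap.apply ℝ E (ι b)) ∘L fderiv ℝ (fderiv ℝ e) q) q :=
      (ContinuousLinearMap.apply ℝ E (ι b)).hasFDerivAt.comp q hd2
    have h2 : HasFDerivAt (fun q => B q b)
        ((ContinuousLinearMap.apply ℝ K b) ∘L fderiv ℝ B q) q :=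
      (ContinuousLinearMap.apply ℝ K b).hasFDerivAt.comp q hBd
    have h3 := (hΛ.hasFDerivAt.comp q hed).clm_apply h2
    have h4 := h1.congr_of_eventuallyEq (f₁ := fun q => Λ (e q) (B q b))
      (Filter.eventually_of_mem (hO'.mem_nhds hq) fun q' hq' => (heq q' hq' b).symm)
    have h5 := congrArg (fun L : A →L[ℝ] E => L (ι a)) (h4.unique h3)
    simp only [ContinuousLinearMap.comp_apply, ContinuousLinearMap.apply_apply, add_apply,
      ContinuousLinearMap.flip_apply, heq q hq a] at h5
    rw [h5, add_comm]
    rfl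
  have hsym : IsSymmSndFDerivAt ℝ e q := hea.isSymmSndFDerivAt (by
    simpa using (ENat.LEInfty.out : (2 : WithTop ℕ∞) ≤ ∞))
  have h1 := hsym.eq (ι a) (ι b)
  rw [key, key] at h1
  have h2 := hbr (B q a) (B q b)
  refine hinj ?_
  rw [map_sub, map_add, map_zero, ← h2]
  rw [← sub_eq_zero] at h1
  rw [← h1]
  abel

end FrameCoefficients

/-! ### Abstract left-invariant fields and their frames -/

section Parallelism

variable {E F : Type*} [NormedAddCommGroup E] [NormedSpace ℝ E] [FiniteDimensional ℝ E]
  [NormedAddCommGroup F] [NormedSpace ℝ F] [FiniteDimensional ℝ F]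
  {M : Type*} [TopologicalSpace M] [ChartedSpace F M] [IsManifold 𝓘(ℝ, F) ∞ M]
  {G : Type*} [TopologicalSpace G] [ChartedSpace E G] [IsManifold 𝓘(ℝ, E) ∞ G]

/-- `Λ` is a frame of the tangent spaces of the target fibres over `W`, consisting of members
of the family `fields` of vector fields. -/
structure IsFrame (S : ArrowSpace E F M G) (fields : Set ((g : G) → TangentSpace 𝓘(ℝ, E) g))
    {K : Submodule ℝ E} (W : Set M) (Λ : G → K →ₗ[ℝ] E) : Prop where
  isOpen : IsOpen W
  mem : ∀ κ, (fun g => Λ g κ) ∈ fields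
  injective : ∀ g, S.s g ∈ W → Function.Injective (Λ g)
  surjective : ∀ g, S.s g ∈ W → ∀ v ∈ S.Tt g, ∃ κ, Λ g κ = v
  determined : ∀ X ∈ fields, ∀ g, S.s g ∈ W → ∀ κ,
    Λ (S.u (S.s g)) κ = X (S.u (S.s g)) → Λ g κ = X g

/-- A family of vector fields with the properties of the left-invariant ones. -/
structure LeftParallelism (S : ArrowSpace E F M G) where
  /-- the vector fields -/
  fields : Set ((g : G) → TangentSpace 𝓘(ℝ, E) g)
  smooth : ∀ X ∈ fields, ContMDiff 𝓘(ℝ, E) 𝓘(ℝ, E).tangent ∞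
    (fun g => (⟨g, X g⟩ : TangentBundle 𝓘(ℝ, E) G))
  tangent : ∀ X ∈ fields, ∀ g, X g ∈ S.Tt g
  smul : ∀ X ∈ fields, ∀ f : M → ℝ, ContMDiff 𝓘(ℝ, F) 𝓘(ℝ, ℝ) ∞ f →
    (fun g => f (S.s g) • X g) ∈ fields
  frame : ∀ x, ∃ (K : Submodule ℝ E) (W : Set M) (Λ : G → K →ₗ[ℝ] E), x ∈ W ∧
    IsFrame S fields W Λ

/-- The coordinate expression of a frame in the preferred chart at `p`. -/
noncomputable def chartFrame {K : Submodule ℝ E} (p : G) (Λ : G → K →ₗ[ℝ] E) (y : E) : K →L[ℝ] E :=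
  LinearMap.toContinuousLinearMap
    ((mfderiv 𝓘(ℝ, E) 𝓘(ℝ, E) (extChartAt 𝓘(ℝ, E) p).symm y).inverse.toLinearMap ∘ₗ
      Λ ((extChartAt 𝓘(ℝ, E) p).symm y))

omit [IsManifold 𝓘(ℝ, E) ∞ G] in
theorem chartFrame_apply {K : Submodule ℝ E} (p : G) (Λ : G → K →ₗ[ℝ] E) (y : E) (κ : K) :
    chartFrame p Λ y κ = chartField p (fun g => Λ g κ) y := rfl

variable {S : ArrowSpace E F M G} (𝓛 : LeftParallelism S) {K : Submodule ℝ E} {W : Set M}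
  {Λ : G → K →ₗ[ℝ] E}

omit [FiniteDimensional ℝ F] [IsManifold 𝓘(ℝ, F) ∞ M] in
theorem IsFrame.contDiffOn_chartFrame (hΛ : IsFrame S 𝓛.fields W Λ) (p : G) :
    ContDiffOn ℝ ∞ (chartFrame p Λ) (extChartAt 𝓘(ℝ, E) p).target :=
  contDiffOn_clm_apply.2 fun κ => contDiffOn_chartField p (𝓛.smooth _ (hΛ.mem κ))

omit [FiniteDimensional ℝ F] [IsManifold 𝓘(ℝ, F) ∞ M] in
theorem IsFrame.injective_chartFrame (hΛ : IsFrame S 𝓛.fields W Λ) {p : G} {y : E}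
    (hy : y ∈ (extChartAt 𝓘(ℝ, E) p).target)
    (hW : S.s ((extChartAt 𝓘(ℝ, E) p).symm y) ∈ W) : Function.Injective (chartFrame p Λ y) := by
  intro κ κ' h
  obtain ⟨A, hA, -⟩ := hasMFDerivAt_chart_symm hy
  refine hΛ.injective _ hW ?_
  have h1 := chartField_spec hy hA (fun g => Λ g κ)
  have h2 := chartField_spec hy hA (fun g => Λ g κ')
  rw [← chartFrame_apply] at h1 h2
  rw [h] at h1
  exact h1.symm.trans h2

/-- Coordinates on the target fibres, with the coefficients of the partial derivatives with
respect to a frame. -/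
theorem IsFrame.exists_slice_coords (hΛ : IsFrame S 𝓛.fields W Λ) {K' : Submodule ℝ E}
    (Φ : FibreChart (E := E) (F := F) S.t K') {h₀ : G} (h₀s : h₀ ∈ Φ.e.source)
    (h₀W : S.s h₀ ∈ W) {j : F × K' → G}
    (hj : j = fun q => Φ.e.symm ((extChartAt 𝓘(ℝ, F) (S.t h₀)).symm q.1, q.2)) :
    ∃ (O : Set (F × K')) (B : F × K' → K' →L[ℝ] K), IsOpen O ∧
      (extChartAt 𝓘(ℝ, F) (S.t h₀) (S.t h₀), (Φ.e h₀).2) ∈ O ∧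
      ContDiffOn ℝ ∞ (fun q => extChartAt 𝓘(ℝ, E) h₀ (j q)) O ∧ ContDiffOn ℝ ∞ B O ∧
      ∀ q ∈ O, q.1 ∈ (extChartAt 𝓘(ℝ, F) (S.t h₀)).target ∧
        ((extChartAt 𝓘(ℝ, F) (S.t h₀)).symm q.1, q.2) ∈ Φ.e.target ∧
        j q ∈ (extChartAt 𝓘(ℝ, E) h₀).source ∧ S.s (j q) ∈ W ∧
        ∀ β, fderiv ℝ (fun q => extChartAt 𝓘(ℝ, E) h₀ (j q)) q (0, β) =
          chartFrame h₀ Λ (extChartAt 𝓘(ℝ, E) h₀ (j q)) (B q β) := by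
  have hne : (∞ : WithTop ℕ∞) ≠ 0 := by simp
  set c := extChartAt 𝓘(ℝ, E) h₀ with hc
  set b := extChartAt 𝓘(ℝ, F) (S.t h₀) with hb
  have hbo : IsOpen b.target := isOpen_extChartAt_target _
  have hco : IsOpen c.source := isOpen_extChartAt_source _
  have hbs : ContMDiffOn 𝓘(ℝ, F) 𝓘(ℝ, F) ∞ b.symm b.target := contMDiffOn_extChartAt_symm _
  have hcs : ContMDiffOn 𝓘(ℝ, E) 𝓘(ℝ, E) ∞ c c.source := by
    rw [hc, extChartAt_source]; exact contMDiffOn_extChartAt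
  let T : Set (F × K') := b.target ×ˢ univ
  have hT : IsOpen T := hbo.prod isOpen_univ
  have hbT : ContMDiffOn 𝓘(ℝ, F × K') (𝓘(ℝ, F).prod 𝓘(ℝ, K')) ∞
      (fun q : F × K' => (b.symm q.1, q.2)) T := by
    refine ContMDiffOn.prodMk (hbs.comp (contDiff_fst.contMDiff).contMDiffOn fun q hq => hq.1)
      contDiff_snd.contMDiff.contMDiffOn
  let T₁ : Set (F × K') := T ∩ (fun q => (b.symm q.1, q.2)) ⁻¹' Φ.e.target
  have hT₁ : IsOpen T₁ := hbT.continuousOn.isOpen_inter_preimage hT Φ.e.open_target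
  have hjT : ContMDiffOn 𝓘(ℝ, F × K') 𝓘(ℝ, E) ∞ j T₁ := by
    rw [hj]
    exact Φ.smooth_symm.comp (hbT.mono inter_subset_left) fun q hq => hq.2
  let T₂ : Set (F × K') := T₁ ∩ j ⁻¹' (c.source ∩ S.s ⁻¹' W)
  have hT₂ : IsOpen T₂ := hjT.continuousOn.isOpen_inter_preimage hT₁
    (hco.inter (hΛ.isOpen.preimage S.smooth_s.continuous))
  have hê : ContDiffOn ℝ ∞ (fun q => c (j q)) T₂ := by
    rw [← contMDiffOn_iff_contDiffOn]
    exact hcs.comp (hjT.mono inter_subset_left) fun q hq => hq.2.1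
  have hbt : b.symm (b (S.t h₀)) = S.t h₀ := b.left_inv (mem_extChartAt_source _)
  have heq0 : (S.t h₀, (Φ.e h₀).2) = Φ.e h₀ := by rw [← Φ.fst_eq _ h₀s]
  have hj0 : j (b (S.t h₀), (Φ.e h₀).2) = h₀ := by
    rw [hj]
    show Φ.e.symm (b.symm (b (S.t h₀)), (Φ.e h₀).2) = h₀
    rw [hbt, heq0, Φ.e.left_inv h₀s]
  have hq₀ : (b (S.t h₀), (Φ.e h₀).2) ∈ T₂ := by
    refine ⟨⟨⟨mem_extChartAt_target _, mem_univ _⟩, ?_⟩, ?_⟩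
    · show (b.symm (b (S.t h₀)), (Φ.e h₀).2) ∈ Φ.e.target
      rw [hbt, heq0]; exact Φ.e.map_source h₀s
    · rw [mem_preimage, hj0]; exact ⟨mem_extChartAt_source _, h₀W⟩
  -- The target of `j q` depends on `q.1` only, so the derivative in a fibre direction is tangent to
  -- a target fibre and hence a combination of the frame.
  have hran : ∀ q ∈ T₂, ∀ β, ∃ κ, chartFrame h₀ Λ (c (j q)) κ =
      fderiv ℝ (fun q => c (j q)) q (ContinuousLinearMap.inr ℝ F K' β) := by
    intro q hq β
    have hcy : c (j q) ∈ c.target := c.map_source hq.2.1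
    obtain ⟨A, hA, -⟩ := hasMFDerivAt_chart_symm hcy
    have hD : HasMFDerivAt 𝓘(ℝ, F × K') 𝓘(ℝ, E) (fun q => c (j q)) q
        (fderiv ℝ (fun q => c (j q)) q) :=
      (((hê.contDiffAt (hT₂.mem_nhds hq)).differentiableAt hne).hasFDerivAt).hasMFDerivAt
    set D := fderiv ℝ (fun q => c (j q)) q
    have ht := ((S.smooth_t.contMDiffAt (x := c.symm (c (j q)))).mdifferentiableAt
      hne).hasMFDerivAt
    have h1 := ht.comp q (hA.comp q hD)
    have hbd : HasMFDerivAt 𝓘(ℝ, F) 𝓘(ℝ, F) b.symm q.1 _ :=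
      ((hbs.contMDiffAt (hbo.mem_nhds hq.1.1.1)).mdifferentiableAt hne).hasMFDerivAt
    have h2 := hbd.comp q (hasFDerivAt_fst (𝕜 := ℝ) (p := q)).hasMFDerivAt
    have h3 := h2.congr_of_eventuallyEq (f₁ := S.t ∘ (c.symm ∘ fun q => c (j q)))
      (Filter.eventually_of_mem (hT₂.mem_nhds hq) fun q' hq' => by
        show S.t (c.symm (c (j q'))) = b.symm q'.1
        rw [c.left_inv hq'.2.1, hj, ← Φ.fst_eq _ (Φ.e.map_target hq'.1.2),
          Φ.e.right_inv hq'.1.2])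
    have h4 : mfderiv 𝓘(ℝ, E) 𝓘(ℝ, F) S.t (c.symm (c (j q))) (A (D (0, β))) = (0 : F) := by
      refine (congrArg (fun L : F × K' →L[ℝ] F => L (0, β)) (hasMFDerivAt_unique h1 h3)).trans ?_
      exact map_zero (mfderiv 𝓘(ℝ, F) 𝓘(ℝ, F) b.symm q.1)
    have hsW : S.s (c.symm (c (j q))) ∈ W := by rw [c.left_inv hq.2.1]; exact hq.2.2
    obtain ⟨κ, hκ⟩ := hΛ.surjective _ hsW _ h4
    refine ⟨κ, A.injective ?_⟩
    rw [chartFrame_apply]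
    exact (chartField_spec hcy hA (fun g => Λ g κ)).trans hκ
  obtain ⟨O, B, hO, hqO, hOT, hB, hBe⟩ := exists_frame_coefficients
    (isOpen_extChartAt_target (I := 𝓘(ℝ, E)) h₀) (hΛ.contDiffOn_chartFrame 𝓛 h₀) hT₂ hê
    (fun q hq => c.map_source hq.2.1) (ContinuousLinearMap.inr ℝ F K') hq₀
    (hΛ.injective_chartFrame 𝓛 (c.map_source hq₀.2.1) (by
      show S.s (c.symm (c (j _))) ∈ W
      rw [c.left_inv hq₀.2.1]; exact hq₀.2.2)) hran
  exact ⟨O, B, hO, hqO, hê.mono hOT, hB, fun q hq => ⟨(hOT hq).1.1.1, (hOT hq).1.2, (hOT hq).2.1,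
    (hOT hq).2.2, hBe q hq⟩⟩

end Parallelism


/-! ### Maps of fibres preserving a parallelism -/

section Preserves

variable {E F : Type*} [NormedAddCommGroup E] [NormedSpace ℝ E] [FiniteDimensional ℝ E]
  [NormedAddCommGroup F] [NormedSpace ℝ F] [FiniteDimensional ℝ F]
  {M : Type*} [TopologicalSpace M] [ChartedSpace F M] [IsManifold 𝓘(ℝ, F) ∞ M]
  {G : Type*} [TopologicalSpace G] [ChartedSpace E G] [IsManifold 𝓘(ℝ, E) ∞ G]
  {S : ArrowSpace E F M G}

/-- At `h`, the differential of `φ` along the target fibre over `x` maps each of the given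
vector fields to itself. -/
def Preserves (S : ArrowSpace E F M G) (fields : Set ((g : G) → TangentSpace 𝓘(ℝ, E) g)) (x : M)
    (φ : G → G) (h : G) : Prop :=
  ∃ D : E →L[ℝ] E, HasMFDerivWithinAt 𝓘(ℝ, E) 𝓘(ℝ, E) φ (S.t ⁻¹' {x}) h D ∧
    ∀ X ∈ fields, D (X h) = (X (φ h) : E)

omit [FiniteDimensional ℝ E] [FiniteDimensional ℝ F] [IsManifold 𝓘(ℝ, F) ∞ M]
  [IsManifold 𝓘(ℝ, E) ∞ G] in
theorem Preserves.congr {fields : Set ((g : G) → TangentSpace 𝓘(ℝ, E) g)} {x : M} {φ ψ : G → G}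
    {h : G} (hφ : Preserves S fields x φ h) (he : ψ =ᶠ[𝓝[S.t ⁻¹' {x}] h] φ) (heh : ψ h = φ h) :
    Preserves S fields x ψ h := by
  obtain ⟨D, hD, hX⟩ := hφ
  exact ⟨D, hD.congr_of_eventuallyEq he heh, fun X hX' => by rw [hX X hX', heh]⟩

omit [FiniteDimensional ℝ E] [FiniteDimensional ℝ F] [IsManifold 𝓘(ℝ, F) ∞ M]
  [IsManifold 𝓘(ℝ, E) ∞ G] in
theorem Preserves.comp {fields : Set ((g : G) → TangentSpace 𝓘(ℝ, E) g)} {x y : M} {φ ψ : G → G}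
    {h : G} (hψ : Preserves S fields y ψ (φ h)) (hφ : Preserves S fields x φ h)
    (hm : ∀ᶠ h' in 𝓝[S.t ⁻¹' {x}] h, S.t (φ h') = y) :
    Preserves S fields x (ψ ∘ φ) h := by
  obtain ⟨D, hD, hX⟩ := hφ
  obtain ⟨D', hD', hX'⟩ := hψ
  refine ⟨D' ∘L D, ?_, fun X h => ?_⟩
  · have h1 := hD.mono (inter_subset_left (t := {h' | S.t (φ h') = y}))
    have h2 := hD'.comp h h1 fun h' hh => hh.2
    refine (h2.mono_of_mem_nhdsWithin ?_)
    exact Filter.inter_mem self_mem_nhdsWithin hm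
  · show D' (D (X _)) = _
    rw [hX X h]
    exact hX' X h

/-- The velocity of coordinates on a target fibre in terms of a frame. -/
theorem hasMFDerivAt_slice {K K' : Submodule ℝ E} {Λ : G → K →ₗ[ℝ] E} {h₀ : G} {j : F × K' → G}
    {O : Set (F × K')} (hO : IsOpen O) {B : F × K' → K' →L[ℝ] K}
    (hê : ContDiffOn ℝ ∞ (fun q => extChartAt 𝓘(ℝ, E) h₀ (j q)) O)
    (hsrc : ∀ q ∈ O, j q ∈ (extChartAt 𝓘(ℝ, E) h₀).source) {q : F × K'} (hq : q ∈ O)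
    (hd : ∀ β, fderiv ℝ (fun q => extChartAt 𝓘(ℝ, E) h₀ (j q)) q (0, β) =
      chartFrame h₀ Λ (extChartAt 𝓘(ℝ, E) h₀ (j q)) (B q β)) :
    ∃ D : K' →L[ℝ] E, HasMFDerivAt 𝓘(ℝ, K') 𝓘(ℝ, E) (fun a => j (q.1, a)) q.2 D ∧
      ∀ β, D β = (Λ (j q) (B q β) : E) := by
  have hne : (∞ : WithTop ℕ∞) ≠ 0 := by simp
  set c := extChartAt 𝓘(ℝ, E) h₀ with hc
  have hcs := hsrc q hq
  obtain ⟨A, hA, -⟩ := hasMFDerivAt_chart_symm (c.map_source hcs)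
  have h1 : HasFDerivAt (fun a : K' => (q.1, a)) (ContinuousLinearMap.inr ℝ F K') q.2 :=
    hasFDerivAt_prodMk_right _ _
  have h2 := ((hê.contDiffAt (hO.mem_nhds hq)).differentiableAt hne).hasFDerivAt.comp q.2 h1
  have h4 := hA.comp q.2 h2.hasMFDerivAt
  refine ⟨_, h4.congr_of_eventuallyEq (f₁ := fun a => j (q.1, a)) ?_, fun β => ?_⟩
  · filter_upwards [h1.continuousAt.eventually (hO.mem_nhds hq)] with a' ha'
    exact (c.left_inv (hsrc _ ha')).symm
  · have h5 := chartField_spec (c.map_source hcs) hA (fun g => Λ g (B q β))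
    rw [← chartFrame_apply, ← hd β] at h5
    refine h5.trans ?_
    rw [c.left_inv hcs]

/-- Maps of a target fibre that preserve a parallelism are determined by a single value. -/
theorem Preserves.eventuallyEq (𝓛 : LeftParallelism S) {x : M} {h : G} (hx : S.t h = x)
    {φ₁ φ₂ : G → G} (h₁ : ∀ᶠ h' in 𝓝[S.t ⁻¹' {x}] h, Preserves S 𝓛.fields x φ₁ h')
    (h₂ : ∀ᶠ h' in 𝓝[S.t ⁻¹' {x}] h, Preserves S 𝓛.fields x φ₂ h') (he : φ₁ h = φ₂ h) :
    φ₁ =ᶠ[𝓝[S.t ⁻¹' {x}] h] φ₂ := by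
  have hne : (∞ : WithTop ℕ∞) ≠ 0 := by simp
  obtain ⟨K', Φ, hs, hW, hΦ, -⟩ := exists_fibreChart S.smooth_t h (S.submersion_t h)
    (w := fun _ => h) contMDiff_const rfl
  obtain ⟨K, W, Λ, hxW, hΛ⟩ := 𝓛.frame (S.s h)
  obtain ⟨O, B, hO, hqO, hê, hB, hOq⟩ := hΛ.exists_slice_coords 𝓛 Φ hs hxW rfl
  set c := extChartAt 𝓘(ℝ, E) h with hc
  set b := extChartAt 𝓘(ℝ, F) (S.t h) with hb
  have hbt : b.symm (b (S.t h)) = S.t h := b.left_inv (mem_extChartAt_source _)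
  let γ : K' → G := fun a => Φ.e.symm (S.t h, a)
  have hΦ0 : (Φ.e h).2 = 0 := by rw [hΦ]
  rw [hΦ0] at hqO
  have hγ0 : γ 0 = h := by show Φ.e.symm (S.t h, 0) = h; rw [← hΦ, Φ.e.left_inv hs]
  have hγj : ∀ a, Φ.e.symm (b.symm (b (S.t h)), a) = γ a := fun a => by rw [hbt]
  let ι : K' → F × K' := fun a => (b (S.t h), a)
  have hι : Continuous ι := by fun_prop
  have hOι : ∀ᶠ a in 𝓝 (0 : K'), ι a ∈ O := hι.continuousAt.eventually (hO.mem_nhds hqO)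
  have hγt : ∀ a, ι a ∈ O → S.t (γ a) = x := fun a ha => by
    have h1 := (hOq _ ha).2.1
    simp only [ι, hbt] at h1
    rw [← hx, ← Φ.fst_eq _ (Φ.e.map_target h1), Φ.e.right_inv h1]
  have hγd : ∀ a, ι a ∈ O → ∃ Dγ : K' →L[ℝ] E, HasMFDerivAt 𝓘(ℝ, K') 𝓘(ℝ, E) γ a Dγ ∧
      ∀ β, Dγ β = (Λ (γ a) (B (ι a) β) : E) := by
    intro a ha
    obtain ⟨Dγ, hDγ, hDe⟩ := hasMFDerivAt_slice hO hê (fun q hq => (hOq q hq).2.2.1) ha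
      (hOq _ ha).2.2.2.2
    simp only [ι, hγj] at hDe
    exact ⟨Dγ, hDγ.congr_of_eventuallyEq (.of_forall fun a => (hγj a).symm), hDe⟩
  have hγc : ContinuousAt γ 0 := by
    obtain ⟨_, h1, -⟩ := hγd 0 hqO
    exact h1.continuousAt
  have hγx : Filter.Tendsto γ (𝓝 0) (𝓝[S.t ⁻¹' {x}] h) :=
    tendsto_nhdsWithin_iff.2 ⟨by simpa [ContinuousAt, hγ0] using hγc, hOι.mono fun a ha => hγt a ha⟩
  set c' := extChartAt 𝓘(ℝ, E) (φ₁ h) with hc'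
  have hco : IsOpen c'.source := isOpen_extChartAt_source _
  have hsrc : ∀ φ : G → G, (∀ᶠ h' in 𝓝[S.t ⁻¹' {x}] h, Preserves S 𝓛.fields x φ h') →
      φ₁ h = φ h → ∀ᶠ h' in 𝓝[S.t ⁻¹' {x}] h, φ h' ∈ c'.source := by
    intro φ hφ hφh
    obtain ⟨D, hD, -⟩ := hφ.self_of_nhdsWithin hx
    refine hD.continuousWithinAt.eventually (hco.mem_nhds ?_)
    rw [← hφh]; exact mem_extChartAt_source _
  -- In fibre coordinates, the velocity of `γ` is a combination of the frame with coefficients `B`.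
  -- A map preserving the frame keeps these coefficients, so `φ ∘ γ` satisfies a total differential
  -- equation that does not depend on `φ`.
  have hode : ∀ φ : G → G, (∀ᶠ h' in 𝓝[S.t ⁻¹' {x}] h, Preserves S 𝓛.fields x φ h') →
      φ₁ h = φ h → ∀ᶠ a in 𝓝 (0 : K'), HasFDerivAt (fun a => c' (φ (γ a)))
        (chartFrame (φ₁ h) Λ (c' (φ (γ a))) ∘L B (ι a)) a := by
    intro φ hφ hφh
    filter_upwards [hγx.eventually hφ, hγx.eventually (hsrc φ hφ hφh), hOι,
      hOι.eventually_nhds] with a ⟨D, hD, hX⟩ hsa ha haO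
    obtain ⟨Dγ, hDγ, hDγe⟩ := hγd a ha
    have h1 := hasMFDerivAt_comp_curve hD (γ := γ) rfl (haO.mono fun a ha => hγt a ha) hDγ
    obtain ⟨A, hA⟩ : ∃ A : E →L[ℝ] E, HasMFDerivAt 𝓘(ℝ, E) 𝓘(ℝ, E) c' (φ (γ a)) A := by
      obtain ⟨A, -, hA⟩ := hasMFDerivAt_chart_symm (c'.map_source hsa)
      rw [c'.left_inv hsa] at hA
      exact ⟨_, hA⟩
    have h2 := hA.comp a h1
    have h3 : HasFDerivAt (fun a => c' (φ (γ a))) (A ∘L D ∘L Dγ) a := h2.hasFDerivAt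
    convert h3 using 1
    ext β
    show chartFrame (φ₁ h) Λ (c' (φ (γ a))) (B (ι a) β) = A (D (Dγ β))
    rw [hDγe, hX _ (hΛ.mem _), chartFrame_apply]
    exact (chartField_apply hsa hA (fun g => Λ g (B (ι a) β))).symm
  have hBc : ContinuousAt (fun a => B (ι a)) 0 :=
    ((hB.continuousOn.continuousAt (hO.mem_nhds hqO))).comp (f := ι) hι.continuousAt
  have hΛc : ContDiffAt ℝ 1 (chartFrame (φ₁ h) Λ) (c' (φ₁ h)) :=
    ((hΛ.contDiffOn_chartFrame 𝓛 (φ₁ h)).contDiffAt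
      ((isOpen_extChartAt_target _).mem_nhds (mem_extChartAt_target _))).of_le (by simp)
  -- Both maps have the same value at `h`, the point with fibre coordinate `0`.
  have key := eventuallyEq_of_same_equation hΛc hBc
    (show (fun a => c' (φ₁ (γ a))) 0 = _ by simp only [hγ0])
    (show (fun a => c' (φ₂ (γ a))) 0 = _ by simp only [hγ0, he])
    (hode φ₁ h₁ rfl) (hode φ₂ h₂ he)
  have hpull : Filter.Tendsto (fun h' => (Φ.e h').2) (𝓝[S.t ⁻¹' {x}] h) (𝓝 0) := by
    have h1 := (continuous_snd.continuousAt.comp (Φ.e.continuousAt hs)).tendsto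
    simp only [Function.comp_def, hΦ0] at h1
    exact h1.mono_left nhdsWithin_le_nhds
  filter_upwards [hpull.eventually key, hsrc φ₁ h₁ rfl, hsrc φ₂ h₂ he, self_mem_nhdsWithin,
    nhdsWithin_le_nhds (Φ.e.open_source.mem_nhds hs)] with h' h1 h2 h3 h4 h5
  have h6 : γ (Φ.e h').2 = h' := by
    show Φ.e.symm (S.t h, _) = h'
    rw [hx, ← show S.t h' = x from h4, ← Φ.fst_eq _ h5]
    exact Φ.e.left_inv h5
  simp only [h6] at h1
  exact c'.injOn h2 h3 h1

end Preserves


/-! ### Anchor and structure functions of a parallelism closed under brackets -/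

section Anchor

variable {E F : Type*} [NormedAddCommGroup E] [NormedSpace ℝ E] [FiniteDimensional ℝ E]
  [NormedAddCommGroup F] [NormedSpace ℝ F] [FiniteDimensional ℝ F]
  {M : Type*} [TopologicalSpace M] [ChartedSpace F M] [IsManifold 𝓘(ℝ, F) ∞ M] [T2Space M]
  {G : Type*} [TopologicalSpace G] [ChartedSpace E G] [IsManifold 𝓘(ℝ, E) ∞ G]
  {S : ArrowSpace E F M G}

omit [FiniteDimensional ℝ F] [IsManifold 𝓘(ℝ, F) ∞ M] [T2Space M] in
-- By the Leibniz rule `[X, (f ∘ s) X] = X(f ∘ s) X`, and this bracket is again a field of the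
-- family. A field of the family is determined at `g` by its value at `u (s g)`, with the same frame
-- coefficients, so the factor `X(f ∘ s)` must agree at the two points unless `X` vanishes at both.
theorem LeftParallelism.derivation_eq (𝓛 : LeftParallelism S)
    (hbr : ∀ X ∈ 𝓛.fields, ∀ Y ∈ 𝓛.fields, VectorField.mlieBracket 𝓘(ℝ, E) X Y ∈ 𝓛.fields)
    {X : (g : G) → TangentSpace 𝓘(ℝ, E) g} (hX : X ∈ 𝓛.fields) {f : M → ℝ}
    (hf : ContMDiff 𝓘(ℝ, F) 𝓘(ℝ, ℝ) ∞ f) (g : G) :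
    (mfderiv 𝓘(ℝ, E) 𝓘(ℝ, ℝ) (f ∘ S.s) g (X g) : ℝ) =
      mfderiv 𝓘(ℝ, E) 𝓘(ℝ, ℝ) (f ∘ S.s) (S.u (S.s g)) (X (S.u (S.s g))) := by
  have : CompleteSpace E := FiniteDimensional.complete ℝ E
  have hne : (∞ : WithTop ℕ∞) ≠ 0 := by simp
  have : IsManifold 𝓘(ℝ, E) (minSmoothness ℝ 2) G := by
    simpa using IsManifold.of_le (n := ∞) (ENat.LEInfty.out : (2 : WithTop ℕ∞) ≤ ∞)
  have hfs : ContMDiff 𝓘(ℝ, E) 𝓘(ℝ, ℝ) ∞ (f ∘ S.s) := hf.comp S.smooth_s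
  have hZ := hbr X hX _ (𝓛.smul X hX f hf)
  set Z := VectorField.mlieBracket 𝓘(ℝ, E) X (fun g => f (S.s g) • X g) with hZdef
  let δ : G → ℝ := fun g => mfderiv 𝓘(ℝ, E) 𝓘(ℝ, ℝ) (f ∘ S.s) g (X g)
  have hδ : ∀ g, (X g : E) = (0 : E) → δ g = 0 := fun g h =>
    (congrArg (fun v : E => (mfderiv 𝓘(ℝ, E) 𝓘(ℝ, ℝ) (f ∘ S.s) g : E →L[ℝ] ℝ) v) h).trans
      (map_zero (mfderiv 𝓘(ℝ, E) 𝓘(ℝ, ℝ) (f ∘ S.s) g : E →L[ℝ] ℝ))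
  show δ g = δ (S.u (S.s g))
  have hZe : ∀ g, (Z g : E) = δ g • (X g : E) := by
    intro g
    have h1 := VectorField.mlieBracket_smul_right (I := 𝓘(ℝ, E)) (V := X) (W := X) (x := g)
      (f := f ∘ S.s) ((hfs.contMDiffAt (x := g)).mdifferentiableAt hne)
      ((𝓛.smooth X hX).contMDiffAt.mdifferentiableAt hne)
    rw [VectorField.mlieBracket_self] at h1
    refine Eq.trans h1 ?_
    rw [Pi.zero_apply, smul_zero, add_zero]
    rfl
  obtain ⟨K, W, Λ, hgW, hΛ⟩ := 𝓛.frame (S.s g)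
  have huW : S.s (S.u (S.s g)) ∈ W := by rwa [S.s_u]
  obtain ⟨κ, hκ⟩ := hΛ.surjective _ huW _ (𝓛.tangent X hX _)
  have hκg := hΛ.determined X hX g hgW κ hκ
  have h1 : Λ g (δ (S.u (S.s g)) • κ) = Z g := by
    refine hΛ.determined Z hZ g hgW _ ?_
    rw [map_smul]
    exact (congrArg (fun v : E => δ (S.u (S.s g)) • v) hκ).trans (hZe _).symm
  rw [map_smul] at h1
  have h2 : δ (S.u (S.s g)) • (Λ g κ : E) = δ g • (Λ g κ : E) := by
    refine h1.trans ((hZe g).trans ?_)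
    exact congrArg (fun v : E => δ g • v) hκg.symm
  by_cases h3 : Λ g κ = 0
  · have h4 : κ = 0 := hΛ.injective g hgW (h3.trans (map_zero _).symm)
    have h5 : (X g : E) = 0 := hκg.symm.trans h3
    have h6 : (X (S.u (S.s g)) : E) = 0 := by rw [h4, map_zero] at hκ; exact hκ.symm
    rw [hδ _ h5, hδ _ h6]
  · exact (smul_left_injective ℝ h3 h2).symm

omit [FiniteDimensional ℝ E] [IsManifold 𝓘(ℝ, E) ∞ G] [IsManifold 𝓘(ℝ, F) ∞ M] in
theorem exists_smooth_extension [IsManifold 𝓘(ℝ, F) ∞ M] (x : M) (ℓ : F →L[ℝ] ℝ) : ∃ f : M → ℝ,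
    ContMDiff 𝓘(ℝ, F) 𝓘(ℝ, ℝ) ∞ f ∧ f =ᶠ[𝓝 x] fun y => ℓ (extChartAt 𝓘(ℝ, F) x y) := by
  obtain ⟨χ⟩ : Nonempty (SmoothBumpFunction 𝓘(ℝ, F) x) := inferInstance
  refine ⟨_, χ.contMDiff_smul (g := fun y => ℓ (extChartAt 𝓘(ℝ, F) x y))
    (ℓ.contDiff.contMDiff.comp_contMDiffOn contMDiffOn_extChartAt), ?_⟩
  filter_upwards [χ.eventuallyEq_one] with y hy
  rw [hy]
  simp

/-- The vector fields of a parallelism closed under brackets are projectable along the source. -/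
theorem LeftParallelism.source_deriv_eq (𝓛 : LeftParallelism S)
    (hbr : ∀ X ∈ 𝓛.fields, ∀ Y ∈ 𝓛.fields, VectorField.mlieBracket 𝓘(ℝ, E) X Y ∈ 𝓛.fields)
    {X : (g : G) → TangentSpace 𝓘(ℝ, E) g} (hX : X ∈ 𝓛.fields) (g : G) :
    (mfderiv 𝓘(ℝ, E) 𝓘(ℝ, F) S.s g (X g) : F) =
      mfderiv 𝓘(ℝ, E) 𝓘(ℝ, F) S.s (S.u (S.s g)) (X (S.u (S.s g))) := by
  have hne : (∞ : WithTop ℕ∞) ≠ 0 := by simp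
  obtain ⟨x, hx⟩ : ∃ x, x = S.s g := ⟨_, rfl⟩
  obtain ⟨A, -, hA⟩ := hasMFDerivAt_chart_symm (E := F) (p := x) (mem_extChartAt_target x)
  rw [extChartAt_to_inv] at hA
  have key : ∀ g', S.s g' = x → ∀ (ℓ : F →L[ℝ] ℝ) (f : M → ℝ),
      f =ᶠ[𝓝 x] (fun y => ℓ (extChartAt 𝓘(ℝ, F) x y)) → ∀ v : E,
      (mfderiv 𝓘(ℝ, E) 𝓘(ℝ, ℝ) (f ∘ S.s) g' v : ℝ) =
        ℓ (A.symm (mfderiv 𝓘(ℝ, E) 𝓘(ℝ, F) S.s g' v : F)) := by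
    intro g' hg' ℓ f hf v
    subst hg'
    have h1 : HasMFDerivAt 𝓘(ℝ, F) 𝓘(ℝ, ℝ) f (S.s g') (ℓ ∘L (A.symm : F →L[ℝ] F)) :=
      (HasMFDerivAt.comp (S.s g') (ℓ.hasFDerivAt.hasMFDerivAt) hA).congr_of_eventuallyEq hf
    have h2 := h1.comp g' ((S.smooth_s.contMDiffAt (x := g')).mdifferentiableAt hne).hasMFDerivAt
    rw [h2.mfderiv]
    rfl
  refine A.symm.injective ((SeparatingDual.eq_iff_forall_dual_eq (R := ℝ)).2 fun ℓ => ?_)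
  -- Vectors of the base are compared through linear functionals in a chart, each realized by a
  -- globally defined smooth function so that `derivation_eq` applies.
  obtain ⟨f, hf, hfx⟩ := exists_smooth_extension x ℓ
  have h1 := 𝓛.derivation_eq hbr hX hf g
  exact (key g hx.symm ℓ f hfx _).symm.trans (h1.trans (key _ ((S.s_u _).trans hx.symm) ℓ f hfx _))

variable {K : Submodule ℝ E} {W : Set M} {Λ : G → K →ₗ[ℝ] E}

omit [T2Space M] in
theorem chart_source_deriv {p : G} {y : E} (hy : y ∈ (extChartAt 𝓘(ℝ, E) p).target) {x x₀ : M}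
    (hx : S.s ((extChartAt 𝓘(ℝ, E) p).symm y) = x) (hx₀ : x ∈ (extChartAt 𝓘(ℝ, F) x₀).source)
    (κ : K) :
    fderiv ℝ (fun y => extChartAt 𝓘(ℝ, F) x₀ (S.s ((extChartAt 𝓘(ℝ, E) p).symm y))) y
      (chartFrame p Λ y κ) = mfderiv 𝓘(ℝ, F) 𝓘(ℝ, F) (extChartAt 𝓘(ℝ, F) x₀) x
        (mfderiv 𝓘(ℝ, E) 𝓘(ℝ, F) S.s ((extChartAt 𝓘(ℝ, E) p).symm y)
          (Λ ((extChartAt 𝓘(ℝ, E) p).symm y) κ) : F) := by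
  have hne : (∞ : WithTop ℕ∞) ≠ 0 := by simp
  subst hx
  obtain ⟨A, hA, -⟩ := hasMFDerivAt_chart_symm hy
  have h1 := (S.smooth_s.contMDiffAt (x := (extChartAt 𝓘(ℝ, E) p).symm y)).mdifferentiableAt hne
  have h2 : MDifferentiableAt 𝓘(ℝ, F) 𝓘(ℝ, F) (extChartAt 𝓘(ℝ, F) x₀)
      (S.s ((extChartAt 𝓘(ℝ, E) p).symm y)) :=
    mdifferentiableAt_extChartAt (by rwa [extChartAt_source] at hx₀)
  have h3 := (h2.hasMFDerivAt.comp _ h1.hasMFDerivAt).comp y hA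
  obtain ⟨D, hD⟩ : ∃ D : E →L[ℝ] F, D = (mfderiv 𝓘(ℝ, F) 𝓘(ℝ, F) (extChartAt 𝓘(ℝ, F) x₀)
      (S.s ((extChartAt 𝓘(ℝ, E) p).symm y)) : F →L[ℝ] F) ∘L (mfderiv 𝓘(ℝ, E) 𝓘(ℝ, F) S.s
        ((extChartAt 𝓘(ℝ, E) p).symm y) : E →L[ℝ] F) ∘L (A : E →L[ℝ] E) := ⟨_, rfl⟩
  have h4 : HasFDerivAt
      (fun y => extChartAt 𝓘(ℝ, F) x₀ (S.s ((extChartAt 𝓘(ℝ, E) p).symm y))) D y := by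
    rw [hD]; exact h3.hasFDerivAt
  have h5 := chartField_spec hy hA (fun g => Λ g κ)
  have h6 := congrArg (fun L : E →L[ℝ] F => L (chartFrame p Λ y κ)) h4.fderiv
  refine Eq.trans h6 ?_
  rw [chartFrame_apply, hD]
  exact congrArg (fun v : E => (mfderiv 𝓘(ℝ, F) 𝓘(ℝ, F) (extChartAt 𝓘(ℝ, F) x₀)
      (S.s ((extChartAt 𝓘(ℝ, E) p).symm y)) (mfderiv 𝓘(ℝ, E) 𝓘(ℝ, F) S.s
        ((extChartAt 𝓘(ℝ, E) p).symm y) v : F) : F)) h5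

/-- The coordinate expression of the anchor map. -/
theorem IsFrame.exists_anchor (𝓛 : LeftParallelism S) (hΛ : IsFrame S 𝓛.fields W Λ)
    (hbr : ∀ X ∈ 𝓛.fields, ∀ Y ∈ 𝓛.fields, VectorField.mlieBracket 𝓘(ℝ, E) X Y ∈ 𝓛.fields)
    {x₀ : M} (hx₀ : x₀ ∈ W) :
    ∃ (O : Set F) (ρ : F → K →L[ℝ] F), IsOpen O ∧ extChartAt 𝓘(ℝ, F) x₀ x₀ ∈ O ∧
      ContDiffOn ℝ ∞ ρ O ∧ ∀ (p : G), ∀ y ∈ (extChartAt 𝓘(ℝ, E) p).target,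
        S.s ((extChartAt 𝓘(ℝ, E) p).symm y) ∈ (extChartAt 𝓘(ℝ, F) x₀).source →
        extChartAt 𝓘(ℝ, F) x₀ (S.s ((extChartAt 𝓘(ℝ, E) p).symm y)) ∈ O → ∀ κ,
        fderiv ℝ (fun y => extChartAt 𝓘(ℝ, F) x₀ (S.s ((extChartAt 𝓘(ℝ, E) p).symm y))) y
          (chartFrame p Λ y κ) =
        ρ (extChartAt 𝓘(ℝ, F) x₀ (S.s ((extChartAt 𝓘(ℝ, E) p).symm y))) κ := by
  set b := extChartAt 𝓘(ℝ, F) x₀ with hb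
  set c := extChartAt 𝓘(ℝ, E) (S.u x₀) with hc
  have hbo : IsOpen b.target := isOpen_extChartAt_target _
  have hbs : IsOpen b.source := isOpen_extChartAt_source _
  have hcs : IsOpen c.source := isOpen_extChartAt_source _
  have hct : IsOpen c.target := isOpen_extChartAt_target _
  have hbm : ContMDiffOn 𝓘(ℝ, F) 𝓘(ℝ, F) ∞ b.symm b.target := contMDiffOn_extChartAt_symm _
  have hbm' : ContMDiffOn 𝓘(ℝ, F) 𝓘(ℝ, F) ∞ b b.source := by
    rw [hb, extChartAt_source]; exact contMDiffOn_extChartAt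
  have hcm : ContMDiffOn 𝓘(ℝ, E) 𝓘(ℝ, E) ∞ c.symm c.target := contMDiffOn_extChartAt_symm _
  have hcm' : ContMDiffOn 𝓘(ℝ, E) 𝓘(ℝ, E) ∞ c c.source := by
    rw [hc, extChartAt_source]; exact contMDiffOn_extChartAt
  let Q : Set M := W ∩ S.u ⁻¹' c.source
  have hQ : IsOpen Q := hΛ.isOpen.inter (hcs.preimage S.smooth_u.continuous)
  let O : Set F := b.target ∩ b.symm ⁻¹' Q
  have hO : IsOpen O := hbm.continuousOn.isOpen_inter_preimage hbo hQ
  let w : F → E := fun x => c (S.u (b.symm x))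
  have hw : ContDiffOn ℝ ∞ w O := by
    rw [← contMDiffOn_iff_contDiffOn]
    exact hcm'.comp (S.smooth_u.comp_contMDiffOn (hbm.mono inter_subset_left)) fun x hx => hx.2.2
  let σ : E → F := fun y => b (S.s (c.symm y))
  let D : Set E := c.target ∩ (S.s ∘ c.symm) ⁻¹' b.source
  have hD : IsOpen D :=
    (S.smooth_s.continuous.comp_continuousOn hcm.continuousOn).isOpen_inter_preimage hct hbs
  have hσ : ContDiffOn ℝ ∞ σ D := by
    rw [← contMDiffOn_iff_contDiffOn]
    exact hbm'.comp (S.smooth_s.comp_contMDiffOn (hcm.mono inter_subset_left)) fun y hy => hy.2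
  have hcw : ∀ x ∈ O, c.symm (w x) = S.u (b.symm x) := fun x hx => c.left_inv hx.2.2
  have hwD : MapsTo w O D := fun x hx => ⟨c.map_source hx.2.2, by
    show S.s (c.symm (w x)) ∈ b.source
    rw [hcw x hx, S.s_u]; exact b.map_target hx.1⟩
  -- The anchor is read off at the unit over `x`, with coordinate `w x`. Projectability along the
  -- source makes it valid at all arrows with source `x`.
  refine ⟨O, fun x => fderiv ℝ σ (w x) ∘L chartFrame (S.u x₀) Λ (w x), hO, ?_, ?_, ?_⟩
  · refine ⟨mem_extChartAt_target _, ?_⟩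
    rw [mem_preimage, extChartAt_to_inv]
    exact ⟨hx₀, mem_extChartAt_source _⟩
  · exact ((hσ.fderiv_of_isOpen hD (m := ∞) (by simp)).comp hw hwD).clm_comp
      ((hΛ.contDiffOn_chartFrame 𝓛 (S.u x₀)).comp hw fun x hx => (hwD hx).1)
  · intro p y hy hsb hsO κ
    have h1 := b.left_inv hsb
    have h2 := chart_source_deriv (S := S) (Λ := Λ) hy rfl hsb κ
    have h3 : c.symm (w (b (S.s ((extChartAt 𝓘(ℝ, E) p).symm y)))) =
        S.u (S.s ((extChartAt 𝓘(ℝ, E) p).symm y)) := by rw [hcw _ hsO, h1]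
    have h4 := chart_source_deriv (S := S) (Λ := Λ) (hwD hsO).1 (x₀ := x₀)
      (x := S.s ((extChartAt 𝓘(ℝ, E) p).symm y))
      (by rw [← hc, h3, S.s_u]) hsb κ
    refine h2.trans (Eq.trans ?_ h4.symm)
    have h5 := 𝓛.source_deriv_eq hbr (hΛ.mem κ) ((extChartAt 𝓘(ℝ, E) p).symm y)
    have h6 : ∀ g', c.symm (w (b (S.s ((extChartAt 𝓘(ℝ, E) p).symm y)))) = g' →
        (mfderiv 𝓘(ℝ, E) 𝓘(ℝ, F) S.s (c.symm (w (b (S.s ((extChartAt 𝓘(ℝ, E) p).symm y)))))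
          (Λ (c.symm (w (b (S.s ((extChartAt 𝓘(ℝ, E) p).symm y))))) κ) : F) =
        mfderiv 𝓘(ℝ, E) 𝓘(ℝ, F) S.s g' (Λ g' κ) := fun g' hg' => by rw [hg']
    exact congrArg (fun v : F => (mfderiv 𝓘(ℝ, F) 𝓘(ℝ, F) b
      (S.s ((extChartAt 𝓘(ℝ, E) p).symm y)) v : F)) (h5.trans (h6 _ h3).symm)

omit [FiniteDimensional ℝ F] [IsManifold 𝓘(ℝ, F) ∞ M] [T2Space M] in
/-- The structure functions of a frame. -/
theorem IsFrame.exists_structure_functions (𝓛 : LeftParallelism S)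
    (hΛ : IsFrame S 𝓛.fields W Λ)
    (hbr : ∀ X ∈ 𝓛.fields, ∀ Y ∈ 𝓛.fields, VectorField.mlieBracket 𝓘(ℝ, E) X Y ∈ 𝓛.fields) :
    ∃ C : M → K → K → K, ∀ (p : G), ∀ y ∈ (extChartAt 𝓘(ℝ, E) p).target,
      S.s ((extChartAt 𝓘(ℝ, E) p).symm y) ∈ W → ∀ ξ η,
      fderiv ℝ (chartFrame p Λ) y (chartFrame p Λ y ξ) η -
        fderiv ℝ (chartFrame p Λ) y (chartFrame p Λ y η) ξ =
      chartFrame p Λ y (C (S.s ((extChartAt 𝓘(ℝ, E) p).symm y)) ξ η) := by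
  have hne : (∞ : WithTop ℕ∞) ≠ 0 := by simp
  -- The coefficients of the bracket of two frame fields are taken at the unit over `x`; since the
  -- bracket belongs to the family, they are its coefficients at every arrow with source `x`.
  have h1 : ∀ x ξ η, ∃ κ, x ∈ W → (Λ (S.u x) κ : E) =
      VectorField.mlieBracket 𝓘(ℝ, E) (fun g => Λ g ξ) (fun g => Λ g η) (S.u x) := by
    intro x ξ η
    by_cases hx : x ∈ W
    · obtain ⟨κ, hκ⟩ := hΛ.surjective (S.u x) (by rwa [S.s_u]) _
        (𝓛.tangent _ (hbr _ (hΛ.mem ξ) _ (hΛ.mem η)) _)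
      exact ⟨κ, fun _ => hκ⟩
    · exact ⟨0, fun h => absurd h hx⟩
  choose C hC using h1
  refine ⟨C, fun p y hy hW ξ η => ?_⟩
  have h2 := lieBracket_chartField hy (𝓛.smooth _ (hΛ.mem ξ)) (𝓛.smooth _ (hΛ.mem η))
  have h3 : ∀ η v, fderiv ℝ (chartField p (fun g => Λ g η)) y v =
      fderiv ℝ (chartFrame p Λ) y v η := by
    intro η v
    have h4 := (((hΛ.contDiffOn_chartFrame 𝓛 p).contDiffAt
      ((isOpen_extChartAt_target p).mem_nhds hy)).differentiableAt hne).hasFDerivAt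
    have h5 : HasFDerivAt (chartField p (fun g => Λ g η))
        ((ContinuousLinearMap.apply ℝ E η) ∘L fderiv ℝ (chartFrame p Λ) y) y :=
      (ContinuousLinearMap.apply ℝ E η).hasFDerivAt.comp y h4
    rw [h5.fderiv]
    rfl
  rw [h3, h3] at h2
  refine Eq.trans h2 ?_
  obtain ⟨A, hA, -⟩ := hasMFDerivAt_chart_symm hy
  refine A.injective ?_
  rw [chartFrame_apply]
  refine (chartField_spec hy hA _).trans (Eq.trans ?_ (chartField_spec hy hA _).symm)
  exact (hΛ.determined _ (hbr _ (hΛ.mem ξ) _ (hΛ.mem η)) _ hW _ (hC _ ξ η hW)).symm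

end Anchor


/-! ### Local multiplications integrating a parallelism -/

section Translations

variable {E F : Type*} [NormedAddCommGroup E] [NormedSpace ℝ E] [FiniteDimensional ℝ E]
  [NormedAddCommGroup F] [NormedSpace ℝ F] [FiniteDimensional ℝ F]
  {M : Type*} [TopologicalSpace M] [ChartedSpace F M] [IsManifold 𝓘(ℝ, F) ∞ M] [T2Space M]
  {G : Type*} [TopologicalSpace G] [ChartedSpace E G] [IsManifold 𝓘(ℝ, E) ∞ G]
  {S : ArrowSpace E F M G}

/-- Multiplication by elements close to a unit, constructed by integrating a parallelism. -/
theorem LeftParallelism.exists_translations (𝓛 : LeftParallelism S)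
    (hbr : ∀ X ∈ 𝓛.fields, ∀ Y ∈ 𝓛.fields, VectorField.mlieBracket 𝓘(ℝ, E) X Y ∈ 𝓛.fields)
    {ℛ : Set ((g : G) → TangentSpace 𝓘(ℝ, E) g)}
    (hℛ : ∀ Y ∈ ℛ, ContMDiff 𝓘(ℝ, E) 𝓘(ℝ, E).tangent ∞
      (fun g => (⟨g, Y g⟩ : TangentBundle 𝓘(ℝ, E) G)))
    (hℛs : ∀ Y ∈ ℛ, ∀ g, Y g ∈ S.Ts g)
    (hcomm : ∀ X ∈ 𝓛.fields, ∀ Y ∈ ℛ, ∀ g, VectorField.mlieBracket 𝓘(ℝ, E) X Y g = 0) (g₀ : G) :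
    ∃ (N : Set (G × G)) (f : G × G → G), IsOpen N ∧ (g₀, S.u (S.s g₀)) ∈ N ∧
      ContMDiffOn (𝓘(ℝ, E).prod 𝓘(ℝ, E)) 𝓘(ℝ, E) ∞ f N ∧
      (∀ᶠ g in 𝓝 g₀, f (g, S.u (S.s g)) = g) ∧
      ∀ q ∈ N, q ∈ S.pairs → S.s (f q) = S.s q.2 ∧ S.t (f q) = S.t q.1 ∧
        Preserves S 𝓛.fields (S.s q.1) (fun h => f (q.1, h)) q.2 ∧
        Preserves S.op ℛ (S.t q.2) (fun g => f (g, q.2)) q.1 := by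
  have hne : (∞ : WithTop ℕ∞) ≠ 0 := by simp
  set h₀ := S.u (S.s g₀) with hh₀
  obtain ⟨K', Φ, hxΦ, hΦ⟩ := S.exists_unit_chart (S.t h₀)
  have hx₀ : S.t h₀ = S.s g₀ := S.t_u _
  have hsh₀ : S.s h₀ = S.t h₀ := by rw [hx₀, hh₀, S.s_u]
  have hux₀ : S.u (S.t h₀) = h₀ := by rw [hx₀]
  have h₀s : h₀ ∈ Φ.e.source := by have := (hΦ _ hxΦ).1; rwa [hux₀] at this
  have hΦ₀ : Φ.e h₀ = (S.t h₀, 0) := by have := (hΦ _ hxΦ).2; rwa [hux₀] at this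
  obtain ⟨K, W, Λ, hxW, hΛ⟩ := 𝓛.frame (S.t h₀)
  obtain ⟨O, B, hO, hqO, hê, hB, hOq⟩ := hΛ.exists_slice_coords 𝓛 Φ h₀s (by rwa [hsh₀]) rfl
  obtain ⟨O₃, ρ, hO₃, hxO₃, hρ, hρe⟩ := hΛ.exists_anchor 𝓛 hbr hxW
  obtain ⟨C, hC⟩ := hΛ.exists_structure_functions 𝓛 hbr
  set b := extChartAt 𝓘(ℝ, F) (S.t h₀) with hb
  set bt := extChartAt 𝓘(ℝ, F) (S.t g₀) with hbt
  set c := extChartAt 𝓘(ℝ, E) h₀ with hc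
  set c₀ := extChartAt 𝓘(ℝ, E) g₀ with hc₀
  rw [hΦ₀] at hqO
  have hbs : IsOpen b.source := isOpen_extChartAt_source _
  have hbts : IsOpen bt.source := isOpen_extChartAt_source _
  have hcs : IsOpen c.source := isOpen_extChartAt_source _
  have hct : IsOpen c.target := isOpen_extChartAt_target _
  have hc₀s : IsOpen c₀.source := isOpen_extChartAt_source _
  have hc₀t : IsOpen c₀.target := isOpen_extChartAt_target _
  have hbm' : ContMDiffOn 𝓘(ℝ, F) 𝓘(ℝ, F) ∞ b b.source := by
    rw [hb, extChartAt_source]; exact contMDiffOn_extChartAt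
  have hbtm' : ContMDiffOn 𝓘(ℝ, F) 𝓘(ℝ, F) ∞ bt bt.source := by
    rw [hbt, extChartAt_source]; exact contMDiffOn_extChartAt
  have hcm : ContMDiffOn 𝓘(ℝ, E) 𝓘(ℝ, E) ∞ c.symm c.target := contMDiffOn_extChartAt_symm _
  have hc₀m : ContMDiffOn 𝓘(ℝ, E) 𝓘(ℝ, E) ∞ c₀.symm c₀.target := contMDiffOn_extChartAt_symm _
  have hc₀m' : ContMDiffOn 𝓘(ℝ, E) 𝓘(ℝ, E) ∞ c₀ c₀.source := by
    rw [hc₀, extChartAt_source]; exact contMDiffOn_extChartAt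
  let j : F × K' → G := fun q => Φ.e.symm (b.symm q.1, q.2)
  let ê : F × K' → E := fun q => c (j q)
  have hcj : ∀ q ∈ O, c.symm (ê q) = j q := fun q hq => c.left_inv (hOq q hq).2.2.1
  -- domains
  let O₁ : Set E := c₀.target ∩ c₀.symm ⁻¹' (S.s ⁻¹' (W ∩ b.source) ∩ S.t ⁻¹' bt.source)
  have hO₁ : IsOpen O₁ := hc₀m.continuousOn.isOpen_inter_preimage hc₀t
    (((hΛ.isOpen.inter hbs).preimage S.smooth_s.continuous).inter
      (hbts.preimage S.smooth_t.continuous))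
  let D : Set E := c.target ∩ (S.s ∘ c.symm) ⁻¹' b.source
  have hD : IsOpen D :=
    (S.smooth_s.continuous.comp_continuousOn hcm.continuousOn).isOpen_inter_preimage hct hbs
  let O₂ : Set (F × K') := O ∩ ê ⁻¹' D
  have hO₂ : IsOpen O₂ := hê.continuousOn.isOpen_inter_preimage hO hD
  let σ : E → F := fun y => b (S.s (c.symm y))
  have hσ : ContDiffOn ℝ ∞ σ D := by
    rw [← contMDiffOn_iff_contDiffOn]
    exact hbm'.comp (S.smooth_s.comp_contMDiffOn (hcm.mono inter_subset_left)) fun y hy => hy.2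
  let s₁ : E → F := fun y => b (S.s (c₀.symm y))
  have hs₁ : ContDiffOn ℝ ∞ s₁ O₁ := by
    rw [← contMDiffOn_iff_contDiffOn]
    exact hbm'.comp (S.smooth_s.comp_contMDiffOn (hc₀m.mono inter_subset_left))
      fun y hy => hy.2.1.2
  let t₁ : E → F := fun y => bt (S.t (c₀.symm y))
  have ht₁ : ContDiffOn ℝ ∞ t₁ O₁ := by
    rw [← contMDiffOn_iff_contDiffOn]
    exact hbtm'.comp (S.smooth_t.comp_contMDiffOn (hc₀m.mono inter_subset_left))
      fun y hy => hy.2.2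
  let s₂ : F × K' → F := fun q => σ (ê q)
  have hs₂ : ContDiffOn ℝ ∞ s₂ O₂ := hσ.comp (hê.mono inter_subset_left) fun q hq => hq.2
  have hs₂j : ∀ q ∈ O₂, s₂ q = b (S.s (j q)) := fun q hq => by
    show b (S.s (c.symm (ê q))) = _
    rw [hcj q hq.1]
  have hsj : ∀ q ∈ O₂, S.s (j q) ∈ b.source := fun q hq => by
    have h1 := hq.2.2
    rwa [mem_preimage, Function.comp_apply, hcj q hq.1] at h1
  have hju : ∀ x, (x, 0) ∈ O → j (x, 0) = S.u (b.symm x) := fun x hx => by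
    have h1 := (hOq _ hx).2.1
    rw [Φ.target_eq] at h1
    have h2 := hΦ _ h1.1
    show Φ.e.symm (b.symm x, 0) = _
    rw [← h2.2, Φ.e.left_inv h2.1]
  have hcg₀ : c₀.symm (c₀ g₀) = g₀ := extChartAt_to_inv _
  have hs₁g₀ : s₁ (c₀ g₀) = b (S.t h₀) := by
    show b (S.s (c₀.symm (c₀ g₀))) = _
    rw [hcg₀, hx₀]
  have hbb : b.symm (b (S.t h₀)) = S.t h₀ := extChartAt_to_inv _
  have hy₀ : c₀ g₀ ∈ O₁ := by
    refine ⟨mem_extChartAt_target _, ?_⟩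
    rw [mem_preimage, hcg₀]
    refine ⟨?_, mem_extChartAt_source _⟩
    rw [mem_preimage, ← hx₀]
    exact ⟨hxW, mem_extChartAt_source _⟩
  have hq₀ : (s₁ (c₀ g₀), 0) ∈ O₂ := by
    rw [hs₁g₀]
    refine ⟨hqO, c.map_source (hOq _ hqO).2.2.1, ?_⟩
    rw [mem_preimage, Function.comp_apply, hcj _ hqO, hju _ hqO, hbb, S.s_u]
    exact mem_extChartAt_source _
  have hs₂0 : ∀ x, (x, 0) ∈ O₂ → s₂ (x, 0) = x := fun x hx => by
    rw [hs₂j _ hx, hju _ hx.1, S.s_u, b.right_inv (hOq _ hx.1).1]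
  have hρ₁ : ∀ y ∈ O₁, s₁ y ∈ O₃ → ∀ ξ,
      fderiv ℝ s₁ y (chartFrame g₀ Λ y ξ) = ρ (s₁ y) ξ := fun y hy hy₃ ξ =>
    hρe g₀ y hy.1 hy.2.1.2 hy₃ ξ
  have hdê : ∀ q ∈ O₂, ∀ β, fderiv ℝ ê q (0, β) = chartFrame h₀ Λ (ê q) (B q β) :=
    fun q hq => (hOq q hq.1).2.2.2.2
  have hρ₂ : ∀ q ∈ O₂, s₂ q ∈ O₃ → ∀ β, fderiv ℝ s₂ q (0, β) = ρ (s₂ q) (B q β) := by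
    intro q hq hq₃ β
    have h1 := ((hσ.contDiffAt (hD.mem_nhds hq.2)).differentiableAt hne).hasFDerivAt.comp q
      ((hê.contDiffAt (hO.mem_nhds hq.1)).differentiableAt hne).hasFDerivAt
    have h2 : fderiv ℝ s₂ q (0, β) = fderiv ℝ σ (ê q) (fderiv ℝ ê q (0, β)) := by
      rw [show fderiv ℝ s₂ q = _ from h1.fderiv]; rfl
    rw [h2, hdê q hq]
    exact hρe h₀ (ê q) hq.2.1 hq.2.2 hq₃ _
  have hbr' : ∀ y ∈ O₁, s₁ y ∈ O₃ → ∀ ξ η,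
      fderiv ℝ (chartFrame g₀ Λ) y (chartFrame g₀ Λ y ξ) η -
        fderiv ℝ (chartFrame g₀ Λ) y (chartFrame g₀ Λ y η) ξ =
      chartFrame g₀ Λ y (C (b.symm (s₁ y)) ξ η) := fun y hy _ ξ η => by
    rw [show b.symm (s₁ y) = S.s (c₀.symm y) from b.left_inv hy.2.1.2]
    exact hC g₀ y hy.1 hy.2.1.1 ξ η
  have hmc : ∀ q ∈ O₂, s₂ q ∈ O₃ → ∀ a a',
      C (b.symm (s₂ q)) (B q a) (B q a') + fderiv ℝ B q (0, a) a' - fderiv ℝ B q (0, a') a = 0 := by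
    intro q hq _ a a'
    have hW : S.s (c.symm (ê q)) ∈ W := by rw [hcj q hq.1]; exact (hOq q hq.1).2.2.2.1
    refine maurer_cartan hO₂ (hê.mono inter_subset_left) (ι := ContinuousLinearMap.inr ℝ F K')
      (hB.mono inter_subset_left) hdê hq (((hΛ.contDiffOn_chartFrame 𝓛 h₀).contDiffAt
        (hct.mem_nhds hq.2.1)).differentiableAt hne) (hΛ.injective_chartFrame 𝓛 hq.2.1 hW)
      (c := C (b.symm (s₂ q))) (fun ξ η => ?_) a a'
    rw [show b.symm (s₂ q) = S.s (c.symm (ê q)) from b.left_inv hq.2.2]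
    exact hC h₀ (ê q) hq.2.1 hW ξ η
  -- The arrows near `g₀` and those near the unit are described in different charts, but with a
  -- common anchor `ρ` and common structure functions `C`, as these depend on the source only. This
  -- is where the model uses closure under brackets.
  obtain ⟨N, f, hN, hyN, hf, hfN⟩ := exists_model_multiplication (c := fun x => C (b.symm x)) hO₁
    ((hΛ.contDiffOn_chartFrame 𝓛 g₀).mono inter_subset_left) hO₂ (hB.mono inter_subset_left) hO₃
    hρ hs₁ hs₂ hy₀ hq₀ (by rw [hs₁g₀]; exact hxO₃) hs₂0 hρ₁ hρ₂ hbr' hmc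
  let N₁ : Set (G × G) := c₀.source ×ˢ Φ.e.source
  have hN₁ : IsOpen N₁ := hc₀s.prod Φ.e.open_source
  let θ : G × G → E × K' := fun p => (c₀ p.1, (Φ.e p.2).2)
  have hθ : ContMDiffOn (𝓘(ℝ, E).prod 𝓘(ℝ, E)) 𝓘(ℝ, E × K') ∞ θ N₁ :=
    (hc₀m'.comp contMDiff_fst.contMDiffOn fun p hp => hp.1).prodMk_space
      (contMDiff_snd.comp_contMDiffOn (Φ.smooth.comp contMDiff_snd.contMDiffOn fun p hp => hp.2))
  have hfm : ContMDiffOn 𝓘(ℝ, E × K') 𝓘(ℝ, E) ∞ f N := contMDiffOn_iff_contDiffOn.2 hf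
  have hθu : ∀ᶠ g in 𝓝 g₀, (g, S.u (S.s g)) ∈ N₁ ∩ θ ⁻¹' N ∧ θ (g, S.u (S.s g)) = (c₀ g, 0) := by
    have hN₂ : IsOpen (N₁ ∩ θ ⁻¹' N) := hθ.continuousOn.isOpen_inter_preimage hN₁ hN
    have h1 : ∀ g, S.s g ∈ Φ.W → θ (g, S.u (S.s g)) = (c₀ g, 0) := fun g hg => by
      show (c₀ g, (Φ.e (S.u (S.s g))).2) = _
      rw [(hΦ _ hg).2]
    have h2 : Continuous fun g => (g, S.u (S.s g)) :=
      continuous_id.prodMk (S.smooth_u.continuous.comp S.smooth_s.continuous)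
    filter_upwards [h2.continuousAt.eventually (hN₂.mem_nhds (x := (g₀, S.u (S.s g₀)))
      ⟨⟨mem_extChartAt_source _, h₀s⟩, by
        rw [mem_preimage, h1 _ (by rw [← hx₀]; exact hxΦ)]; exact hyN⟩),
      S.smooth_s.continuous.continuousAt.eventually (Φ.isOpen_W.mem_nhds (by
        rw [← hx₀]; exact hxΦ))] with g hg hg'
    exact ⟨hg, h1 g hg'⟩
  refine ⟨N₁ ∩ θ ⁻¹' N, fun p => c₀.symm (f (θ p)),
    hθ.continuousOn.isOpen_inter_preimage hN₁ hN, hθu.self_of_nhds.1,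
    hc₀m.comp (hfm.comp (hθ.mono inter_subset_left) fun p hp => hp.2)
      fun p hp => (hfN _ hp.2).2.1.1, ?_, ?_⟩
  · filter_upwards [hθu] with g hg
    show c₀.symm (f (θ (g, S.u (S.s g)))) = g
    rw [(hfN _ hg.1.2).2.2.2.2.1 (by rw [hg.2]), hg.2]
    exact c₀.left_inv hg.1.1.1
  rintro ⟨g, h⟩ ⟨⟨hg, hh⟩, hqN⟩ hgh
  obtain ⟨hyO, hfO, hqO₂, hfs, -, hfd, hft, hfR⟩ := hfN _ hqN
  have hgh' : S.s g = S.t h := hgh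
  have hcg : c₀.symm (c₀ g) = g := c₀.left_inv hg
  have hsg : S.s g ∈ b.source := by
    have := hyO.2.1.2
    change S.s (c₀.symm (c₀ g)) ∈ b.source at this
    rwa [hcg] at this
  have hs₁y : s₁ (c₀ g) = b (S.t h) := by
    show b (S.s (c₀.symm (c₀ g))) = _
    rw [hcg, hgh']
  have hjh : j (s₁ (c₀ g), (Φ.e h).2) = h := by
    show Φ.e.symm (b.symm (s₁ (c₀ g)), (Φ.e h).2) = h
    rw [hs₁y, b.left_inv (hgh' ▸ hsg), ← Φ.fst_eq _ hh]
    exact Φ.e.left_inv hh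
  set y := c₀ g with hy
  set a := (Φ.e h).2 with ha
  have hθq : θ (g, h) = (y, a) := rfl
  rw [mem_preimage] at hqN
  rw [hθq] at hqN hfO hfs hfd hft hfR
  change (s₁ y, a) ∈ O₂ at hqO₂
  change s₁ (f (y, a)) = s₂ (s₁ y, a) at hfs
  have hsf : S.s (c₀.symm (f (y, a))) = S.s h := by
    have h1 : b (S.s (c₀.symm (f (y, a)))) = b (S.s h) := by
      rw [hs₂j _ hqO₂, hjh] at hfs; exact hfs
    refine b.injOn hfO.2.1.2 ?_ h1
    have := hsj _ hqO₂
    rwa [hjh] at this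
  have hWh : S.s h ∈ W := by rw [← hsf]; exact hfO.2.1.1
  obtain ⟨A, hA, -⟩ := hasMFDerivAt_chart_symm hfO.1
  have hfD : HasFDerivAt f (fderiv ℝ f (y, a)) (y, a) :=
    ((hf.contDiffAt (hN.mem_nhds hqN)).differentiableAt hne).hasFDerivAt
  refine ⟨hsf, ?_, ?_, ?_⟩
  · have h1 : t₁ (f (y, a)) = t₁ y := by
      refine hft t₁ (ht₁.differentiableOn hne) fun y' hy' ξ => ?_
      obtain ⟨A', hA', -⟩ := hasMFDerivAt_chart_symm hy'.1
      have hbtd : MDifferentiableAt 𝓘(ℝ, F) 𝓘(ℝ, F) bt (S.t (c₀.symm y')) :=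
        (hbtm'.contMDiffAt (hbts.mem_nhds hy'.2.2)).mdifferentiableAt hne
      have h2 := (hbtd.hasMFDerivAt.comp _ ((S.smooth_t.contMDiffAt
        (x := c₀.symm y')).mdifferentiableAt hne).hasMFDerivAt).comp y' hA'
      have h3 := hasMFDerivAt_unique h2
        ((((ht₁.contDiffAt (hO₁.mem_nhds hy')).differentiableAt hne).hasFDerivAt).hasMFDerivAt)
      have h4 : (A' (chartFrame g₀ Λ y' ξ) : E) = Λ (c₀.symm y') ξ :=
        chartField_spec hy'.1 hA' (fun g => Λ g ξ)
      have h5 : mfderiv 𝓘(ℝ, E) 𝓘(ℝ, F) S.t (c₀.symm y') (Λ (c₀.symm y') ξ) = (0 : F) :=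
        𝓛.tangent _ (hΛ.mem ξ) _
      refine (congrArg (fun L : E →L[ℝ] F => L (chartFrame g₀ Λ y' ξ)) h3).symm.trans ?_
      refine (congrArg (fun v : E => (mfderiv 𝓘(ℝ, F) 𝓘(ℝ, F) bt (S.t (c₀.symm y'))
        (mfderiv 𝓘(ℝ, E) 𝓘(ℝ, F) S.t (c₀.symm y') v : F) : F)) h4).trans ?_
      exact (congrArg (fun v : F => (mfderiv 𝓘(ℝ, F) 𝓘(ℝ, F) bt (S.t (c₀.symm y')) v : F)) h5).trans
        (map_zero (mfderiv 𝓘(ℝ, F) 𝓘(ℝ, F) bt (S.t (c₀.symm y')) : F →L[ℝ] F))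
    have h2 := bt.injOn hfO.2.2 hyO.2.2 h1
    exact h2.trans (by rw [hcg])
  · obtain ⟨Dγ, hDγ, hDe⟩ := hasMFDerivAt_slice (h₀ := h₀) hO hê
      (fun q hq => (hOq q hq).2.2.1) hqO₂.1 (hOq _ hqO₂.1).2.2.2.2
    obtain ⟨P, hP⟩ : ∃ P : E →L[ℝ] K', HasMFDerivAt 𝓘(ℝ, E) 𝓘(ℝ, K') (fun h' => (Φ.e h').2) h P :=
      ⟨_, (((contMDiff_snd.comp_contMDiffOn Φ.smooth).contMDiffAt
        (Φ.e.open_source.mem_nhds hh)).mdifferentiableAt hne).hasMFDerivAt⟩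
    have hDγ' : HasMFDerivAt 𝓘(ℝ, K') 𝓘(ℝ, E) (fun a => Φ.e.symm (S.t h, a)) a Dγ :=
      hDγ.congr_of_eventuallyEq (.of_forall fun a => by
        show Φ.e.symm (S.t h, a) = Φ.e.symm (b.symm (s₁ y), a)
        rw [hs₁y, b.left_inv (hgh' ▸ hsg)])
    -- On the target fibre through `h`, the slice is inverse to the fibre coordinate. So their
    -- differentials are inverse to each other on vectors tangent to this fibre.
    have hid : ∀ v : E, mfderiv 𝓘(ℝ, E) 𝓘(ℝ, F) S.t h v = (0 : F) → Dγ (P v) = v := by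
      intro v hv
      have h1 : HasMFDerivWithinAt 𝓘(ℝ, E) 𝓘(ℝ, E) (fun h' => Φ.e.symm (S.t h, (Φ.e h').2))
          (S.t ⁻¹' {S.t h}) h (Dγ ∘L P) := (hDγ'.comp h hP).hasMFDerivWithinAt
      have h2 : HasMFDerivWithinAt 𝓘(ℝ, E) 𝓘(ℝ, E) (fun h' => Φ.e.symm (S.t h, (Φ.e h').2))
          (S.t ⁻¹' {S.t h}) h (.id ℝ E) := by
        refine (hasMFDerivAt_id h).hasMFDerivWithinAt.congr_of_eventuallyEq ?_ ?_
        · filter_upwards [self_mem_nhdsWithin, nhdsWithin_le_nhds (Φ.e.open_source.mem_nhds hh)]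
            with h' h1 h2
          rw [← show S.t h' = S.t h from h1, ← Φ.fst_eq _ h2]
          exact Φ.e.left_inv h2
        · rw [← Φ.fst_eq _ hh]
          exact Φ.e.left_inv hh
      exact fibre_deriv_unique S.smooth_t (S.submersion_t h) hv rfl h1 h2
    have hι : HasFDerivAt (fun a : K' => (y, a)) (ContinuousLinearMap.inr ℝ E K') a :=
      hasFDerivAt_prodMk_right _ _
    have h3 := (hA.comp a (hfD.comp a hι).hasMFDerivAt).comp h hP
    refine ⟨_, h3.hasMFDerivWithinAt, fun X hX => ?_⟩
    obtain ⟨κ, hκ⟩ := hΛ.surjective (S.u (S.s h)) (by rwa [S.s_u]) _ (𝓛.tangent X hX _)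
    have hκh := hΛ.determined X hX h hWh κ hκ
    have hκf : Λ (c₀.symm (f (y, a))) κ = X (c₀.symm (f (y, a))) := by
      refine hΛ.determined X hX _ (by rw [hsf]; exact hWh) κ ?_
      rw [hsf]; exact hκ
    -- The frame coefficients of `X` at `h`, computed through the slice, are those fixed at the unit
    -- over `s h`; the product has the same source and hence the same coefficients.
    have h5 : B (s₁ y, a) (P (X h)) = κ := by
      refine hΛ.injective h hWh ?_
      have h6 := hDe (P (X h))
      have h8 : j (s₁ y, a) = h := hjh
      have h7 : (Λ (j (s₁ y, a)) (B (s₁ y, a) (P (X h))) : E) = Λ h (B (s₁ y, a) (P (X h))) := by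
        rw [h8]
      exact (h7.symm.trans (h6.symm.trans (hid _ (𝓛.tangent X hX h)))).trans hκh.symm
    show (A (fderiv ℝ f (y, a) (0, P (X h))) : E) = X (c₀.symm (f (y, a)))
    rw [hfd, ← hκf]
    show A (chartFrame g₀ Λ (f (y, a)) (B (s₁ y, a) (P (X h)))) = _
    rw [h5]
    exact chartField_spec hfO.1 hA (fun g => Λ g κ)
  · obtain ⟨P, hP⟩ : ∃ P : E →L[ℝ] E, HasMFDerivAt 𝓘(ℝ, E) 𝓘(ℝ, E) c₀ g P :=
      ⟨_, ((hc₀m'.contMDiffAt (hc₀s.mem_nhds hg)).mdifferentiableAt hne).hasMFDerivAt⟩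
    have hι : HasFDerivAt (fun y' : E => (y', a)) (ContinuousLinearMap.inl ℝ E K') y :=
      hasFDerivAt_prodMk_left _ _
    have h3 := (hA.comp y (hfD.comp y hι).hasMFDerivAt).comp g hP
    refine ⟨_, h3.hasMFDerivWithinAt, fun Y hY => ?_⟩
    show (A (fderiv ℝ f (y, a) (P (Y g), 0)) : E) = Y (c₀.symm (f (y, a)))
    rw [show P (Y g) = _ from chartField_apply hg hP Y]
    refine (congrArg A (hfR (chartField g₀ Y) ?_ ?_ ?_)).trans (chartField_spec hfO.1 hA Y)
    · exact ((contDiffOn_chartField g₀ (hℛ Y hY)).differentiableOn hne).mono inter_subset_left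
    · intro y' hy' _ ξ
      -- Vanishing of the bracket of `Y` with the frame fields is, in coordinates, the relation
      -- required of `R` by the model.
      have h6 := lieBracket_chartField hy'.1 (𝓛.smooth _ (hΛ.mem ξ)) (hℛ Y hY)
      obtain ⟨A', hA', -⟩ := hasMFDerivAt_chart_symm hy'.1
      have h7 : chartField g₀ (VectorField.mlieBracket 𝓘(ℝ, E) (fun g => Λ g ξ) Y) y' = 0 := by
        refine A'.injective ?_
        rw [map_zero]
        exact (chartField_spec hy'.1 hA' _).trans (hcomm _ (hΛ.mem ξ) Y hY _)
      rw [h7, sub_eq_zero, ← chartFrame_apply] at h6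
      refine h6.trans ?_
      have h8 := (((hΛ.contDiffOn_chartFrame 𝓛 g₀).contDiffAt
        (hc₀t.mem_nhds hy'.1)).differentiableAt hne).hasFDerivAt
      have h9 : HasFDerivAt (chartField g₀ (fun g => Λ g ξ))
          ((ContinuousLinearMap.apply ℝ E ξ) ∘L fderiv ℝ (chartFrame g₀ Λ) y') y' :=
        (ContinuousLinearMap.apply ℝ E ξ).hasFDerivAt.comp y' h8
      rw [h9.fderiv]
      rfl
    · intro y' hy'
      obtain ⟨A', hA', -⟩ := hasMFDerivAt_chart_symm hy'.1
      have hbd : MDifferentiableAt 𝓘(ℝ, F) 𝓘(ℝ, F) b (S.s (c₀.symm y')) :=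
        (hbm'.contMDiffAt (hbs.mem_nhds hy'.2.1.2)).mdifferentiableAt hne
      have h2 := (hbd.hasMFDerivAt.comp _ ((S.smooth_s.contMDiffAt
        (x := c₀.symm y')).mdifferentiableAt hne).hasMFDerivAt).comp y' hA'
      have h3 := hasMFDerivAt_unique h2
        ((((hs₁.contDiffAt (hO₁.mem_nhds hy')).differentiableAt hne).hasFDerivAt).hasMFDerivAt)
      have h4 : (A' (chartField g₀ Y y') : E) = Y (c₀.symm y') := chartField_spec hy'.1 hA' Y
      have h5 : mfderiv 𝓘(ℝ, E) 𝓘(ℝ, F) S.s (c₀.symm y') (Y (c₀.symm y')) = (0 : F) :=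
        hℛs Y hY _
      refine (congrArg (fun L : E →L[ℝ] F => L (chartField g₀ Y y')) h3).symm.trans ?_
      refine (congrArg (fun v : E => (mfderiv 𝓘(ℝ, F) 𝓘(ℝ, F) b (S.s (c₀.symm y'))
        (mfderiv 𝓘(ℝ, E) 𝓘(ℝ, F) S.s (c₀.symm y') v : F) : F)) h4).trans ?_
      exact (congrArg (fun v : F => (mfderiv 𝓘(ℝ, F) 𝓘(ℝ, F) b (S.s (c₀.symm y')) v : F)) h5).trans
        (map_zero (mfderiv 𝓘(ℝ, F) 𝓘(ℝ, F) b (S.s (c₀.symm y')) : F →L[ℝ] F))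

end Translations


/-! ### Framings in coordinates and the frames they induce -/

section FramingCharts

variable {E F : Type*} [NormedAddCommGroup E] [NormedSpace ℝ E] [FiniteDimensional ℝ E]
  [NormedAddCommGroup F] [NormedSpace ℝ F] [FiniteDimensional ℝ F]
  {M : Type*} [TopologicalSpace M] [ChartedSpace F M] [IsManifold 𝓘(ℝ, F) ∞ M]
  {G : Type*} [TopologicalSpace G] [ChartedSpace E G] [IsManifold 𝓘(ℝ, E) ∞ G]

/-- Coordinates adapted to the target fibres. -/
theorem ArrowSpace.exists_adapted_coords (S : ArrowSpace E F M G) (g₀ : G) :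
    ∃ (K : Submodule ℝ E) (e : OpenPartialHomeomorph G (F × K)), g₀ ∈ e.source ∧
      ContMDiffOn 𝓘(ℝ, E) 𝓘(ℝ, F × K) ∞ e e.source ∧
      ContMDiffOn 𝓘(ℝ, F × K) 𝓘(ℝ, E) ∞ e.symm e.target ∧
      ∃ (P : (g : G) → S.Tt g →ₗ[ℝ] K) (L : (g : G) → K →ₗ[ℝ] S.Tt g), ∀ g ∈ e.source,
        (mfderiv 𝓘(ℝ, E) 𝓘(ℝ, F × K) e g).IsInvertible ∧
        (∀ v : S.Tt g, (mfderiv 𝓘(ℝ, E) 𝓘(ℝ, F × K) e g (v : TangentSpace 𝓘(ℝ, E) g) : F × K) =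
          (0, P g v)) ∧ (∀ v, L g (P g v) = v) ∧ ∀ κ, P g (L g κ) = κ := by
  have hne : (∞ : WithTop ℕ∞) ≠ 0 := by simp
  obtain ⟨K, Φ, hg₀, hW, -, -⟩ := exists_fibreChart S.smooth_t g₀ (S.submersion_t g₀)
    (w := fun _ => g₀) contMDiff_const rfl
  set b := chartAt F (S.t g₀) with hb
  have hbm : ContMDiffOn 𝓘(ℝ, F) 𝓘(ℝ, F) ∞ b b.source := contMDiffOn_extChartAt
  have hbm' : ContMDiffOn 𝓘(ℝ, F) 𝓘(ℝ, F) ∞ b.symm b.target := by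
    have := contMDiffOn_extChartAt_symm (I := 𝓘(ℝ, F)) (n := ∞) (S.t g₀)
    simpa using this
  let e := Φ.e.trans (b.prod (OpenPartialHomeomorph.refl K))
  have hsrc : ∀ g ∈ e.source, g ∈ Φ.e.source ∧ S.t g ∈ b.source := by
    intro g hg
    have h1 : g ∈ Φ.e.source ∧ Φ.e g ∈ (b.prod (OpenPartialHomeomorph.refl K)).source := by
      simpa [e] using hg
    exact ⟨h1.1, by rw [← Φ.fst_eq g h1.1]; exact h1.2.1⟩
  have hes : ContMDiffOn 𝓘(ℝ, E) 𝓘(ℝ, F × K) ∞ e e.source := by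
    have h1 := Φ.smooth.mono fun g hg => (hsrc g hg).1
    exact (hbm.comp (contMDiff_fst.comp_contMDiffOn h1) fun g hg => by
      show (Φ.e g).1 ∈ b.source
      rw [Φ.fst_eq g (hsrc g hg).1]; exact (hsrc g hg).2).prodMk_space
        (contMDiff_snd.comp_contMDiffOn h1)
  have htgt : ∀ z ∈ e.target, z.1 ∈ b.target ∧ (b.symm z.1, z.2) ∈ Φ.e.target := by
    intro z hz
    exact ⟨hz.1.1, hz.2⟩
  have het : ContMDiffOn 𝓘(ℝ, F × K) 𝓘(ℝ, E) ∞ e.symm e.target := by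
    have h1 : ContMDiffOn 𝓘(ℝ, F × K) (𝓘(ℝ, F).prod 𝓘(ℝ, K)) ∞
        (fun z : F × K => (b.symm z.1, z.2)) e.target :=
      (hbm'.comp contDiff_fst.contMDiff.contMDiffOn fun z hz => (htgt z hz).1).prodMk
        contDiff_snd.contMDiff.contMDiffOn
    exact Φ.smooth_symm.comp h1 fun z hz => (htgt z hz).2
  suffices h : ∀ g, ∃ (P : S.Tt g →ₗ[ℝ] K) (L : K →ₗ[ℝ] S.Tt g), g ∈ e.source →
        (mfderiv 𝓘(ℝ, E) 𝓘(ℝ, F × K) e g).IsInvertible ∧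
        (∀ v : S.Tt g, (mfderiv 𝓘(ℝ, E) 𝓘(ℝ, F × K) e g (v : TangentSpace 𝓘(ℝ, E) g) : F × K) =
          (0, P v)) ∧ (∀ v, L (P v) = v) ∧ ∀ κ, P (L κ) = κ by
    choose P L h using h
    refine ⟨K, e, ?_, hes, het, P, L, h⟩
    refine ⟨hg₀, ?_⟩
    show (Φ.e g₀).1 ∈ b.source ∧ _
    rw [Φ.fst_eq g₀ hg₀]
    exact ⟨mem_chart_source F _, trivial⟩
  intro g
  by_cases hg : g ∈ e.source
  swap
  · exact ⟨0, 0, fun h => absurd h hg⟩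
  obtain ⟨A, hA⟩ : ∃ A : E →L[ℝ] F × K, HasMFDerivAt 𝓘(ℝ, E) 𝓘(ℝ, F × K) e g A :=
    ⟨_, ((hes.contMDiffAt (e.open_source.mem_nhds hg)).mdifferentiableAt hne).hasMFDerivAt⟩
  obtain ⟨B, hB⟩ : ∃ B : F × K →L[ℝ] E, HasMFDerivAt 𝓘(ℝ, F × K) 𝓘(ℝ, E) e.symm (e g) B :=
    ⟨_, ((het.contMDiffAt (e.open_target.mem_nhds (e.map_source hg))).mdifferentiableAt
      hne).hasMFDerivAt⟩
  have hBA : B ∘L A = .id ℝ E := hasMFDerivAt_unique (hB.comp g hA)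
    ((hasMFDerivAt_id g).congr_of_eventuallyEq
      (Filter.eventually_of_mem (e.open_source.mem_nhds hg) fun x hx => e.left_inv hx))
  have hAB : A ∘L B = .id ℝ (F × K) := by
    have hA' : HasMFDerivAt 𝓘(ℝ, E) 𝓘(ℝ, F × K) e (e.symm (e g)) A := by rwa [e.left_inv hg]
    exact hasMFDerivAt_unique (hA'.comp (e g) hB)
      ((hasMFDerivAt_id _).congr_of_eventuallyEq
        (Filter.eventually_of_mem (e.open_target.mem_nhds (e.map_source hg))
          fun x hx => e.right_inv hx))
  let Ae : E ≃L[ℝ] F × K := ContinuousLinearEquiv.equivOfInverse A B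
    (fun v => congrArg (fun L : E →L[ℝ] E => L v) hBA)
    fun v => congrArg (fun L : F × K →L[ℝ] F × K => L v) hAB
  have hfst : ∀ v : E, v ∈ S.Tt g ↔ (A v).1 = 0 := by
    intro v
    obtain ⟨β, hβ, hβ'⟩ := hasMFDerivAt_chart_symm (E := F) (p := S.t g₀)
      ((extChartAt 𝓘(ℝ, F) (S.t g₀)).map_source (x := S.t g)
        (by rw [extChartAt_source]; exact (hsrc g hg).2))
    rw [(extChartAt 𝓘(ℝ, F) (S.t g₀)).left_inv
      (by rw [extChartAt_source]; exact (hsrc g hg).2)] at hβ'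
    have h1 := hβ'.comp g ((S.smooth_t.contMDiffAt (x := g)).mdifferentiableAt hne).hasMFDerivAt
    have h2 : HasMFDerivAt 𝓘(ℝ, E) 𝓘(ℝ, F) (fun g => (e g).1) g
        (ContinuousLinearMap.fst ℝ F K ∘L A) :=
      (ContinuousLinearMap.fst ℝ F K).hasFDerivAt.hasMFDerivAt.comp g hA
    have h3 := h2.congr_of_eventuallyEq (f₁ := extChartAt 𝓘(ℝ, F) (S.t g₀) ∘ S.t)
      (Filter.eventually_of_mem (e.open_source.mem_nhds hg) fun g' hg' => by
        show b (S.t g') = b (Φ.e g').1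
        rw [Φ.fst_eq g' (hsrc g' hg').1])
    have h4 : (A v).1 = β.symm (mfderiv 𝓘(ℝ, E) 𝓘(ℝ, F) S.t g v : F) :=
      congrArg (fun L : E →L[ℝ] F => L v) (hasMFDerivAt_unique h3 h1)
    rw [h4]
    refine ⟨fun h => ?_, fun h => ?_⟩
    · exact (congrArg β.symm (show (mfderiv 𝓘(ℝ, E) 𝓘(ℝ, F) S.t g v : F) = 0 from h)).trans
        (map_zero _)
    · exact β.symm.injective (h.trans (map_zero _).symm)
  let η₀ : S.Tt g →ₗ[ℝ] K := (LinearMap.snd ℝ F K ∘ₗ A.toLinearMap) ∘ₗ (S.Tt g).subtype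
  have hη : ∀ v : S.Tt g, A (v : TangentSpace 𝓘(ℝ, E) g) = (0, η₀ v) := fun v =>
    Prod.ext ((hfst _).1 v.2) rfl
  let η : S.Tt g ≃ₗ[ℝ] K := LinearEquiv.ofBijective η₀ ⟨fun v w hvw => Subtype.ext
    (Ae.injective ((hη v).trans ((congrArg (Prod.mk 0) hvw).trans (hη w).symm))), fun κ => by
      have h1 : A (Ae.symm (0, κ)) = (0, κ) := Ae.apply_symm_apply _
      exact ⟨⟨Ae.symm (0, κ), (hfst _).2 (by rw [h1])⟩, congrArg Prod.snd h1⟩⟩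
  refine ⟨η, η.symm, fun _ => ?_⟩
  rw [hA.mfderiv]
  exact ⟨⟨Ae, rfl⟩, hη, η.symm_apply_apply, η.apply_symm_apply⟩

variable {S : ArrowSpace E F M G}

omit [FiniteDimensional ℝ E] [FiniteDimensional ℝ F] [IsManifold 𝓘(ℝ, F) ∞ M] in
-- The framing is the identity over `M`, so the section `σ` can only be the restriction of `X` to
-- the units. This removes `σ` from the definition.
theorem TFraming.leftInvariant_iff (θ : TFraming S) {X : (g : G) → TangentSpace 𝓘(ℝ, E) g} :
    θ.LeftInvariant X ↔
      ContMDiff 𝓘(ℝ, E) 𝓘(ℝ, E).tangent ∞ (fun g => (⟨g, X g⟩ : TangentBundle 𝓘(ℝ, E) G)) ∧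
      ∀ g, ∃ h : X g ∈ S.Tt g,
        (θ.iso g ⟨X g, h⟩ : TangentSpace 𝓘(ℝ, E) (S.u (S.s g))) = X (S.u (S.s g)) := by
  have hmk : ∀ {g : G} {v w : TangentSpace 𝓘(ℝ, E) g},
      (⟨g, v⟩ : TangentBundle 𝓘(ℝ, E) G) = ⟨g, w⟩ → (v : E) = w := fun h => by
    simpa using h
  refine and_congr_right fun hX => ⟨fun ⟨hT, σ, hσ, h⟩ g => ⟨hT g, ?_⟩, fun h => ?_⟩
  · have h1 := θ.map_unit (S.s g) ⟨X (S.u (S.s g)), hT _⟩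
    rw [θ.map_eq, h] at h1
    have h2 : (⟨S.u (S.s (S.u (S.s g))), (σ (S.s (S.u (S.s g))) : TangentSpace 𝓘(ℝ, E) _)⟩ :
        TangentBundle 𝓘(ℝ, E) G) = ⟨S.u (S.s g), (σ (S.s g) : TangentSpace 𝓘(ℝ, E) _)⟩ :=
      congrArg (fun x => (⟨S.u x, (σ x : TangentSpace 𝓘(ℝ, E) _)⟩ : TangentBundle 𝓘(ℝ, E) G))
        (S.s_u (S.s g))
    rw [h]
    exact hmk (h2.symm.trans h1)
  · choose hT h using h
    exact ⟨hT, fun x => ⟨X (S.u x), hT _⟩, hX.comp S.smooth_u, fun g => Subtype.ext (h g)⟩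

/-- The vectors corresponding under a framing to a smooth section along the units. -/
theorem TFraming.contMDiffAt_inverse (θ : TFraming S) {K : Submodule ℝ E}
    {e : OpenPartialHomeomorph G (F × K)} (he : ContMDiffOn 𝓘(ℝ, E) 𝓘(ℝ, F × K) ∞ e e.source)
    {P : (g : G) → S.Tt g →ₗ[ℝ] K} {L : (g : G) → K →ₗ[ℝ] S.Tt g}
    (hPL : ∀ g ∈ e.source, (∀ v : S.Tt g,
      (mfderiv 𝓘(ℝ, E) 𝓘(ℝ, F × K) e g (v : TangentSpace 𝓘(ℝ, E) g) : F × K) = (0, P g v)) ∧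
      (∀ v, L g (P g v) = v) ∧ ∀ κ, P g (L g κ) = κ)
    (κ : K) {g₀ : G} (hg₀ : S.u (S.s g₀) ∈ e.source) :
    ContMDiffAt 𝓘(ℝ, E) 𝓘(ℝ, E).tangent ∞ (fun g => (⟨g, ((θ.iso g).symm (L (S.u (S.s g)) κ) :
      TangentSpace 𝓘(ℝ, E) g)⟩ : TangentBundle 𝓘(ℝ, E) G)) g₀ := by
  have : CompleteSpace E := FiniteDimensional.complete ℝ E
  have : CompleteSpace F := FiniteDimensional.complete ℝ F
  obtain ⟨K', e', hge', he', hes', P', L', hPL'⟩ := S.exists_adapted_coords g₀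
  let D : Set G := e'.source ∩ (fun g => S.u (S.s g)) ⁻¹' e.source
  have hD : IsOpen D := e'.open_source.inter
    (e.open_source.preimage (S.smooth_u.continuous.comp S.smooth_s.continuous))
  -- The matrix of the framing in adapted coordinates near `g₀` and near the unit. It depends
  -- smoothly on `g` and is invertible, so its inverse is smooth; the field in question has
  -- coordinates `(0, N⁻¹ κ)`.
  let N : G → K' →L[ℝ] K := fun g =>
    LinearMap.toContinuousLinearMap (P (S.u (S.s g)) ∘ₗ (θ.iso g).toLinearMap ∘ₗ L' g)
  have hN : ∀ g ∈ D, ∃ Ne : K' ≃L[ℝ] K, (Ne : K' →L[ℝ] K) = N g ∧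
      ∀ κ, Ne.symm κ = P' g ((θ.iso g).symm (L (S.u (S.s g)) κ)) := by
    intro g hg
    obtain ⟨-, -, h1, h2⟩ := hPL' g hg.1
    obtain ⟨-, h3, h4⟩ := hPL _ hg.2
    exact ⟨(LinearEquiv.ofLinearMap
      (P (S.u (S.s g)) ∘ₗ (θ.iso g).toLinearMap ∘ₗ L' g)
      (P' g ∘ₗ (θ.iso g).symm.toLinearMap ∘ₗ L (S.u (S.s g)))
      (by ext κ; simp [h1, h4]) (by ext κ; simp [h2, h3])).toContinuousLinearEquiv, by ext; rfl,
      fun κ => rfl⟩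
  have hfield : ∀ (V : F × K' → F × K') (g : G), g ∈ e'.source →
      ContDiffAt ℝ ∞ V (e' g) → ContMDiffAt 𝓘(ℝ, E) 𝓘(ℝ, E).tangent ∞ (fun g =>
        (⟨g, VectorField.mpullback 𝓘(ℝ, E) 𝓘(ℝ, F × K') e' V g⟩ : TangentBundle 𝓘(ℝ, E) G)) g := by
    intro V g hg hV
    exact ContMDiffAt.mpullback_vectorField_preimage (n := ∞) (m := ∞)
      (contMDiffAt_vectorSpace_iff_contDiffAt.2 hV) (he'.contMDiffAt (e'.open_source.mem_nhds hg))
      (hPL' g hg).1 (by simp)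
  have hpull : ∀ (V : F × K' → F × K') (g : G), g ∈ e'.source → ∀ v : S.Tt g,
      V (e' g) = (0, P' g v) →
      VectorField.mpullback 𝓘(ℝ, E) 𝓘(ℝ, F × K') e' V g = (v : TangentSpace 𝓘(ℝ, E) g) := by
    intro V g hg v hV
    obtain ⟨hinv, h1, -, -⟩ := hPL' g hg
    have h2 := h1 v
    obtain ⟨A, hA⟩ := hinv
    show (mfderiv 𝓘(ℝ, E) 𝓘(ℝ, F × K') e' g).inverse (V (e' g)) = _
    rw [← hA] at h2 ⊢
    rw [hV, ContinuousLinearMap.inverse_equiv]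
    refine (congrArg A.symm h2.symm).trans ?_
    exact A.symm_apply_apply _
  have hNs : ∀ β, ContMDiffOn 𝓘(ℝ, E) 𝓘(ℝ, K) ∞ (fun g => N g β) D := by
    intro β
    have h1 : ContMDiffOn 𝓘(ℝ, E) 𝓘(ℝ, E).tangent ∞
        (fun g => (⟨g, (L' g β : TangentSpace 𝓘(ℝ, E) g)⟩ : TangentBundle 𝓘(ℝ, E) G)) D := by
      intro g hg
      refine ((hfield (fun _ => (0, β)) g hg.1 contDiffAt_const).congr_of_eventuallyEq
        ?_).contMDiffWithinAt
      filter_upwards [e'.open_source.mem_nhds hg.1] with g' hg'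
      rw [hpull _ g' hg' (L' g' β) (by rw [(hPL' g' hg').2.2.2])]
    have h2 : ContMDiffOn 𝓘(ℝ, E) 𝓘(ℝ, E).tangent ∞ (fun g =>
        (⟨S.u (S.s g), (θ.iso g (L' g β) : TangentSpace 𝓘(ℝ, E) (S.u (S.s g)))⟩ :
          TangentBundle 𝓘(ℝ, E) G)) D :=
      (θ.smooth.comp h1 fun g hg => (L' g β).2).congr fun g hg => (θ.map_eq g (L' g β)).symm
    have h3 := he.contMDiffOn_tangentMapWithin (m := ∞) (by simp) e.open_source.uniqueMDiffOn
    have h4 := h3.comp h2 fun g hg => hg.2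
    have h5 := (contMDiff_snd_tangentBundle_modelSpace (F × K)
      𝓘(ℝ, F × K) (n := ∞)).comp_contMDiffOn h4
    have h6 := contDiff_snd.contMDiff (n := ∞).comp_contMDiffOn h5
    refine h6.congr fun g hg => ?_
    show P (S.u (S.s g)) (θ.iso g (L' g β)) = (mfderivWithin 𝓘(ℝ, E) 𝓘(ℝ, F × K) e e.source
      (S.u (S.s g)) (θ.iso g (L' g β) : TangentSpace 𝓘(ℝ, E) (S.u (S.s g))) : F × K).2
    rw [mfderivWithin_of_isOpen e.open_source hg.2, (hPL _ hg.2).1]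
  let Q : Set (F × K') := e'.target ∩ e'.symm ⁻¹' D
  have hQ : IsOpen Q := hes'.continuousOn.isOpen_inter_preimage e'.open_target hD
  have hNQ : ContDiffOn ℝ ∞ (fun z => N (e'.symm z)) Q := contDiffOn_clm_apply.2 fun β =>
    contMDiffOn_iff_contDiffOn.1 ((hNs β).comp (hes'.mono inter_subset_left) fun z hz => hz.2)
  have hg₀D : g₀ ∈ D := ⟨hge', hg₀⟩
  have hg₀Q : e' g₀ ∈ Q := ⟨e'.map_source hge', by rwa [mem_preimage, e'.left_inv hge']⟩
  let V : F × K' → F × K' := fun z => (0, (N (e'.symm z)).inverse κ)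
  have hV : ContDiffAt ℝ ∞ V (e' g₀) := by
    obtain ⟨Ne, hNe, -⟩ := hN g₀ hg₀D
    rw [← e'.left_inv hge'] at hNe
    have h1 : ContDiffAt ℝ ∞ ContinuousLinearMap.inverse (N (e'.symm (e' g₀))) := by
      rw [← hNe]; exact contDiffAt_map_inverse Ne
    exact contDiffAt_const.prodMk ((h1.comp (e' g₀) (hNQ.contDiffAt (hQ.mem_nhds hg₀Q))).clm_apply
      contDiffAt_const)
  refine (hfield V g₀ hge' hV).congr_of_eventuallyEq ?_
  filter_upwards [hD.mem_nhds hg₀D] with g hg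
  rw [hpull V g hg.1 ((θ.iso g).symm (L (S.u (S.s g)) κ)) ?_]
  show ((0 : F), (N (e'.symm (e' g))).inverse κ) = _
  obtain ⟨Ne, hNe, hNs⟩ := hN g hg
  rw [e'.left_inv hg.1, ← hNe, ContinuousLinearMap.inverse_equiv]
  exact congrArg (Prod.mk 0) (hNs κ)

/-- Extension of a framing by local frames. -/
theorem TFraming.exists_frame [T2Space M] (θ : TFraming S) (x : M) :
    ∃ (K : Submodule ℝ E) (W : Set M) (Λ : G → K →ₗ[ℝ] E), x ∈ W ∧
      IsFrame S {X | θ.LeftInvariant X} W Λ := by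
  classical
  obtain ⟨K, e, hxe, he, -, P, L, hPL⟩ := S.exists_adapted_coords (S.u x)
  obtain ⟨χ, hχ⟩ : ∃ χ : SmoothBumpFunction 𝓘(ℝ, F) x, tsupport χ ⊆ S.u ⁻¹' e.source := by
    obtain ⟨χ, -, h⟩ := (SmoothBumpFunction.nhds_basis_tsupport (I := 𝓘(ℝ, F)) x).mem_iff.1
      ((e.open_source.preimage S.smooth_u.continuous).mem_nhds hxe)
    exact ⟨χ, h⟩
  have hχs : ∀ y, χ y ≠ 0 → S.u y ∈ e.source := fun y hy => hχ (subset_tsupport _ hy)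
  let Y : (κ : K) → (g : G) → S.Tt g := fun κ g => (θ.iso g).symm (L (S.u (S.s g)) κ)
  -- Frames must consist of globally defined invariant fields. A cutoff that depends on the source
  -- alone preserves left-invariance, and the fields form a frame where the cutoff does not vanish.
  let Λ : G → K →ₗ[ℝ] E := fun g => χ (S.s g) • ((S.Tt g).subtype ∘ₗ
    (θ.iso g).symm.toLinearMap ∘ₗ L (S.u (S.s g)))
  have hΛ : ∀ g κ, (Λ g κ : E) = ((χ (S.s g) • Y κ g : S.Tt g) : TangentSpace 𝓘(ℝ, E) g) :=
    fun g κ => rfl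
  have hiso : ∀ g κ, θ.iso g (χ (S.s g) • Y κ g) = χ (S.s g) • L (S.u (S.s g)) κ := fun g κ => by
    rw [map_smul, LinearEquiv.apply_symm_apply]
  have hmk : ∀ {g : G} {v w : TangentSpace 𝓘(ℝ, E) g},
      (⟨g, v⟩ : TangentBundle 𝓘(ℝ, E) G) = ⟨g, w⟩ → (v : E) = w := fun h => by
    simpa using h
  have hunit : ∀ y κ, (Λ (S.u y) κ : E) =
      ((χ y • L (S.u y) κ : S.Tt (S.u y)) : TangentSpace 𝓘(ℝ, E) (S.u y)) := by
    intro y κ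
    have h1 := θ.map_unit y (χ (S.s (S.u y)) • Y κ (S.u y))
    rw [θ.map_eq, hiso] at h1
    have h2 := congrArg (fun x => (⟨S.u x, ((χ x • L (S.u x) κ : S.Tt (S.u x)) :
      TangentSpace 𝓘(ℝ, E) _)⟩ : TangentBundle 𝓘(ℝ, E) G)) (S.s_u y)
    exact hmk (h1.symm.trans h2)
  refine ⟨K, {y | χ y ≠ 0}, Λ, ?_, isOpen_ne_fun χ.continuous continuous_const,
    fun κ => ?_, fun g hg => ?_, fun g hg v hv => ?_, fun X hX g hg κ hκ => ?_⟩
  · show χ x ≠ 0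
    rw [χ.eq_one]; exact one_ne_zero
  · refine θ.leftInvariant_iff.2 ⟨?_, fun g => ⟨(χ (S.s g) • Y κ g).2, ?_⟩⟩
    · have h1 : ContMDiffOn 𝓘(ℝ, E) 𝓘(ℝ, E).tangent ∞
          (fun g => (⟨g, (Y κ g : TangentSpace 𝓘(ℝ, E) g)⟩ : TangentBundle 𝓘(ℝ, E) G))
          ((fun g => S.u (S.s g)) ⁻¹' e.source) := fun g hg =>
        (θ.contMDiffAt_inverse he (fun g hg => (hPL g hg).2) κ hg).contMDiffWithinAt
      refine ContMDiffOn.smul_section_of_tsupport (ψ := χ ∘ S.s)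
        ((χ.contMDiff.comp S.smooth_s).contMDiffOn) (e.open_source.preimage
          (S.smooth_u.continuous.comp S.smooth_s.continuous)) ?_ h1
      exact (tsupport_comp_subset_preimage χ S.smooth_s.continuous).trans fun g hg => hχ hg
    · exact (congrArg Subtype.val (hiso g κ)).trans (hunit (S.s g) κ).symm
  · intro κ κ' h
    have h1 : χ (S.s g) • Y κ g = χ (S.s g) • Y κ' g := Subtype.ext h
    have h2 := (θ.iso g).symm.injective (smul_right_injective _ hg h1)
    have h3 := congrArg (P (S.u (S.s g))) h2
    rwa [(hPL _ (hχs _ hg)).2.2.2, (hPL _ (hχs _ hg)).2.2.2] at h3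
  · refine ⟨(χ (S.s g))⁻¹ • P (S.u (S.s g)) (θ.iso g ⟨v, hv⟩), ?_⟩
    rw [map_smul]
    show (χ (S.s g))⁻¹ • ((χ (S.s g) • Y _ g : S.Tt g) : TangentSpace 𝓘(ℝ, E) g) = v
    have h1 : Y (P (S.u (S.s g)) (θ.iso g ⟨v, hv⟩)) g = ⟨v, hv⟩ := by
      show (θ.iso g).symm (L _ (P _ _)) = _
      rw [(hPL _ (hχs _ hg)).2.2.1, LinearEquiv.symm_apply_apply]
    rw [h1]
    exact inv_smul_smul₀ hg v
  · obtain ⟨hXs, hX⟩ := θ.leftInvariant_iff.1 hX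
    obtain ⟨hXt, hXe⟩ := hX g
    have h1 : χ (S.s g) • Y κ g = ⟨X g, hXt⟩ := by
      refine (θ.iso g).injective (Subtype.ext ?_)
      rw [hiso]
      exact ((hunit _ κ).symm.trans hκ).trans hXe.symm
    exact congrArg Subtype.val h1

end FramingCharts


/-! ### Invariant fields of framings as parallelisms -/

section FramingParallelism

variable {E F : Type*} [NormedAddCommGroup E] [NormedSpace ℝ E] [FiniteDimensional ℝ E]
  [NormedAddCommGroup F] [NormedSpace ℝ F] [FiniteDimensional ℝ F]
  {M : Type*} [TopologicalSpace M] [ChartedSpace F M] [IsManifold 𝓘(ℝ, F) ∞ M] [T2Space M]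
  {G : Type*} [TopologicalSpace G] [ChartedSpace E G] [IsManifold 𝓘(ℝ, E) ∞ G]
  {S : ArrowSpace E F M G}

/-- The left-invariant vector fields of a framing form a parallelism. -/
def TFraming.parallelism (θ : TFraming S) : LeftParallelism S where
  fields := {X | θ.LeftInvariant X}
  smooth _ hX := hX.1
  tangent _ hX := hX.2.1
  smul X hX f hf := by
    obtain ⟨hXs, hX⟩ := θ.leftInvariant_iff.1 hX
    refine θ.leftInvariant_iff.2 ⟨?_, fun g => ?_⟩
    · exact ContMDiff.smul_section (hf.comp S.smooth_s) hXs
    · obtain ⟨h, he⟩ := hX g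
      refine ⟨(S.Tt g).smul_mem _ h, ?_⟩
      have h1 : (⟨f (S.s g) • X g, (S.Tt g).smul_mem _ h⟩ : S.Tt g) = f (S.s g) • ⟨X g, h⟩ := rfl
      rw [h1, map_smul, S.s_u]
      exact congrArg (fun v : E => f (S.s g) • v) he
  frame := θ.exists_frame

omit [FiniteDimensional ℝ E] [FiniteDimensional ℝ F] [IsManifold 𝓘(ℝ, F) ∞ M] [T2Space M] in
/-- A source framing is a target framing of the opposite arrow space. -/
def SFraming.op (θ : SFraming S) : TFraming S.op where
  iso := θ.iso
  map := θ.map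
  map_eq := θ.map_eq
  smooth := θ.smooth
  map_unit := θ.map_unit

end FramingParallelism

/-! ### Rigidity, associativity and submersivity for a parallelism -/

section ParallelismGerms

variable {E F : Type*} [NormedAddCommGroup E] [NormedSpace ℝ E] [FiniteDimensional ℝ E]
  [NormedAddCommGroup F] [NormedSpace ℝ F] [FiniteDimensional ℝ F]
  {M : Type*} [TopologicalSpace M] [ChartedSpace F M] [IsManifold 𝓘(ℝ, F) ∞ M]
  {G : Type*} [TopologicalSpace G] [ChartedSpace E G] [IsManifold 𝓘(ℝ, E) ∞ G]
  {S : ArrowSpace E F M G}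

/-- Left translations preserve the first family of vector fields, right translations the
second. -/
def ArrowSpace.PreservesBoth (S : ArrowSpace E F M G)
    (𝓛 ℛ : Set ((g : G) → TangentSpace 𝓘(ℝ, E) g)) (f : G × G → G) (q : G × G) : Prop :=
  Preserves S 𝓛 (S.s q.1) (fun h => f (q.1, h)) q.2 ∧
    Preserves S.op ℛ (S.t q.2) (fun g => f (g, q.2)) q.1

omit [FiniteDimensional ℝ E] [FiniteDimensional ℝ F] [IsManifold 𝓘(ℝ, F) ∞ M]
  [IsManifold 𝓘(ℝ, E) ∞ G] in
theorem ArrowSpace.PreservesBoth.op {𝓛 ℛ : Set ((g : G) → TangentSpace 𝓘(ℝ, E) g)}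
    {f : G × G → G} {q : G × G} (h : S.PreservesBoth 𝓛 ℛ f q) :
    S.op.PreservesBoth ℛ 𝓛 (f ∘ Prod.swap) q.swap := ⟨h.2, h.1⟩

omit [FiniteDimensional ℝ E] [FiniteDimensional ℝ F] [IsManifold 𝓘(ℝ, F) ∞ M]
  [IsManifold 𝓘(ℝ, E) ∞ G] in
theorem ArrowSpace.PreservesBoth.congr {𝓛 ℛ : Set ((g : G) → TangentSpace 𝓘(ℝ, E) g)}
    {f f' : G × G → G} {q : G × G} (hq : q ∈ S.pairs) (hff' : f =ᶠ[𝓝[S.pairs] q] f')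
    (h : S.PreservesBoth 𝓛 ℛ f q) : S.PreservesBoth 𝓛 ℛ f' q := by
  have he : f' q = f q := (Filter.Eventually.self_of_nhdsWithin hff' hq).symm
  refine ⟨h.1.congr (Filter.EventuallyEq.symm ?_) he, h.2.congr (Filter.EventuallyEq.symm ?_) he⟩
  · exact S.tendsto_prodMk_left.eventually hff'
  · exact S.tendsto_prodMk_right.eventually hff'

variable (𝓛 : LeftParallelism S) {ℛ : Set ((g : G) → TangentSpace 𝓘(ℝ, E) g)}
  {f f' : G × G → G} {g h k : G}

omit [FiniteDimensional ℝ E] [FiniteDimensional ℝ F] [IsManifold 𝓘(ℝ, F) ∞ M]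
  [IsManifold 𝓘(ℝ, E) ∞ G] in
theorem ArrowSpace.Adm.preserves_left {𝓛 ℛ : Set ((g : G) → TangentSpace 𝓘(ℝ, E) g)}
    (hf : S.Adm (S.PreservesBoth 𝓛 ℛ) f (g, h)) :
    ∀ᶠ h' in 𝓝[S.t ⁻¹' {S.s g}] h, Preserves S 𝓛 (S.s g) (fun h => f (g, h)) h' :=
  (S.tendsto_prodMk_left.eventually (p := fun q => S.IsMulAt f q ∧ S.PreservesBoth 𝓛 ℛ f q)
    hf).mono fun _ h => h.2.1

theorem LeftParallelism.propagate (hgh : S.s g = S.t h)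
    (hf : S.Adm (S.PreservesBoth 𝓛.fields ℛ) f (g, h))
    (hf' : S.Adm (S.PreservesBoth 𝓛.fields ℛ) f' (g, h)) (he : f (g, h) = f' (g, h)) :
    ∀ᶠ h' in 𝓝[S.t ⁻¹' {S.s g}] h, f (g, h') = f' (g, h') :=
  Preserves.eventuallyEq 𝓛 hgh.symm hf.preserves_left hf'.preserves_left he

/-- The identity preserves every vector field, so left translation by a unit is compared with it. -/
theorem LeftParallelism.unit {x : M} (hx : S.t h = x)
    (hf : S.Adm (S.PreservesBoth 𝓛.fields ℛ) f (S.u x, h)) (he : f (S.u x, h) = h) :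
    ∀ᶠ h' in 𝓝[S.t ⁻¹' {x}] h, f (S.u x, h') = h' := by
  have h1 := hf.preserves_left
  rw [S.s_u] at h1
  refine Preserves.eventuallyEq 𝓛 hx h1 (.of_forall fun h' => ?_) he
  exact ⟨.id ℝ E, (hasMFDerivAt_id h').hasMFDerivWithinAt, fun X _ => rfl⟩

/-- Left translation by `f (g, h)` and the composite of the left translations by `h` and by `g` both
preserve the parallelism, and they agree at `k`. -/
theorem LeftParallelism.associates (hgh : S.s g = S.t h) (hhk : S.s h = S.t k)
    (h₁ : S.Adm (S.PreservesBoth 𝓛.fields ℛ) f (g, h))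
    (h₂ : S.Adm (S.PreservesBoth 𝓛.fields ℛ) f (h, k))
    (h₃ : S.Adm (S.PreservesBoth 𝓛.fields ℛ) f (f (g, h), k))
    (h₄ : S.Adm (S.PreservesBoth 𝓛.fields ℛ) f (g, f (h, k)))
    (he : f (f (g, h), k) = f (g, f (h, k))) :
    ∀ᶠ k' in 𝓝[S.t ⁻¹' {S.s h}] k, f (f (g, h), k') = f (g, f (h, k')) := by
  have hs : S.s (f (g, h)) = S.s h :=
    (Filter.Eventually.self_of_nhdsWithin (p := fun q => S.IsMulAt f q ∧ _) h₁ hgh).1.s_eq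
  have e₁ := h₃.preserves_left
  rw [hs] at e₁
  refine Preserves.eventuallyEq 𝓛 (φ₂ := (fun l => f (g, l)) ∘ fun k' => f (h, k')) hhk.symm e₁ ?_ he
  have h2 := S.tendsto_prodMk_left.eventually
    (p := fun q => S.IsMulAt f q ∧ S.PreservesBoth 𝓛.fields ℛ f q) h₂
  have hk2 := Filter.Eventually.self_of_nhdsWithin
    (p := fun q => S.IsMulAt f q ∧ S.PreservesBoth 𝓛.fields ℛ f q) h₂ hhk
  have ht : Filter.Tendsto (fun k' => f (h, k')) (𝓝[S.t ⁻¹' {S.s h}] k)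
      (𝓝[S.t ⁻¹' {S.s g}] (f (h, k))) :=
    tendsto_nhdsWithin_iff.2 ⟨hk2.1.smooth.continuousWithinAt.tendsto.comp S.tendsto_prodMk_left,
      h2.mono fun k' hk' => hk'.1.t_eq.trans hgh.symm⟩
  filter_upwards [h2, ht.eventually h₄.preserves_left, eventually_eventually_nhdsWithin.2 h2]
    with k' hk' hk4 hk5
  exact Preserves.comp (φ := fun k' => f (h, k')) hk4 hk'.2.1
    (hk5.mono fun k'' hk'' => hk''.1.t_eq.trans hgh.symm)

/-- Given `z`, a vector `v` at `g` with the same target projection is completed by some `w₀` to a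
tangent vector of the space of composable pairs. The remaining error `z - D (v, w₀)` is tangent to a
target fibre, hence a combination of the frame at the product, and it is the image of the same
combination at `h` under left translation. -/
theorem LeftParallelism.isSubmersionAt {q : G × G} (hq : q ∈ S.pairs)
    (hf : S.Adm (S.PreservesBoth 𝓛.fields ℛ) f q) : S.IsSubmersionAt f S.pairs q := by
  have hne : (∞ : WithTop ℕ∞) ≠ 0 := by simp
  obtain ⟨g, h⟩ := q
  -- Composing with the retraction onto composable pairs turns `f` into a map with an honest
  -- derivative on a neighbourhood in `G × G`.
  obtain ⟨O, R, hO, hqO, hR, hRO⟩ := S.exists_pairs_retraction hq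
  obtain ⟨hmul, hPq⟩ := Filter.Eventually.self_of_nhdsWithin
    (p := fun q => S.IsMulAt f q ∧ S.PreservesBoth 𝓛.fields ℛ f q) hf hq
  have hRq : R (g, h) = (g, h) := (hRO _ hqO).2.2 hq
  have hRt : Filter.Tendsto R (𝓝 (g, h)) (𝓝[S.pairs] (g, h)) :=
    tendsto_nhdsWithin_iff.2 ⟨by
      have := (hR.continuousOn.continuousAt (hO.mem_nhds hqO)).tendsto
      rwa [hRq] at this, Filter.eventually_of_mem (hO.mem_nhds hqO) fun q hq => (hRO q hq).1⟩
  have hfR : ContMDiffAt (𝓘(ℝ, E).prod 𝓘(ℝ, E)) 𝓘(ℝ, E) ∞ (f ∘ R) (g, h) := by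
    have h1 : ContMDiffWithinAt (𝓘(ℝ, E).prod 𝓘(ℝ, E)) 𝓘(ℝ, E) ∞ f S.pairs (R (g, h)) := by
      rw [hRq]; exact hmul.smooth
    exact (h1.comp (g, h) (hR.contMDiffAt (hO.mem_nhds hqO)).contMDiffWithinAt
      fun q hq => (hRO q hq).1).contMDiffAt (hO.mem_nhds hqO)
  obtain ⟨D, hD⟩ : ∃ D : E × E →L[ℝ] E,
      HasMFDerivAt (𝓘(ℝ, E).prod 𝓘(ℝ, E)) 𝓘(ℝ, E) (f ∘ R) (g, h) D :=
    ⟨_, (hfR.mdifferentiableAt hne).hasMFDerivAt⟩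
  have hDf : HasMFDerivWithinAt (𝓘(ℝ, E).prod 𝓘(ℝ, E)) 𝓘(ℝ, E) f S.pairs (g, h) D := by
    refine hD.hasMFDerivWithinAt.congr_of_eventuallyEq ?_ (congrArg f hRq.symm)
    filter_upwards [self_mem_nhdsWithin, nhdsWithin_le_nhds (hO.mem_nhds hqO)] with q hq hqO
    exact congrArg f ((hRO q hqO).2.2 hq).symm
  have hDt : ∀ v w : E, (mfderiv 𝓘(ℝ, E) 𝓘(ℝ, F) S.t (f (g, h)) (D (v, w)) : F) =
      mfderiv 𝓘(ℝ, E) 𝓘(ℝ, F) S.t g v := by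
    intro v w
    have ht : HasMFDerivAt 𝓘(ℝ, E) 𝓘(ℝ, F) S.t ((f ∘ R) (g, h))
        (mfderiv 𝓘(ℝ, E) 𝓘(ℝ, F) S.t (f (g, h)) : E →L[ℝ] F) := by
      have : (f ∘ R) (g, h) = f (g, h) := congrArg f hRq
      rw [this]
      exact ((S.smooth_t.contMDiffAt).mdifferentiableAt hne).hasMFDerivAt
    have h1 := ht.comp (g, h) hD
    have h2 := (((S.smooth_t.contMDiffAt (x := g)).mdifferentiableAt hne).hasMFDerivAt).comp
      (g, h) (hasMFDerivAt_fst (I := 𝓘(ℝ, E)) (I' := 𝓘(ℝ, E)) (g, h))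
    have h3 := h2.congr_of_eventuallyEq (f₁ := S.t ∘ (f ∘ R)) (by
      filter_upwards [hRt.eventually
        (p := fun q => S.IsMulAt f q ∧ S.PreservesBoth 𝓛.fields ℛ f q) hf,
        hO.mem_nhds hqO] with q hq hqO
      exact hq.1.t_eq.trans (congrArg S.t (hRO q hqO).2.1))
    exact congrArg (fun L : E × E →L[ℝ] F => L (v, w)) (hasMFDerivAt_unique h1 h3)
  refine ⟨D, hDf, ?_⟩
  intro (z : E)
  obtain ⟨(v : E), hv⟩ := S.submersion_t g (mfderiv 𝓘(ℝ, E) 𝓘(ℝ, F) S.t (f (g, h)) z : F)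
  obtain ⟨(w₀ : E), hw₀⟩ := S.submersion_t h (mfderiv 𝓘(ℝ, E) 𝓘(ℝ, F) S.s g v : F)
  obtain ⟨D', hD', hX⟩ := hPq.1
  obtain ⟨K, W, Λ, hW, hΛ⟩ := 𝓛.frame (S.s h)
  have hz : (z - D (v, w₀) : E) ∈ S.Tt (f (g, h)) := by
    show (mfderiv 𝓘(ℝ, E) 𝓘(ℝ, F) S.t (f (g, h)) (z - D (v, w₀) : E) : F) = 0
    refine (map_sub (mfderiv 𝓘(ℝ, E) 𝓘(ℝ, F) S.t (f (g, h)) : E →L[ℝ] F) z (D (v, w₀))).trans ?_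
    exact sub_eq_zero.2 (hv.symm.trans (hDt v w₀).symm)
  obtain ⟨κ, hκ⟩ := hΛ.surjective (f (g, h)) (by rw [hmul.s_eq]; exact hW) _ hz
  have h1 : HasMFDerivWithinAt 𝓘(ℝ, E) 𝓘(ℝ, E) (fun h => f (g, h)) (S.t ⁻¹' {S.s g}) h
      (D ∘L ContinuousLinearMap.inr ℝ E E) := by
    have h2 : HasMFDerivAt 𝓘(ℝ, E) (𝓘(ℝ, E).prod 𝓘(ℝ, E)) (fun h' : G => (g, h')) h
        (ContinuousLinearMap.inr ℝ E E) :=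
      (hasMFDerivAt_const g h).prodMk (hasMFDerivAt_id h)
    exact hDf.comp h h2.hasMFDerivWithinAt fun h' hh' => Eq.symm hh'
  have h2 : (D (0, Λ h κ) : E) = D' (Λ h κ) := fibre_deriv_unique S.smooth_t (S.submersion_t h)
    (𝓛.tangent _ (hΛ.mem κ) h) (Eq.symm hq) h1 hD'
  have h3 : (D (0, Λ h κ) : E) = z - D (v, w₀) := h2.trans ((hX _ (hΛ.mem κ)).trans hκ)
  refine ⟨v, (w₀ + Λ h κ : E), ?_, ?_⟩
  · let T : E →L[ℝ] F := mfderiv 𝓘(ℝ, E) 𝓘(ℝ, F) S.t h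
    have hT : T (Λ h κ) = 0 := 𝓛.tangent _ (hΛ.mem κ) h
    have h4 : T (w₀ + Λ h κ) = mfderiv 𝓘(ℝ, E) 𝓘(ℝ, F) S.s g v := by
      rw [map_add, hT, add_zero]
      exact hw₀
    have h5 : ∀ (x y : M) (a b : F), x = y → a = b →
        (⟨x, a⟩ : TangentBundle 𝓘(ℝ, F) M) = ⟨y, b⟩ := by rintro x _ a _ rfl rfl; rfl
    exact h5 _ _ _ _ hq h4.symm
  · have h6 : ((v, w₀ + Λ h κ) : E × E) = (v, w₀) + (0, Λ h κ) := by simp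
    refine (congrArg D h6).trans ((map_add D _ _).trans ?_)
    rw [h3]
    exact add_sub_cancel _ _

end ParallelismGerms


/-! ### Existence of a structure giving rise to given framings -/

section ParallelismGerms

variable {E F : Type*} [NormedAddCommGroup E] [NormedSpace ℝ E] [FiniteDimensional ℝ E]
  [NormedAddCommGroup F] [NormedSpace ℝ F] [FiniteDimensional ℝ F]
  {M : Type*} [TopologicalSpace M] [ChartedSpace F M] [IsManifold 𝓘(ℝ, F) ∞ M] [T2Space M]
  {G : Type*} [TopologicalSpace G] [ChartedSpace E G] [IsManifold 𝓘(ℝ, E) ∞ G]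
  {S : ArrowSpace E F M G}

theorem LeftParallelism.exists_adm (𝓛 : LeftParallelism S) (ℛ : LeftParallelism S.op)
    (h𝓛 : ∀ X ∈ 𝓛.fields, ∀ Y ∈ 𝓛.fields, VectorField.mlieBracket 𝓘(ℝ, E) X Y ∈ 𝓛.fields)
    (hc : ∀ X ∈ 𝓛.fields, ∀ Y ∈ ℛ.fields, ∀ g, VectorField.mlieBracket 𝓘(ℝ, E) X Y g = 0) (g : G) :
    ∃ f, S.Adm (S.PreservesBoth 𝓛.fields ℛ.fields) f (g, S.u (S.s g)) ∧
      ∀ᶠ g' in 𝓝 g, f (g', S.u (S.s g')) = g' := by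
  obtain ⟨N, f, hN, hgN, hf, hfu, hfN⟩ := 𝓛.exists_translations h𝓛 ℛ.smooth ℛ.tangent hc g
  refine ⟨f, ?_, hfu⟩
  filter_upwards [self_mem_nhdsWithin, nhdsWithin_le_nhds (hN.mem_nhds hgN)] with q hq hqN
  obtain ⟨h1, h2, h3⟩ := hfN q hqN hq
  exact ⟨⟨(hf.contMDiffAt (hN.mem_nhds hqN)).contMDiffWithinAt, h1, h2⟩, h3⟩

/-- The multiplications for which left translations preserve the members of a parallelism along
the target fibres, and right translations those of a commuting parallelism along the source
fibres. -/
def LeftParallelism.mulGerm (𝓛 : LeftParallelism S) (ℛ : LeftParallelism S.op)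
    (h𝓛 : ∀ X ∈ 𝓛.fields, ∀ Y ∈ 𝓛.fields, VectorField.mlieBracket 𝓘(ℝ, E) X Y ∈ 𝓛.fields)
    (hℛ : ∀ X ∈ ℛ.fields, ∀ Y ∈ ℛ.fields, VectorField.mlieBracket 𝓘(ℝ, E) X Y ∈ ℛ.fields)
    (hc : ∀ X ∈ 𝓛.fields, ∀ Y ∈ ℛ.fields, ∀ g, VectorField.mlieBracket 𝓘(ℝ, E) X Y g = 0) :
    MulGerm S :=
  have hop : ∀ {f : G × G → G} {q : G × G}, S.Adm (S.PreservesBoth 𝓛.fields ℛ.fields) f q →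
      S.op.Adm (S.op.PreservesBoth ℛ.fields 𝓛.fields) (f ∘ Prod.swap) q.swap := fun h =>
    h.op fun _ hq => hq.op
  { P := S.PreservesBoth 𝓛.fields ℛ.fields
    T := fun _ => True
    congr := fun hq hff' h => h.congr hq hff'
    propagate_left := fun hgh hf hf' he => 𝓛.propagate hgh hf hf' he
    propagate_right := fun hgh hf hf' he => ℛ.propagate hgh.symm (hop hf) (hop hf') he
    unit_left := fun hx hf he => 𝓛.unit hx hf he
    unit_right := fun hx hf he => ℛ.unit hx (hop hf) he
    submersion := fun hq hf => 𝓛.isSubmersionAt hq hf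
    T_near := fun _ => ⟨.of_forall fun _ => trivial, .of_forall fun _ => trivial,
      .of_forall fun _ => trivial⟩
    assoc_left := fun _ hgh hhk h₁ h₂ h₃ h₄ he => 𝓛.associates hgh hhk h₁ h₂ h₃ h₄ he
    assoc_right := fun _ hgh hhk h₁ h₂ h₃ h₄ he =>
      (ℛ.associates hhk.symm hgh.symm (hop h₂) (hop h₁) (hop h₄) (hop h₃) he.symm).mono
        fun _ => Eq.symm
    exists_right := 𝓛.exists_adm ℛ h𝓛 hc
    exists_left := fun g => by
      obtain ⟨f, hf, hfu⟩ := ℛ.exists_adm (S := S.op) 𝓛 hℛ (fun X hX Y hY g => by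
        rw [VectorField.mlieBracket_swap_apply, hc Y hY X hX, neg_zero]) g
      exact ⟨f ∘ Prod.swap, hf.op fun _ hq => hq.op, hfu⟩ }

/-- Translations preserving the left-invariant vector fields have the differentials prescribed by
the framing. -/
theorem TFraming.deriv_of_preserves (θ : TFraming S) {g : G} {φ : G → G}
    (hφ : Preserves S θ.parallelism.fields (S.s g) φ (S.u (S.s g))) (hg : φ (S.u (S.s g)) = g) :
    ∃ D : TangentSpace 𝓘(ℝ, E) (S.u (S.s g)) →L[ℝ] TangentSpace 𝓘(ℝ, E) (φ (S.u (S.s g))),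
      HasMFDerivWithinAt 𝓘(ℝ, E) 𝓘(ℝ, E) φ (S.t ⁻¹' {S.s g}) (S.u (S.s g)) D ∧
      BijOn D (S.Tt (S.u (S.s g))) (S.Tt (φ (S.u (S.s g)))) ∧
      ∀ v : S.Tt g, (⟨φ (S.u (S.s g)), D (θ.iso g v)⟩ : TangentBundle 𝓘(ℝ, E) G) = ⟨g, v⟩ := by
  obtain ⟨D, hD, hX⟩ := hφ
  obtain ⟨K, W, Λ, hW, hΛ⟩ := θ.parallelism.frame (S.s g)
  have key : ∀ v : S.Tt g, (D (θ.iso g v : TangentSpace 𝓘(ℝ, E) (S.u (S.s g))) : E) =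
      (v : TangentSpace 𝓘(ℝ, E) g) := by
    intro v
    obtain ⟨κ, hκ⟩ := hΛ.surjective g hW _ v.2
    obtain ⟨h1, h2⟩ := (θ.leftInvariant_iff.1 (hΛ.mem κ)).2 g
    have h3 : (⟨Λ g κ, h1⟩ : S.Tt g) = v := Subtype.ext hκ
    rw [h3] at h2
    refine (congrArg D h2).trans ((hX _ (hΛ.mem κ)).trans (Eq.trans ?_ hκ))
    rw [hg]
  refine ⟨D, hD, ?_, fun v => ?_⟩
  · have h1 : ∀ w : E, w ∈ S.Tt (φ (S.u (S.s g))) ↔ w ∈ S.Tt g := fun w => by rw [hg]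
    refine ⟨fun w hw => ?_, fun w hw w' hw' h => ?_, fun v hv => ?_⟩
    · refine (h1 _).2 ?_
      have h2 := key ((θ.iso g).symm ⟨w, hw⟩)
      rw [LinearEquiv.apply_symm_apply] at h2
      have h3 : (D w : E) ∈ S.Tt g := by
        rw [show (D w : E) = _ from h2]; exact ((θ.iso g).symm ⟨w, hw⟩).2
      exact h3
    · have h2 := key ((θ.iso g).symm ⟨w, hw⟩)
      have h3 := key ((θ.iso g).symm ⟨w', hw'⟩)
      rw [LinearEquiv.apply_symm_apply] at h2 h3
      have h4 := (θ.iso g).symm.injective (Subtype.ext (h2.symm.trans (Eq.trans h h3)))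
      exact congrArg Subtype.val h4
    · exact ⟨_, (θ.iso g ⟨v, (h1 v).1 hv⟩).2, key ⟨v, (h1 v).1 hv⟩⟩
  · have h5 : ∀ (x y : G) (a b : E), x = y → a = b →
        (⟨x, a⟩ : TangentBundle 𝓘(ℝ, E) G) = ⟨y, b⟩ := by rintro x _ a _ rfl rfl; rfl
    exact h5 _ _ _ _ hg (key v)

/-- The class of multiplications determined by framings satisfying the bracket conditions. -/
def BracketConditions.mulGerm {ωs : SFraming S} {ωt : TFraming S} (h : BracketConditions ωs ωt) :
    MulGerm S :=
  ωt.parallelism.mulGerm ωs.op.parallelism (fun X hX Y hY => h.1 X Y hX hY)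
    (fun X hX Y hY => h.2.1 X Y hX hY) fun X hX Y hY => h.2.2 X Y hX hY

/-- A local multiplication in the class of `BracketConditions.mulGerm` is completed by an inversion.
Since translations preserve invariant fields, their differentials at units are the ones prescribed
by the framings. -/
theorem BracketConditions.exists_givesRiseTo [ParacompactSpace M] {ωs : SFraming S}
    {ωt : TFraming S} (h : BracketConditions ωs ωt) :
    ∃ L : LocalLieGroupoid S, L.GivesRiseTo ωs ωt := by
  obtain ⟨f, hf⟩ := h.mulGerm.exists_isLocalMul
  obtain ⟨Γ, hΓ, hΓU⟩ := hf.exists_preGroupoid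
  obtain ⟨r, hr⟩ := Γ.exists_inversion
  obtain ⟨L, hLU, hLm, -, -⟩ := Γ.exists_localLieGroupoid hr (Q := fun _ => True)
    fun _ => .of_forall fun _ => trivial
  have hP : ∀ p ∈ L.U, S.PreservesBoth ωt.parallelism.fields ωs.op.parallelism.fields L.mul p := by
    intro p hp
    rw [hLU] at hp
    rw [hLm, hΓ]
    exact (Filter.Eventually.self_of_nhdsWithin (hΓU p hp) (Γ.pairs_of_mem hp)).2
  have hUs : ∀ g, {h | (g, h) ∈ L.U} ⊆ S.t ⁻¹' {S.s g} := fun g h hh => by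
    rw [mem_ofPred_eq, hLU] at hh; exact (Γ.pairs_of_mem hh).symm
  have hUt : ∀ g, {h | (h, g) ∈ L.U} ⊆ S.s ⁻¹' {S.t g} := fun g h hh => by
    rw [mem_ofPred_eq, hLU] at hh; exact Γ.pairs_of_mem hh
  have hl := fun g => ωt.deriv_of_preserves (hP _ (L.right_unit_mem g)).1 (L.mul_unit g)
  have hr := fun g => ωs.op.deriv_of_preserves (hP _ (L.left_unit_mem g)).2 (L.unit_mul g)
  refine ⟨L, fun g => ⟨?_, ?_⟩, fun g => ?_, fun g => ?_⟩
  · obtain ⟨D, hD, hb, -⟩ := hr g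
    exact ⟨D, hD.mono (hUt g), hb⟩
  · obtain ⟨D, hD, hb, -⟩ := hl g
    exact ⟨D, hD.mono (hUs g), hb⟩
  · obtain ⟨D, hD, -, hv⟩ := hr g
    exact ⟨D, hD.mono (hUt g), hv⟩
  · obtain ⟨D, hD, -, hv⟩ := hl g
    exact ⟨D, hD.mono (hUs g), hv⟩

end ParallelismGerms


/-! ### Brackets of related vector fields -/

section RelatedFields

variable {A E : Type*} [NormedAddCommGroup A] [NormedSpace ℝ A] [NormedAddCommGroup E]
  [NormedSpace ℝ E]

/-- Lie brackets of related vector fields are related. -/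
theorem fderiv_lieBracket_of_related {f : A → E} {Q : Set A} (hQ : IsOpen Q)
    (hf : ContDiffOn ℝ ∞ f Q) {V₁ V₂ : A → A} (hV₁ : ContDiffOn ℝ ∞ V₁ Q)
    (hV₂ : ContDiffOn ℝ ∞ V₂ Q) {X₁ X₂ : E → E} {a : A} (ha : a ∈ Q)
    (hX₁ : DifferentiableAt ℝ X₁ (f a)) (hX₂ : DifferentiableAt ℝ X₂ (f a))
    (h₁ : ∀ q ∈ Q, fderiv ℝ f q (V₁ q) = X₁ (f q)) (h₂ : ∀ q ∈ Q, fderiv ℝ f q (V₂ q) = X₂ (f q)) :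
    fderiv ℝ f a (fderiv ℝ V₂ a (V₁ a) - fderiv ℝ V₁ a (V₂ a)) =
      fderiv ℝ X₂ (f a) (X₁ (f a)) - fderiv ℝ X₁ (f a) (X₂ (f a)) := by
  have hne : (∞ : WithTop ℕ∞) ≠ 0 := by simp
  have hfa := hf.contDiffAt (hQ.mem_nhds ha)
  have hd := (hfa.differentiableAt hne).hasFDerivAt
  have hd2 : HasFDerivAt (fderiv ℝ f) (fderiv ℝ (fderiv ℝ f) a) a :=
    ((hfa.fderiv_right (m := ∞) (by simp)).differentiableAt hne).hasFDerivAt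
  -- The relation `Df (V) = X ∘ f` is differentiated along `W`. Antisymmetrizing removes the second
  -- derivative of `f`, which is symmetric.
  have key : ∀ {V W : A → A} {X Y : E → E}, ContDiffOn ℝ ∞ V Q → DifferentiableAt ℝ X (f a) →
      (∀ q ∈ Q, fderiv ℝ f q (V q) = X (f q)) → (∀ q ∈ Q, fderiv ℝ f q (W q) = Y (f q)) →
      fderiv ℝ (fderiv ℝ f) a (W a) (V a) + fderiv ℝ f a (fderiv ℝ V a (W a)) =
        fderiv ℝ X (f a) (Y (f a)) := by
    intro V W X Y hV hX hVX hWY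
    have hVd := ((hV.contDiffAt (hQ.mem_nhds ha)).differentiableAt hne).hasFDerivAt
    have h3 := hd2.clm_apply hVd
    have h4 := (hX.hasFDerivAt.comp a hd).congr_of_eventuallyEq
      (f₁ := fun q => fderiv ℝ f q (V q)) (Filter.eventually_of_mem (hQ.mem_nhds ha) hVX)
    have h5 := congrArg (fun L : A →L[ℝ] E => L (W a)) (h3.unique h4)
    simp only [ContinuousLinearMap.comp_apply, add_apply,
      ContinuousLinearMap.flip_apply, hWY a ha] at h5
    rw [← h5, add_comm]
  have hsym : IsSymmSndFDerivAt ℝ f a := hfa.isSymmSndFDerivAt (by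
    simpa using (ENat.LEInfty.out : (2 : WithTop ℕ∞) ≤ ∞))
  rw [← key hV₂ hX₂ h₂ h₁, ← key hV₁ hX₁ h₁ h₂, hsym.eq (V₁ a) (V₂ a), map_sub]
  abel

variable [FiniteDimensional ℝ E] {G : Type*} [TopologicalSpace G] [ChartedSpace E G]
  [IsManifold 𝓘(ℝ, E) ∞ G]

/-- Lie brackets of vector fields related by a parametrization. -/
theorem mlieBracket_of_related {f : A → G} {Q : Set A} (hQ : IsOpen Q)
    (hf : ContMDiffOn 𝓘(ℝ, A) 𝓘(ℝ, E) ∞ f Q) {V₁ V₂ : A → A} (hV₁ : ContDiffOn ℝ ∞ V₁ Q)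
    (hV₂ : ContDiffOn ℝ ∞ V₂ Q) {X₁ X₂ : (g : G) → TangentSpace 𝓘(ℝ, E) g}
    (hX₁ : ContMDiff 𝓘(ℝ, E) 𝓘(ℝ, E).tangent ∞ (fun g => (⟨g, X₁ g⟩ : TangentBundle 𝓘(ℝ, E) G)))
    (hX₂ : ContMDiff 𝓘(ℝ, E) 𝓘(ℝ, E).tangent ∞ (fun g => (⟨g, X₂ g⟩ : TangentBundle 𝓘(ℝ, E) G)))
    (h₁ : ∀ q ∈ Q, ∀ D : A →L[ℝ] E, HasMFDerivAt 𝓘(ℝ, A) 𝓘(ℝ, E) f q D → D (V₁ q) = (X₁ (f q) : E))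
    (h₂ : ∀ q ∈ Q, ∀ D : A →L[ℝ] E, HasMFDerivAt 𝓘(ℝ, A) 𝓘(ℝ, E) f q D → D (V₂ q) = (X₂ (f q) : E))
    {a : A} (ha : a ∈ Q) {D : A →L[ℝ] E} (hD : HasMFDerivAt 𝓘(ℝ, A) 𝓘(ℝ, E) f a D) :
    D (fderiv ℝ V₂ a (V₁ a) - fderiv ℝ V₁ a (V₂ a)) =
      (VectorField.mlieBracket 𝓘(ℝ, E) X₁ X₂ (f a) : E) := by
  have hne : (∞ : WithTop ℕ∞) ≠ 0 := by simp
  set c := extChartAt 𝓘(ℝ, E) (f a) with hc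
  have hcs : IsOpen c.source := isOpen_extChartAt_source _
  have hcm : ContMDiffOn 𝓘(ℝ, E) 𝓘(ℝ, E) ∞ c c.source := by
    rw [hc, extChartAt_source]; exact contMDiffOn_extChartAt
  let Q' : Set A := Q ∩ f ⁻¹' c.source
  have hQ' : IsOpen Q' := hf.continuousOn.isOpen_inter_preimage hQ hcs
  have ha' : a ∈ Q' := ⟨ha, mem_extChartAt_source _⟩
  have hF : ContDiffOn ℝ ∞ (fun q => c (f q)) Q' := by
    rw [← contMDiffOn_iff_contDiffOn]
    exact hcm.comp (hf.mono inter_subset_left) fun q hq => hq.2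
  have hchart : ∀ q ∈ Q', ∃ (C : E ≃L[ℝ] E) (D' : A →L[ℝ] E),
      HasMFDerivAt 𝓘(ℝ, E) 𝓘(ℝ, E) c (f q) (C : E →L[ℝ] E) ∧
      HasMFDerivAt 𝓘(ℝ, A) 𝓘(ℝ, E) f q D' ∧ fderiv ℝ (fun q => c (f q)) q = C ∘L D' := by
    intro q hq
    obtain ⟨C, -, hC⟩ := hasMFDerivAt_chart_symm (c.map_source hq.2)
    rw [c.left_inv hq.2] at hC
    obtain ⟨D', hD'⟩ : ∃ D' : A →L[ℝ] E, HasMFDerivAt 𝓘(ℝ, A) 𝓘(ℝ, E) f q D' :=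
      ⟨_, ((hf.contMDiffAt (hQ.mem_nhds hq.1)).mdifferentiableAt hne).hasMFDerivAt⟩
    have hfd : HasFDerivAt (fun q => c (f q)) ((C.symm : E →L[ℝ] E) ∘L D') q :=
      (hC.comp q hD').hasFDerivAt
    exact ⟨C.symm, D', hC, hD', hfd.fderiv⟩
  have hrel : ∀ (V : A → A) (X : (g : G) → TangentSpace 𝓘(ℝ, E) g),
      (∀ q ∈ Q, ∀ D : A →L[ℝ] E, HasMFDerivAt 𝓘(ℝ, A) 𝓘(ℝ, E) f q D → D (V q) = (X (f q) : E)) →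
      ∀ q ∈ Q', fderiv ℝ (fun q => c (f q)) q (V q) = chartField (f a) X (c (f q)) := by
    intro V X h q hq
    obtain ⟨C, D', hC, hD', he⟩ := hchart q hq
    rw [he]
    exact (congrArg C (h q hq.1 D' hD')).trans (chartField_apply hq.2 hC X)
  have hdiff : ∀ {X : (g : G) → TangentSpace 𝓘(ℝ, E) g}, ContMDiff 𝓘(ℝ, E) 𝓘(ℝ, E).tangent ∞
      (fun g => (⟨g, X g⟩ : TangentBundle 𝓘(ℝ, E) G)) →
      DifferentiableAt ℝ (chartField (f a) X) (c (f a)) := fun hX =>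
    ((contDiffOn_chartField (f a) hX).contDiffAt ((isOpen_extChartAt_target _).mem_nhds
      (mem_extChartAt_target _))).differentiableAt hne
  have key := fderiv_lieBracket_of_related hQ' hF (hV₁.mono inter_subset_left)
    (hV₂.mono inter_subset_left) ha' (hdiff hX₁) (hdiff hX₂) (hrel V₁ X₁ h₁) (hrel V₂ X₂ h₂)
  rw [lieBracket_chartField (mem_extChartAt_target _) hX₁ hX₂] at key
  obtain ⟨C, D', hC, hD', he⟩ := hchart a ha'
  have hDD' : D = D' := hasMFDerivAt_unique hD hD'
  rw [he, ← hDD'] at key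
  refine C.injective (key.trans ?_)
  exact (chartField_apply ha'.2 hC _).symm

end RelatedFields

/-! ### Parametrizations of target fibres -/

section FibreSlices

variable {E F : Type*} [NormedAddCommGroup E] [NormedSpace ℝ E] [FiniteDimensional ℝ E]
  [NormedAddCommGroup F] [NormedSpace ℝ F] [FiniteDimensional ℝ F]
  {M : Type*} [TopologicalSpace M] [ChartedSpace F M] [IsManifold 𝓘(ℝ, F) ∞ M]
  {G : Type*} [TopologicalSpace G] [ChartedSpace E G] [IsManifold 𝓘(ℝ, E) ∞ G]

/-- Parametrizations of the target fibres. -/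
theorem ArrowSpace.exists_fibre_slice (S : ArrowSpace E F M G) (h : G) :
    ∃ (K : Submodule ℝ E) (γ : K → G) (O : Set K), IsOpen O ∧ 0 ∈ O ∧ γ 0 = h ∧
      ContMDiffOn 𝓘(ℝ, K) 𝓘(ℝ, E) ∞ γ O ∧ (∀ a ∈ O, S.t (γ a) = S.t h) ∧
      ∀ X : (g : G) → TangentSpace 𝓘(ℝ, E) g,
        ContMDiff 𝓘(ℝ, E) 𝓘(ℝ, E).tangent ∞ (fun g => (⟨g, X g⟩ : TangentBundle 𝓘(ℝ, E) G)) →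
        (∀ g, X g ∈ S.Tt g) → ∃ ξ : K → K, ContDiffOn ℝ ∞ ξ O ∧ ∀ a ∈ O, ∀ D : K →L[ℝ] E,
          HasMFDerivAt 𝓘(ℝ, K) 𝓘(ℝ, E) γ a D → D (ξ a) = (X (γ a) : E) := by
  have hne : (∞ : WithTop ℕ∞) ≠ 0 := by simp
  obtain ⟨K, Φ, hs, hW, hΦ, -⟩ := exists_fibreChart S.smooth_t h (S.submersion_t h)
    (w := fun _ => h) contMDiff_const rfl
  have hmem : ∀ a ∈ Metric.ball (0 : K) Φ.r, (S.t h, a) ∈ Φ.e.target := fun a ha => by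
    rw [Φ.target_eq]; exact ⟨hW, ha⟩
  have hγs : ContMDiffOn 𝓘(ℝ, K) 𝓘(ℝ, E) ∞ (fun a => Φ.e.symm (S.t h, a)) (Metric.ball 0 Φ.r) :=
    Φ.smooth_symm.comp (contMDiff_const.prodMk contMDiff_id).contMDiffOn hmem
  have hγt : ∀ a ∈ Metric.ball (0 : K) Φ.r, S.t (Φ.e.symm (S.t h, a)) = S.t h := fun a ha => by
    rw [← Φ.fst_eq _ (Φ.e.map_target (hmem a ha)), Φ.e.right_inv (hmem a ha)]
  have hp : ContMDiffOn 𝓘(ℝ, E) 𝓘(ℝ, K) ∞ (fun g => (Φ.e g).2) Φ.e.source :=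
    contMDiff_snd.comp_contMDiffOn Φ.smooth
  refine ⟨K, fun a => Φ.e.symm (S.t h, a), Metric.ball 0 Φ.r, Metric.isOpen_ball,
    Metric.mem_ball_self Φ.r_pos, ?_, hγs, hγt, fun X hX hXt => ?_⟩
  · show Φ.e.symm (S.t h, 0) = h
    rw [← hΦ, Φ.e.left_inv hs]
  -- The coordinate expression of `X` is its image under the differential of the fibre coordinate.
  -- On vectors tangent to the fibre this differential is inverse to that of the parametrization.
  refine ⟨fun a => (mfderiv 𝓘(ℝ, E) 𝓘(ℝ, K) (fun g => (Φ.e g).2) (Φ.e.symm (S.t h, a))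
    (X (Φ.e.symm (S.t h, a))) : K), ?_, fun a ha D hD => ?_⟩
  · have h1 := hp.contMDiffOn_tangentMapWithin (m := ∞) (by simp) Φ.e.open_source.uniqueMDiffOn
    have h2 := h1.comp (hX.comp_contMDiffOn hγs) fun a ha => Φ.e.map_target (hmem a ha)
    have h3 := (contMDiff_snd_tangentBundle_modelSpace K 𝓘(ℝ, K) (n := ∞)).comp_contMDiffOn h2
    refine contMDiffOn_iff_contDiffOn.1 (h3.congr fun a ha => ?_)
    show _ = (mfderivWithin 𝓘(ℝ, E) 𝓘(ℝ, K) (fun g => (Φ.e g).2) Φ.e.source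
      (Φ.e.symm (S.t h, a)) (X (Φ.e.symm (S.t h, a))) : K)
    rw [mfderivWithin_of_isOpen Φ.e.open_source (Φ.e.map_target (hmem a ha))]
  · set g := Φ.e.symm (S.t h, a) with hg
    have hgs : g ∈ Φ.e.source := Φ.e.map_target (hmem a ha)
    have hga : (Φ.e g).2 = a := by rw [hg, Φ.e.right_inv (hmem a ha)]
    obtain ⟨P, hP⟩ : ∃ P : E →L[ℝ] K, HasMFDerivAt 𝓘(ℝ, E) 𝓘(ℝ, K) (fun g => (Φ.e g).2) g P :=
      ⟨_, ((hp.contMDiffAt (Φ.e.open_source.mem_nhds hgs)).mdifferentiableAt hne).hasMFDerivAt⟩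
    refine (congrArg (fun L : E →L[ℝ] K => D (L (X g))) hP.mfderiv).trans ?_
    rw [← hga] at hD
    have h1 : HasMFDerivWithinAt 𝓘(ℝ, E) 𝓘(ℝ, E) (fun h' => Φ.e.symm (S.t h, (Φ.e h').2))
        (S.t ⁻¹' {S.t h}) g (D ∘L P) := (hD.comp g hP).hasMFDerivWithinAt
    have h2 : HasMFDerivWithinAt 𝓘(ℝ, E) 𝓘(ℝ, E) (fun h' => Φ.e.symm (S.t h, (Φ.e h').2))
        (S.t ⁻¹' {S.t h}) g (.id ℝ E) := by
      refine (hasMFDerivAt_id g).hasMFDerivWithinAt.congr_of_eventuallyEq ?_ ?_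
      · filter_upwards [self_mem_nhdsWithin, nhdsWithin_le_nhds (Φ.e.open_source.mem_nhds hgs)]
          with h' h1 h2
        rw [← show S.t h' = S.t h from h1, ← Φ.fst_eq _ h2]
        exact Φ.e.left_inv h2
      · rw [hga]
        rfl
    exact fibre_deriv_unique S.smooth_t (S.submersion_t g) (hXt g) (hγt a ha) h1 h2

end FibreSlices


/-! ### Translations in a structure giving rise to framings -/

section TranslationGerms

variable {E F : Type*} [NormedAddCommGroup E] [NormedSpace ℝ E] [FiniteDimensional ℝ E]
  [NormedAddCommGroup F] [NormedSpace ℝ F] [FiniteDimensional ℝ F]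
  {M : Type*} [TopologicalSpace M] [ChartedSpace F M] [IsManifold 𝓘(ℝ, F) ∞ M]
  {G : Type*} [TopologicalSpace G] [ChartedSpace E G] [IsManifold 𝓘(ℝ, E) ∞ G]
  {S : ArrowSpace E F M G}

theorem ArrowSpace.IsMulAt.exists_left_deriv {f : G × G → G} {g h : G}
    (hf : S.IsMulAt f (g, h)) : ∃ D : E →L[ℝ] E,
      HasMFDerivWithinAt 𝓘(ℝ, E) 𝓘(ℝ, E) (fun k => f (g, k)) (S.t ⁻¹' {S.s g}) h D := by
  have hne : (∞ : WithTop ℕ∞) ≠ 0 := by simp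
  have h2 : HasMFDerivAt 𝓘(ℝ, E) (𝓘(ℝ, E).prod 𝓘(ℝ, E)) (fun h' : G => (g, h')) h
      (ContinuousLinearMap.inr ℝ E E) :=
    (hasMFDerivAt_const g h).prodMk (hasMFDerivAt_id h)
  have h1 := (hf.smooth.mdifferentiableWithinAt hne).hasMFDerivWithinAt
  exact ⟨_, h1.comp h h2.hasMFDerivWithinAt fun h' hh' => Eq.symm hh'⟩

/-- If left translations have the prescribed differentials at units, then by associativity they
have the prescribed differentials everywhere. -/
theorem Preserves.of_assoc {fields : Set ((g : G) → TangentSpace 𝓘(ℝ, E) g)}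
    (hT : ∀ X ∈ fields, ∀ g, X g ∈ S.Tt g) {f : G × G → G} {g h : G} (hgh : S.s g = S.t h)
    (hf : S.IsMulAt f (g, h))
    (h₁ : Preserves S fields (S.s h) (fun k => f (h, k)) (S.u (S.s h)))
    (h₂ : Preserves S fields (S.s h) (fun k => f (f (g, h), k)) (S.u (S.s h)))
    (e₁ : f (h, S.u (S.s h)) = h) (e₂ : f (f (g, h), S.u (S.s h)) = f (g, h))
    (ht : ∀ᶠ k in 𝓝[S.t ⁻¹' {S.s h}] S.u (S.s h), S.t (f (h, k)) = S.t h)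
    (ha : ∀ᶠ k in 𝓝[S.t ⁻¹' {S.s h}] S.u (S.s h), f (f (g, h), k) = f (g, f (h, k))) :
    Preserves S fields (S.s g) (fun k => f (g, k)) h := by
  obtain ⟨D, hD⟩ := hf.exists_left_deriv
  obtain ⟨D₁, hD₁, hX₁⟩ := h₁
  obtain ⟨D₂, hD₂, hX₂⟩ := h₂
  refine ⟨D, hD, fun X hX => ?_⟩
  have hD' : HasMFDerivWithinAt 𝓘(ℝ, E) 𝓘(ℝ, E) (fun k => f (g, k)) (S.t ⁻¹' {S.s g})
      ((fun k => f (h, k)) (S.u (S.s h))) D := by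
    show HasMFDerivWithinAt 𝓘(ℝ, E) 𝓘(ℝ, E) (fun k => f (g, k)) _ (f (h, S.u (S.s h))) D
    rw [e₁]; exact hD
  have hsub : S.t ⁻¹' {S.s h} ∩ {k | S.t (f (h, k)) = S.t h} ⊆
      (fun k => f (h, k)) ⁻¹' (S.t ⁻¹' {S.s g}) := fun k hk =>
    (show S.t (f (h, k)) = S.t h from hk.2).trans hgh.symm
  have h3 := hD'.comp (S.u (S.s h))
    (hD₁.mono (inter_subset_left (t := {k | S.t (f (h, k)) = S.t h})))
    hsub
  have h4 : HasMFDerivWithinAt 𝓘(ℝ, E) 𝓘(ℝ, E) (fun k => f (f (g, h), k)) (S.t ⁻¹' {S.s h})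
      (S.u (S.s h)) (D ∘L D₁) := by
    refine (h3.mono_of_mem_nhdsWithin (Filter.inter_mem self_mem_nhdsWithin ht)).congr_of_eventuallyEq
      ha ?_
    exact e₂.trans (congrArg (fun k => f (g, k)) e₁).symm
  -- Near the unit over `s h`, translation by `h` followed by translation by `g` is translation by
  -- `f (g, h)`. Two of the three differentials are known at this unit; their quotient is the
  -- differential of translation by `g` at `h`.
  have h5 : D (D₁ (X (S.u (S.s h)))) = D₂ (X (S.u (S.s h))) :=
    fibre_deriv_unique S.smooth_t (S.submersion_t _) (hT X hX _) (S.t_u _) h4 hD₂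
  have h6 : (D₁ (X (S.u (S.s h))) : E) = X h := by
    refine (hX₁ X hX).trans ?_
    exact congrArg (fun k => (X k : E)) e₁
  have h7 : (D₂ (X (S.u (S.s h))) : E) = X (f (g, h)) := by
    refine (hX₂ X hX).trans ?_
    exact congrArg (fun k => (X k : E)) e₂
  exact (congrArg D h6).symm.trans (h5.trans h7)

variable [T2Space M]

/-- The converse of `TFraming.deriv_of_preserves`: an invariant field has at `u (s g)` the value
that the framing assigns to its value at `g`. -/
theorem TFraming.preserves_of_deriv (θ : TFraming S) {g : G} {φ : G → G} {A : Set G}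
    (hA : A ∈ 𝓝[S.t ⁻¹' {S.s g}] S.u (S.s g)) (hg : φ (S.u (S.s g)) = g)
    {D : TangentSpace 𝓘(ℝ, E) (S.u (S.s g)) →L[ℝ] TangentSpace 𝓘(ℝ, E) (φ (S.u (S.s g)))}
    (hD : HasMFDerivWithinAt 𝓘(ℝ, E) 𝓘(ℝ, E) φ A (S.u (S.s g)) D)
    (hv : ∀ v : S.Tt g, (⟨φ (S.u (S.s g)), D (θ.iso g v)⟩ : TangentBundle 𝓘(ℝ, E) G) = ⟨g, v⟩) :
    Preserves S θ.parallelism.fields (S.s g) φ (S.u (S.s g)) := by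
  have key : ∀ (x : G) (a b : E), x = g →
      (⟨x, a⟩ : TangentBundle 𝓘(ℝ, E) G) = ⟨g, b⟩ → a = b := by
    rintro x a b rfl h; cases h; rfl
  refine ⟨D, hD.mono_of_mem_nhdsWithin hA, fun X hX => ?_⟩
  obtain ⟨h1, h2⟩ := (θ.leftInvariant_iff.1 hX).2 g
  have h3 := key _ _ _ hg (hv ⟨X g, h1⟩)
  refine (congrArg D h2).symm.trans (Eq.trans h3 ?_)
  exact congrArg (fun k => (X k : E)) hg.symm

theorem LocalLieGroupoid.GivesRiseTo.preserves {L : LocalLieGroupoid S} {ωs : SFraming S}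
    {ωt : TFraming S} (h : L.GivesRiseTo ωs ωt) (g : G) :
    Preserves S ωt.parallelism.fields (S.s g) (fun h => L.mul (g, h)) (S.u (S.s g)) ∧
    Preserves S.op ωs.op.parallelism.fields (S.t g) (fun h => L.mul (h, g)) (S.u (S.t g)) := by
  obtain ⟨-, hr, hl⟩ := h
  constructor
  · obtain ⟨D, hD, hv⟩ := hl g
    refine ωt.preserves_of_deriv ?_ (L.mul_unit g) hD hv
    exact S.tendsto_prodMk_left (L.toPreGroupoid.eventually_mem (L.right_unit_mem g))
  · obtain ⟨D, hD, hv⟩ := hr g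
    refine ωs.op.preserves_of_deriv ?_ (L.unit_mul g) hD hv
    exact S.tendsto_prodMk_right (L.toPreGroupoid.eventually_mem (L.left_unit_mem g))

/-- The multiplication of a local Lie groupoid giving rise to framings is compatible with them near
pairs for which the relevant triples associate. -/
theorem LocalLieGroupoid.GivesRiseTo.adm {L : LocalLieGroupoid S} {ωs : SFraming S}
    {ωt : TFraming S} (h : L.GivesRiseTo ωs ωt) {p : G × G} (hp : p ∈ L.U)
    {O : Set (G × G × G)} (hO : IsOpen O) (hr : (p.1, p.2, S.u (S.s p.2)) ∈ O)
    (hl : (S.u (S.t p.1), p.1, p.2) ∈ O)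
    (ha : ∀ g h k, (g, h, k) ∈ O → S.s g = S.t h → S.s h = S.t k →
      L.mul (L.mul (g, h), k) = L.mul (g, L.mul (h, k))) :
    S.Adm (S.PreservesBoth ωt.parallelism.fields ωs.op.parallelism.fields) L.mul p := by
  have c₁ : Continuous fun q : G × G => (q.1, q.2, S.u (S.s q.2)) :=
    continuous_fst.prodMk (continuous_snd.prodMk
      ((S.smooth_u.continuous.comp S.smooth_s.continuous).comp continuous_snd))
  have c₂ : Continuous fun q : G × G => (S.u (S.t q.1), q.1, q.2) :=
    ((S.smooth_u.continuous.comp S.smooth_t.continuous).comp continuous_fst).prodMk continuous_id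
  filter_upwards [L.toPreGroupoid.eventually_mem hp, nhdsWithin_le_nhds
    (c₁.continuousAt.preimage_mem_nhds (hO.mem_nhds hr)), nhdsWithin_le_nhds
    (c₂.continuousAt.preimage_mem_nhds (hO.mem_nhds hl))]
  rintro ⟨g, h'⟩ hU h1 h2
  have hgh : S.s g = S.t h' := L.toPreGroupoid.pairs_of_mem hU
  have hm : S.IsMulAt L.mul (g, h') := L.toPreGroupoid.isMulAt _ hU
  have hs : S.s (L.mul (g, h')) = S.s h' := hm.s_eq
  have ht : S.t (L.mul (g, h')) = S.t g := hm.t_eq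
  refine ⟨hm, ?_, ?_⟩
  · have p₂ := (h.preserves (L.mul (g, h'))).1
    have e₂ := L.mul_unit (L.mul (g, h'))
    rw [hs] at p₂ e₂
    refine Preserves.of_assoc ωt.parallelism.tangent hgh hm (h.preserves h').1 p₂ (L.mul_unit h')
      e₂ ?_ ?_
    · filter_upwards [S.tendsto_prodMk_left
        (L.toPreGroupoid.eventually_mem (L.right_unit_mem h'))] with k hk using L.t_mul _ hk
    · have c : Continuous fun k : G => (g, h', k) := by fun_prop
      filter_upwards [nhdsWithin_le_nhds (c.continuousAt.preimage_mem_nhds (hO.mem_nhds h1)),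
        self_mem_nhdsWithin] with k hk hk'
      exact ha _ _ _ hk hgh (Eq.symm hk')
  · have p₂ := (h.preserves (L.mul (g, h'))).2
    have e₂ := L.unit_mul (L.mul (g, h'))
    rw [ht] at p₂ e₂
    refine Preserves.of_assoc (S := S.op) (f := L.mul ∘ Prod.swap) (g := h') (h := g)
      ωs.op.parallelism.tangent hgh.symm hm.op (h.preserves g).2 p₂ (L.unit_mul g)
      e₂ ?_ ?_
    · filter_upwards [S.tendsto_prodMk_right
        (L.toPreGroupoid.eventually_mem (L.left_unit_mem g))] with k hk using L.s_mul _ hk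
    · have c : Continuous fun k : G => (k, g, h') := by fun_prop
      filter_upwards [nhdsWithin_le_nhds (c.continuousAt.preimage_mem_nhds (hO.mem_nhds h2)),
        self_mem_nhdsWithin] with k hk hk'
      exact (ha _ _ _ hk hk' hgh).symm

/-- Adjoining a unit to `(g, u (s g))` or `(u (t g), g)`, on either side, gives a triple with two
unit entries, where local associativity is available. -/
theorem LocalLieGroupoid.GivesRiseTo.adm_units {L : LocalLieGroupoid S} {ωs : SFraming S}
    {ωt : TFraming S} (h : L.GivesRiseTo ωs ωt) (g : G) :
    S.Adm (S.PreservesBoth ωt.parallelism.fields ωs.op.parallelism.fields) L.mul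
      (g, S.u (S.s g)) ∧
    S.Adm (S.PreservesBoth ωt.parallelism.fields ωs.op.parallelism.fields) L.mul
      (S.u (S.t g), g) := by
  obtain ⟨O, hO, hu, ha⟩ := L.assoc
  have ha' : ∀ g h k, (g, h, k) ∈ O → S.s g = S.t h → S.s h = S.t k →
      L.mul (L.mul (g, h), k) = L.mul (g, L.mul (h, k)) := fun g h k hk h1 h2 =>
    (ha g h k hk h1 h2).2.2.2.2
  refine ⟨h.adm (L.right_unit_mem g) hO ?_ (hu g).2.1 ha',
    h.adm (L.left_unit_mem g) hO (hu g).2.1 ?_ ha'⟩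
  · have := (hu g).2.2
    simpa only [S.s_u] using this
  · have := (hu g).1
    simpa only [S.t_u] using this

end TranslationGerms


/-! ### The bracket conditions for a local Lie groupoid -/

section BracketsOfInvariantFields

variable {E F : Type*} [NormedAddCommGroup E] [NormedSpace ℝ E] [FiniteDimensional ℝ E]
  [NormedAddCommGroup F] [NormedSpace ℝ F] [FiniteDimensional ℝ F]
  {M : Type*} [TopologicalSpace M] [ChartedSpace F M] [IsManifold 𝓘(ℝ, F) ∞ M]
  {G : Type*} [TopologicalSpace G] [ChartedSpace E G] [IsManifold 𝓘(ℝ, E) ∞ G]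
  {S : ArrowSpace E F M G}

/-- A map that preserves the vector fields of a parallelism preserves their brackets. -/
theorem Preserves.mlieBracket (𝓛 : LeftParallelism S) {X₁ X₂ : (g : G) → TangentSpace 𝓘(ℝ, E) g}
    (hX₁ : X₁ ∈ 𝓛.fields) (hX₂ : X₂ ∈ 𝓛.fields) {x : M} {h : G} (hx : S.t h = x) {φ : G → G}
    (hφ : ∀ᶠ h' in 𝓝[S.t ⁻¹' {x}] h,
      ContMDiffWithinAt 𝓘(ℝ, E) 𝓘(ℝ, E) ∞ φ (S.t ⁻¹' {x}) h' ∧ Preserves S 𝓛.fields x φ h') :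
    VectorField.mlieBracket 𝓘(ℝ, E) X₁ X₂ h ∈ S.Tt h ∧ ∀ D : E →L[ℝ] E,
      HasMFDerivWithinAt 𝓘(ℝ, E) 𝓘(ℝ, E) φ (S.t ⁻¹' {x}) h D →
      D (VectorField.mlieBracket 𝓘(ℝ, E) X₁ X₂ h) =
        (VectorField.mlieBracket 𝓘(ℝ, E) X₁ X₂ (φ h) : E) := by
  have hne : (∞ : WithTop ℕ∞) ≠ 0 := by simp
  obtain ⟨K, γ, O, hO, h0, hγ0, hγ, hγt, hξ⟩ := S.exists_fibre_slice h
  obtain ⟨ξ₁, hξ₁, h₁⟩ := hξ X₁ (𝓛.smooth _ hX₁) (𝓛.tangent _ hX₁)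
  obtain ⟨ξ₂, hξ₂, h₂⟩ := hξ X₂ (𝓛.smooth _ hX₂) (𝓛.tangent _ hX₂)
  obtain ⟨N, hNφ, hN, hhN⟩ := eventually_nhds_iff.1 (eventually_nhdsWithin_iff.1 hφ)
  have hγx : ∀ a ∈ O, γ a ∈ S.t ⁻¹' {x} := fun a ha => (hγt a ha).trans hx
  set Q := O ∩ γ ⁻¹' N with hQ
  have hQo : IsOpen Q := hγ.continuousOn.isOpen_inter_preimage hO hN
  have h0Q : (0 : K) ∈ Q := ⟨h0, by show γ 0 ∈ N; rwa [hγ0]⟩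
  have hγd : ∀ a ∈ Q, ∃ D : K →L[ℝ] E, HasMFDerivAt 𝓘(ℝ, K) 𝓘(ℝ, E) γ a D := fun a ha =>
    ⟨_, ((hγ.contMDiffAt (hO.mem_nhds ha.1)).mdifferentiableAt hne).hasMFDerivAt⟩
  have hψ : ContMDiffOn 𝓘(ℝ, K) 𝓘(ℝ, E) ∞ (φ ∘ γ) Q := fun a ha =>
    ((hNφ _ ha.2 (hγx a ha.1)).1.comp a (hγ.mono inter_subset_left a ha)
      fun a' ha' => hγx a' ha'.1)
  have hcomp : ∀ a ∈ Q, ∀ {D : E →L[ℝ] E} {D' : K →L[ℝ] E},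
      HasMFDerivWithinAt 𝓘(ℝ, E) 𝓘(ℝ, E) φ (S.t ⁻¹' {x}) (γ a) D →
      HasMFDerivAt 𝓘(ℝ, K) 𝓘(ℝ, E) γ a D' →
      HasMFDerivAt 𝓘(ℝ, K) 𝓘(ℝ, E) (φ ∘ γ) a (D ∘L D') := by
    intro a ha D D' hD hD'
    have h3 := hD.comp a (hD'.hasMFDerivWithinAt (s := Q)) fun a' ha' => hγx a' ha'.1
    exact h3.hasMFDerivAt (hQo.mem_nhds ha)
  have hrel : ∀ {X : (g : G) → TangentSpace 𝓘(ℝ, E) g} {ξ : K → K}, X ∈ 𝓛.fields →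
      (∀ a ∈ O, ∀ D : K →L[ℝ] E, HasMFDerivAt 𝓘(ℝ, K) 𝓘(ℝ, E) γ a D → D (ξ a) = (X (γ a) : E)) →
      ∀ a ∈ Q, ∀ D : K →L[ℝ] E, HasMFDerivAt 𝓘(ℝ, K) 𝓘(ℝ, E) (φ ∘ γ) a D →
        D (ξ a) = (X ((φ ∘ γ) a) : E) := by
    intro X ξ hX hξ a ha D hD
    obtain ⟨D', hD'⟩ := hγd a ha
    obtain ⟨D₁, hD₁, hX₁⟩ := (hNφ _ ha.2 (hγx a ha.1)).2
    have h3 := congrArg (fun L : K →L[ℝ] E => L (ξ a))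
      (hasMFDerivAt_unique hD (hcomp a ha hD₁ hD'))
    exact Eq.trans h3 ((congrArg D₁ (hξ a ha.1 D' hD')).trans (hX₁ X hX))
  obtain ⟨D', hD'⟩ := hγd 0 h0Q
  -- The same coordinate fields on the slice are related to `X₁`, `X₂` by `γ` and, as `φ` preserves
  -- the fields, also by `φ ∘ γ`. So one coordinate bracket `w` represents the bracket both at `h`
  -- and at `φ h`.
  have e₁ := mlieBracket_of_related hQo (hγ.mono inter_subset_left)
    (hξ₁.mono inter_subset_left) (hξ₂.mono inter_subset_left) (𝓛.smooth _ hX₁) (𝓛.smooth _ hX₂)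
    (fun a ha => h₁ a ha.1) (fun a ha => h₂ a ha.1) h0Q hD'
  set w := fderiv ℝ ξ₂ 0 (ξ₁ 0) - fderiv ℝ ξ₁ 0 (ξ₂ 0) with hw
  have e₁' : D' w = (VectorField.mlieBracket 𝓘(ℝ, E) X₁ X₂ h : E) :=
    e₁.trans (congrArg (fun k => (VectorField.mlieBracket 𝓘(ℝ, E) X₁ X₂ k : E)) hγ0)
  refine ⟨?_, fun D hD => ?_⟩
  · have ht : HasMFDerivAt 𝓘(ℝ, E) 𝓘(ℝ, F) S.t (γ 0)
        (mfderiv 𝓘(ℝ, E) 𝓘(ℝ, F) S.t h : E →L[ℝ] F) := by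
      rw [hγ0]
      exact (S.smooth_t.contMDiffAt.mdifferentiableAt hne).hasMFDerivAt
    have h3 := ht.comp 0 hD'
    have h4 := (hasMFDerivAt_const (I := 𝓘(ℝ, K)) (I' := 𝓘(ℝ, F)) (S.t h) (0 : K)).congr_of_eventuallyEq
      (f₁ := S.t ∘ γ) (Filter.eventually_of_mem (hO.mem_nhds h0) hγt)
    have h5 := congrArg (fun L : K →L[ℝ] F => L w) (hasMFDerivAt_unique h3 h4)
    have h6 : (mfderiv 𝓘(ℝ, E) 𝓘(ℝ, F) S.t h : E →L[ℝ] F) (D' w) = 0 := h5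
    rw [e₁'] at h6
    exact h6
  · have hD0 : HasMFDerivWithinAt 𝓘(ℝ, E) 𝓘(ℝ, E) φ (S.t ⁻¹' {x}) (γ 0) D := by rwa [hγ0]
    have e₂ := mlieBracket_of_related hQo hψ
      (hξ₁.mono inter_subset_left) (hξ₂.mono inter_subset_left) (𝓛.smooth _ hX₁) (𝓛.smooth _ hX₂)
      (hrel hX₁ h₁) (hrel hX₂ h₂) h0Q (hcomp 0 h0Q hD0 hD')
    refine (congrArg D e₁').symm.trans (Eq.trans e₂ ?_)
    exact congrArg (fun k => (VectorField.mlieBracket 𝓘(ℝ, E) X₁ X₂ (φ k) : E)) hγ0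

/-- Vector fields preserved by left translations commute with vector fields preserved by right
translations. -/
theorem ArrowSpace.Adm.mlieBracket_eq_zero {𝓛 : LeftParallelism S} {ℛ : LeftParallelism S.op}
    {f : G × G → G} {g h : G} (hgh : S.s g = S.t h)
    (hf : S.Adm (S.PreservesBoth 𝓛.fields ℛ.fields) f (g, h))
    {X Y : (g : G) → TangentSpace 𝓘(ℝ, E) g} (hX : X ∈ 𝓛.fields) (hY : Y ∈ ℛ.fields) :
    VectorField.mlieBracket 𝓘(ℝ, E) X Y (f (g, h)) = 0 := by
  have hne : (∞ : WithTop ℕ∞) ≠ 0 := by simp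
  obtain ⟨K₁, σ, O₁, hO₁, h0₁, hσ0, hσ, hσt, hυ⟩ := S.op.exists_fibre_slice g
  obtain ⟨K₂, γ, O₂, hO₂, h0₂, hγ0, hγ, hγt, hξ⟩ := S.exists_fibre_slice h
  obtain ⟨υ, hυ, h₁⟩ := hυ Y (ℛ.smooth _ hY) (ℛ.tangent _ hY)
  obtain ⟨ξ, hξ, h₂⟩ := hξ X (𝓛.smooth _ hX) (𝓛.tangent _ hX)
  obtain ⟨N, hNf, hN, hhN⟩ := eventually_nhds_iff.1 (eventually_nhdsWithin_iff.1 hf)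
  -- A product of a slice in a source fibre and a slice in a target fibre, all of whose pairs are
  -- composable. Under multiplication `X` comes from a field on the second factor and `Y` from one
  -- on the first, and such fields commute.
  let j : K₁ × K₂ → G × G := fun q => (σ q.1, γ q.2)
  have hj : ContMDiffOn 𝓘(ℝ, K₁ × K₂) (𝓘(ℝ, E).prod 𝓘(ℝ, E)) ∞ j (O₁ ×ˢ O₂) :=
    (hσ.comp (contDiff_fst.contMDiff.contMDiffOn) fun q hq => hq.1).prodMk
      (hγ.comp (contDiff_snd.contMDiff.contMDiffOn) fun q hq => hq.2)
  have hjp : ∀ q ∈ O₁ ×ˢ O₂, j q ∈ S.pairs := fun q hq =>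
    (hσt q.1 hq.1).trans (Eq.trans hgh (hγt q.2 hq.2).symm)
  set Q := O₁ ×ˢ O₂ ∩ j ⁻¹' N with hQ
  have hQo : IsOpen Q := hj.continuousOn.isOpen_inter_preimage (hO₁.prod hO₂) hN
  have h0Q : (0 : K₁ × K₂) ∈ Q := ⟨⟨h0₁, h0₂⟩, by
    show (σ 0, γ 0) ∈ N; rwa [hσ0, hγ0]⟩
  have hψ : ContMDiffOn 𝓘(ℝ, K₁ × K₂) 𝓘(ℝ, E) ∞ (f ∘ j) Q := fun q hq =>
    ((hNf _ hq.2 (hjp q hq.1)).1.smooth.comp q (hj.mono inter_subset_left q hq)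
      fun q' hq' => hjp q' hq'.1)
  have hV₁ : ContDiffOn ℝ ∞ (fun q : K₁ × K₂ => ((0 : K₁), ξ q.2)) Q :=
    contDiffOn_const.prodMk (hξ.comp contDiff_snd.contDiffOn fun q hq => hq.1.2)
  have hV₂ : ContDiffOn ℝ ∞ (fun q : K₁ × K₂ => (υ q.1, (0 : K₂))) Q :=
    (hυ.comp contDiff_fst.contDiffOn fun q hq => hq.1.1).prodMk contDiffOn_const
  have r₁ : ∀ q ∈ Q, ∀ D : K₁ × K₂ →L[ℝ] E, HasMFDerivAt 𝓘(ℝ, K₁ × K₂) 𝓘(ℝ, E) (f ∘ j) q D →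
      D (0, ξ q.2) = (X ((f ∘ j) q) : E) := by
    intro q hq D hD
    have hγq : HasMFDerivAt 𝓘(ℝ, K₂) 𝓘(ℝ, E) γ q.2 (mfderiv 𝓘(ℝ, K₂) 𝓘(ℝ, E) γ q.2) :=
      ((hγ.contMDiffAt (hO₂.mem_nhds hq.1.2)).mdifferentiableAt hne).hasMFDerivAt
    have hfib : ∀ a ∈ O₂, γ a ∈ S.t ⁻¹' {S.s (σ q.1)} := fun a ha =>
      (hγt a ha).trans (hgh.symm.trans (hσt q.1 hq.1.1).symm)
    obtain ⟨D₁, hD₁, hX₁⟩ := (hNf _ hq.2 (hjp q hq.1)).2.1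
    have h3 := hD₁.comp q.2 (hγq.hasMFDerivWithinAt (s := O₂)) hfib
      |>.hasMFDerivAt (hO₂.mem_nhds hq.1.2)
    have h4 : HasMFDerivAt 𝓘(ℝ, K₂) 𝓘(ℝ, K₁ × K₂) (fun a : K₂ => (q.1, a)) q.2
        (ContinuousLinearMap.inr ℝ K₁ K₂) := (hasFDerivAt_prodMk_right q.1 q.2).hasMFDerivAt
    have hD' : HasMFDerivAt 𝓘(ℝ, K₁ × K₂) 𝓘(ℝ, E) (f ∘ j) ((fun a : K₂ => (q.1, a)) q.2) D := hD
    have h5 := congrArg (fun L : K₂ →L[ℝ] E => L (ξ q.2)) (hasMFDerivAt_unique (hD'.comp q.2 h4) h3)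
    exact Eq.trans h5 ((congrArg D₁ (h₂ q.2 hq.1.2 _ hγq)).trans (hX₁ X hX))
  have r₂ : ∀ q ∈ Q, ∀ D : K₁ × K₂ →L[ℝ] E, HasMFDerivAt 𝓘(ℝ, K₁ × K₂) 𝓘(ℝ, E) (f ∘ j) q D →
      D (υ q.1, 0) = (Y ((f ∘ j) q) : E) := by
    intro q hq D hD
    have hσq : HasMFDerivAt 𝓘(ℝ, K₁) 𝓘(ℝ, E) σ q.1 (mfderiv 𝓘(ℝ, K₁) 𝓘(ℝ, E) σ q.1) :=
      ((hσ.contMDiffAt (hO₁.mem_nhds hq.1.1)).mdifferentiableAt hne).hasMFDerivAt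
    have hfib : ∀ a ∈ O₁, σ a ∈ S.op.t ⁻¹' {S.t (γ q.2)} := fun a ha =>
      (hσt a ha).trans (hgh.trans (hγt q.2 hq.1.2).symm)
    obtain ⟨D₁, hD₁, hX₁⟩ := (hNf _ hq.2 (hjp q hq.1)).2.2
    have h3 := hD₁.comp q.1 (hσq.hasMFDerivWithinAt (s := O₁)) hfib
      |>.hasMFDerivAt (hO₁.mem_nhds hq.1.1)
    have h4 : HasMFDerivAt 𝓘(ℝ, K₁) 𝓘(ℝ, K₁ × K₂) (fun a : K₁ => (a, q.2)) q.1
        (ContinuousLinearMap.inl ℝ K₁ K₂) := (hasFDerivAt_prodMk_left q.1 q.2).hasMFDerivAt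
    have hD' : HasMFDerivAt 𝓘(ℝ, K₁ × K₂) 𝓘(ℝ, E) (f ∘ j) ((fun a : K₁ => (a, q.2)) q.1) D := hD
    have h5 := congrArg (fun L : K₁ →L[ℝ] E => L (υ q.1)) (hasMFDerivAt_unique (hD'.comp q.1 h4) h3)
    exact Eq.trans h5 ((congrArg D₁ (h₁ q.1 hq.1.1 _ hσq)).trans (hX₁ Y hY))
  obtain ⟨D, hD⟩ : ∃ D : K₁ × K₂ →L[ℝ] E, HasMFDerivAt 𝓘(ℝ, K₁ × K₂) 𝓘(ℝ, E) (f ∘ j) 0 D :=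
    ⟨_, ((hψ.contMDiffAt (hQo.mem_nhds h0Q)).mdifferentiableAt hne).hasMFDerivAt⟩
  have e := mlieBracket_of_related hQo hψ hV₁ hV₂ (𝓛.smooth _ hX) (ℛ.smooth _ hY) r₁ r₂ h0Q hD
  have d₁ : HasFDerivAt (fun q : K₁ × K₂ => ((0 : K₁), ξ q.2))
      ((0 : K₁ × K₂ →L[ℝ] K₁).prod (fderiv ℝ ξ 0 ∘L ContinuousLinearMap.snd ℝ K₁ K₂)) 0 :=
    (hasFDerivAt_const _ _).prodMk (HasFDerivAt.comp (0 : K₁ × K₂)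
      (((hξ.contDiffAt (hO₂.mem_nhds h0₂)).differentiableAt hne).hasFDerivAt) hasFDerivAt_snd)
  have d₂ : HasFDerivAt (fun q : K₁ × K₂ => (υ q.1, (0 : K₂)))
      ((fderiv ℝ υ 0 ∘L ContinuousLinearMap.fst ℝ K₁ K₂).prod (0 : K₁ × K₂ →L[ℝ] K₂)) 0 :=
    (HasFDerivAt.comp (0 : K₁ × K₂)
      (((hυ.contDiffAt (hO₁.mem_nhds h0₁)).differentiableAt hne).hasFDerivAt) hasFDerivAt_fst).prodMk
      (hasFDerivAt_const _ _)
  rw [d₁.fderiv, d₂.fderiv] at e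
  have e0 : (VectorField.mlieBracket 𝓘(ℝ, E) X Y (f (σ 0, γ 0)) : E) = 0 :=
    e.symm.trans ((congrArg D (by simp)).trans (map_zero D))
  rw [hσ0, hγ0] at e0
  exact e0

variable [T2Space M]

/-- A vector field with the same behaviour under translations of units as left-invariant ones is
left-invariant. -/
theorem TFraming.leftInvariant_mlieBracket (θ : TFraming S)
    {ℛ : Set ((g : G) → TangentSpace 𝓘(ℝ, E) g)} {f : G × G → G}
    (hf : ∀ g, S.Adm (S.PreservesBoth θ.parallelism.fields ℛ) f (g, S.u (S.s g)))
    (hu : ∀ g, f (g, S.u (S.s g)) = g) {X Y : (g : G) → TangentSpace 𝓘(ℝ, E) g}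
    (hX : θ.LeftInvariant X) (hY : θ.LeftInvariant Y) :
    θ.LeftInvariant (VectorField.mlieBracket 𝓘(ℝ, E) X Y) := by
  refine θ.leftInvariant_iff.2 ⟨smooth_mlieBracket hX.1 hY.1, fun g => ?_⟩
  have h1 := (Filter.Eventually.self_of_nhdsWithin
    (p := fun q => S.IsMulAt f q ∧ S.PreservesBoth θ.parallelism.fields ℛ f q) (hf g)
    (S.right_unit_mem_pairs g)).2.1
  obtain ⟨D, hD, -, hv⟩ := θ.deriv_of_preserves h1 (hu g)
  have h2 : ∀ᶠ h' in 𝓝[S.t ⁻¹' {S.s g}] S.u (S.s g),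
      ContMDiffWithinAt 𝓘(ℝ, E) 𝓘(ℝ, E) ∞ (fun h => f (g, h)) (S.t ⁻¹' {S.s g}) h' ∧
        Preserves S θ.parallelism.fields (S.s g) (fun h => f (g, h)) h' := by
    filter_upwards [S.tendsto_prodMk_left.eventually
      (p := fun q => S.IsMulAt f q ∧ S.PreservesBoth θ.parallelism.fields ℛ f q) (hf g)] with h' hh
    refine ⟨?_, hh.2.1⟩
    have h3 : ContMDiff 𝓘(ℝ, E) (𝓘(ℝ, E).prod 𝓘(ℝ, E)) ∞ (fun k : G => (g, k)) :=
      contMDiff_const.prodMk contMDiff_id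
    exact hh.1.smooth.comp h' h3.contMDiffAt.contMDiffWithinAt fun k hk => Eq.symm hk
  obtain ⟨h3, h4⟩ := Preserves.mlieBracket θ.parallelism hX hY (S.t_u _) h2
  have h5 := h4 D hD
  have key : ∀ (x : G) (a b : E), x = g →
      (⟨x, a⟩ : TangentBundle 𝓘(ℝ, E) G) = ⟨g, b⟩ → a = b := by
    rintro x a b rfl h; cases h; rfl
  -- Translation by `g` carries the bracket at the unit to the bracket at `g`, while its
  -- differential is inverse to the framing; comparing the two gives invariance.
  have h6 := key _ _ _ (hu g) (hv ((θ.iso g).symm ⟨_, h3⟩))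
  rw [LinearEquiv.apply_symm_apply] at h6
  have h7 : (VectorField.mlieBracket 𝓘(ℝ, E) X Y g : E) =
      ((θ.iso g).symm ⟨_, h3⟩ : S.Tt g) := by
    refine Eq.trans ?_ (Eq.trans h5.symm h6)
    exact congrArg (fun k => (VectorField.mlieBracket 𝓘(ℝ, E) X Y k : E)) (hu g).symm
  have h8 : VectorField.mlieBracket 𝓘(ℝ, E) X Y g ∈ S.Tt g := by
    have := ((θ.iso g).symm ⟨_, h3⟩ : S.Tt g).2
    rw [← h7] at this
    exact this
  refine ⟨h8, ?_⟩
  have h9 : (⟨_, h8⟩ : S.Tt g) = (θ.iso g).symm ⟨_, h3⟩ := Subtype.ext h7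
  rw [h9, LinearEquiv.apply_symm_apply]

/-- The invariant vector fields of a local Lie groupoid satisfy the bracket conditions. -/
theorem LocalLieGroupoid.GivesRiseTo.bracketConditions {L : LocalLieGroupoid S} {ωs : SFraming S}
    {ωt : TFraming S} (h : L.GivesRiseTo ωs ωt) : BracketConditions ωs ωt := by
  refine ⟨fun X Y hX hY => ?_, fun X Y hX hY => ?_, fun X Y hX hY g => ?_⟩
  · exact ωt.leftInvariant_mlieBracket (fun g => (h.adm_units g).1) L.mul_unit hX hY
  · exact ωs.op.leftInvariant_mlieBracket (f := L.mul ∘ Prod.swap)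
      (fun g => (h.adm_units g).2.op fun _ hq => hq.op) L.unit_mul hX hY
  · have := (h.adm_units g).1.mlieBracket_eq_zero (S.right_unit_mem_pairs g) (X := X) (Y := Y) hX hY
    rwa [L.mul_unit] at this

end BracketsOfInvariantFields


/-! ### Uniqueness of the structure -/

section Uniqueness

variable {E F : Type*} [NormedAddCommGroup E] [NormedSpace ℝ E] [FiniteDimensional ℝ E]
  [NormedAddCommGroup F] [NormedSpace ℝ F] [FiniteDimensional ℝ F]
  {M : Type*} [TopologicalSpace M] [ChartedSpace F M] [IsManifold 𝓘(ℝ, F) ∞ M]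
  {G : Type*} [TopologicalSpace G] [ChartedSpace E G] [IsManifold 𝓘(ℝ, E) ∞ G]
  {S : ArrowSpace E F M G}

/-- Target fibres are locally connected. -/
theorem ArrowSpace.exists_preconnected_nhds (S : ArrowSpace E F M G) {x : M} {h : G}
    (hx : S.t h = x) {N : Set G} (hN : N ∈ 𝓝 h) :
    ∃ A ∈ 𝓝[S.t ⁻¹' {x}] h, A ⊆ N ∩ S.t ⁻¹' {x} ∧ IsPreconnected A := by
  obtain ⟨K, Φ, hs, hW, hΦ, -⟩ := exists_fibreChart S.smooth_t h (S.submersion_t h)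
    (w := fun _ => h) contMDiff_const rfl
  rw [hx] at hW hΦ
  have hmem : ∀ a ∈ Metric.ball (0 : K) Φ.r, (x, a) ∈ Φ.e.target := fun a ha => by
    rw [Φ.target_eq]; exact ⟨hW, ha⟩
  have hc : ContinuousOn (fun a : K => Φ.e.symm (x, a)) (Metric.ball 0 Φ.r) :=
    Φ.e.continuousOn_symm.comp (by fun_prop) hmem
  have hc0 : Φ.e.symm (x, (0 : K)) = h := by rw [← hΦ, Φ.e.left_inv hs]
  have h1 : ∀ᶠ a : K in 𝓝 0, Φ.e.symm (x, a) ∈ N :=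
    (hc.continuousAt (Metric.ball_mem_nhds 0 Φ.r_pos)).eventually (by
      show ∀ᶠ y in 𝓝 (Φ.e.symm (x, (0 : K))), y ∈ N
      rw [hc0]; exact hN)
  obtain ⟨ε, hε, hball⟩ := Metric.eventually_nhds_iff.1 h1
  set δ := min ε Φ.r with hδ
  have hδ0 : 0 < δ := lt_min hε Φ.r_pos
  have hδr : Metric.ball (0 : K) δ ⊆ Metric.ball 0 Φ.r := Metric.ball_subset_ball (min_le_right _ _)
  refine ⟨(fun a : K => Φ.e.symm (x, a)) '' Metric.ball 0 δ, ?_, ?_,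
    ((convex_ball (0 : K) δ).isPreconnected).image _ (hc.mono hδr)⟩
  · have h2 : ContinuousAt (fun h => ‖(Φ.e h).2‖) h :=
      (continuous_snd.continuousAt.comp (Φ.e.continuousAt hs)).norm
    filter_upwards [nhdsWithin_le_nhds (Φ.e.open_source.mem_nhds hs), nhdsWithin_le_nhds
      (h2.eventually_lt continuousAt_const (by simpa [hΦ] using hδ0)), self_mem_nhdsWithin]
      with h' hs' hn hx'
    refine ⟨(Φ.e h').2, mem_ball_zero_iff.2 hn, ?_⟩
    have h3 : (x, (Φ.e h').2) = Φ.e h' := Prod.ext (hx'.symm.trans (Φ.fst_eq h' hs').symm) rfl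
    show Φ.e.symm (x, (Φ.e h').2) = h'
    rw [h3, Φ.e.left_inv hs']
  · rintro _ ⟨a, ha, rfl⟩
    refine ⟨hball ?_, ?_⟩
    · simpa using (mem_ball_zero_iff.1 ha).trans_le (min_le_left _ _)
    show S.t (Φ.e.symm (x, a)) = x
    rw [← Φ.fst_eq _ (Φ.e.map_target (hmem a (hδr ha))), Φ.e.right_inv (hmem a (hδr ha))]

namespace MulGerm

variable {𝒞 : MulGerm S}

/-- Agreement of two multiplications propagates along a connected subset of a target fibre. -/
theorem eq_of_isPreconnected {f f' : G × G → G} {g : G} {A : Set G} (hA : IsPreconnected A)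
    (hAt : A ⊆ S.t ⁻¹' {S.s g}) (hf : ∀ h ∈ A, 𝒞.Adm f (g, h)) (hf' : ∀ h ∈ A, 𝒞.Adm f' (g, h))
    {h₁ h₂ : G} (hh₁ : h₁ ∈ A) (hh₂ : h₂ ∈ A) (he : f (g, h₁) = f' (g, h₁)) :
    f (g, h₂) = f' (g, h₂) := by
  have : PreconnectedSpace A := Subtype.preconnectedSpace hA
  exact Propagates.eq_of_preconnected (S.t2_t (S.t g)) (X := A) (p := Subtype.val)
    continuous_subtype_val (fun a => hAt a.2)
    (fun a => (hf a a.2).propagates (hf' a a.2) (Eq.symm (hAt a.2))) (a₀ := ⟨h₁, hh₁⟩) he ⟨h₂, hh₂⟩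

/-- On the product of two fibres, agreement of two multiplications is locally constant. -/
theorem eventually_eq_iff {f f' : G × G → G} {x : M} {g h : G} (hg : S.s g = x) (hh : S.t h = x)
    (hf : 𝒞.Adm f (g, h)) (hf' : 𝒞.Adm f' (g, h)) : ∃ A ∈ 𝓝[S.s ⁻¹' {x}] g,
      ∃ B ∈ 𝓝[S.t ⁻¹' {x}] h, ∀ g₁ ∈ A, ∀ g₂ ∈ A, ∀ h₁ ∈ B, ∀ h₂ ∈ B,
        f (g₁, h₁) = f' (g₁, h₁) → f (g₂, h₂) = f' (g₂, h₂) := by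
  have h1 := eventually_nhdsWithin_iff.1 (hf.eventually.and hf'.eventually)
  rw [nhds_prod_eq] at h1
  obtain ⟨P₁, hP₁, P₂, hP₂, hP⟩ := Filter.eventually_prod_iff.1 h1
  obtain ⟨A, hA, hAs, hAc⟩ := S.op.exists_preconnected_nhds (x := x) hg hP₁
  obtain ⟨B, hB, hBs, hBc⟩ := S.exists_preconnected_nhds hh hP₂
  have hadm : ∀ g' ∈ A, ∀ h' ∈ B, 𝒞.Adm f (g', h') ∧ 𝒞.Adm f' (g', h') := fun g' hg' h' hh' =>
    hP (hAs hg').1 (hBs hh').1 ((hAs hg').2.trans (Eq.symm (hBs hh').2))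
  refine ⟨A, hA, B, hB, fun g₁ hg₁ g₂ hg₂ h₁ hh₁ h₂ hh₂ he => ?_⟩
  have hs : ∀ g' ∈ A, S.s g' = x := fun g' hg' => (hAs hg').2
  have ht : ∀ h' ∈ B, S.t h' = x := fun h' hh' => (hBs hh').2
  have e₁ := eq_of_isPreconnected hBc (fun h' hh' => (ht h' hh').trans (hs g₁ hg₁).symm)
    (fun h' hh' => (hadm g₁ hg₁ h' hh').1) (fun h' hh' => (hadm g₁ hg₁ h' hh').2) hh₁ hh₂ he
  exact eq_of_isPreconnected (𝒞 := 𝒞.op) (f := f ∘ Prod.swap) (f' := f' ∘ Prod.swap) hAc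
    (fun g' hg' => (hs g' hg').trans (ht h₂ hh₂).symm)
    (fun g' hg' => 𝒞.adm_op (hadm g' hg' h₂ hh₂).1)
    (fun g' hg' => 𝒞.adm_op (hadm g' hg' h₂ hh₂).2) hg₁ hg₂ e₁

/-- Two multiplications that agree at a pair of units agree on every connected set of pairs
composable over this unit. -/
theorem eqOn_of_isPreconnected {f f' : G × G → G} {x : M} {A : Set (G × G)} (hA : IsPreconnected A)
    (hx : ∀ p ∈ A, S.s p.1 = x ∧ S.t p.2 = x) (hf : ∀ p ∈ A, 𝒞.Adm f p)
    (hf' : ∀ p ∈ A, 𝒞.Adm f' p) {p₀ : G × G} (hp₀ : p₀ ∈ A) (he : f p₀ = f' p₀) : EqOn f f' A := by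
  intro p hp
  have : PreconnectedSpace A := Subtype.preconnectedSpace hA
  -- Inside `A` both entries of a pair may vary at once, whereas rigidity concerns one entry at a
  -- time. Local constancy on products of small connected neighbourhoods covers this case, and it
  -- replaces a separate closedness argument.
  have hl : IsLocallyConstant fun q : A => (f q.1 = f' q.1) := by
    refine (IsLocallyConstant.iff_eventually_eq _).2 ?_
    rintro ⟨⟨g, h⟩, hq⟩
    obtain ⟨B, hB, C, hC, hBC⟩ := eventually_eq_iff (hx _ hq).1 (hx _ hq).2 (hf _ hq) (hf' _ hq)
    have h1 : Filter.Tendsto (fun q : A => q.1.1) (𝓝 ⟨(g, h), hq⟩) (𝓝[S.s ⁻¹' {x}] g) :=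
      tendsto_nhdsWithin_iff.2 ⟨(continuous_fst.comp continuous_subtype_val).tendsto _,
        .of_forall fun q => (hx _ q.2).1⟩
    have h2 : Filter.Tendsto (fun q : A => q.1.2) (𝓝 ⟨(g, h), hq⟩) (𝓝[S.t ⁻¹' {x}] h) :=
      tendsto_nhdsWithin_iff.2 ⟨(continuous_snd.comp continuous_subtype_val).tendsto _,
        .of_forall fun q => (hx _ q.2).2⟩
    have hg : g ∈ B := mem_of_mem_nhdsWithin (s := S.s ⁻¹' {x}) (hx _ hq).1 hB
    have hh : h ∈ C := mem_of_mem_nhdsWithin (s := S.t ⁻¹' {x}) (hx _ hq).2 hC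
    filter_upwards [h1 hB, h2 hC] with q hq1 hq2
    exact propext ⟨hBC _ hq1 _ hg _ hq2 _ hh, hBC _ hg _ hq1 _ hh _ hq2⟩
  exact (hl.apply_eq_of_preconnectedSpace ⟨p₀, hp₀⟩ ⟨p, hp⟩).mp he

end MulGerm

variable [T2Space M] {ωs : SFraming S} {ωt : TFraming S}

namespace LocalLieGroupoid.GivesRiseTo

variable {L L₁ L₂ : LocalLieGroupoid S}

/-- Local Lie groupoid structures giving rise to the same framings have a common restriction. -/
theorem exists_common_restriction [ParacompactSpace M] (h₁ : L₁.GivesRiseTo ωs ωt) (h₂ : L₂.GivesRiseTo ωs ωt) :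
    ∃ L₀ : LocalLieGroupoid S, L₀.IsRestrictionOf L₁ ∧ L₀.IsRestrictionOf L₂ := by
  let 𝒞 := h₁.bracketConditions.mulGerm
  have hR : ∀ g, L₁.mul =ᶠ[𝓝[S.pairs] (g, S.u (S.s g))] L₂.mul := fun g =>
    MulGerm.eventuallyEq_of_right_units (𝒞 := 𝒞) (h₁.adm_units g).1 (h₂.adm_units g).1
      (.of_forall fun g => (L₁.mul_unit g).trans (L₂.mul_unit g).symm)
  have hL : ∀ g, L₁.mul =ᶠ[𝓝[S.pairs] (S.u (S.t g), g)] L₂.mul := fun g => by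
    have h3 := MulGerm.eventuallyEq_of_right_units (𝒞 := 𝒞.op)
      (f := L₁.mul ∘ Prod.swap) (f' := L₂.mul ∘ Prod.swap) (g₀ := g)
      (𝒞.adm_op (h₁.adm_units g).2) (𝒞.adm_op (h₂.adm_units g).2)
      (.of_forall fun g => (L₁.unit_mul g).trans (L₂.unit_mul g).symm)
    exact (S.op.tendsto_swap_pairs (S.u (S.t g), g)).eventually h3
  -- The largest open set of pairs on which both products are defined and agree. By rigidity it
  -- contains the pairs with one unit entry.
  let O : Set (G × G) := {p | ∀ᶠ q in 𝓝 p, q ∈ S.pairs → q ∈ L₁.U ∧ q ∈ L₂.U ∧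
    L₁.mul q = L₂.mul q}
  have hO : ∀ p ∈ O ∩ S.pairs, p ∈ L₁.U ∧ p ∈ L₂.U ∧ L₁.mul p = L₂.mul p := fun p hp =>
    hp.1.self_of_nhds hp.2
  let Γ : PreGroupoid S :=
    { U := O ∩ S.pairs
      mul := L₁.mul
      isOpen_U := ⟨O, isOpen_setOfPred_eventually_nhds, rfl⟩
      right_unit_mem := fun g => ⟨eventually_nhdsWithin_iff.1 (by
        filter_upwards [L₁.toPreGroupoid.eventually_mem (L₁.right_unit_mem g),
          L₂.toPreGroupoid.eventually_mem (L₂.right_unit_mem g), hR g] with q a b c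
          using ⟨a, b, c⟩), S.right_unit_mem_pairs g⟩
      left_unit_mem := fun g => ⟨eventually_nhdsWithin_iff.1 (by
        filter_upwards [L₁.toPreGroupoid.eventually_mem (L₁.left_unit_mem g),
          L₂.toPreGroupoid.eventually_mem (L₂.left_unit_mem g), hL g] with q a b c
          using ⟨a, b, c⟩), S.left_unit_mem_pairs g⟩
      isMulAt := fun p hp => L₁.toPreGroupoid.isMulAt p (hO p hp).1
      submersion := fun p hp => L₁.toPreGroupoid.submersion p (hO p hp).1
      mul_unit := L₁.mul_unit
      unit_mul := L₁.unit_mul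
      assoc := L₁.toPreGroupoid.assoc }
  have hinv : ∀ x, L₁.inv =ᶠ[𝓝 (S.u x)] L₂.inv := fun x => by
    refine Γ.right_inversion_unique (L₁.isRightInversion x) ?_
    have h := L₂.isRightInversion x
    refine { h with mul_eq := ?_ }
    have h3 : Filter.Tendsto (fun g => (g, L₂.inv g)) (𝓝 (S.u x)) (𝓝[S.pairs] (S.u x, S.u x)) :=
      tendsto_nhdsWithin_iff.2 ⟨Filter.tendsto_id.prodMk_nhds h.tendsto,
        h.t_eq.mono fun g hg => hg.symm⟩
    have h4 := hR (S.u x)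
    rw [S.s_u] at h4
    filter_upwards [h3.eventually h4, h.mul_eq] with g hg hg' using hg.trans hg'
  obtain ⟨L₀, hU, hm, hi, hV⟩ := Γ.exists_localLieGroupoid L₁.isRightInversion
    (Q := fun g => g ∈ L₁.V ∧ g ∈ L₂.V ∧ L₁.inv g = L₂.inv g) fun x => by
      filter_upwards [L₁.isOpen_V.mem_nhds (L₁.unit_mem_V x),
        L₂.isOpen_V.mem_nhds (L₂.unit_mem_V x), hinv x] with g a b c using ⟨a, b, c⟩
  have hU' : ∀ p ∈ L₀.U, p ∈ L₁.U ∧ p ∈ L₂.U ∧ L₁.mul p = L₂.mul p := fun p hp =>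
    hO p (hU.subset hp)
  exact ⟨L₀, ⟨fun p hp => (hU' p hp).1, fun g hg => (hV g hg).1, fun p _ => by rw [hm],
      fun g _ => by rw [hi]⟩, ⟨fun p hp => (hU' p hp).2.1, fun g hg => (hV g hg).2.1,
      fun p hp => by rw [hm]; exact (hU' p hp).2.2, fun g hg => by rw [hi]; exact (hV g hg).2.2⟩⟩

/-- The multiplication of a 3-associative local Lie groupoid is compatible with the framings on
its whole domain. -/
theorem adm_of_threeAssociative (h : L.GivesRiseTo ωs ωt) (ha : L.ThreeAssociative) {p : G × G}
    (hp : p ∈ L.U) :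
    S.Adm (S.PreservesBoth ωt.parallelism.fields ωs.op.parallelism.fields) L.mul p := by
  let R : G × G × G → Prop := fun p => S.s p.1 = S.t p.2.1 → S.s p.2.1 = S.t p.2.2 →
      (p.1, p.2.1) ∈ L.U ∧ (p.2.1, p.2.2) ∈ L.U ∧ (L.mul (p.1, p.2.1), p.2.2) ∈ L.U ∧
      (p.1, L.mul (p.2.1, p.2.2)) ∈ L.U
  -- For `p ∈ U`, all four products in the triples obtained by adding a unit before or after `p` are
  -- defined, and this persists nearby. There 3-associativity supplies the associative law.
  refine h.adm hp (O := {p | ∀ᶠ q in 𝓝 p, R q}) isOpen_setOfPred_eventually_nhds ?_ ?_ ?_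
  · refine L.toPreGroupoid.eventually_mem_triple hp (L.right_unit_mem _) ?_ ?_
    · have := L.right_unit_mem (L.mul p)
      rwa [L.s_mul p hp] at this
    · show (p.1, L.mul (p.2, S.u (S.s p.2))) ∈ L.U
      rwa [L.mul_unit]
  · refine L.toPreGroupoid.eventually_mem_triple (L.left_unit_mem _) hp ?_ ?_
    · show (L.mul (S.u (S.t p.1), p.1), p.2) ∈ L.U
      rwa [L.unit_mul]
    · have := L.left_unit_mem (L.mul p)
      rwa [L.t_mul p hp] at this
  · intro g h k hk h1 h2
    obtain ⟨a, b, c, d⟩ := Filter.Eventually.self_of_nhds (p := R) hk h1 h2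
    exact ha g h k a b c d

/-- Strongly connected 3-associative local Lie groupoid structures giving rise to the same framings
have the same multiplication if their domains are equal. -/
theorem eqOn_mul (h₁ : L₁.GivesRiseTo ωs ωt) (h₂ : L₂.GivesRiseTo ωs ωt)
    (hc : ∀ x, IsConnected {p ∈ L₁.U | S.s p.1 = x ∧ S.t p.2 = x}) (ha₁ : L₁.ThreeAssociative)
    (ha₂ : L₂.ThreeAssociative) (hU : L₁.U = L₂.U) : EqOn L₁.mul L₂.mul L₁.U := by
  intro p hp
  have hpp : S.s p.1 = S.t p.2 := L₁.toPreGroupoid.pairs_of_mem hp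
  have hu := L₁.toPreGroupoid.unit_mem (S.t p.2)
  refine MulGerm.eqOn_of_isPreconnected (𝒞 := h₁.bracketConditions.mulGerm)
    (hc (S.t p.2)).isPreconnected (fun q hq => hq.2)
    (fun q hq => h₁.adm_of_threeAssociative ha₁ hq.1)
    (fun q hq => h₂.adm_of_threeAssociative ha₂ (hU ▸ hq.1)) ⟨hu, S.s_u _, S.t_u _⟩ ?_ ⟨hp, hpp, rfl⟩
  exact (L₁.toPreGroupoid.unit_mul_unit _).trans (L₂.toPreGroupoid.unit_mul_unit _).symm

end LocalLieGroupoid.GivesRiseTo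

omit [FiniteDimensional ℝ E] [FiniteDimensional ℝ F] [IsManifold 𝓘(ℝ, F) ∞ M]
  [IsManifold 𝓘(ℝ, E) ∞ G] [T2Space M] in
/-- In a 3-associative local Lie groupoid the multiplication determines the inversion. -/
theorem LocalLieGroupoid.eqOn_inv {L₁ L₂ : LocalLieGroupoid S} (ha : L₁.ThreeAssociative)
    (hU : L₁.U = L₂.U) (hV : L₁.V = L₂.V) (hm : EqOn L₁.mul L₂.mul L₁.U) :
    EqOn L₁.inv L₂.inv L₁.V := by
  intro g hg
  have hg₂ : g ∈ L₂.V := hV ▸ hg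
  have h₁ : (L₁.inv g, g) ∈ L₁.U := L₁.V_pairs _ (L₁.inv_mem g hg) _ hg (L₁.s_inv g hg)
  have h₂ : (g, L₂.inv g) ∈ L₁.U := by
    rw [hU]; exact L₂.V_pairs _ hg₂ _ (L₂.inv_mem g hg₂) (L₂.t_inv g hg₂).symm
  have e₁ := L₁.inv_mul g hg
  have e₂ : L₁.mul (g, L₂.inv g) = S.u (S.t g) := (hm h₂).trans (L₂.mul_inv g hg₂)
  have u₁ := L₁.left_unit_mem (L₂.inv g)
  have u₂ := L₁.right_unit_mem (L₁.inv g)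
  have v₁ := L₁.unit_mul (L₂.inv g)
  have v₂ := L₁.mul_unit (L₁.inv g)
  rw [L₂.t_inv g hg₂] at u₁ v₁
  rw [L₁.s_inv g hg] at u₂ v₂
  -- The triple consists of the first inverse, `g` and the second inverse of `g`. Its two
  -- bracketings are the second and the first inverse.
  have := ha _ _ _ h₁ h₂ (by rwa [e₁]) (by rwa [e₂])
  rw [e₁, e₂, v₁, v₂] at this
  exact this.symm

end Uniqueness

end LocalLie

/-! ### The main theorem -/

theorem mainTheorem5
    {E E' F : Type*}
    [NormedAddCommGroup E] [NormedSpace ℝ E] [FiniteDimensional ℝ E]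
    [NormedAddCommGroup E'] [NormedSpace ℝ E'] [FiniteDimensional ℝ E']
    [NormedAddCommGroup F] [NormedSpace ℝ F] [FiniteDimensional ℝ F]
    {M : Type*} [TopologicalSpace M] [ChartedSpace F M] [IsManifold 𝓘(ℝ, F) ∞ M]
    [T2Space M] [SecondCountableTopology M]
    {G : Type*} [TopologicalSpace G] [ChartedSpace E G] [IsManifold 𝓘(ℝ, E) ∞ G]
    {G' : Type*} [TopologicalSpace G'] [ChartedSpace E' G'] [IsManifold 𝓘(ℝ, E') ∞ G'] :
    -- coverings of bi-regular local Lie groupoids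
    (∀ (S : LocalLie.ArrowSpace E F M G) (L : LocalLie.LocalLieGroupoid S)
        (S' : LocalLie.ArrowSpace E' F M G') (φ : G' → G),
      L.BiRegular → LocalLie.IsGeneralizedCovering S' S φ →
      ∃ L' : LocalLie.LocalLieGroupoid S', LocalLie.IsMorphism L' L φ id ∧ L'.BiRegular) ∧
    -- characterization through framings
    (∀ (S : LocalLie.ArrowSpace E F M G), S.SConnected → S.TConnected →
      ∀ (ωs : LocalLie.SFraming S) (ωt : LocalLie.TFraming S),
        ((∃ L : LocalLie.LocalLieGroupoid S, L.GivesRiseTo ωs ωt) ↔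
          LocalLie.BracketConditions ωs ωt) ∧
        -- uniqueness up to restriction
        ∀ L₁ L₂ : LocalLie.LocalLieGroupoid S, L₁.GivesRiseTo ωs ωt → L₂.GivesRiseTo ωs ωt →
          (∃ L₀ : LocalLie.LocalLieGroupoid S, L₀.IsRestrictionOf L₁ ∧ L₀.IsRestrictionOf L₂) ∧
          (L₁.StronglyConnected → L₂.StronglyConnected →
            L₁.ThreeAssociative → L₂.ThreeAssociative → L₁.U = L₂.U → L₁.V = L₂.V →
            EqOn L₁.mul L₂.mul L₁.U ∧ EqOn L₁.inv L₂.inv L₁.V)) := by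
  -- Local compactness together with the Hausdorff and second countability assumptions makes `M`
  -- paracompact, as needed for all gluing.
  have := Manifold.locallyCompact_of_finiteDimensional (M := M) 𝓘(ℝ, F)
  refine ⟨fun S L S' φ hL hφ => hφ.exists_lift_localLieGroupoid L hL,
    fun S _ _ ωs ωt => ⟨⟨fun ⟨L, hL⟩ => hL.bracketConditions, fun h => h.exists_givesRiseTo⟩,
      fun L₁ L₂ h₁ h₂ => ⟨h₁.exists_common_restriction h₂, fun hc₁ _ ha₁ ha₂ hU hV => ?_⟩⟩⟩
  have hm := h₁.eqOn_mul h₂ hc₁.2.2.2.1 ha₁ ha₂ hU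
  exact ⟨hm, LocalLie.LocalLieGroupoid.eqOn_inv ha₁ hU hV hm⟩
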